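/- **Models.** Let $n\ge 2$ and let $\psi(x)=\sum_{S\subseteq[n]}\widehat\psi(S)\prod_{i\in S}x_i$ be a multilinear polynomial on $\{-1,1\}^n$. Its dependency graph $G$ on $[n]$ has $i\sim j$ iff $\partial_i\partial_j\psi\not\equiv 0$. The Markov random field $\mu\propto e^{\psi}$ is a $(k,d,\alpha,\lambda)$-MRF if $\deg\psi\le k$; every site has at most $d$ neighbours in $G$; whenever $i\sim j$ there is a maximal monomial $S\ni i,j$ of $\psi$ (that is, $\widehat\psi(S)\ne 0$ and $\widehat\psi(S')=0$ for all $S'\supsetneq S$) with $|\widehat\psi(S)|\ge\alpha$; and $\sum_{S\ni i}|\widehat\psi(S)|\le\lambda$ for every $i$. Throughout, $k\ge 2$, $d\ge 1$, $0<\alpha\le\lambda$ and $0<\delta\le 1$. **Dynamics.** In the continuous-time Glauber dynamics $(X^t)_{t\ge0}$, $X^0$ is arbitrary (possibly random), the update times of the sites are independent Poisson processes of rate $1$, independent of $X^0$, and when site $i$ updates at time $t$, given the history, $X_i^t=1$ with probability $\sigma(2\partial_i\psi(X_{-i}^t))$, where $\sigma(z)=1/(1+e^{-z})$. All updates are observed,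 whether or not the value changes: for each site one is given the ordered list of its update times in $[0,T]$ and the resulting spins. **Algorithm 1.** Put $$q=\tfrac12\Big(\tfrac{e^{-2\lambda}}{2d}\Big)^{k-2},\quad L=\frac{\alpha^2qe^{-6\lambda}}{64d},\quad \kappa=\frac{5\alpha^2q}{64}e^{-6\lambda},\quad q'=\frac{L^5}{6^5},$$ $$M=\Big\lceil\frac{2000\log(2n^2/\delta)}{\kappa^2}\Big\rceil,\quad r=\Big\lceil\frac{\log(2\max\{1,2(k-2)\})}{L}\Big\rceil,\quad T=L\,(Mr+2M/q').$$ For $i<j$ and $\ell\ge0$ let $\mathcal C^{(\ell)}$ be the event that the window $((\ell+r-1)L,(\ell+r)L]$, split into three consecutive intervals of length $L/3$, shows the update pattern $iijii$: in the first third $i$ updates at least twice and $j$ does not update, in the second $j$ updates at least once and $i$ does not, and in the last $i$ updates at least twice and $j$ does not. Let $\tau_0=0$ and $\tau_{s+1}=\min\{\ell\ge\tau_s+r:\mathcal C^{(\ell)}\text{ occurs}\}$. When $\mathcal C^{(\ell)}$ occurs, let $Y_1,Y_2$ be the indicators that $X_i=1$ at the first and second updates of $i$ in the first third, and $Y_1',Y_2'$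 the same for the last third, and put $$Z^{(\ell)}=Y_1Y_2-2Y_1Y_1'+Y_1'Y_2'.$$ Given the trajectory on $[0,T]$, the algorithm returns $\perp$ if for some $i<j$ fewer than $M$ stopping times occur with $(\tau_s+r)L\le T$; otherwise it returns the graph in which $i<j$ are adjacent iff $\frac1M\sum_{s=1}^M Z^{(\tau_s)}\ge\kappa$. **Theorem.** There is a single program for a real RAM (unit-cost elementary instructions and tests: addition, subtraction, comparison and addressing with natural numbers; arithmetic, $\exp$, $\log$ and comparison of reals, with no rounding; arrays) that halts with the result of Algorithm 1 for all parameters and all well-formed inputs on $[0,T]$. Moreover, for all $k,d,\alpha,\lambda$ as above there is a constant $C=C(k,d,\alpha,\lambda)>0$ such that for all $n\ge2$ and $\delta\in(0,1]$ one has $T\le C\log(n/\delta)$, and for every $(k,d,\alpha,\lambda)$-MRF on $n$ sites and its Glauber dynamics on $[0,T]$, with probability at least $1-\delta$ all of the following hold: Algorithm 1 returns exactly the dependency graph $G$; the total number of site updates in $[0,T]$ is at most $Cn\log(n/\delta)$; and the program halts with this output after at most $Cn^2\log(n/\delta)$ steps. -/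

import Mathlib

open MeasureTheory ProbabilityTheory Filter
open scoped ENNReal

namespace GlauberMRF

noncomputable section

/-! ## Multilinear polynomials on the hypercube and Markov random fields

A configuration in `{-1,1}^n` is a function `Fin n → Bool`, where `true` stands for `+1`
and `false` for `-1`. -/

/-- The numerical value `±1` of a spin. -/
def sgn (b : Bool) : ℝ := if b then 1 else -1

/-- A real function on `{-1,1}^n`, given by the coefficients of its unique multilinear expansion
`ψ(x) = ∑_S ψ̂(S) x^S`. -/
abbrev Multilinear (n : ℕ) : Type := Finset (Fin n) → ℝ

/-- The value `∑_S ψ̂(S) ∏_{i ∈ S} x_i`. -/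
def Multilinear.eval {n : ℕ} (ψ : Multilinear n) (x : Fin n → Bool) : ℝ :=
  ∑ S : Finset (Fin n), ψ S * ∏ i ∈ S, sgn (x i)

/-- The partial derivative `∂_i ψ = ∑_{S ∌ i} ψ̂(S ∪ {i}) x^S`. -/
def Multilinear.pderiv {n : ℕ} (i : Fin n) (ψ : Multilinear n) : Multilinear n :=
  fun S => if i ∈ S then 0 else ψ (insert i S)

theorem Multilinear.pderiv_comm {n : ℕ} (i j : Fin n) (ψ : Multilinear n) :
    (ψ.pderiv j).pderiv i = (ψ.pderiv i).pderiv j := by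
  funext S
  by_cases hij : i = j
  · subst hij; rfl
  · have hji : ¬ j = i := fun h => hij h.symm
    by_cases hi : i ∈ S <;> by_cases hj : j ∈ S <;>
      simp [Multilinear.pderiv, hi, hj, hij, hji, Finset.insert_comm]

theorem Multilinear.pderiv_self {n : ℕ} (i : Fin n) (ψ : Multilinear n) :
    (ψ.pderiv i).pderiv i = fun _ => 0 := by
  funext S
  simp [Multilinear.pderiv]

/-- The dependency graph of `ψ`: `i ∼ j` iff the function `∂_i ∂_j ψ` is not identically zero. -/
def dependencyGraph {n : ℕ} (ψ : Multilinear n) : SimpleGraph (Fin n) where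
  Adj i j := ∃ x, ((ψ.pderiv j).pderiv i).eval x ≠ 0
  symm := ⟨fun i j ⟨x, hx⟩ => ⟨x, by rwa [Multilinear.pderiv_comm]⟩⟩
  loopless := ⟨fun i ⟨x, hx⟩ => hx (by
    rw [Multilinear.pderiv_self]; simp [Multilinear.eval])⟩

/-- `S` is a maximal monomial of `ψ`. -/
def IsMaximalMonomial {n : ℕ} (ψ : Multilinear n) (S : Finset (Fin n)) : Prop :=
  ψ S ≠ 0 ∧ ∀ S', S ⊂ S' → ψ S' = 0

/-- The Hamiltonian `ψ` defines a `(k,d,α,lam)`-Markov random field. -/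
structure IsMRF {n : ℕ} (k d : ℕ) (α lam : ℝ) (ψ : Multilinear n) : Prop where
  /-- the polynomial degree is at most `k` -/
  degree : ∀ S : Finset (Fin n), k < S.card → ψ S = 0
  /-- every site has at most `d` neighbours -/
  vertex_degree : ∀ i : Fin n, {j | (dependencyGraph ψ).Adj i j}.ncard ≤ d
  /-- every edge lies in a maximal monomial with a coefficient of size at least `α` -/
  edge_coeff : ∀ i j : Fin n, (dependencyGraph ψ).Adj i j →
    ∃ S, IsMaximalMonomial ψ S ∧ i ∈ S ∧ j ∈ S ∧ α ≤ |ψ S|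
  /-- the width `∑_{S ∋ i} |ψ̂(S)|` is at most `lam` -/
  width : ∀ i : Fin n, ∑ S : Finset (Fin n), (if i ∈ S then |ψ S| else 0) ≤ lam

/-! ## Continuous-time Glauber dynamics -/

/-- A trajectory of the dynamics: the initial configuration, the successive update times of every
site (`time i m` is the `m`-th update time of site `i`, counted from `m = 0`), and the spins
chosen at these updates. -/
structure Trajectory (n : ℕ) where
  init : Fin n → Bool
  time : Fin n → ℕ → ℝ
  spin : Fin n → ℕ → Bool

/-- The number of updates of site `i` at times in `(a, b]`. -/
def Trajectory.count {n : ℕ} (X : Trajectory n) (i : Fin n) (a b : ℝ) : ℕ :=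
  {m : ℕ | X.time i m ∈ Set.Ioc a b}.ncard

/-- The configuration `X^t`: a site carries the spin chosen at its last update up to time `t`
(included), and its initial spin if there was none. -/
def Trajectory.config {n : ℕ} (X : Trajectory n) (t : ℝ) : Fin n → Bool := fun i =>
  if X.count i 0 t = 0 then X.init i else X.spin i (X.count i 0 t - 1)

/-- The history right before the `m`-th update of site `i`: the initial configuration, the
clocks, and the spins chosen at all updates of strictly smaller time. -/
abbrev past {Ω : Type*} {n : ℕ} (X : Ω → Trajectory n) (i : Fin n) (m : ℕ) : MeasurableSpace Ω :=
  MeasurableSpace.comap (fun ω => (X ω).init) inferInstance ⊔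
  MeasurableSpace.comap (fun ω => (X ω).time) inferInstance ⊔
  ⨆ q : Fin n × ℕ, MeasurableSpace.comap
    (fun ω => decide ((X ω).time q.1 q.2 < (X ω).time i m) && (X ω).spin q.1 q.2) inferInstance

/-- The random trajectory `X` is the continuous-time Glauber dynamics of `μ_ψ`, started at an
arbitrary (possibly random) configuration: the update times of the sites are independent Poisson
processes of rate one, independent of the initial configuration, and at every update of a site `i`
the new spin is `+1` with conditional probability `σ(2 ∂_i ψ)`, evaluated at the current
configuration of the other sites, given the history. (The clocks run independently of the spins,
so the future clock times may be included in the history. As `∂_i ψ` does not depend on `x_i`,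
it may be evaluated at the configuration after the update.) -/
structure IsGlauberDynamics {Ω : Type*} [MeasurableSpace Ω] {n : ℕ} (ψ : Multilinear n)
    (P : Measure Ω) (X : Ω → Trajectory n) : Prop where
  measurable_init : Measurable fun ω => (X ω).init
  measurable_time : ∀ i m, Measurable fun ω => (X ω).time i m
  measurable_spin : ∀ i m, Measurable fun ω => (X ω).spin i m
  /-- almost surely, the update times of a site are positive, listed increasingly, and finitely
  many in every bounded interval -/
  time_pos : ∀ i, ∀ᵐ ω ∂P, 0 < (X ω).time i 0
  time_strictMono : ∀ i, ∀ᵐ ω ∂P, StrictMono ((X ω).time i)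
  time_tendsto : ∀ i, ∀ᵐ ω ∂P, Tendsto ((X ω).time i) atTop atTop
  /-- the number of updates of a site in an interval is Poisson, with the length as its mean -/
  count_law : ∀ i (a b : ℝ), 0 ≤ a → a ≤ b →
    HasLaw (fun ω => (X ω).count i a b) (poissonMeasure (b - a).toNNReal) P
  /-- the numbers of updates of all sites in successive disjoint intervals are independent -/
  count_indep : ∀ t : ℕ → ℝ, 0 ≤ t 0 → Monotone t →
    iIndepFun (fun (q : Fin n × ℕ) ω => (X ω).count q.1 (t q.2) (t (q.2 + 1))) P
  /-- the initial configuration is independent of the clocks -/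
  init_indep : IndepFun (fun ω => (X ω).init) (fun ω => (X ω).time) P
  /-- the law of an update -/
  update_law : ∀ i m,
    P[fun ω => if (X ω).spin i m then (1 : ℝ) else 0 | past X i m] =ᵐ[P]
      fun ω => Real.sigmoid (2 * (ψ.pderiv i).eval ((X ω).config ((X ω).time i m)))

/-! ## The algorithm -/

/-- What is observed: the initial configuration and, for every site, the ordered list of its
update times, each with the spin chosen there. -/
structure Observation (n : ℕ) where
  init : Fin n → Bool
  updates : Fin n → List (ℝ × Bool)

/-- The observation of a trajectory on the time interval `[0, T]`. -/
def observe {n : ℕ} (X : Trajectory n) (T : ℝ) : Observation n where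
  init := X.init
  updates i := (List.range (X.count i 0 T)).map fun m => (X.time i m, X.spin i m)

/-- Well-formed observations on `[0, T]`: the lists are ordered by time. -/
def Observation.Valid {n : ℕ} (obs : Observation n) (T : ℝ) : Prop :=
  ∀ i, (obs.updates i).Pairwise (fun u v => u.1 < v.1) ∧ ∀ u ∈ obs.updates i, 0 < u.1 ∧ u.1 ≤ T

/-- The total number of site updates in an observation. -/
def Observation.size {n : ℕ} (obs : Observation n) : ℕ := ∑ i, (obs.updates i).length

/-- `½ (exp(-2 lam) / (2d))^(k-2)` -/
def qBurn (k d : ℕ) (lam : ℝ) : ℝ := 1 / 2 * (Real.exp (-2 * lam) / (2 * d)) ^ (k - 2)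

/-- The window length `L`. -/
def window (k d : ℕ) (α lam : ℝ) : ℝ := α ^ 2 * qBurn k d lam * Real.exp (-6 * lam) / (64 * d)

/-- The threshold `κ`. -/
def threshold (k d : ℕ) (α lam : ℝ) : ℝ := 5 * α ^ 2 * qBurn k d lam / 64 * Real.exp (-6 * lam)

/-- `L^5 / 6^5` -/
def qGood (k d : ℕ) (α lam : ℝ) : ℝ := window k d α lam ^ 5 / 6 ^ 5

/-- The number `M` of samples of the statistic for every pair of sites. -/
def samples (k d : ℕ) (α lam δ : ℝ) (n : ℕ) : ℕ :=
  ⌈2000 * Real.log (2 * (n : ℝ) ^ 2 / δ) / threshold k d α lam ^ 2⌉₊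

/-- The number `r` of windows in a block. -/
def blockLength (k d : ℕ) (α lam : ℝ) : ℕ :=
  ⌈Real.log (2 * max 1 (2 * ((k : ℝ) - 2))) / window k d α lam⌉₊

/-- The length `T` of the observed trajectory. -/
def horizon (k d : ℕ) (α lam δ : ℝ) (n : ℕ) : ℝ :=
  window k d α lam *
    (samples k d α lam δ n * blockLength k d α lam + 2 * samples k d α lam δ n / qGood k d α lam)

/-- The updates in a list whose times are in `(a, b]`. -/
def updatesIn (l : List (ℝ × Bool)) (a b : ℝ) : List (ℝ × Bool) :=
  l.filter fun u => decide (a < u.1) && decide (u.1 ≤ b)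

/-- The updates in the third number `p = 0, 1, 2` of the last window
`[(ℓ + r - 1) L, (ℓ + r) L]` of the block of `r` windows that starts at `ℓ L`. -/
def third (l : List (ℝ × Bool)) (L : ℝ) (r ℓ p : ℕ) : List (ℝ × Bool) :=
  updatesIn l (((ℓ : ℝ) + r - 1) * L + p * (L / 3)) (((ℓ : ℝ) + r - 1) * L + (p + 1) * (L / 3))

/-- The event `C^(ℓ)`, for the lists `li`, `lj` of updates of the sites `i`, `j`: in the last window
of the block, `i` updates at least twice and `j` does not in the first third, `j` updates and `i`
does not in the second, and `i` updates at least twice and `j` does not in the last. -/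
def Pattern (li lj : List (ℝ × Bool)) (L : ℝ) (r ℓ : ℕ) : Prop :=
  (2 ≤ (third li L r ℓ 0).length ∧ third lj L r ℓ 0 = []) ∧
  (third li L r ℓ 1 = [] ∧ 1 ≤ (third lj L r ℓ 1).length) ∧
  (2 ≤ (third li L r ℓ 2).length ∧ third lj L r ℓ 2 = [])

/-- The stopping times: `τ_{s+1}` is the least `ℓ ≥ τ_s + r` such that `C^(ℓ)` occurs, where
`τ_0 = 0`, and `⊤` if there is none. -/
def stopIndex (li lj : List (ℝ × Bool)) (L : ℝ) (r : ℕ) : ℕ → ℕ∞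
  | 0 => 0
  | s + 1 => ⨅ ℓ : {ℓ : ℕ // stopIndex li lj L r s + r ≤ (ℓ : ℕ∞) ∧ Pattern li lj L r ℓ}, (ℓ.1 : ℕ∞)

/-- The indicator that the `m`-th update of a list (counted from `0`) results in the spin `+1`. -/
def indicator (l : List (ℝ × Bool)) (m : ℕ) : ℝ := if l[m]?.map Prod.snd = some true then 1 else 0

/-- The statistic `Z^(ℓ) = Y₁ Y₂ - 2 Y₁ Y₁' + Y₁' Y₂'` of site `i`. -/
def statistic (li : List (ℝ × Bool)) (L : ℝ) (r ℓ : ℕ) : ℝ :=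
  indicator (third li L r ℓ 0) 0 * indicator (third li L r ℓ 0) 1
    - 2 * indicator (third li L r ℓ 0) 0 * indicator (third li L r ℓ 2) 0
    + indicator (third li L r ℓ 2) 0 * indicator (third li L r ℓ 2) 1

/-- At least `M` stopping times occur on the observed trajectory: the `M`-th is finite, and its
block is over by time `T`. -/
def EnoughStops (li lj : List (ℝ × Bool)) (L : ℝ) (r M : ℕ) (T : ℝ) : Prop :=
  stopIndex li lj L r M ≠ ⊤ ∧ (((stopIndex li lj L r M).toNat : ℝ) + r) * L ≤ T

/-- The average of the statistic over the first `M` stopping times. -/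
def average (li lj : List (ℝ × Bool)) (L : ℝ) (r M : ℕ) : ℝ :=
  1 / (M : ℝ) * ∑ s ∈ Finset.Icc 1 M, statistic li L r (stopIndex li lj L r s).toNat

open Classical in
/-- The algorithm `FindMarkovBlanket`. The value `none` is the failure `⊥`; otherwise the result is
the graph in which a pair `i < j` is an edge iff the average of the statistic is at least `κ`. -/
def findMarkovBlanket (k d : ℕ) (α lam δ : ℝ) {n : ℕ} (obs : Observation n) :
    Option (SimpleGraph (Fin n)) :=
  let L := window k d α lam
  let r := blockLength k d α lam
  let M := samples k d α lam δ n
  if ∀ i j : Fin n, i < j →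
      EnoughStops (obs.updates i) (obs.updates j) L r M (horizon k d α lam δ n) then
    some (SimpleGraph.fromRel fun i j =>
      i < j ∧ threshold k d α lam ≤ average (obs.updates i) (obs.updates j) L r M)
  else none

/-! ## Running time: structured programs for a real RAM

The machine has registers and arrays for natural numbers, and registers and arrays for real
numbers. A program names finitely many registers and arrays. Every elementary instruction and
every test of a branch or a loop takes one step. Natural numbers can only be added, subtracted,
compared, and used as addresses; reals admit the four arithmetic operations, `exp`, `log` and
comparison, but no rounding. -/

/-- The memory of the machine. -/
structure Memory where
  nat : ℕ → ℕ
  real : ℕ → ℝ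
  natArr : ℕ → ℕ → ℕ
  realArr : ℕ → ℕ → ℝ

/-- Elementary instructions; the first argument of a computing instruction is the register that
receives the result. -/
inductive Instr where
  /-- load a literal -/
  | const (x c : ℕ)
  | add (x y z : ℕ)
  | sub (x y z : ℕ)
  /-- `x := a[y]` -/
  | load (x a y : ℕ)
  /-- `a[x] := y` -/
  | store (a x y : ℕ)
  /-- copy the value of the natural number register `y` to the real register `x` -/
  | cast (x y : ℕ)
  | radd (x y z : ℕ)
  | rsub (x y z : ℕ)
  | rmul (x y z : ℕ)
  | rdiv (x y z : ℕ)
  | rexp (x y : ℕ)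
  | rlog (x y : ℕ)
  | rload (x a y : ℕ)
  | rstore (a x y : ℕ)

/-- The effect of an elementary instruction. -/
def Instr.exec (s : Memory) : Instr → Memory
  | const x c => { s with nat := Function.update s.nat x c }
  | add x y z => { s with nat := Function.update s.nat x (s.nat y + s.nat z) }
  | sub x y z => { s with nat := Function.update s.nat x (s.nat y - s.nat z) }
  | load x a y => { s with nat := Function.update s.nat x (s.natArr a (s.nat y)) }
  | store a x y => { s with
      natArr := Function.update s.natArr a (Function.update (s.natArr a) (s.nat x) (s.nat y)) }
  | cast x y => { s with real := Function.update s.real x (s.nat y) }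
  | radd x y z => { s with real := Function.update s.real x (s.real y + s.real z) }
  | rsub x y z => { s with real := Function.update s.real x (s.real y - s.real z) }
  | rmul x y z => { s with real := Function.update s.real x (s.real y * s.real z) }
  | rdiv x y z => { s with real := Function.update s.real x (s.real y / s.real z) }
  | rexp x y => { s with real := Function.update s.real x (Real.exp (s.real y)) }
  | rlog x y => { s with real := Function.update s.real x (Real.log (s.real y)) }
  | rload x a y => { s with real := Function.update s.real x (s.realArr a (s.nat y)) }
  | rstore a x y => { s with
      realArr := Function.update s.realArr a (Function.update (s.realArr a) (s.nat x) (s.real y)) }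

/-- Tests: comparison of two registers. -/
inductive Test where
  | natLt (x y : ℕ)
  | realLe (x y : ℕ)

/-- The test succeeds. -/
def Test.Holds (s : Memory) : Test → Prop
  | natLt x y => s.nat x < s.nat y
  | realLe x y => s.real x ≤ s.real y

/-- Structured programs. -/
inductive Program where
  | instr (a : Instr)
  | seq (p q : Program)
  | ite (b : Test) (p q : Program)
  | loop (b : Test) (p : Program)

/-- `Run p s t s'`: started with the memory `s`, the program `p` halts after exactly `t` steps,
with the memory `s'`. (`loop b p` repeats `p` as long as `b` holds.) -/
inductive Run : Program → Memory → ℕ → Memory → Prop where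
  | instr (a : Instr) (s : Memory) : Run (.instr a) s 1 (a.exec s)
  | seq {p q : Program} {s s₁ s₂ : Memory} {t₁ t₂ : ℕ} :
      Run p s t₁ s₁ → Run q s₁ t₂ s₂ → Run (.seq p q) s (t₁ + t₂) s₂
  | ite_true {b : Test} {p q : Program} {s s₁ : Memory} {t : ℕ} :
      b.Holds s → Run p s t s₁ → Run (.ite b p q) s (1 + t) s₁
  | ite_false {b : Test} {p q : Program} {s s₁ : Memory} {t : ℕ} :
      ¬ b.Holds s → Run q s t s₁ → Run (.ite b p q) s (1 + t) s₁
  | loop_true {b : Test} {p : Program} {s s₁ s₂ : Memory} {t₁ t₂ : ℕ} :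
      b.Holds s → Run p s t₁ s₁ → Run (.loop b p) s₁ t₂ s₂ → Run (.loop b p) s (1 + t₁ + t₂) s₂
  | loop_false {b : Test} {p : Program} {s : Memory} :
      ¬ b.Holds s → Run (.loop b p) s 1 s

/-- The lists of updates of all sites, one after the other. -/
def Observation.concat {n : ℕ} (obs : Observation n) : List (ℝ × Bool) :=
  (List.ofFn obs.updates).flatten

/-- The initial memory: the natural number registers `0, 1, 2` hold `n, k, d`, and the real
registers `0, 1, 2` hold `α, lam, δ`. The natural number arrays `0, 1, 2` hold, for every site,
its initial spin (`1` for `+1` and `0` for `-1`), its number of updates, and the position of its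
first update in the concatenation of the lists of updates; the natural number array `3` and the
real array `0` hold the spins and the times of this concatenation. All else is zero. -/
def inputMemory (k d : ℕ) (α lam δ : ℝ) {n : ℕ} (obs : Observation n) : Memory where
  nat x := if x = 0 then n else if x = 1 then k else if x = 2 then d else 0
  real x := if x = 0 then α else if x = 1 then lam else if x = 2 then δ else 0
  natArr a m :=
    if a = 3 then (obs.concat[m]?.map fun u => u.2.toNat).getD 0
    else if h : m < n then
      if a = 0 then (obs.init ⟨m, h⟩).toNat
      else if a = 1 then (obs.updates ⟨m, h⟩).length
      else if a = 2 then ∑ i : Fin n, if (i : ℕ) < m then (obs.updates i).length else 0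
      else 0
    else 0
  realArr a m := if a = 0 then (obs.concat[m]?.map Prod.fst).getD 0 else 0

/-- The final memory `s` represents the result of the algorithm: the natural number register `0`
is `0` for a failure; for a graph it is `1`, and the natural number array `4` holds
the adjacency matrix, row by row. -/
def Represents {n : ℕ} (s : Memory) : Option (SimpleGraph (Fin n)) → Prop
  | none => s.nat 0 = 0
  | some G => s.nat 0 = 1 ∧ ∀ i j : Fin n,
      (G.Adj i j → s.natArr 4 ((i : ℕ) * n + j) = 1) ∧
      (¬ G.Adj i j → s.natArr 4 ((i : ℕ) * n + j) = 0)

end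

end GlauberMRF

open GlauberMRF

set_option linter.unusedSectionVars false

namespace GlauberMRF

/-! Consider a window that shows the pattern iijii and in which no other neighbour of i or j
updates, and let x be the configuration at its start. Since ∂_iψ depends only on the neighbours of
i, the first two spins of i in the first third are both +1 with the same probability p =
σ(2∂_iψ(x)). The first two spins of i in the last third share a probability p', evaluated after the
last update of j. The spin of i that j sees is the last one of the first third. It is never the
first one, because i rings at least twice, so Y₁ is independent of p'. Hence Z has conditional mean
E(p - p')² (`peel₆_linear`, `peel₆'_linear`, `lintegral_window`). This mean vanishes if i and j are
not adjacent (`meanStat_eq_zero`). In general it is at least e^{-6λ}/2 · (∂_i∂_jψ(x))²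
(`meanStat_ge`).

For an edge this derivative may vanish at x. Let S be a maximal monomial through i and j, and let V
be S without i and j. Whatever the other spins are, some assignment of the spins in V makes
|∂_i∂_jψ| at least α (`Multilinear.exists_abs_eval_ge`). If all sites of V update during a suitable
stretch before the window, and the other neighbours of i except j do not, then this assignment is
hit with probability at least (e^{-2λ}/2)^{|V|}, because every update takes either spin with
probability at least e^{-2λ}/2 (`IsGlauberDynamics.lintegral_hit`). For a good length of the
stretch, the event about the clocks has probability at least d^{-|V|}/3 (`exists_refresh_length`,
`measure_refreshed_ge`). A window fails to be quiet with probability at most 2dL = 2κ/5. As -2 ≤ Z ≤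
1, the mean of Z at a stop is at most 2κ/5 for a non-edge and at least 2κ for an edge, and κ
separates the two.

Concentration along the stops comes from exponential moments. Instead of conditional expectations,
the proof carries nonnegative weights that are measurable with respect to the history. The spins are
integrated out from the last block to the first, which replaces the exponential of Z at each stop by
a function of the clocks of the other sites in that block (`lintegral_prod_stopWeight_le`). The
stops depend on the clocks of i and j only, and their blocks are disjoint. So these functions are
independent of what precedes them; normalized to mean at most one, they have a product of mean at
most one (`lintegral_prod_stopWeight_le_one`). Markov's inequality gives the error exp(-9κ²M/400)
for each pair (`measure_nonedge_le`, `measure_edge_le`). The same device, applied to the attempts of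
the scan, shows that M stops occur in time (`measure_stops_lt_le`). A union bound over the pairs
costs δ/2, and a Poisson tail bound for the number of updates costs the other δ/2.

The program first merges the updates of each site with the ends of the cells of length L/3, which
gives a table of cumulative counts. With this table one step of the scan of a pair takes constant
time: the pattern is read off from differences of entries, and the entries also locate the four
spins. The cost is linear in the number of updates plus n² times the number of windows, and both are
of the required order. Correctness rests on `stopIndex_invariant`, which identifies the recursively
defined stopping times with the stops of a greedy scan. -/

/-! ### Multilinear polynomials, their derivatives and the dependency graph. -/

theorem abs_sgn (b : Bool) : |sgn b| = 1 := by cases b <;> simp [sgn]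

theorem abs_prod_sgn {n : ℕ} (S : Finset (Fin n)) (x : Fin n → Bool) :
    |∏ i ∈ S, sgn (x i)| = 1 := by
  rw [Finset.abs_prod]; simp [abs_sgn]

namespace Multilinear

variable {n : ℕ}

/-- Summation over all sets, split according to the membership of `i`. -/
theorem sum_split (i : Fin n) (F : Finset (Fin n) → ℝ) :
    ∑ S, F S = ∑ S, if i ∈ S then 0 else F S + F (insert i S) := by
  rw [← Finset.sum_filter_add_sum_filter_not Finset.univ (fun S : Finset (Fin n) => i ∈ S)]
  have h1 : ∑ S with i ∈ S, F S = ∑ S with i ∉ S, F (insert i S) := by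
    refine Finset.sum_nbij' (fun S => S.erase i) (fun S => insert i S) ?_ ?_ ?_ ?_ ?_
    · intro S _; simp
    · intro S _; simp
    · intro S hS; exact Finset.insert_erase (by simpa using hS)
    · intro S hS; exact Finset.erase_insert (by simpa using hS)
    · intro S hS
      have : i ∈ S := by simpa using hS
      simp [Finset.insert_erase this]
  rw [h1, ← Finset.sum_add_distrib, Finset.sum_filter]
  refine Finset.sum_congr rfl fun S _ => ?_
  by_cases h : i ∈ S <;> simp [h, add_comm]

/-- The part of a multilinear polynomial that does not contain `x_i`. -/
noncomputable def free (i : Fin n) (f : Multilinear n) : Multilinear n := fun S => if i ∈ S then 0 else f S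

theorem prod_sgn_update {i : Fin n} {S : Finset (Fin n)} (h : i ∉ S) (x : Fin n → Bool) (b : Bool) :
    ∏ a ∈ S, sgn (Function.update x i b a) = ∏ a ∈ S, sgn (x a) := by
  refine Finset.prod_congr rfl fun a ha => ?_
  rw [Function.update_of_ne]
  rintro rfl; exact h ha

theorem eval_eq (i : Fin n) (f : Multilinear n) (x : Fin n → Bool) :
    f.eval x = (f.free i).eval x + sgn (x i) * (f.pderiv i).eval x := by
  unfold eval
  rw [sum_split i, Finset.mul_sum, ← Finset.sum_add_distrib]
  refine Finset.sum_congr rfl fun S _ => ?_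
  by_cases h : i ∈ S
  · simp [h, free, pderiv]
  · simp [h, free, pderiv, Finset.prod_insert h]; ring

theorem eval_pderiv_update (i : Fin n) (f : Multilinear n) (x : Fin n → Bool) (b : Bool) :
    (f.pderiv i).eval (Function.update x i b) = (f.pderiv i).eval x := by
  unfold eval
  refine Finset.sum_congr rfl fun S _ => ?_
  by_cases h : i ∈ S
  · simp [h, pderiv]
  · rw [prod_sgn_update h]

theorem eval_free_update (i : Fin n) (f : Multilinear n) (x : Fin n → Bool) (b : Bool) :
    (f.free i).eval (Function.update x i b) = (f.free i).eval x := by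
  unfold eval
  refine Finset.sum_congr rfl fun S _ => ?_
  by_cases h : i ∈ S
  · simp [h, free]
  · rw [prod_sgn_update h]

theorem eval_update (i : Fin n) (f : Multilinear n) (x : Fin n → Bool) (b : Bool) :
    f.eval (Function.update x i b) = (f.free i).eval x + sgn b * (f.pderiv i).eval x := by
  rw [eval_eq i, eval_free_update, eval_pderiv_update]; simp

theorem eval_update_sub (i : Fin n) (f : Multilinear n) (x : Fin n → Bool) :
    f.eval (Function.update x i true) - f.eval (Function.update x i false)
      = 2 * (f.pderiv i).eval x := by
  rw [eval_update, eval_update]; simp [sgn]; ring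

/-- Every restriction to the sites of a maximal set takes a value at least the coefficient. -/
theorem exists_abs_eval_ge (S : Finset (Fin n)) :
    ∀ (f : Multilinear n), (∀ S', S ⊂ S' → f S' = 0) → ∀ y : Fin n → Bool,
      ∃ x : Fin n → Bool, (∀ a, a ∉ S → x a = y a) ∧ |f S| ≤ |f.eval x| := by
  induction S using Finset.induction_on with
  | empty =>
    intro f hf y
    refine ⟨y, fun _ _ => rfl, ?_⟩
    unfold eval
    rw [Finset.sum_eq_single ∅]
    · simp
    · intro S _ hS
      rw [hf S (Finset.empty_ssubset.2 (Finset.nonempty_iff_ne_empty.2 hS))]; simp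
    · simp
  | insert i S hi ih =>
    intro f hf y
    obtain ⟨x, hx, hle⟩ := ih (f.pderiv i) (by
      intro S' hS'
      by_cases h : i ∈ S'
      · simp [pderiv, h]
      · simp only [pderiv, h, if_false]
        refine hf _ ⟨Finset.insert_subset_insert i hS'.1, fun hc => hS'.2 ?_⟩
        intro a ha
        have := hc (Finset.mem_insert_of_mem ha)
        rcases Finset.mem_insert.1 this with rfl | h'
        · exact absurd ha h
        · exact h') y
    simp only [pderiv, hi, if_false] at hle
    have h2 := eval_update_sub i f x
    -- The values at the two choices of the spin at `i` differ by twice the derivative, so they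
    -- cannot both be smaller than it in absolute value.
    have : |f (insert i S)| ≤ |f.eval (Function.update x i true)| ∨
        |f (insert i S)| ≤ |f.eval (Function.update x i false)| := by
      by_contra! hc
      have h3 := abs_sub (f.eval (Function.update x i true)) (f.eval (Function.update x i false))
      rw [h2, abs_mul, abs_two] at h3
      have h4 : |eval (pderiv i f) x| = |Multilinear.eval (fun S => if i ∈ S then 0 else f (insert i S)) x| := rfl
      linarith [hc.1, hc.2]
    have hag : ∀ b a, a ∉ insert i S → Function.update x i b a = y a := by
      intro b a ha
      simp only [Finset.mem_insert, not_or] at ha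
      rw [Function.update_of_ne ha.1, hx a ha.2]
    rcases this with h | h
    exacts [⟨_, hag _, h⟩, ⟨_, hag _, h⟩]

end Multilinear

variable {n : ℕ} {ψ : Multilinear n}

theorem eval_pderiv_update_of_not_adj {i a : Fin n} (h : ¬ (dependencyGraph ψ).Adj i a)
    (x : Fin n → Bool) (b : Bool) :
    (ψ.pderiv i).eval (Function.update x a b) = (ψ.pderiv i).eval x := by
  have h0 : ∀ x, ((ψ.pderiv i).pderiv a).eval x = 0 := by
    intro x
    by_contra hc
    exact h ⟨x, by rwa [Multilinear.pderiv_comm]⟩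
  rw [Multilinear.eval_update, Multilinear.eval_eq a (ψ.pderiv i) x, h0]; simp

/-- The derivative `∂_i ψ` only depends on the neighbours of `i`. -/
theorem eval_pderiv_congr {i : Fin n} {x y : Fin n → Bool}
    (h : ∀ a, (dependencyGraph ψ).Adj i a → x a = y a) :
    (ψ.pderiv i).eval x = (ψ.pderiv i).eval y := by
  -- The coordinates are changed from `x` to `y` one at a time: at a neighbour nothing changes, and
  -- elsewhere the derivative does not see the change.
  have key : ∀ S : Finset (Fin n),
      (ψ.pderiv i).eval (fun a => if a ∈ S then y a else x a) = (ψ.pderiv i).eval x := by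
    intro S
    induction S using Finset.induction_on with
    | empty => simp
    | insert c S hc ih =>
      rw [← ih]
      have hu : (fun a => if a ∈ insert c S then y a else x a)
          = Function.update (fun a => if a ∈ S then y a else x a) c (y c) := by
        funext a
        by_cases hac : a = c
        · subst hac; simp
        · simp [hac, Finset.mem_insert]
      rw [hu]
      by_cases hadj : (dependencyGraph ψ).Adj i c
      · rw [← h c hadj, Function.update_eq_self_iff.2]; simp [hc]
      · exact eval_pderiv_update_of_not_adj hadj _ _
  have := key Finset.univ
  simpa using this.symm

theorem IsMRF.abs_eval_pderiv_le {k d : ℕ} {α lam : ℝ} (h : IsMRF k d α lam ψ) (i : Fin n)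
    (x : Fin n → Bool) : |(ψ.pderiv i).eval x| ≤ lam := by
  refine le_trans ?_ (h.width i)
  rw [Multilinear.sum_split i]
  refine (Finset.abs_sum_le_sum_abs _ _).trans (Finset.sum_le_sum fun S _ => ?_)
  rw [abs_mul, abs_prod_sgn, mul_one]
  by_cases hi : i ∈ S <;> simp [Multilinear.pderiv, hi]

/-- Differentiation in `i` and `j` turns the maximal set `S` into the maximal set `S \ {i, j}` with
the same coefficient, so the mixed derivative is not identically zero. In particular the rest of `S`
consists of neighbours of `i`. The first two conclusions are the input that
`Multilinear.exists_abs_eval_ge` needs. -/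
theorem IsMaximalMonomial.adj {S : Finset (Fin n)} (hS : IsMaximalMonomial ψ S) {i j : Fin n}
    (hi : i ∈ S) (hj : j ∈ S) (hij : i ≠ j) :
    |ψ S| = |((ψ.pderiv j).pderiv i) ((S.erase i).erase j)| ∧
    (∀ S', (S.erase i).erase j ⊂ S' → ((ψ.pderiv j).pderiv i) S' = 0) ∧
    (dependencyGraph ψ).Adj i j := by
  have h1 : ((ψ.pderiv j).pderiv i) ((S.erase i).erase j) = ψ S := by
    simp only [Multilinear.pderiv]
    rw [if_neg (by simp), if_neg (by simp [hij.symm])]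
    congr 1
    ext a; simp only [Finset.mem_insert, Finset.mem_erase]
    by_cases h1 : a = i <;> by_cases h2 : a = j <;> simp_all
  have h2 : ∀ S', (S.erase i).erase j ⊂ S' → ((ψ.pderiv j).pderiv i) S' = 0 := by
    intro S' hS'
    simp only [Multilinear.pderiv]
    split_ifs with h3 h4
    · rfl
    · rfl
    · apply hS.2
      refine ⟨?_, ?_⟩
      · intro a ha
        by_cases h1 : a = i
        · simp [h1]
        by_cases h2 : a = j
        · simp [h2]
        exact Finset.mem_insert_of_mem (Finset.mem_insert_of_mem (hS'.1 (by simp [*])))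
      · intro hc
        refine hS'.2 fun a ha => ?_
        have : a ∈ S := hc (by simp [ha])
        have h5 : a ≠ i := by rintro rfl; exact h3 ha
        have h6 : a ≠ j := by
          rintro rfl; exact h4 (by simp [ha])
        simp [*]
  refine ⟨by rw [h1], h2, ?_⟩
  obtain ⟨x, -, hx⟩ := Multilinear.exists_abs_eval_ge _ _ h2 (fun _ => true)
  refine ⟨x, fun h0 => ?_⟩
  rw [h0, h1, abs_zero] at hx
  exact hS.1 (abs_nonpos_iff.1 hx)

/-! ### Regular clocks and their counts. -/

/-- Clocks that are positive, increasing, unbounded and never ring simultaneously. -/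
structure RegularClock {n : ℕ} (τ : Fin n → ℕ → ℝ) : Prop where
  pos : ∀ i, 0 < τ i 0
  lt_succ : ∀ i m, τ i m < τ i (m + 1)
  unbounded : ∀ i (k : ℕ), ∃ m, (k : ℝ) < τ i m
  ne : ∀ i j, i ≠ j → ∀ m m', τ i m ≠ τ j m'

/-- Regularity is phrased by countably many comparisons of coordinates (successive rings, natural
bounds) so that it is visibly measurable. -/
theorem measurableSet_regularClock (n : ℕ) :
    MeasurableSet {τ : Fin n → ℕ → ℝ | RegularClock τ} := by
  have h : {τ : Fin n → ℕ → ℝ | RegularClock τ}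
      = (⋂ i, {τ : Fin n → ℕ → ℝ | 0 < τ i 0}) ∩ (⋂ i, ⋂ m, {τ : Fin n → ℕ → ℝ | τ i m < τ i (m + 1)})
        ∩ (⋂ i, ⋂ k : ℕ, ⋃ m, {τ : Fin n → ℕ → ℝ | (k : ℝ) < τ i m})
        ∩ (⋂ i, ⋂ j, ⋂ (_ : i ≠ j), ⋂ m, ⋂ m', {τ : Fin n → ℕ → ℝ | τ i m ≠ τ j m'}) := by
    ext τ
    simp only [Set.mem_inter_iff, Set.mem_iInter, Set.mem_iUnion, Set.mem_ofPred_eq]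
    exact ⟨fun ⟨a, b, c, d⟩ => ⟨⟨⟨a, b⟩, c⟩, d⟩, fun ⟨⟨⟨a, b⟩, c⟩, d⟩ => ⟨a, b, c, d⟩⟩
  have hm : ∀ (i : Fin n) (m : ℕ), Measurable fun τ : Fin n → ℕ → ℝ => τ i m := fun i m =>
    (measurable_pi_apply m).comp (measurable_pi_apply i)
  rw [h]
  refine ((MeasurableSet.inter ?_ ?_).inter ?_).inter ?_
  · exact .iInter fun i => measurableSet_lt measurable_const (hm i 0)
  · exact .iInter fun i => .iInter fun m => measurableSet_lt (hm i m) (hm i (m + 1))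
  · exact .iInter fun i => .iInter fun k => .iUnion fun m => measurableSet_lt measurable_const (hm i m)
  · exact .iInter fun i => .iInter fun j => .iInter fun _ => .iInter fun m => .iInter fun m' =>
      (measurableSet_eq_fun (hm i m) (hm j m')).compl

/-- The number of rings of clock `i` in `(a, b]`. -/
noncomputable def clockCount {n : ℕ} (τ : Fin n → ℕ → ℝ) (i : Fin n) (a b : ℝ) : ℕ :=
  {m : ℕ | τ i m ∈ Set.Ioc a b}.ncard

theorem count_eq_clockCount {n : ℕ} (X : Trajectory n) (i : Fin n) (a b : ℝ) :
    X.count i a b = clockCount X.time i a b := rfl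

theorem measurable_clockCount {n : ℕ} (i : Fin n) (a b : ℝ) :
    Measurable fun τ : Fin n → ℕ → ℝ => clockCount τ i a b := by
  have : Measurable fun τ : Fin n → ℕ → ℝ => {m : ℕ | τ i m ∈ Set.Ioc a b} := by
    refine measurable_set_iff.2 fun m => ?_
    exact measurableSet_setOfPred.1 (((measurable_pi_apply m).comp (measurable_pi_apply i)) measurableSet_Ioc)
  exact measurable_ncard.comp this

namespace RegularClock

variable {n : ℕ} {τ : Fin n → ℕ → ℝ} (h : RegularClock τ)
include h

theorem strictMono (i : Fin n) : StrictMono (τ i) := strictMono_nat_of_lt_succ (h.lt_succ i)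

theorem time_pos (i : Fin n) (m : ℕ) : 0 < τ i m :=
  (h.pos i).trans_le ((h.strictMono i).monotone (Nat.zero_le m))

theorem exists_setOf_le_eq (i : Fin n) (t : ℝ) : ∃ N : ℕ, ∀ m, τ i m ≤ t ↔ m < N := by
  classical
  obtain ⟨k, hk⟩ := exists_nat_gt t
  obtain ⟨m, hm⟩ := h.unbounded i k
  have hex : ∃ m, t < τ i m := ⟨m, hk.trans hm⟩
  refine ⟨Nat.find hex, fun m => ⟨fun hm => ?_, fun hm => not_lt.1 (Nat.find_min hex hm)⟩⟩
  by_contra hc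
  exact absurd (Nat.find_spec hex) (not_lt.2 (((h.strictMono i).monotone (not_lt.1 hc)).trans hm))

/-- The dictionary between times and counts. Through it, later statements about the order of updates
become linear arithmetic with natural numbers. -/
theorem le_iff_lt_clockCount (i : Fin n) (t : ℝ) (m : ℕ) : τ i m ≤ t ↔ m < clockCount τ i 0 t := by
  obtain ⟨N, hN⟩ := h.exists_setOf_le_eq i t
  have : {m : ℕ | τ i m ∈ Set.Ioc 0 t} = Set.Iio N := by
    ext m; simp [hN, h.time_pos]
  rw [clockCount, this, hN]; simp [Set.ncard_eq_toFinset_card']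

theorem setOf_mem_Ioc (i : Fin n) {a b : ℝ} :
    {m : ℕ | τ i m ∈ Set.Ioc a b} = Set.Ico (clockCount τ i 0 a) (clockCount τ i 0 b) := by
  ext m
  simp only [Set.mem_ofPred_eq, Set.mem_Ioc, Set.mem_Ico]
  rw [h.le_iff_lt_clockCount i b, ← not_le, h.le_iff_lt_clockCount i a, not_lt]

theorem clockCount_eq_sub (i : Fin n) (a b : ℝ) :
    clockCount τ i a b = clockCount τ i 0 b - clockCount τ i 0 a := by
  rw [clockCount, h.setOf_mem_Ioc]; simp [Set.ncard_eq_toFinset_card']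

theorem clockCount_mono (i : Fin n) {a b : ℝ} (hab : a ≤ b) :
    clockCount τ i 0 a ≤ clockCount τ i 0 b := by
  by_contra! hc
  have h1 := (h.le_iff_lt_clockCount i a _).2 hc
  exact absurd ((h.le_iff_lt_clockCount i b _).1 (h1.trans hab)) (lt_irrefl _)

theorem clockCount_add (i : Fin n) {a b : ℝ} (hab : a ≤ b) :
    clockCount τ i 0 a + clockCount τ i a b = clockCount τ i 0 b := by
  have := h.clockCount_mono i hab
  rw [h.clockCount_eq_sub i a b]; omega

end RegularClock

/-! ### Poisson probabilities. -/

section Poisson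

theorem poissonMeasure_zero_set (x : ℝ) (hx : 0 ≤ x) :
    poissonMeasure x.toNNReal {0} = ENNReal.ofReal (Real.exp (-x)) := by
  rw [poissonMeasure_singleton]; simp [hx]

theorem poissonMeasure_pos_set (x : ℝ) (hx : 0 ≤ x) :
    poissonMeasure x.toNNReal {m | 1 ≤ m} = ENNReal.ofReal (1 - Real.exp (-x)) := by
  have : {m : ℕ | 1 ≤ m} = {0}ᶜ := by ext m; simp [Nat.one_le_iff_ne_zero]
  rw [this, prob_compl_eq_one_sub (measurableSet_singleton _), poissonMeasure_zero_set x hx,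
    ENNReal.ofReal_sub _ (Real.exp_nonneg _), ENNReal.ofReal_one]

/-- Only the atom at two is kept. -/
theorem poissonMeasure_two_le_set (x : ℝ) (hx : 0 ≤ x) :
    ENNReal.ofReal (Real.exp (-x) * x ^ 2 / 2) ≤ poissonMeasure x.toNNReal {m | 2 ≤ m} := by
  refine le_trans (le_of_eq ?_) (measure_mono (?_ : ({2} : Set ℕ) ⊆ _))
  · rw [poissonMeasure_singleton]; simp [hx]
  · intro m hm; simp_all

theorem lintegral_exp_poissonMeasure (x : ℝ) (hx : 0 ≤ x) :
    ∫⁻ m, ENNReal.ofReal (Real.exp (m : ℝ)) ∂(poissonMeasure x.toNNReal)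
      = ENNReal.ofReal (Real.exp (x * (Real.exp 1 - 1))) := by
  have hs : HasSum (fun m : ℕ => Real.exp (-x) * x ^ m / (m.factorial : ℝ) * Real.exp m)
      (Real.exp (x * (Real.exp 1 - 1))) := by
    have := (NormedSpace.expSeries_div_hasSum_exp (x * Real.exp 1)).mul_left (Real.exp (-x))
    rw [← Real.exp_eq_exp_ℝ, ← Real.exp_add] at this
    have e1 : (fun m : ℕ => Real.exp (-x) * x ^ m / (m.factorial : ℝ) * Real.exp m)
        = fun m : ℕ => Real.exp (-x) * ((x * Real.exp 1) ^ m / (m.factorial : ℝ)) := by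
      funext m
      rw [mul_pow, ← Real.exp_nat_mul, mul_one]; ring
    rw [e1, show x * (Real.exp 1 - 1) = -x + x * Real.exp 1 by ring]
    exact this
  rw [poissonMeasure, lintegral_sum_measure]
  simp_rw [lintegral_smul_measure, lintegral_dirac, smul_eq_mul]
  rw [← hs.tsum_eq, ENNReal.ofReal_tsum_of_nonneg (fun m => by positivity) hs.summable]
  refine tsum_congr fun m => ?_
  rw [← ENNReal.ofReal_mul (by positivity)]
  simp [hx]

end Poisson

/-! ### Almost sure regularity of the clocks. -/

namespace IsGlauberDynamics

variable {Ω : Type*} [mΩ : MeasurableSpace Ω] {n : ℕ} {ψ : Multilinear n} {P : Measure Ω}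
  [IsProbabilityMeasure P] {X : Ω → Trajectory n} (hX : IsGlauberDynamics ψ P X)
include hX

theorem measurable_clocks : Measurable fun ω => (X ω).time :=
  measurable_pi_lambda _ fun i => measurable_pi_lambda _ fun m => hX.measurable_time i m

theorem measurable_count (i : Fin n) (a b : ℝ) : Measurable fun ω => (X ω).count i a b :=
  (measurable_clockCount i a b).comp hX.measurable_clocks

theorem measure_count_ge_one_le (i : Fin n) {a b : ℝ} (ha : 0 ≤ a) (hab : a ≤ b) :
    P {ω | 1 ≤ (X ω).count i a b} ≤ ENNReal.ofReal (b - a) := by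
  have h := (hX.count_law i a b ha hab).measure_eq (p := fun m => 1 ≤ m) (MeasurableSet.of_discrete)
  rw [h, poissonMeasure_pos_set _ (sub_nonneg.2 hab)]
  apply ENNReal.ofReal_le_ofReal
  linarith [Real.add_one_le_exp (-(b - a))]

/-- `Set.ncard` of an infinite set is zero, so a ring makes a count positive only once finiteness is
known. -/
theorem ae_finite_rings (i : Fin n) (t : ℝ) : ∀ᵐ ω ∂P, {m | (X ω).time i m ≤ t}.Finite := by
  filter_upwards [hX.time_tendsto i] with ω h
  have := h.eventually (eventually_gt_atTop t)
  obtain ⟨N, hN⟩ := eventually_atTop.1 this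
  refine (Set.finite_Iio N).subset fun m hm => ?_
  by_contra hc
  exact absurd (hN m (not_lt.1 hc)) (not_lt.2 hm)

/-- A common ring makes both clocks ring in the same one of `N` cells of length `T / N`. By
independence this has probability at most `(T / N) ^ 2` for each cell, and there are `N` cells.
Letting `N` tend to infinity then excludes common rings, although only laws of counts are given. -/
theorem measure_common_ring_le {i j : Fin n} (hij : i ≠ j) (T N : ℕ) (hN : 0 < N) :
    P {ω | ∃ m m', (X ω).time i m = (X ω).time j m' ∧ 0 < (X ω).time i m ∧ (X ω).time i m ≤ T}
      ≤ ENNReal.ofReal ((T : ℝ) ^ 2 / N) := by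
  set h : ℝ := T / N with hh
  have hN' : (0 : ℝ) < N := by exact_mod_cast hN
  have h0 : 0 ≤ h := by positivity
  have hind := hX.count_indep (fun c => c * h) (by simp) (fun a b hab => by
    have : (a : ℝ) ≤ b := by exact_mod_cast hab
    exact mul_le_mul_of_nonneg_right this h0)
  have hcell : ∀ c : ℕ, P ({ω | 1 ≤ (X ω).count i (c * h) ((c + 1 : ℕ) * h)} ∩
      {ω | 1 ≤ (X ω).count j (c * h) ((c + 1 : ℕ) * h)}) ≤ ENNReal.ofReal (h ^ 2) := by
    intro c
    have hi := hind.indepFun (i := (i, c)) (j := (j, c)) (by simp [hij])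
    rw [hi.measure_inter_preimage_eq_mul {m | 1 ≤ m} {m | 1 ≤ m} .of_discrete .of_discrete
      |> (fun e => (show P ({ω | 1 ≤ (X ω).count i (c * h) ((c + 1 : ℕ) * h)} ∩
      {ω | 1 ≤ (X ω).count j (c * h) ((c + 1 : ℕ) * h)}) = _ from e)), pow_two, ENNReal.ofReal_mul h0]
    have hle : (c : ℝ) * h ≤ ((c + 1 : ℕ) : ℝ) * h := by
      push_cast; nlinarith
    have e : ((c + 1 : ℕ) : ℝ) * h - c * h = h := by push_cast; ring
    refine mul_le_mul' ?_ ?_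
    · have := hX.measure_count_ge_one_le i (a := c * h) (b := ((c + 1 : ℕ) : ℝ) * h) (by positivity) hle
      rwa [e] at this
    · have := hX.measure_count_ge_one_le j (a := c * h) (b := ((c + 1 : ℕ) : ℝ) * h) (by positivity) hle
      rwa [e] at this
  have hsub : ∀ᵐ ω ∂P, ω ∈ {ω | ∃ m m', (X ω).time i m = (X ω).time j m' ∧ 0 < (X ω).time i m ∧
      (X ω).time i m ≤ T} → ω ∈ ⋃ c ∈ Finset.range N,
        ({ω | 1 ≤ (X ω).count i (c * h) ((c + 1 : ℕ) * h)} ∩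
      {ω | 1 ≤ (X ω).count j (c * h) ((c + 1 : ℕ) * h)}) := by
    filter_upwards [hX.ae_finite_rings i T, hX.ae_finite_rings j T] with ω hfi hfj
    rintro ⟨m, m', he, hpos, hle⟩
    have hT : (0 : ℝ) < T := hpos.trans_le hle
    have hpos' : 0 < h := by positivity
    set s := (X ω).time i m
    have hNh : (N : ℝ) * h = T := by rw [hh]; field_simp
    -- Cells are open on the left and closed on the right, so the cell of `s` has the number `⌈s /
    -- h⌉₊ - 1`.
    have hceil : 0 < ⌈s / h⌉₊ := Nat.ceil_pos.2 (by positivity)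
    have hc1 : ⌈s / h⌉₊ ≤ N := Nat.ceil_le.2 (by rw [div_le_iff₀ hpos', hNh]; exact hle)
    have hc2 : (((⌈s / h⌉₊ - 1 : ℕ) : ℝ)) < s / h := by
      have := Nat.ceil_lt_add_one (a := s / h) (by positivity)
      rw [Nat.cast_pred hceil]; linarith
    have hc3 : s / h ≤ ((⌈s / h⌉₊ - 1 + 1 : ℕ) : ℝ) := by
      rw [Nat.sub_add_cancel hceil]; exact Nat.le_ceil _
    rw [lt_div_iff₀ hpos'] at hc2
    rw [div_le_iff₀ hpos'] at hc3
    have hcl : ((⌈s / h⌉₊ - 1 + 1 : ℕ) : ℝ) * h ≤ T := by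
      rw [Nat.sub_add_cancel hceil, ← hNh]
      exact mul_le_mul_of_nonneg_right (by exact_mod_cast hc1) h0
    simp only [Set.mem_iUnion, Finset.mem_range]
    refine ⟨⌈s / h⌉₊ - 1, by omega, ?_, ?_⟩
    · refine Nat.one_le_iff_ne_zero.2 ?_
      refine ((Set.ncard_pos (hfi.subset fun q hq => ?_)).2 ⟨m, ?_⟩).ne'
      · exact hq.2.trans hcl
      · exact ⟨hc2, hc3⟩
    · refine Nat.one_le_iff_ne_zero.2 ?_
      refine ((Set.ncard_pos (hfj.subset fun q hq => ?_)).2 ⟨m', ?_⟩).ne'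
      · exact hq.2.trans hcl
      · show (X ω).time j m' ∈ Set.Ioc _ _
        rw [← he]; exact ⟨hc2, hc3⟩
  calc P _ ≤ P _ := measure_mono_ae hsub
    _ ≤ ∑ c ∈ Finset.range N, _ := measure_biUnion_finset_le _ _
    _ ≤ ∑ c ∈ Finset.range N, ENNReal.ofReal (h ^ 2) := Finset.sum_le_sum fun c _ => hcell c
    _ = ENNReal.ofReal ((T : ℝ) ^ 2 / N) := by
      rw [Finset.sum_const, Finset.card_range, nsmul_eq_mul, ← ENNReal.ofReal_natCast,
        ← ENNReal.ofReal_mul (by positivity)]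
      congr 1; rw [hh]; field_simp

theorem measure_common_ring_eq_zero {i j : Fin n} (hij : i ≠ j) (T : ℕ) :
    P {ω | ∃ m m', (X ω).time i m = (X ω).time j m' ∧ 0 < (X ω).time i m ∧ (X ω).time i m ≤ T} = 0 := by
  have hlim : Tendsto (fun N : ℕ => ENNReal.ofReal ((T : ℝ) ^ 2 / N)) atTop (nhds 0) := by
    have := tendsto_const_div_atTop_nhds_zero_nat ((T : ℝ) ^ 2)
    simpa using ENNReal.tendsto_ofReal this
  refine le_antisymm (ge_of_tendsto hlim ?_) zero_le
  filter_upwards [eventually_gt_atTop 0] with N hN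
  exact hX.measure_common_ring_le hij T N hN

theorem ae_regularClock : ∀ᵐ ω ∂P, RegularClock (X ω).time := by
  have h1 := ae_all_iff.2 hX.time_pos
  have h2 := ae_all_iff.2 hX.time_strictMono
  have h3 := ae_all_iff.2 hX.time_tendsto
  have h4 : ∀ᵐ ω ∂P, ∀ i j : Fin n, i ≠ j → ∀ T : ℕ,
      ¬ ∃ m m', (X ω).time i m = (X ω).time j m' ∧ 0 < (X ω).time i m ∧ (X ω).time i m ≤ T := by
    refine ae_all_iff.2 fun i => ae_all_iff.2 fun j => ?_
    by_cases hij : i = j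
    · simp [hij]
    · refine Eventually.mono (ae_all_iff.2 fun T => ?_) fun ω h _ => h
      exact measure_eq_zero_iff_ae_notMem.1 (hX.measure_common_ring_eq_zero hij T)
  filter_upwards [h1, h2, h3, h4] with ω a b c e
  refine ⟨a, fun i m => b i (Nat.lt_succ_self m), fun i k => ?_, fun i j hij m m' he => ?_⟩
  · exact ((c i).eventually (eventually_gt_atTop (k : ℝ))).exists
  · obtain ⟨T, hT⟩ := exists_nat_ge ((X ω).time i m)
    exact e i j hij T ⟨m, m', he, (a i).trans_le ((b i).monotone (Nat.zero_le m)), hT⟩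

end IsGlauberDynamics

/-! ### Histories: the clocks together with the spins chosen up to a time. -/

section History

variable {Ω : Type*} {n : ℕ}

/-- The information in the initial configuration and all clocks. -/
abbrev clockInfo (X : Ω → Trajectory n) : MeasurableSpace Ω :=
  MeasurableSpace.comap (fun ω => (X ω).init) inferInstance ⊔
  MeasurableSpace.comap (fun ω => (X ω).time) inferInstance

/-- The initial configuration, all clocks, and the spins chosen up to the random time `σ`. -/
noncomputable abbrev history (X : Ω → Trajectory n) (σ : Ω → ℝ) : MeasurableSpace Ω :=
  clockInfo X ⊔ ⨆ q : Fin n × ℕ, MeasurableSpace.comap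
    (fun ω => decide ((X ω).time q.1 q.2 ≤ σ ω) && (X ω).spin q.1 q.2) inferInstance

variable {X : Ω → Trajectory n} {σ σ' : Ω → ℝ}

theorem clockInfo_le_history : clockInfo X ≤ history X σ := le_sup_left

theorem clockInfo_le_past (i : Fin n) (m : ℕ) : clockInfo X ≤ past X i m := le_sup_left

theorem measurable_clocks_time : Measurable[clockInfo X] fun ω => (X ω).time :=
  Measurable.mono (comap_measurable _) le_sup_right le_rfl

theorem measurable_clocks_init : Measurable[clockInfo X] fun ω => (X ω).init :=
  Measurable.mono (comap_measurable _) le_sup_left le_rfl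

theorem measurable_clockInfo_comp {β : Type*} [MeasurableSpace β] {f : (Fin n → ℕ → ℝ) → β}
    (hf : Measurable f) : Measurable[clockInfo X] fun ω => f (X ω).time :=
  hf.comp measurable_clocks_time

theorem measurable_time_apply (i : Fin n) (m : ℕ) : Measurable[clockInfo X] fun ω => (X ω).time i m :=
  measurable_clockInfo_comp (f := fun τ => τ i m)
    ((measurable_pi_apply m).comp (measurable_pi_apply i))

theorem measurable_clockInfo_count (i : Fin n) (a b : ℝ) :
    Measurable[clockInfo X] fun ω => (X ω).count i a b :=
  measurable_clockInfo_comp (measurable_clockCount i a b)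

theorem measurable_random_time {N : Ω → ℕ} (i : Fin n) (hN : Measurable[clockInfo X] N) :
    Measurable[clockInfo X] fun ω => (X ω).time i (N ω) := by
  let _ : MeasurableSpace Ω := clockInfo X
  intro S hS
  have : (fun ω => (X ω).time i (N ω)) ⁻¹' S
      = ⋃ m, (N ⁻¹' {m}) ∩ ((fun ω => (X ω).time i m) ⁻¹' S) := by
    ext ω; simp
  rw [this]
  exact .iUnion fun m => (hN (measurableSet_singleton m)).inter (measurable_time_apply i m hS)

/-- Comparison of a history with another `σ`-algebra on a set determined by the clocks. -/
theorem history_inter {m₂ : MeasurableSpace Ω} (hb : clockInfo X ≤ m₂) {A : Set Ω}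
    (hA : MeasurableSet[clockInfo X] A)
    (hq : ∀ q : Fin n × ℕ,
      MeasurableSet[m₂] ({ω | (X ω).time q.1 q.2 ≤ σ ω ∧ (X ω).spin q.1 q.2 = true} ∩ A))
    {S : Set Ω} (hS : MeasurableSet[history X σ] S) : MeasurableSet[m₂] (S ∩ A) := by
  -- The sets whose trace on `A` is `m₂`-measurable form a `σ`-algebra, so it suffices to look at
  -- the generators of the history.
  let m₃ : MeasurableSpace Ω :=
    { MeasurableSet' := fun S => MeasurableSet[m₂] (S ∩ A)
      measurableSet_empty := by simp
      measurableSet_compl := fun S hS => by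
        have : Sᶜ ∩ A = A \ (S ∩ A) := by ext ω; simp; tauto
        rw [this]; exact (hb _ hA).diff hS
      measurableSet_iUnion := fun f hf => by
        rw [Set.iUnion_inter]; exact MeasurableSet.iUnion hf }
  have hle : history X σ ≤ m₃ := by
    refine sup_le (fun S hS => (hb _ hS).inter (hb _ hA)) (iSup_le fun q => ?_)
    rw [← measurable_iff_comap_le]
    refine measurable_to_bool ?_
    have : (fun ω => decide ((X ω).time q.1 q.2 ≤ σ ω) && (X ω).spin q.1 q.2) ⁻¹' {true}
        = {ω | (X ω).time q.1 q.2 ≤ σ ω ∧ (X ω).spin q.1 q.2 = true} := by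
      ext ω; simp
    rw [this]; exact hq q
  exact hle _ hS

/-- Off `A` the function is zero, so a preimage is its trace on `A` together with all or nothing of
the complement. -/
theorem measurable_of_history_support {m₂ : MeasurableSpace Ω} (hb : clockInfo X ≤ m₂) {A : Set Ω}
    (hA : MeasurableSet[clockInfo X] A)
    (hq : ∀ q : Fin n × ℕ,
      MeasurableSet[m₂] ({ω | (X ω).time q.1 q.2 ≤ σ ω ∧ (X ω).spin q.1 q.2 = true} ∩ A))
    {f : Ω → ℝ≥0∞} (hf : Measurable[history X σ] f) (hs : ∀ ω, f ω ≠ 0 → ω ∈ A) :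
    Measurable[m₂] f := by
  classical
  intro S hS
  have h1 : f ⁻¹' S = (f ⁻¹' S ∩ A) ∪ ((if (0 : ℝ≥0∞) ∈ S then Set.univ else ∅) ∩ Aᶜ) := by
    ext ω
    by_cases hω : ω ∈ A
    · simp [hω]
    · have : f ω = 0 := by by_contra hc; exact hω (hs ω hc)
      by_cases h0 : (0 : ℝ≥0∞) ∈ S <;> simp [hω, this, h0]
  rw [h1]
  refine (history_inter hb hA hq (hf hS)).union (MeasurableSet.inter ?_ (hb _ hA).compl)
  split_ifs <;> simp

theorem measurableSet_history_spin (q : Fin n × ℕ) :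
    MeasurableSet[history X σ] {ω | (X ω).time q.1 q.2 ≤ σ ω ∧ (X ω).spin q.1 q.2 = true} := by
  have h : Measurable[history X σ]
      (fun ω => decide ((X ω).time q.1 q.2 ≤ σ ω) && (X ω).spin q.1 q.2) :=
    Measurable.mono (comap_measurable _)
      ((le_iSup (fun q : Fin n × ℕ => MeasurableSpace.comap
    (fun ω => decide ((X ω).time q.1 q.2 ≤ σ ω) && (X ω).spin q.1 q.2) inferInstance) q).trans
        le_sup_right) le_rfl
  have := h (measurableSet_singleton true)
  convert this using 1
  ext ω; simp

theorem measurableSet_past_spin (i : Fin n) (m : ℕ) (q : Fin n × ℕ) :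
    MeasurableSet[past X i m]
      {ω | (X ω).time q.1 q.2 < (X ω).time i m ∧ (X ω).spin q.1 q.2 = true} := by
  have h : Measurable[past X i m]
      (fun ω => decide ((X ω).time q.1 q.2 < (X ω).time i m) && (X ω).spin q.1 q.2) :=
    Measurable.mono (comap_measurable _)
      ((le_iSup (fun q : Fin n × ℕ => MeasurableSpace.comap
    (fun ω => decide ((X ω).time q.1 q.2 < (X ω).time i m) && (X ω).spin q.1 q.2)
      inferInstance) q).trans le_sup_right) le_rfl
  have := h (measurableSet_singleton true)
  convert this using 1
  ext ω; simp

/-- Where `σ` precedes the update, every spin chosen up to `σ` was chosen strictly before the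
update. This makes weights from a history admissible in the law of the update, provided that they
vanish elsewhere. -/
theorem measurable_past_of_history (hσ : Measurable[clockInfo X] σ) {i : Fin n} {m : ℕ}
    {f : Ω → ℝ≥0∞} (hf : Measurable[history X σ] f) (hs : ∀ ω, f ω ≠ 0 → σ ω < (X ω).time i m) :
    Measurable[past X i m] f := by
  have hA : MeasurableSet[clockInfo X] {ω | σ ω < (X ω).time i m} :=
    @measurableSet_lt _ _ _ _ _ (clockInfo X) _ _ _ _ _ hσ (measurable_time_apply i m)
  refine measurable_of_history_support (clockInfo_le_past i m) hA (fun q => ?_) hf hs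
  have h1 : MeasurableSet[clockInfo X] {ω | (X ω).time q.1 q.2 ≤ σ ω} :=
    @measurableSet_le _ _ _ _ _ (clockInfo X) _ _ _ _ _ (measurable_time_apply q.1 q.2) hσ
  have : ({ω | (X ω).time q.1 q.2 ≤ σ ω ∧ (X ω).spin q.1 q.2 = true} ∩ {ω | σ ω < (X ω).time i m})
      = ({ω | (X ω).time q.1 q.2 < (X ω).time i m ∧ (X ω).spin q.1 q.2 = true} ∩
        ({ω | (X ω).time q.1 q.2 ≤ σ ω} ∩ {ω | σ ω < (X ω).time i m})) := by
    ext ω; simp only [Set.mem_inter_iff, Set.mem_ofPred_eq]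
    constructor
    · rintro ⟨⟨a, b⟩, c⟩; exact ⟨⟨a.trans_lt c, b⟩, a, c⟩
    · rintro ⟨⟨a, b⟩, c, e⟩; exact ⟨⟨c, b⟩, e⟩
  rw [this]
  exact (measurableSet_past_spin i m q).inter (clockInfo_le_past i m _ (h1.inter hA))

/-- The spin chosen at the update number `N` of site `a`, if it happened up to time `σ`. -/
noncomputable def maskedSpin (X : Ω → Trajectory n) (σ : Ω → ℝ) (a : Fin n) (N : Ω → ℕ) (ω : Ω) : Bool :=
  decide ((X ω).time a (N ω) ≤ σ ω) && (X ω).spin a (N ω)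

theorem measurable_maskedSpin (a : Fin n) {N : Ω → ℕ} (hN : Measurable[clockInfo X] N) :
    Measurable[history X σ] (maskedSpin X σ a N) := by
  refine @measurable_to_bool _ (history X σ) _ ?_
  have : (maskedSpin X σ a N) ⁻¹' {true} = ⋃ m, (N ⁻¹' {m}) ∩
      {ω | (X ω).time a m ≤ σ ω ∧ (X ω).spin a m = true} := by
    ext ω; simp [maskedSpin]
  rw [this]
  exact @MeasurableSet.iUnion _ _ (history X σ) _ _ fun m =>
    @MeasurableSet.inter _ (history X σ) _ _ (clockInfo_le_history _ (hN (measurableSet_singleton m)))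
      (measurableSet_history_spin (a, m))

theorem maskedSpin_eq {a : Fin n} {N : Ω → ℕ} {ω : Ω} (h : (X ω).time a (N ω) ≤ σ ω) :
    maskedSpin X σ a N ω = (X ω).spin a (N ω) := by
  simp [maskedSpin, h]

/-- The configuration at time `t`, as a function of the history. -/
noncomputable def maskedConfig (X : Ω → Trajectory n) (t : ℝ) (ω : Ω) (a : Fin n) : Bool :=
  if (X ω).count a 0 t = 0 then (X ω).init a
    else maskedSpin X (fun _ => t) a (fun ω => (X ω).count a 0 t - 1) ω

theorem measurable_maskedConfig (t : ℝ) :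
    Measurable[history X (fun _ => t)] (maskedConfig X t) := by
  let _ : MeasurableSpace Ω := history X (fun _ => t)
  refine measurable_pi_lambda _ fun a => ?_
  have hc : Measurable[clockInfo X] fun ω => (X ω).count a 0 t := measurable_clockInfo_count a 0 t
  refine Measurable.ite ?_ ?_ ?_
  · exact clockInfo_le_history _ (hc (measurableSet_singleton 0))
  · exact (measurable_pi_apply a).comp (measurable_clocks_init.mono clockInfo_le_history le_rfl)
  · refine measurable_maskedSpin a ?_
    exact (@Measurable.of_discrete _ _ _ _ _ (fun k : ℕ => k - 1)).comp hc

/-- The mask is never active: the last update counted up to time `t` has indeed happened by then. -/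
theorem maskedConfig_eq {t : ℝ} {ω : Ω} (h : RegularClock (X ω).time) :
    maskedConfig X t ω = (X ω).config t := by
  funext a
  unfold maskedConfig Trajectory.config
  split_ifs with h0
  · rfl
  · rw [maskedSpin_eq]
    rw [h.le_iff_lt_clockCount, ← count_eq_clockCount]; omega

end History

/-! ### Integrating out the spin of one update. -/

/-- The conditional probability that site `i` takes the spin `b` at an update. -/
noncomputable def updateProb {n : ℕ} (ψ : Multilinear n) (i : Fin n) (b : Bool) (x : Fin n → Bool) : ℝ :=
  if b then Real.sigmoid (2 * (ψ.pderiv i).eval x) else 1 - Real.sigmoid (2 * (ψ.pderiv i).eval x)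

theorem updateProb_nonneg {n : ℕ} (ψ : Multilinear n) (i : Fin n) (b : Bool) (x : Fin n → Bool) :
    0 ≤ updateProb ψ i b x := by
  unfold updateProb
  split_ifs
  · exact Real.sigmoid_nonneg _
  · exact sub_nonneg.2 (Real.sigmoid_le_one _)

namespace IsGlauberDynamics

variable {Ω : Type*} [mΩ : MeasurableSpace Ω] {n : ℕ} {ψ : Multilinear n} {P : Measure Ω}
  [IsProbabilityMeasure P] {X : Ω → Trajectory n} (hX : IsGlauberDynamics ψ P X)
include hX

theorem clockInfo_le : clockInfo X ≤ mΩ :=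
  sup_le hX.measurable_init.comap_le hX.measurable_clocks.comap_le

theorem past_le (i : Fin n) (m : ℕ) : past X i m ≤ mΩ := by
  refine sup_le hX.clockInfo_le (iSup_le fun q => ?_)
  rw [← measurable_iff_comap_le]
  refine measurable_to_bool ?_
  have : (fun ω => decide ((X ω).time q.1 q.2 < (X ω).time i m) && (X ω).spin q.1 q.2) ⁻¹' {true}
      = {ω | (X ω).time q.1 q.2 < (X ω).time i m} ∩ {ω | (X ω).spin q.1 q.2 = true} := by
    ext ω; simp
  rw [this]
  exact (measurableSet_lt (hX.measurable_time _ _) (hX.measurable_time _ _)).inter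
    (hX.measurable_spin _ _ (measurableSet_singleton true))

theorem history_le {σ : Ω → ℝ} (hσ : Measurable[clockInfo X] σ) : history X σ ≤ mΩ := by
  refine sup_le hX.clockInfo_le (iSup_le fun q => ?_)
  rw [← measurable_iff_comap_le]
  refine measurable_to_bool ?_
  have : (fun ω => decide ((X ω).time q.1 q.2 ≤ σ ω) && (X ω).spin q.1 q.2) ⁻¹' {true}
      = {ω | (X ω).time q.1 q.2 ≤ σ ω} ∩ {ω | (X ω).spin q.1 q.2 = true} := by
    ext ω; simp
  rw [this]
  exact (measurableSet_le (hX.measurable_time _ _) (hσ.mono hX.clockInfo_le le_rfl)).inter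
    (hX.measurable_spin _ _ (measurableSet_singleton true))

/-- The right-hand side of `update_law` is not shown to be measurable with respect to the past. The
function `g` built from the conditional expectation is, and it agrees with the update probability
almost surely. -/
theorem ae_updateProb_eq (i : Fin n) (m : ℕ) (b : Bool) :
    ∃ g : Ω → ℝ≥0∞, Measurable[past X i m] g ∧
      (g =ᵐ[P] fun ω => ENNReal.ofReal (updateProb ψ i b ((X ω).config ((X ω).time i m)))) ∧
      ∀ S, MeasurableSet[past X i m] S →
        P (S ∩ {ω | (X ω).spin i m = b}) = ∫⁻ ω in S, g ω ∂P := by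
  have hle := hX.past_le i m
  set Y : Ω → ℝ := fun ω => if (X ω).spin i m then (1 : ℝ) else 0 with hY
  have hms : MeasurableSet {ω | (X ω).spin i m = true} :=
    hX.measurable_spin i m (measurableSet_singleton true)
  have hYm : Measurable Y := Measurable.ite hms measurable_const measurable_const
  have hYi : Integrable Y P := by
    refine Integrable.of_bound hYm.aestronglyMeasurable 1 (Eventually.of_forall fun ω => ?_)
    simp only [hY]; split_ifs <;> simp
  set c : Ω → ℝ := P[Y | past X i m] with hc
  have hcm : Measurable[past X i m] c := stronglyMeasurable_condExp.measurable
  have hce := hX.update_law i m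
  have hint : ∀ S, MeasurableSet[past X i m] S →
      ∫ ω in S, c ω ∂P = P.real (S ∩ {ω | (X ω).spin i m = true}) := by
    intro S hS
    rw [hc, setIntegral_condExp hle hYi hS]
    have : Y = Set.indicator {ω | (X ω).spin i m = true} 1 := by
      funext ω; simp [hY, Set.indicator_apply]
    rw [this, setIntegral_indicator hms]
    simp
  have hc0 : ∀ᵐ ω ∂P, 0 ≤ c ω ∧ c ω ≤ 1 := by
    filter_upwards [hce] with ω h
    rw [hc, h]; exact ⟨Real.sigmoid_nonneg _, Real.sigmoid_le_one _⟩
  cases b with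
  | true =>
    refine ⟨fun ω => ENNReal.ofReal (c ω), ENNReal.measurable_ofReal.comp hcm, ?_, ?_⟩
    · filter_upwards [hce] with ω h
      simp only [updateProb, if_true]; rw [hc, h]
    · intro S hS
      rw [← ofReal_integral_eq_lintegral_ofReal integrable_condExp.integrableOn
        (ae_restrict_of_ae (hc0.mono fun ω h => h.1)), hint S hS, measureReal_def,
        ENNReal.ofReal_toReal (measure_ne_top _ _)]
  | false =>
    refine ⟨fun ω => ENNReal.ofReal (1 - c ω), ENNReal.measurable_ofReal.comp
      ((@measurable_const _ _ _ (past X i m) 1).sub hcm), ?_, ?_⟩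
    · filter_upwards [hce] with ω h
      simp only [updateProb, Bool.false_eq_true, if_false]; rw [hc, h]
    · intro S hS
      show _ = ∫⁻ ω in S, ENNReal.ofReal (1 - c ω) ∂P
      have hi1 : Integrable (fun ω => 1 - c ω) P := (integrable_const 1).sub integrable_condExp
      rw [← ofReal_integral_eq_lintegral_ofReal hi1.integrableOn
        (ae_restrict_of_ae (hc0.mono fun ω h => sub_nonneg.2 h.2)),
        integral_sub (integrable_const _).integrableOn integrable_condExp.integrableOn, hint S hS]
      have h1 : S ∩ {ω | (X ω).spin i m = false} = S \ (S ∩ {ω | (X ω).spin i m = true}) := by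
        ext ω; simp
      have h2 : P.real (S ∩ {ω | (X ω).spin i m = false})
          = P.real S - P.real (S ∩ {ω | (X ω).spin i m = true}) := by
        rw [h1, measureReal_sdiff Set.inter_subset_left ((hle _ hS).inter hms)]
      rw [setIntegral_const, smul_eq_mul, mul_one, ← h2, measureReal_def,
        ENNReal.ofReal_toReal (measure_ne_top _ _)]

theorem lintegral_past_spin (i : Fin n) (m : ℕ) (b : Bool) {f : Ω → ℝ≥0∞}
    (hf : Measurable[past X i m] f) :
    ∫⁻ ω, f ω * (if (X ω).spin i m = b then 1 else 0) ∂P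
      = ∫⁻ ω, f ω * ENNReal.ofReal (updateProb ψ i b ((X ω).config ((X ω).time i m))) ∂P := by
  obtain ⟨g, hgm, hge, hgS⟩ := hX.ae_updateProb_eq i m b
  have hle := hX.past_le i m
  have hms : MeasurableSet {ω | (X ω).spin i m = b} :=
    hX.measurable_spin i m (measurableSet_singleton b)
  have hfm : Measurable f := hf.mono hle le_rfl
  have hgm' : Measurable g := hgm.mono hle le_rfl
  have h1 : ∫⁻ ω, f ω * ENNReal.ofReal (updateProb ψ i b ((X ω).config ((X ω).time i m))) ∂P
      = ∫⁻ ω, g ω * f ω ∂P := by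
    refine lintegral_congr_ae ?_
    filter_upwards [hge] with ω h
    rw [h, mul_comm]
  have h2 : ∫⁻ ω, f ω * (if (X ω).spin i m = b then 1 else 0) ∂P
      = ∫⁻ ω in {ω | (X ω).spin i m = b}, f ω ∂P := by
    rw [← lintegral_indicator hms]
    refine lintegral_congr fun ω => ?_
    simp [Set.indicator_apply]
  -- On the past, restricting to the spin `b` and using the density `g` give the same measure. Hence
  -- integrals of all past-measurable functions agree, not only of indicators.
  have h3 : (P.restrict {ω | (X ω).spin i m = b}).trim hle = (P.withDensity g).trim hle := by
    refine @Measure.ext _ (past X i m) _ _ fun S hS => ?_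
    rw [trim_measurableSet_eq hle hS, trim_measurableSet_eq hle hS, withDensity_apply _ (hle _ hS),
      ← hgS S hS, Measure.restrict_apply (hle _ hS)]
  rw [h1, h2, ← lintegral_trim hle hf, h3, lintegral_trim hle hf,
    lintegral_withDensity_eq_lintegral_mul _ hgm' hfm]
  rfl

/-- Integration over the spin chosen at a random update of site `i` after time `σ`. -/
theorem lintegral_spin {σ : Ω → ℝ} (hσ : Measurable[clockInfo X] σ) (i : Fin n) {N : Ω → ℕ}
    (hN : Measurable[clockInfo X] N) {H : Bool → Ω → ℝ≥0∞} (hH : ∀ b, Measurable[history X σ] (H b))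
    (hs : ∀ b ω, H b ω ≠ 0 → σ ω < (X ω).time i (N ω)) :
    ∫⁻ ω, H ((X ω).spin i (N ω)) ω ∂P
      = ∫⁻ ω, ∑ b, H b ω *
          ENNReal.ofReal (updateProb ψ i b ((X ω).config ((X ω).time i (N ω)))) ∂P := by
  have hNm : ∀ m, MeasurableSet (N ⁻¹' {m}) := fun m =>
    hX.clockInfo_le _ (hN (measurableSet_singleton m))
  have hU : ⋃ m, N ⁻¹' {m} = Set.univ := by ext ω; simp
  have hd : Pairwise (Function.onFun Disjoint fun m => N ⁻¹' {m}) := by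
    intro a b hab
    refine Set.disjoint_left.2 fun ω h1 h2 => hab ?_
    simp at h1 h2; omega
  -- The space is cut according to the value of `N`, so that the number of the update is
  -- deterministic on each piece.
  rw [← setLIntegral_univ, ← setLIntegral_univ (fun ω => ∑ b, H b ω * _), ← hU,
    lintegral_iUnion hNm hd, lintegral_iUnion hNm hd]
  refine tsum_congr fun m => ?_
  have hfm : ∀ b, Measurable[past X i m] ((N ⁻¹' {m}).indicator (H b)) := fun b => by
    refine measurable_past_of_history hσ (f := (N ⁻¹' {m}).indicator (H b)) ?_ ?_
    · exact (hH b).indicator (clockInfo_le_history _ (hN (measurableSet_singleton m)))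
    · intro ω hω
      have h1 : ω ∈ N ⁻¹' {m} := Set.mem_of_indicator_ne_zero hω
      rw [Set.indicator_of_mem h1] at hω
      have := hs b ω hω
      rwa [show N ω = m from h1] at this
  have key := fun b => hX.lintegral_past_spin i m b (hfm b)
  have hms : ∀ b, MeasurableSet {ω | (X ω).spin i m = b} := fun b =>
    hX.measurable_spin i m (measurableSet_singleton b)
  have e1 : ∫⁻ ω in N ⁻¹' {m}, H ((X ω).spin i (N ω)) ω ∂P
      = ∑ b, ∫⁻ ω, (N ⁻¹' {m}).indicator (H b) ω * (if (X ω).spin i m = b then 1 else 0) ∂P := by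
    rw [← lintegral_finsetSum, ← lintegral_indicator (hNm m)]
    · refine lintegral_congr fun ω => ?_
      by_cases h : ω ∈ N ⁻¹' {m}
      · have h' : N ω = m := h
        simp only [Set.indicator_of_mem h, h']
        cases (X ω).spin i m <;> simp
      · simp [Set.indicator_of_notMem h]
    · intro b _
      exact ((hfm b).mono (hX.past_le i m) le_rfl).mul
        (Measurable.ite (hms b) measurable_const measurable_const)
  rw [e1, Finset.sum_congr rfl fun b _ => key b]
  simp only [Fintype.sum_bool]
  rw [← lintegral_add_left', ← lintegral_indicator (hNm m)]
  · refine lintegral_congr fun ω => ?_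
    by_cases h : ω ∈ N ⁻¹' {m}
    · have h' : N ω = m := h
      simp only [Set.indicator_of_mem h, h']
    · simp [Set.indicator_of_notMem h]
  -- The factor `updateProb` has a measurable version by the law of the update, which spares a study
  -- of the configuration at a random time.
  · obtain ⟨g, hg1, hg2, -⟩ := hX.ae_updateProb_eq i m true
    refine (((hfm true).mono (hX.past_le i m) le_rfl).mul
      (hg1.mono (hX.past_le i m) le_rfl)).aemeasurable.congr ?_
    filter_upwards [hg2] with ω hω
    simp [hω]

end IsGlauberDynamics

/-! ### Configurations along a regular trajectory -/

section Path

variable {n : ℕ} {x : Trajectory n} (h : RegularClock x.time)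
include h

theorem config_eq_of_count_eq_zero {a : Fin n} {s t : ℝ} (hst : s ≤ t) (h0 : x.count a s t = 0) :
    x.config t a = x.config s a := by
  have := h.clockCount_add a hst
  rw [← count_eq_clockCount, ← count_eq_clockCount, ← count_eq_clockCount, h0, add_zero] at this
  unfold Trajectory.config
  rw [this]

theorem config_eq_spin {a : Fin n} {t : ℝ} {m : ℕ} (hm : x.count a 0 t = m + 1) :
    x.config t a = x.spin a m := by
  unfold Trajectory.config
  rw [hm]; simp

theorem count_eq_zero_of_subinterval {a : Fin n} {s t s' t' : ℝ} (h1 : s' ≤ s) (h12 : s ≤ t)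
    (h2 : t ≤ t') (h0 : x.count a s' t' = 0) : x.count a s t = 0 := by
  have e1 := h.clockCount_add a (h1.trans (h12.trans h2))
  have e2 := h.clockCount_add a h12
  have e3 := h.clockCount_mono a h1
  have e4 := h.clockCount_mono a h2
  simp only [count_eq_clockCount] at h0 ⊢
  omega

end Path

theorem updateProb_congr {n : ℕ} {ψ : Multilinear n} {i : Fin n} {x y : Fin n → Bool}
    (h : ∀ a, (dependencyGraph ψ).Adj i a → x a = y a) (b : Bool) :
    updateProb ψ i b x = updateProb ψ i b y := by
  unfold updateProb; rw [eval_pderiv_congr h]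

theorem sum_updateProb {n : ℕ} (ψ : Multilinear n) (i : Fin n) (x : Fin n → Bool) :
    updateProb ψ i true x + updateProb ψ i false x = 1 := by
  simp [updateProb]

/-! ### The window pattern -/

/-- The clocks of `i` and `j` ring in the order `iijii` in `(t₀, t₁]`, `(t₁, t₂]`, `(t₂, t₃]`. -/
structure ClockPattern {n : ℕ} (τ : Fin n → ℕ → ℝ) (i j : Fin n) (t₀ t₁ t₂ t₃ : ℝ) : Prop where
  first_i : 2 ≤ clockCount τ i t₀ t₁
  first_j : clockCount τ j t₀ t₁ = 0
  second_i : clockCount τ i t₁ t₂ = 0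
  second_j : 1 ≤ clockCount τ j t₁ t₂
  third_i : 2 ≤ clockCount τ i t₂ t₃
  third_j : clockCount τ j t₂ t₃ = 0

/-- The other neighbours of `i` and `j` do not update in `(t₀, t₃]`. -/
def Quiet {n : ℕ} (ψ : Multilinear n) (τ : Fin n → ℕ → ℝ) (i j : Fin n) (t₀ t₃ : ℝ) : Prop :=
  ∀ a, a ≠ i → a ≠ j → ((dependencyGraph ψ).Adj i a ∨ (dependencyGraph ψ).Adj j a) →
    clockCount τ a t₀ t₃ = 0

/-- The value `1` or `0` of a spin `+1` or `-1`. -/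
def bit (b : Bool) : ℝ := if b then 1 else 0

/-- The statistic as a function of the four spins. -/
def zstat (y₁ y₂ a b : Bool) : ℝ := bit y₁ * bit y₂ - 2 * bit y₁ * bit a + bit a * bit b

theorem neg_two_le_zstat (y₁ y₂ a b : Bool) : -2 ≤ zstat y₁ y₂ a b := by
  cases y₁ <;> cases y₂ <;> cases a <;> cases b <;> norm_num [zstat, bit]

theorem zstat_le_one (y₁ y₂ a b : Bool) : zstat y₁ y₂ a b ≤ 1 := by
  cases y₁ <;> cases y₂ <;> cases a <;> cases b <;> norm_num [zstat, bit]

/-- The conditional expectation of the statistic on a quiet window. -/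
noncomputable def meanStat {n : ℕ} (ψ : Multilinear n) (i j : Fin n) (x : Fin n → Bool) : ℝ :=
  ∑ z, ∑ c, updateProb ψ i z x * updateProb ψ j c (Function.update x i z) *
    (updateProb ψ i true x - updateProb ψ i true (Function.update x j c)) ^ 2

/-- Identities along a path hold only for regular clocks with the right pattern. A weight supported
on such clocks makes them usable under the integral. -/
theorem lintegral_mul_congr_of_support {Ω : Type*} [MeasurableSpace Ω] {P : Measure Ω}
    {Φ f g : Ω → ℝ≥0∞} (h : ∀ ω, Φ ω ≠ 0 → f ω = g ω) :
    ∫⁻ ω, Φ ω * f ω ∂P = ∫⁻ ω, Φ ω * g ω ∂P := by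
  refine lintegral_congr fun ω => ?_
  by_cases h0 : Φ ω = 0
  · simp [h0]
  · rw [h ω h0]

theorem history_mono {Ω : Type*} {n : ℕ} {X : Ω → Trajectory n} {σ σ' : Ω → ℝ}
    (hσ : Measurable[clockInfo X] σ) (h : ∀ ω, σ ω ≤ σ' ω) : history X σ ≤ history X σ' := by
  intro S hS
  have := history_inter (m₂ := history X σ') clockInfo_le_history (A := Set.univ) .univ
    (fun q => ?_) hS
  · simpa using this
  · rw [Set.inter_univ]
    have e : {ω | (X ω).time q.1 q.2 ≤ σ ω ∧ (X ω).spin q.1 q.2 = true}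
        = {ω | (X ω).time q.1 q.2 ≤ σ' ω ∧ (X ω).spin q.1 q.2 = true} ∩
          {ω | (X ω).time q.1 q.2 ≤ σ ω} := by
      ext ω; simp only [Set.mem_inter_iff, Set.mem_ofPred_eq]
      exact ⟨fun ⟨a, b⟩ => ⟨⟨a.trans (h ω), b⟩, a⟩, fun ⟨⟨_, b⟩, c⟩ => ⟨c, b⟩⟩
    rw [e]
    exact (measurableSet_history_spin q).inter (clockInfo_le_history _
      (@measurableSet_le _ _ _ _ _ (clockInfo X) _ _ _ _ _ (measurable_time_apply q.1 q.2) hσ))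

namespace IsGlauberDynamics

variable {Ω : Type*} [mΩ : MeasurableSpace Ω] {n : ℕ} {ψ : Multilinear n} {P : Measure Ω}
  [IsProbabilityMeasure P] {X : Ω → Trajectory n} (hX : IsGlauberDynamics ψ P X)
include hX

/-- The data `V` that survive the step take values in a discrete space, so an arbitrary `F` may be
integrated without further measurability conditions. -/
theorem lintegral_peel {γ : Type*} [MeasurableSpace γ] [DiscreteMeasurableSpace γ] {σ : Ω → ℝ}
    (hσ : Measurable[clockInfo X] σ) (i : Fin n) {N : Ω → ℕ} (hN : Measurable[clockInfo X] N)
    {Φ : Ω → ℝ≥0∞} (hΦ : Measurable[history X σ] Φ)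
    (hs : ∀ ω, Φ ω ≠ 0 → σ ω < (X ω).time i (N ω))
    {V : Ω → γ} (hV : Measurable[history X σ] V) (F : γ → Bool → ℝ) (hF : ∀ v b, 0 ≤ F v b) :
    ∫⁻ ω, Φ ω * ENNReal.ofReal (F (V ω) ((X ω).spin i (N ω))) ∂P
      = ∫⁻ ω, Φ ω * ENNReal.ofReal
          (∑ b, updateProb ψ i b ((X ω).config ((X ω).time i (N ω))) * F (V ω) b) ∂P := by
  have := hX.lintegral_spin hσ i hN (H := fun b ω => Φ ω * ENNReal.ofReal (F (V ω) b)) (fun b => by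
      have h1 : Measurable[history X σ] fun ω => ENNReal.ofReal (F (V ω) b) :=
        (Measurable.of_discrete (f := fun v => ENNReal.ofReal (F v b))).comp hV
      exact hΦ.mul h1) (fun b ω h => hs ω (left_ne_zero_of_mul h))
  rw [this]
  refine lintegral_congr fun ω => ?_
  rw [ENNReal.ofReal_sum_of_nonneg (fun b _ => mul_nonneg (updateProb_nonneg _ _ _ _) (hF _ _)),
    Finset.mul_sum]
  refine Finset.sum_congr rfl fun b _ => ?_
  rw [mul_assoc, ← ENNReal.ofReal_mul (hF _ _), mul_comm (F _ _)]

end IsGlauberDynamics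

/-! ### Consequences of the pattern -/

section Pathwise

variable {n : ℕ} {ψ : Multilinear n} {x : Trajectory n} {i j : Fin n} {t₀ t₁ t₂ t₃ : ℝ}

/-- What the pattern says about the relevant update times. -/
structure PatternTimes (x : Trajectory n) (i j : Fin n) (t₀ t₁ t₂ t₃ : ℝ) : Prop where
  a₁ : t₀ < x.time i (x.count i 0 t₀)
  a₂ : x.time i (x.count i 0 t₀) < x.time i (x.count i 0 t₀ + 1)
  a₃ : x.time i (x.count i 0 t₀ + 1) ≤ x.time i (x.count i 0 t₁ - 1)
  a₄ : x.time i (x.count i 0 t₁ - 1) ≤ t₁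
  a₅ : t₁ < x.time j (x.count j 0 t₂ - 1)
  a₆ : x.time j (x.count j 0 t₂ - 1) ≤ t₂
  a₇ : t₂ < x.time i (x.count i 0 t₂)
  a₈ : x.time i (x.count i 0 t₂) < x.time i (x.count i 0 t₂ + 1)
  a₉ : x.time i (x.count i 0 t₂ + 1) ≤ t₃

/-- Updates are numbered from zero, so `count i 0 t` is the number of the first update of `i` after
`t`, and `count i 0 t - 1` that of the last one up to `t`. -/
theorem ClockPattern.patternTimes (h : RegularClock x.time)
    (hp : ClockPattern x.time i j t₀ t₁ t₂ t₃) (h01 : t₀ ≤ t₁) (h12 : t₁ ≤ t₂) (h23 : t₂ ≤ t₃) :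
    PatternTimes x i j t₀ t₁ t₂ t₃ := by
  have i01 := h.clockCount_add i h01
  have i12 := h.clockCount_add i h12
  have i23 := h.clockCount_add i h23
  have j12 := h.clockCount_add j h12
  obtain ⟨p1, p2, p3, p4, p5, p6⟩ := hp
  simp only [← count_eq_clockCount] at *
  have lt_iff : ∀ a t m, t < x.time a m ↔ x.count a 0 t ≤ m := fun a t m => by
    rw [← not_le, h.le_iff_lt_clockCount, not_lt]; rfl
  have le_iff : ∀ a t m, x.time a m ≤ t ↔ m < x.count a 0 t := fun a t m =>
    h.le_iff_lt_clockCount a t m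
  refine ⟨?_, h.lt_succ _ _, (h.strictMono i).monotone (by omega), ?_, ?_, ?_, ?_, h.lt_succ _ _, ?_⟩
  · rw [lt_iff]
  · rw [le_iff]; omega
  · rw [lt_iff]; omega
  · rw [le_iff]; omega
  · rw [lt_iff]
  · rw [le_iff]; omega

variable (h : RegularClock x.time) (hp : ClockPattern x.time i j t₀ t₁ t₂ t₃)
  (hq : Quiet ψ x.time i j t₀ t₃)
include h hp hq

/-- In the first third no neighbour of `i` moves: `j` is silent by the pattern and the others by
quietness. The updates of `i` itself are irrelevant to its own derivative. -/
theorem config_first {t : ℝ} (h0 : t₀ ≤ t) (h1 : t ≤ t₁) (h12 : t₁ ≤ t₂) (h23 : t₂ ≤ t₃) (b : Bool) :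
    updateProb ψ i b (x.config t) = updateProb ψ i b (x.config t₀) := by
  refine updateProb_congr (fun a ha => config_eq_of_count_eq_zero h h0 ?_) b
  by_cases haj : a = j
  · subst haj
    exact count_eq_zero_of_subinterval h le_rfl h0 h1 hp.first_j
  · exact count_eq_zero_of_subinterval h le_rfl h0 (h1.trans (h12.trans h23))
      (hq a ha.ne.symm haj (Or.inl ha))

/-- When `j` updates, the only neighbour of `j` that may have changed is `i`, which carries its last
spin of the first third. -/
theorem config_second (h01 : t₀ ≤ t₁) (h23 : t₂ ≤ t₃) {t : ℝ} (h1 : t₁ ≤ t)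
    (h2 : t ≤ t₂) (b : Bool) :
    updateProb ψ j b (x.config t)
      = updateProb ψ j b (Function.update (x.config t₀) i (x.spin i (x.count i 0 t₁ - 1))) := by
  refine updateProb_congr (fun a ha => ?_) b
  by_cases hai : a = i
  · subst hai
    have i01 := h.clockCount_add a h01
    have p1 := hp.first_i
    simp only [← count_eq_clockCount] at i01 p1
    rw [Function.update_self, config_eq_of_count_eq_zero h h1
      (count_eq_zero_of_subinterval h le_rfl h1 h2 hp.second_i), config_eq_spin h]
    omega
  · rw [Function.update_of_ne hai]
    exact config_eq_of_count_eq_zero h (h01.trans h1) (count_eq_zero_of_subinterval h le_rfl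
      (h01.trans h1) (h2.trans h23) (hq a hai ha.ne.symm (Or.inr ha)))

/-- Likewise, in the last third the only neighbour of `i` that may have changed is `j`, which
carries its last spin of the middle third. -/
theorem config_third (h01 : t₀ ≤ t₁) (h12 : t₁ ≤ t₂) {t : ℝ} (h2 : t₂ ≤ t)
    (h3 : t ≤ t₃) (b : Bool) :
    updateProb ψ i b (x.config t)
      = updateProb ψ i b (Function.update (x.config t₀) j (x.spin j (x.count j 0 t₂ - 1))) := by
  refine updateProb_congr (fun a ha => ?_) b
  by_cases haj : a = j
  · subst haj
    have j12 := h.clockCount_add a h12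
    have p1 := hp.second_j
    simp only [← count_eq_clockCount] at j12 p1
    rw [Function.update_self, config_eq_of_count_eq_zero h h2
      (count_eq_zero_of_subinterval h le_rfl h2 h3 hp.third_j), config_eq_spin h]
    omega
  · rw [Function.update_of_ne haj]
    exact config_eq_of_count_eq_zero h (h01.trans (h12.trans h2)) (count_eq_zero_of_subinterval h le_rfl
      (h01.trans (h12.trans h2)) h3 (hq a ha.ne.symm haj (Or.inl ha)))

end Pathwise

/-! ### Integrating out the spins of a window -/

section Peel

variable {n : ℕ} (ψ : Multilinear n) (i j : Fin n) (g : Bool → Bool → Bool → Bool → ℝ)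

/-- The relevant spins of a window are, in order of time, `y₁`, `y₂`, the last spin `z` of `i` in
the first third, the last spin `c` of `j` in the middle third, and `a`, `b` in the last third. They
are integrated out backwards, and the index counts how many are gone. The primed versions are for
windows in which `i` rings exactly twice in the first third, so that `z` is `y₂`. Other updates in
the window never enter, since no relevant update probability depends on them. -/
noncomputable def peel₁ (x : Fin n → Bool) (y₁ y₂ c a : Bool) : ℝ :=
  ∑ b, updateProb ψ i b (Function.update x j c) * g y₁ y₂ a b

noncomputable def peel₂ (x : Fin n → Bool) (y₁ y₂ c : Bool) : ℝ :=
  ∑ a, updateProb ψ i a (Function.update x j c) * peel₁ ψ i j g x y₁ y₂ c a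

noncomputable def peel₃ (x : Fin n → Bool) (y₁ y₂ z : Bool) : ℝ :=
  ∑ c, updateProb ψ j c (Function.update x i z) * peel₂ ψ i j g x y₁ y₂ c

noncomputable def peel₄ (x : Fin n → Bool) (y₁ y₂ : Bool) : ℝ :=
  ∑ z, updateProb ψ i z x * peel₃ ψ i j g x y₁ y₂ z

noncomputable def peel₅ (x : Fin n → Bool) (y₁ : Bool) : ℝ :=
  ∑ y₂, updateProb ψ i y₂ x * peel₄ ψ i j g x y₁ y₂

noncomputable def peel₆ (x : Fin n → Bool) : ℝ :=
  ∑ y₁, updateProb ψ i y₁ x * peel₅ ψ i j g x y₁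

noncomputable def peel₅' (x : Fin n → Bool) (y₁ : Bool) : ℝ :=
  ∑ y₂, updateProb ψ i y₂ x * peel₃ ψ i j g x y₁ y₂ y₂

noncomputable def peel₆' (x : Fin n → Bool) : ℝ :=
  ∑ y₁, updateProb ψ i y₁ x * peel₅' ψ i j g x y₁

variable {g} (hg : ∀ y₁ y₂ a b, 0 ≤ g y₁ y₂ a b)
include hg

theorem peel₁_nonneg (x) (y₁ y₂ c a) : 0 ≤ peel₁ ψ i j g x y₁ y₂ c a :=
  Finset.sum_nonneg fun _ _ => mul_nonneg (updateProb_nonneg _ _ _ _) (hg _ _ _ _)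

theorem peel₂_nonneg (x) (y₁ y₂ c) : 0 ≤ peel₂ ψ i j g x y₁ y₂ c :=
  Finset.sum_nonneg fun _ _ => mul_nonneg (updateProb_nonneg _ _ _ _) (peel₁_nonneg ψ i j hg _ _ _ _ _)

theorem peel₃_nonneg (x) (y₁ y₂ c) : 0 ≤ peel₃ ψ i j g x y₁ y₂ c :=
  Finset.sum_nonneg fun _ _ => mul_nonneg (updateProb_nonneg _ _ _ _) (peel₂_nonneg ψ i j hg _ _ _ _)

theorem peel₄_nonneg (x) (y₁ y₂) : 0 ≤ peel₄ ψ i j g x y₁ y₂ :=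
  Finset.sum_nonneg fun _ _ => mul_nonneg (updateProb_nonneg _ _ _ _) (peel₃_nonneg ψ i j hg _ _ _ _)

theorem peel₅_nonneg (x) (y₁) : 0 ≤ peel₅ ψ i j g x y₁ :=
  Finset.sum_nonneg fun _ _ => mul_nonneg (updateProb_nonneg _ _ _ _) (peel₄_nonneg ψ i j hg _ _ _)

theorem peel₅'_nonneg (x) (y₁) : 0 ≤ peel₅' ψ i j g x y₁ :=
  Finset.sum_nonneg fun _ _ => mul_nonneg (updateProb_nonneg _ _ _ _) (peel₃_nonneg ψ i j hg _ _ _ _)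

end Peel

/-- Given `c`, the three terms of the statistic have means p², -2pp' and p'², which add up to (p -
p')². -/
theorem peel₆_linear {n : ℕ} (ψ : Multilinear n) (i j : Fin n) (A B : ℝ) (x : Fin n → Bool) :
    peel₆ ψ i j (fun y₁ y₂ a b => A + B * zstat y₁ y₂ a b) x = A + B * meanStat ψ i j x := by
  simp only [peel₆, peel₅, peel₄, peel₃, peel₂, peel₁, meanStat, Fintype.sum_bool, zstat, bit]
  have hf : ∀ k y, updateProb ψ k false y = 1 - updateProb ψ k true y := fun k y => by
    linarith [sum_updateProb ψ k y]
  simp only [hf, if_true, Bool.false_eq_true, if_false]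
  ring

/-- Identifying `z` with `y₂` changes nothing: the mixed term contains only `y₁`, which is
independent of `z`, and the term with `y₂` does not involve what happens after the first third. -/
theorem peel₆'_linear {n : ℕ} (ψ : Multilinear n) (i j : Fin n) (A B : ℝ) (x : Fin n → Bool) :
    peel₆' ψ i j (fun y₁ y₂ a b => A + B * zstat y₁ y₂ a b) x = A + B * meanStat ψ i j x := by
  simp only [peel₆', peel₅', peel₃, peel₂, peel₁, meanStat, Fintype.sum_bool, zstat, bit]
  have hf : ∀ k y, updateProb ψ k false y = 1 - updateProb ψ k true y := fun k y => by
    linarith [sum_updateProb ψ k y]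
  simp only [hf, if_true, Bool.false_eq_true, if_false]
  ring

theorem measurable_masked_pair {Ω : Type*} {n : ℕ} {X : Ω → Trajectory n} {σ : Ω → ℝ} {t₀ : ℝ}
    (hle : history X (fun _ => t₀) ≤ history X σ) {κ : Type} [Fintype κ] {site : κ → Fin n}
    {M : κ → Ω → ℕ} (hM : ∀ k, Measurable[clockInfo X] (M k)) :
    Measurable[history X σ] fun ω =>
      (maskedConfig X t₀ ω, fun k => maskedSpin X σ (site k) (M k) ω) := by
  let _ : MeasurableSpace Ω := history X σ
  exact ((measurable_maskedConfig t₀).mono hle le_rfl).prodMk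
    (measurable_pi_lambda _ fun k => measurable_maskedSpin _ (hM k))

namespace IsGlauberDynamics

variable {Ω : Type*} [mΩ : MeasurableSpace Ω] {n : ℕ} {ψ : Multilinear n} {P : Measure Ω}
  [IsProbabilityMeasure P] {X : Ω → Trajectory n} (hX : IsGlauberDynamics ψ P X)
include hX

theorem measurable_count_clockInfo_comp (a : Fin n) (t : ℝ) (f : ℕ → ℕ) :
    Measurable[clockInfo X] fun ω => f ((X ω).count a 0 t) :=
  (@Measurable.of_discrete _ _ _ _ _ f).comp (measurable_clockInfo_count a 0 t)

/-- A peeling step inside a window: the spin number `N` of site `a` is integrated out, where the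
spins that still occur were chosen up to time `s`. -/
theorem lintegral_peel_window {t₀ : ℝ} {Φ : Ω → ℝ≥0∞} (hΦ : Measurable[history X (fun _ => t₀)] Φ)
    (hreg : ∀ ω, Φ ω ≠ 0 → RegularClock (X ω).time)
    {s : Ω → ℝ} (hsm : Measurable[clockInfo X] s) (a : Fin n) {N : Ω → ℕ}
    (hN : Measurable[clockInfo X] N)
    (hs : ∀ ω, Φ ω ≠ 0 → t₀ ≤ s ω ∧ s ω < (X ω).time a (N ω))
    {κ : Type} [Fintype κ] (site : κ → Fin n) {M : κ → Ω → ℕ} (hM : ∀ k, Measurable[clockInfo X] (M k))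
    (hMs : ∀ k ω, Φ ω ≠ 0 → (X ω).time (site k) (M k ω) ≤ s ω)
    (F : (Fin n → Bool) → (κ → Bool) → Bool → ℝ) (hF : ∀ x v b, 0 ≤ F x v b) :
    ∫⁻ ω, Φ ω * ENNReal.ofReal (F ((X ω).config t₀) (fun k => (X ω).spin (site k) (M k ω))
        ((X ω).spin a (N ω))) ∂P
      = ∫⁻ ω, Φ ω * ENNReal.ofReal
          (∑ b, updateProb ψ a b ((X ω).config ((X ω).time a (N ω))) *
            F ((X ω).config t₀) (fun k => (X ω).spin (site k) (M k ω)) b) ∂P := by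
  -- The support condition gives `t₀ ≤ s` only where `Φ` is nonzero. The maximum makes the history
  -- at `t₀` part of the history at `σ` everywhere.
  set σ : Ω → ℝ := fun ω => max t₀ (s ω) with hσd
  have hσ : Measurable[clockInfo X] σ := (@measurable_const _ _ _ (clockInfo X) t₀).max hsm
  have hle : history X (fun _ => t₀) ≤ history X σ :=
    history_mono (@measurable_const _ _ _ (clockInfo X) t₀) fun ω => le_max_left _ _
  have hσs : ∀ ω, Φ ω ≠ 0 → σ ω = s ω := fun ω h => max_eq_right (hs ω h).1
  have hV : Measurable[history X σ] fun ω =>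
      (maskedConfig X t₀ ω, fun k => maskedSpin X σ (site k) (M k) ω) := by
    exact measurable_masked_pair hle hM
  have key := hX.lintegral_peel hσ a hN (hΦ.mono hle le_rfl)
    (fun ω h => by rw [hσs ω h]; exact (hs ω h).2) hV (fun v b => F v.1 v.2 b)
    (fun v b => hF v.1 v.2 b)
  have e : ∀ ω, Φ ω ≠ 0 → (maskedConfig X t₀ ω = (X ω).config t₀) ∧
      (fun k => maskedSpin X σ (site k) (M k) ω) = fun k => (X ω).spin (site k) (M k ω) := by
    intro ω h
    refine ⟨maskedConfig_eq (hreg ω h), ?_⟩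
    funext k
    exact maskedSpin_eq (by rw [hσs ω h]; exact hMs k ω h)
  calc _ = _ := lintegral_mul_congr_of_support fun ω h => by rw [← (e ω h).1, ← (e ω h).2]
    _ = _ := key
    _ = _ := lintegral_mul_congr_of_support fun ω h => by
      simp only [(e ω h).1, (e ω h).2]

variable {i j : Fin n} {t₀ t₁ t₂ t₃ : ℝ} (h01 : t₀ ≤ t₁) (h12 : t₁ ≤ t₂) (h23 : t₂ ≤ t₃)
include h01 h12 h23

/-- The first three peeling steps: the spins of `i` after `t₂` and the last spin of `j`. -/
theorem lintegral_window_tail {Φ : Ω → ℝ≥0∞} (hΦ : Measurable[history X (fun _ => t₀)] Φ)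
    (hs : ∀ ω, Φ ω ≠ 0 → RegularClock (X ω).time ∧ ClockPattern (X ω).time i j t₀ t₁ t₂ t₃ ∧
      Quiet ψ (X ω).time i j t₀ t₃) {g : Bool → Bool → Bool → Bool → ℝ}
    (hg : ∀ y₁ y₂ a b, 0 ≤ g y₁ y₂ a b) :
    ∫⁻ ω, Φ ω * ENNReal.ofReal (g ((X ω).spin i ((X ω).count i 0 t₀))
        ((X ω).spin i ((X ω).count i 0 t₀ + 1)) ((X ω).spin i ((X ω).count i 0 t₂))
        ((X ω).spin i ((X ω).count i 0 t₂ + 1))) ∂P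
      = ∫⁻ ω, Φ ω * ENNReal.ofReal (peel₃ ψ i j g ((X ω).config t₀)
        ((X ω).spin i ((X ω).count i 0 t₀)) ((X ω).spin i ((X ω).count i 0 t₀ + 1))
        ((X ω).spin i ((X ω).count i 0 t₁ - 1))) ∂P := by
  have hreg : ∀ ω, Φ ω ≠ 0 → RegularClock (X ω).time := fun ω h => (hs ω h).1
  have hpt : ∀ ω, Φ ω ≠ 0 → PatternTimes (X ω) i j t₀ t₁ t₂ t₃ := fun ω h =>
    (hs ω h).2.1.patternTimes (hs ω h).1 h01 h12 h23
  have m1 := measurable_count_clockInfo_comp hX i t₀ id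
  have m2 := measurable_count_clockInfo_comp hX i t₀ (· + 1)
  have mK := measurable_count_clockInfo_comp hX i t₁ (· - 1)
  have mJ := measurable_count_clockInfo_comp hX j t₂ (· - 1)
  have m1' := measurable_count_clockInfo_comp hX i t₂ id
  have m2' := measurable_count_clockInfo_comp hX i t₂ (· + 1)
  simp only [id] at m1 m1'
  -- the second spin of `i` in the last third
  have step1 := hX.lintegral_peel_window hΦ hreg (measurable_random_time i m1') i m2'
    (fun ω h => by obtain ⟨a1, a2, a3, a4, a5, a6, a7, a8, a9⟩ := hpt ω h; exact ⟨by linarith, a8⟩)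
    (κ := Fin 3) (site := fun _ => i)
    (M := fun k ω => if k = 0 then (X ω).count i 0 t₀ else if k = 1 then (X ω).count i 0 t₀ + 1 else
      (X ω).count i 0 t₂)
    (fun k => by fin_cases k <;> simpa)
    (fun k ω h => by
      obtain ⟨a1, a2, a3, a4, a5, a6, a7, a8, a9⟩ := hpt ω h
      fin_cases k <;> simp <;> linarith)
    (fun _ v b => g (v 0) (v 1) (v 2) b) (fun _ _ _ => hg _ _ _ _)
  simp only [Fin.isValue, one_ne_zero, ↓reduceIte, Fin.reduceEq] at step1
  rw [step1]
  have step2 := hX.lintegral_peel_window hΦ hreg (measurable_random_time j mJ) i m1'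
    (fun ω h => by obtain ⟨a1, a2, a3, a4, a5, a6, a7, a8, a9⟩ := hpt ω h; exact ⟨by linarith, by linarith⟩)
    (κ := Fin 3) (site := fun k => if k = 2 then j else i)
    (M := fun k ω => if k = 0 then (X ω).count i 0 t₀ else if k = 1 then (X ω).count i 0 t₀ + 1 else
      (X ω).count j 0 t₂ - 1)
    (fun k => by fin_cases k <;> simpa)
    (fun k ω h => by
      obtain ⟨a1, a2, a3, a4, a5, a6, a7, a8, a9⟩ := hpt ω h
      fin_cases k <;> simp <;> linarith)
    (fun x v a => peel₁ ψ i j g x (v 0) (v 1) (v 2) a) (fun _ _ _ => peel₁_nonneg ψ i j hg _ _ _ _ _)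
  simp only [Fin.isValue, one_ne_zero, ↓reduceIte, Fin.reduceEq] at step2
  have step3 := hX.lintegral_peel_window hΦ hreg (measurable_random_time i mK) j mJ
    (fun ω h => by obtain ⟨a1, a2, a3, a4, a5, a6, a7, a8, a9⟩ := hpt ω h; exact ⟨by linarith, by linarith⟩)
    (κ := Fin 3) (site := fun _ => i)
    (M := fun k ω => if k = 0 then (X ω).count i 0 t₀ else if k = 1 then (X ω).count i 0 t₀ + 1 else
      (X ω).count i 0 t₁ - 1)
    (fun k => by fin_cases k <;> simpa)
    (fun k ω h => by
      obtain ⟨a1, a2, a3, a4, a5, a6, a7, a8, a9⟩ := hpt ω h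
      fin_cases k <;> simp <;> linarith)
    (fun x v c => peel₂ ψ i j g x (v 0) (v 1) c) (fun _ _ _ => peel₂_nonneg ψ i j hg _ _ _ _)
  simp only [Fin.isValue, one_ne_zero, ↓reduceIte] at step3
  calc _ = _ := lintegral_mul_congr_of_support fun ω h => ?_
    _ = _ := step2
    _ = _ := lintegral_mul_congr_of_support fun ω h => ?_
    _ = _ := step3
    _ = _ := lintegral_mul_congr_of_support fun ω h => ?_
  · obtain ⟨a1, a2, a3, a4, a5, a6, a7, a8, a9⟩ := hpt ω h
    simp only [peel₁, config_third (hs ω h).1 (hs ω h).2.1 (hs ω h).2.2 h01 h12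
      (by linarith : t₂ ≤ (X ω).time i ((X ω).count i 0 t₂ + 1)) a9]
  · obtain ⟨a1, a2, a3, a4, a5, a6, a7, a8, a9⟩ := hpt ω h
    simp only [peel₂, config_third (hs ω h).1 (hs ω h).2.1 (hs ω h).2.2 h01 h12
      a7.le (by linarith : (X ω).time i ((X ω).count i 0 t₂) ≤ t₃)]
  · obtain ⟨a1, a2, a3, a4, a5, a6, a7, a8, a9⟩ := hpt ω h
    simp only [peel₃, config_second (hs ω h).1 (hs ω h).2.1 (hs ω h).2.2 h01 h23
      a5.le a6]

/-- The expectation over the spins of a quiet window in which `i` rings exactly twice in the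
first third. -/
theorem lintegral_window_two {Φ : Ω → ℝ≥0∞} (hΦ : Measurable[history X (fun _ => t₀)] Φ)
    (hs : ∀ ω, Φ ω ≠ 0 → RegularClock (X ω).time ∧ ClockPattern (X ω).time i j t₀ t₁ t₂ t₃ ∧
      Quiet ψ (X ω).time i j t₀ t₃)
    (h2 : ∀ ω, Φ ω ≠ 0 → (X ω).count i 0 t₁ - 1 = (X ω).count i 0 t₀ + 1)
    {g : Bool → Bool → Bool → Bool → ℝ} (hg : ∀ y₁ y₂ a b, 0 ≤ g y₁ y₂ a b) :
    ∫⁻ ω, Φ ω * ENNReal.ofReal (g ((X ω).spin i ((X ω).count i 0 t₀))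
        ((X ω).spin i ((X ω).count i 0 t₀ + 1)) ((X ω).spin i ((X ω).count i 0 t₂))
        ((X ω).spin i ((X ω).count i 0 t₂ + 1))) ∂P
      = ∫⁻ ω, Φ ω * ENNReal.ofReal (peel₆' ψ i j g ((X ω).config t₀)) ∂P := by
  have hreg : ∀ ω, Φ ω ≠ 0 → RegularClock (X ω).time := fun ω h => (hs ω h).1
  have hpt : ∀ ω, Φ ω ≠ 0 → PatternTimes (X ω) i j t₀ t₁ t₂ t₃ := fun ω h =>
    (hs ω h).2.1.patternTimes (hs ω h).1 h01 h12 h23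
  have m1 := measurable_count_clockInfo_comp hX i t₀ id
  have m2 := measurable_count_clockInfo_comp hX i t₀ (· + 1)
  simp only [id] at m1
  rw [lintegral_window_tail hX h01 h12 h23 hΦ hs hg]
  have step5 := hX.lintegral_peel_window hΦ hreg (measurable_random_time i m1) i m2
    (fun ω h => by obtain ⟨a1, a2, a3, a4, a5, a6, a7, a8, a9⟩ := hpt ω h; exact ⟨by linarith, by linarith⟩)
    (κ := Fin 1) (site := fun _ => i) (M := fun _ ω => (X ω).count i 0 t₀) (fun k => m1)
    (fun k ω h => le_rfl)
    (fun x v y => peel₃ ψ i j g x (v 0) y y) (fun _ _ _ => peel₃_nonneg ψ i j hg _ _ _ _)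
  have step6 := hX.lintegral_peel_window hΦ hreg
    (@measurable_const _ _ _ (clockInfo X) t₀) i m1
    (fun ω h => by obtain ⟨a1, a2, a3, a4, a5, a6, a7, a8, a9⟩ := hpt ω h; exact ⟨le_rfl, a1⟩)
    (κ := Fin 0) (site := fun _ => i) (M := fun _ ω => (X ω).count i 0 t₀) (fun k => m1)
    (fun k ω h => k.elim0)
    (fun x v y => peel₅' ψ i j g x y) (fun _ _ _ => peel₅'_nonneg ψ i j hg _ _)
  calc _ = _ := lintegral_mul_congr_of_support fun ω h => by rw [h2 ω h]
    _ = _ := step5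
    _ = _ := lintegral_mul_congr_of_support fun ω h => ?_
    _ = _ := step6
    _ = _ := lintegral_mul_congr_of_support fun ω h => ?_
  · obtain ⟨a1, a2, a3, a4, a5, a6, a7, a8, a9⟩ := hpt ω h
    simp only [peel₅', config_first (hs ω h).1 (hs ω h).2.1 (hs ω h).2.2
      (by linarith : t₀ ≤ (X ω).time i ((X ω).count i 0 t₀ + 1)) (a3.trans a4) h12 h23]
  · obtain ⟨a1, a2, a3, a4, a5, a6, a7, a8, a9⟩ := hpt ω h
    simp only [peel₆', config_first (hs ω h).1 (hs ω h).2.1 (hs ω h).2.2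
      a1.le (by linarith : (X ω).time i ((X ω).count i 0 t₀) ≤ t₁) h12 h23]

/-- The same for windows in which `i` rings more than twice in the first third. -/
theorem lintegral_window_more {Φ : Ω → ℝ≥0∞} (hΦ : Measurable[history X (fun _ => t₀)] Φ)
    (hs : ∀ ω, Φ ω ≠ 0 → RegularClock (X ω).time ∧ ClockPattern (X ω).time i j t₀ t₁ t₂ t₃ ∧
      Quiet ψ (X ω).time i j t₀ t₃)
    (h2 : ∀ ω, Φ ω ≠ 0 → (X ω).count i 0 t₀ + 1 < (X ω).count i 0 t₁ - 1)
    {g : Bool → Bool → Bool → Bool → ℝ} (hg : ∀ y₁ y₂ a b, 0 ≤ g y₁ y₂ a b) :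
    ∫⁻ ω, Φ ω * ENNReal.ofReal (g ((X ω).spin i ((X ω).count i 0 t₀))
        ((X ω).spin i ((X ω).count i 0 t₀ + 1)) ((X ω).spin i ((X ω).count i 0 t₂))
        ((X ω).spin i ((X ω).count i 0 t₂ + 1))) ∂P
      = ∫⁻ ω, Φ ω * ENNReal.ofReal (peel₆ ψ i j g ((X ω).config t₀)) ∂P := by
  have hreg : ∀ ω, Φ ω ≠ 0 → RegularClock (X ω).time := fun ω h => (hs ω h).1
  have hpt : ∀ ω, Φ ω ≠ 0 → PatternTimes (X ω) i j t₀ t₁ t₂ t₃ := fun ω h =>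
    (hs ω h).2.1.patternTimes (hs ω h).1 h01 h12 h23
  have m1 := measurable_count_clockInfo_comp hX i t₀ id
  have m2 := measurable_count_clockInfo_comp hX i t₀ (· + 1)
  have mK := measurable_count_clockInfo_comp hX i t₁ (· - 1)
  simp only [id] at m1
  rw [lintegral_window_tail hX h01 h12 h23 hΦ hs hg]
  have step4 := hX.lintegral_peel_window hΦ hreg (measurable_random_time i m2) i mK
    (fun ω h => by
      obtain ⟨a1, a2, a3, a4, a5, a6, a7, a8, a9⟩ := hpt ω h
      exact ⟨by linarith, (hreg ω h).strictMono i (h2 ω h)⟩)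
    (κ := Fin 2) (site := fun _ => i)
    (M := fun k ω => if k = 0 then (X ω).count i 0 t₀ else (X ω).count i 0 t₀ + 1)
    (fun k => by fin_cases k <;> simpa)
    (fun k ω h => by
      obtain ⟨a1, a2, a3, a4, a5, a6, a7, a8, a9⟩ := hpt ω h
      fin_cases k
      · exact a2.le
      · exact le_rfl)
    (fun x v z => peel₃ ψ i j g x (v 0) (v 1) z) (fun _ _ _ => peel₃_nonneg ψ i j hg _ _ _ _)
  simp only [Fin.isValue, one_ne_zero, ↓reduceIte] at step4
  have step5 := hX.lintegral_peel_window hΦ hreg (measurable_random_time i m1) i m2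
    (fun ω h => by obtain ⟨a1, a2, a3, a4, a5, a6, a7, a8, a9⟩ := hpt ω h; exact ⟨by linarith, by linarith⟩)
    (κ := Fin 1) (site := fun _ => i) (M := fun _ ω => (X ω).count i 0 t₀) (fun k => m1)
    (fun k ω h => le_rfl)
    (fun x v y => peel₄ ψ i j g x (v 0) y) (fun _ _ _ => peel₄_nonneg ψ i j hg _ _ _)
  have step6 := hX.lintegral_peel_window hΦ hreg
    (@measurable_const _ _ _ (clockInfo X) t₀) i m1
    (fun ω h => by obtain ⟨a1, a2, a3, a4, a5, a6, a7, a8, a9⟩ := hpt ω h; exact ⟨le_rfl, a1⟩)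
    (κ := Fin 0) (site := fun _ => i) (M := fun _ ω => (X ω).count i 0 t₀) (fun k => m1)
    (fun k ω h => k.elim0)
    (fun x v y => peel₅ ψ i j g x y) (fun _ _ _ => peel₅_nonneg ψ i j hg _ _)
  rw [step4]
  calc _ = _ := lintegral_mul_congr_of_support fun ω h => ?_
    _ = _ := step5
    _ = _ := lintegral_mul_congr_of_support fun ω h => ?_
    _ = _ := step6
    _ = _ := lintegral_mul_congr_of_support fun ω h => ?_
  · obtain ⟨a1, a2, a3, a4, a5, a6, a7, a8, a9⟩ := hpt ω h
    simp only [peel₄, config_first (hs ω h).1 (hs ω h).2.1 (hs ω h).2.2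
      (by linarith : t₀ ≤ (X ω).time i ((X ω).count i 0 t₁ - 1)) a4 h12 h23]
  · obtain ⟨a1, a2, a3, a4, a5, a6, a7, a8, a9⟩ := hpt ω h
    simp only [peel₅, config_first (hs ω h).1 (hs ω h).2.1 (hs ω h).2.2
      (by linarith : t₀ ≤ (X ω).time i ((X ω).count i 0 t₀ + 1)) (a3.trans a4) h12 h23]
  · obtain ⟨a1, a2, a3, a4, a5, a6, a7, a8, a9⟩ := hpt ω h
    simp only [peel₆, config_first (hs ω h).1 (hs ω h).2.1 (hs ω h).2.2
      a1.le (by linarith : (X ω).time i ((X ω).count i 0 t₀) ≤ t₁) h12 h23]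

/-- The statistic of a quiet window has the conditional expectation `meanStat`. -/
theorem lintegral_window {Φ : Ω → ℝ≥0∞} (hΦ : Measurable[history X (fun _ => t₀)] Φ)
    (hs : ∀ ω, Φ ω ≠ 0 → RegularClock (X ω).time ∧ ClockPattern (X ω).time i j t₀ t₁ t₂ t₃ ∧
      Quiet ψ (X ω).time i j t₀ t₃) {A B : ℝ} (hAB : ∀ y₁ y₂ a b, 0 ≤ A + B * zstat y₁ y₂ a b) :
    ∫⁻ ω, Φ ω * ENNReal.ofReal (A + B * zstat ((X ω).spin i ((X ω).count i 0 t₀))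
        ((X ω).spin i ((X ω).count i 0 t₀ + 1)) ((X ω).spin i ((X ω).count i 0 t₂))
        ((X ω).spin i ((X ω).count i 0 t₂ + 1))) ∂P
      = ∫⁻ ω, Φ ω * ENNReal.ofReal (A + B * meanStat ψ i j ((X ω).config t₀)) ∂P := by
  -- `D` says that `i` rings exactly twice in the first third, so that the spin seen by `j` is `Y₂`.
  -- Otherwise it is a later spin, which needs an extra integration. Both cases give the same mean.
  set D : Set Ω := {ω | (X ω).count i 0 t₁ - 1 = (X ω).count i 0 t₀ + 1} with hD
  have hDm : MeasurableSet[clockInfo X] D :=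
    measurableSet_eq_fun (measurable_count_clockInfo_comp hX i t₁ (· - 1))
      (measurable_count_clockInfo_comp hX i t₀ (· + 1))
  have hD1 := lintegral_window_two hX h01 h12 h23
    (Φ := D.indicator Φ) (hΦ.indicator (clockInfo_le_history _ hDm))
    (fun ω h => hs ω fun h0 => h (by simp [Set.indicator_apply, h0]))
    (fun ω h => (Set.mem_of_indicator_ne_zero h : ω ∈ D)) hAB
  have hD2 := lintegral_window_more hX h01 h12 h23
    (Φ := Dᶜ.indicator Φ) (hΦ.indicator (clockInfo_le_history _ hDm).compl)
    (fun ω h => hs ω fun h0 => h (by simp [Set.indicator_apply, h0]))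
    (fun ω h => by
      have h1 : ω ∉ D := Set.mem_of_indicator_ne_zero h
      have hΦ0 : Φ ω ≠ 0 := fun h0 => h (by simp [Set.indicator_apply, h0])
      have e := (hs ω hΦ0).1.clockCount_add i h01
      have e2 := (hs ω hΦ0).2.1.first_i
      simp only [← count_eq_clockCount] at e e2
      simp only [hD, Set.mem_ofPred_eq] at h1
      omega) hAB
  simp only [peel₆'_linear, peel₆_linear] at hD1 hD2
  have split : ∀ f : Ω → ℝ≥0∞, ∫⁻ ω, Φ ω * f ω ∂P
      = ∫⁻ ω, D.indicator Φ ω * f ω ∂P + ∫⁻ ω, Dᶜ.indicator Φ ω * f ω ∂P := by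
    intro f
    have hDm' := hX.clockInfo_le _ hDm
    rw [← lintegral_add_compl _ hDm', ← lintegral_indicator hDm', ← lintegral_indicator hDm'.compl]
    congr 1 <;> (refine lintegral_congr fun ω => ?_; simp only [Set.indicator_apply]; split_ifs <;> simp)
  rw [split, split, hD1, hD2]

end IsGlauberDynamics

/-! ### Lower bounds on update probabilities -/

theorem sigmoid_ge {lam z : ℝ} (h : |z| ≤ lam) : Real.exp (-2 * lam) / 2 ≤ Real.sigmoid (2 * z) := by
  have h0 : 0 ≤ lam := (abs_nonneg z).trans h
  have h1 : Real.exp (-(2 * z)) ≤ Real.exp (2 * lam) := Real.exp_le_exp.2 (by linarith [neg_le_of_abs_le h])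
  have h2 : 1 ≤ Real.exp (2 * lam) := Real.one_le_exp (by linarith)
  have h3 : Real.exp (-2 * lam) = (Real.exp (2 * lam))⁻¹ := by rw [← Real.exp_neg]; ring_nf
  rw [Real.sigmoid_def, h3, div_eq_mul_inv, ← mul_inv]
  apply inv_anti₀ (by positivity); linarith

theorem one_sub_sigmoid_ge {lam z : ℝ} (h : |z| ≤ lam) :
    Real.exp (-2 * lam) / 2 ≤ 1 - Real.sigmoid (2 * z) := by
  have h' : |(-z)| ≤ lam := by rwa [abs_neg]
  have := sigmoid_ge h'
  rwa [← Real.sigmoid_neg, ← mul_neg]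

theorem updateProb_ge {n k d : ℕ} {α lam : ℝ} {ψ : Multilinear n} (h : IsMRF k d α lam ψ) (i : Fin n)
    (b : Bool) (x : Fin n → Bool) : Real.exp (-2 * lam) / 2 ≤ updateProb ψ i b x := by
  unfold updateProb
  split_ifs
  · exact sigmoid_ge (h.abs_eval_pderiv_le i x)
  · exact one_sub_sigmoid_ge (h.abs_eval_pderiv_le i x)

/-- The derivative of σ(2z) is 2σ(1 - σ). One of the two factors is at least 1/2, and the other is
at least e^{-2λ}/2. -/
theorem sigmoid_sub_ge {lam u v : ℝ} (hu : |u| ≤ lam) (hv : |v| ≤ lam) (huv : v ≤ u) :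
    Real.exp (-2 * lam) / 2 * (u - v) ≤ Real.sigmoid (2 * u) - Real.sigmoid (2 * v) := by
  have h0 : 0 ≤ lam := (abs_nonneg u).trans hu
  have hd : ∀ z, deriv (fun z => Real.sigmoid (2 * z)) z
      = Real.sigmoid (2 * z) * (1 - Real.sigmoid (2 * z)) * 2 := fun z => by
    have h1 : HasDerivAt (fun z : ℝ => 2 * z) 2 z := by simpa using (hasDerivAt_id z).const_mul 2
    exact ((Real.hasDerivAt_sigmoid (2 * z)).comp z h1).deriv
  have hdiff : Differentiable ℝ fun z => Real.sigmoid (2 * z) :=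
    differentiable_sigmoid.comp (differentiable_id.const_mul 2)
  refine Convex.mul_sub_le_image_sub_of_le_deriv (convex_Icc (-lam) lam)
    hdiff.continuous.continuousOn hdiff.differentiableOn (fun z hz => ?_) v (abs_le.1 hv) u (abs_le.1 hu) huv
  have hz' : |z| ≤ lam := abs_le.2 (show z ∈ Set.Icc (-lam) lam from interior_subset hz)
  rw [hd]
  have a := sigmoid_ge hz'
  have b := one_sub_sigmoid_ge hz'
  have he : 0 < Real.exp (-2 * lam) := Real.exp_pos _
  rcases le_total (Real.sigmoid (2 * z)) (1 / 2) with h | h <;> nlinarith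

theorem sq_sigmoid_sub_ge {lam u v : ℝ} (hu : |u| ≤ lam) (hv : |v| ≤ lam) :
    (Real.exp (-2 * lam) / 2 * (u - v)) ^ 2 ≤ (Real.sigmoid (2 * u) - Real.sigmoid (2 * v)) ^ 2 := by
  have he : 0 < Real.exp (-2 * lam) := Real.exp_pos _
  rcases le_total v u with h | h
  · exact pow_le_pow_left₀ (mul_nonneg (by positivity) (sub_nonneg.2 h)) (sigmoid_sub_ge hu hv h) 2
  · have := pow_le_pow_left₀ (mul_nonneg (by positivity) (sub_nonneg.2 h)) (sigmoid_sub_ge hv hu h) 2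
    nlinarith

theorem meanStat_nonneg {n : ℕ} (ψ : Multilinear n) (i j : Fin n) (x : Fin n → Bool) :
    0 ≤ meanStat ψ i j x :=
  Finset.sum_nonneg fun _ _ => Finset.sum_nonneg fun _ _ =>
    mul_nonneg (mul_nonneg (updateProb_nonneg _ _ _ _) (updateProb_nonneg _ _ _ _)) (sq_nonneg _)

theorem meanStat_eq_zero {n : ℕ} {ψ : Multilinear n} {i j : Fin n}
    (h : ¬ (dependencyGraph ψ).Adj i j) (x : Fin n → Bool) : meanStat ψ i j x = 0 := by
  unfold meanStat
  refine Finset.sum_eq_zero fun z _ => Finset.sum_eq_zero fun c _ => ?_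
  have : updateProb ψ i true x = updateProb ψ i true (Function.update x j c) :=
    updateProb_congr (fun a ha => by rw [Function.update_of_ne]; rintro rfl; exact h ha) _
  rw [this]; simp

/-- Only the outcome in which `j` flips is kept, which has probability at least e^{-2λ}/2. The flip
moves ∂_iψ by twice the mixed derivative, up to sign, and `sq_sigmoid_sub_ge` turns this into a
difference of probabilities. -/
theorem meanStat_ge {n k d : ℕ} {α lam : ℝ} {ψ : Multilinear n} (h : IsMRF k d α lam ψ) (i j : Fin n)
    (x : Fin n → Bool) :
    Real.exp (-6 * lam) / 2 * (((ψ.pderiv i).pderiv j).eval x) ^ 2 ≤ meanStat ψ i j x := by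
  set e := Real.exp (-2 * lam) with he
  have he0 : 0 < e := Real.exp_pos _
  have he6 : Real.exp (-6 * lam) = e ^ 3 := by
    rw [he, ← Real.exp_nat_mul]; congr 1; push_cast; ring
  set c := !(x j) with hc
  have hx : Function.update x j (x j) = x := by simp
  have hdiff : (2 * ((ψ.pderiv i).pderiv j).eval x) ^ 2
      = ((ψ.pderiv i).eval x - (ψ.pderiv i).eval (Function.update x j c)) ^ 2 := by
    have h1 := Multilinear.eval_update_sub j (ψ.pderiv i) x
    rw [← h1]
    nth_rewrite 3 [← hx]
    rw [hc]
    cases x j <;> (simp; try ring)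
  have hs := sq_sigmoid_sub_ge (h.abs_eval_pderiv_le i x)
    (h.abs_eval_pderiv_le i (Function.update x j c))
  rw [mul_pow, ← hdiff] at hs
  have hupd : ∀ y, updateProb ψ i true y = Real.sigmoid (2 * (ψ.pderiv i).eval y) := fun y => rfl
  set D := (updateProb ψ i true x - updateProb ψ i true (Function.update x j c)) ^ 2 with hD
  have hD' : (e / 2) ^ 2 * (2 * ((ψ.pderiv i).pderiv j).eval x) ^ 2 ≤ D := hs
  have hterm : ∀ z, updateProb ψ i z x * (e / 2 * D) ≤ ∑ c', updateProb ψ i z x *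
      updateProb ψ j c' (Function.update x i z) *
      (updateProb ψ i true x - updateProb ψ i true (Function.update x j c')) ^ 2 := by
    intro z
    refine le_trans ?_ (Finset.single_le_sum (f := fun c' => updateProb ψ i z x *
      updateProb ψ j c' (Function.update x i z) *
      (updateProb ψ i true x - updateProb ψ i true (Function.update x j c')) ^ 2) (fun c' _ =>
        mul_nonneg (mul_nonneg (updateProb_nonneg _ _ _ _) (updateProb_nonneg _ _ _ _)) (sq_nonneg _))
        (Finset.mem_univ c))
    rw [mul_assoc]
    exact mul_le_mul_of_nonneg_left (mul_le_mul_of_nonneg_right (updateProb_ge h _ _ _) (sq_nonneg _))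
      (updateProb_nonneg _ _ _ _)
  calc _ = e / 2 * ((e / 2) ^ 2 * (2 * ((ψ.pderiv i).pderiv j).eval x) ^ 2) := by rw [he6]; ring
    _ ≤ e / 2 * D := mul_le_mul_of_nonneg_left hD' (by positivity)
    _ = ∑ z, updateProb ψ i z x * (e / 2 * D) := by
      rw [← Finset.sum_mul, Fintype.sum_bool, sum_updateProb, one_mul]
    _ ≤ _ := Finset.sum_le_sum fun z _ => hterm z

/-! ### Hitting a target configuration -/

namespace IsGlauberDynamics

variable {Ω : Type*} [mΩ : MeasurableSpace Ω] {n : ℕ} {ψ : Multilinear n} {P : Measure Ω}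
  [IsProbabilityMeasure P] {X : Ω → Trajectory n} (hX : IsGlauberDynamics ψ P X)
include hX

theorem measurable_config (t : ℝ) : Measurable fun ω => (X ω).config t := by
  refine measurable_pi_lambda _ fun a => ?_
  have hc := hX.measurable_count a 0 t
  refine Measurable.ite (hc (measurableSet_singleton 0)) ?_ ?_
  · exact (measurable_pi_apply a).comp hX.measurable_init
  · refine measurable_to_bool ?_
    have : (fun ω => (X ω).spin a ((X ω).count a 0 t - 1)) ⁻¹' {true}
        = ⋃ m, ({ω | (X ω).count a 0 t - 1 = m} ∩ {ω | (X ω).spin a m = true}) := by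
      ext ω; simp
    rw [this]
    refine .iUnion fun m => MeasurableSet.inter ?_ (hX.measurable_spin a m (measurableSet_singleton true))
    exact ((Measurable.of_discrete (f := fun k : ℕ => k - 1)).comp hc) (measurableSet_singleton m)

omit hX in
theorem measurable_fold_max {ι : Type*} (s : Finset ι) (u : ℝ) {f : ι → Ω → ℝ} {m : MeasurableSpace Ω}
    (hf : ∀ a, Measurable[m] (f a)) : Measurable[m] fun ω => s.fold max u (fun a => f a ω) := by
  classical
  induction s using Finset.induction_on with
  | empty => simp only [Finset.fold_empty]; exact @measurable_const _ _ _ m u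
  | insert a s ha ih =>
    simp only [Finset.fold_insert ha]
    exact (hf a).max ih

/-- Sites that update between `u` and `t` hit any target, which may depend on the configuration
at time `u`, with a probability bounded below. -/
theorem lintegral_hit {k d : ℕ} {α lam : ℝ} (hψ : IsMRF k d α lam ψ) {u t : ℝ} (hut : u ≤ t)
    (tgt : (Fin n → Bool) → Fin n → Bool) (V : Finset (Fin n)) :
    ∀ {Φ : Ω → ℝ≥0∞}, Measurable[history X (fun _ => u)] Φ →
    (∀ ω, Φ ω ≠ 0 → RegularClock (X ω).time ∧ ∀ s ∈ V, (X ω).count s u t ≠ 0) →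
    ENNReal.ofReal (Real.exp (-2 * lam) / 2) ^ V.card * ∫⁻ ω, Φ ω ∂P
      ≤ ∫⁻ ω, Φ ω * {ω | ∀ s ∈ V, (X ω).config t s = tgt ((X ω).config u) s}.indicator 1 ω ∂P := by
  classical
  set e := Real.exp (-2 * lam) / 2 with he
  induction V using Finset.strongInduction with
  | H V ih =>
  intro Φ hΦ hs
  rcases V.eq_empty_or_nonempty with rfl | hV
  · simp
  have hreg : ∀ ω, Φ ω ≠ 0 → RegularClock (X ω).time := fun ω h => (hs ω h).1
  set last : Fin n → Ω → ℕ := fun s ω => (X ω).count s 0 t - 1 with hlast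
  have hlm : ∀ s, Measurable[clockInfo X] (last s) := fun s =>
    measurable_count_clockInfo_comp hX s t (· - 1)
  have htm : ∀ s, Measurable[clockInfo X] fun ω => (X ω).time s (last s ω) := fun s =>
    measurable_random_time s (hlm s)
  -- `D s` says that the final spin of `s` is chosen after those of all other sites of `V`. There
  -- the spin of `s` can be integrated out first, and the remaining sites are left to the induction.
  set D : Fin n → Set Ω := fun s => {ω | ∀ s' ∈ V, s' ≠ s →
    (X ω).time s' (last s' ω) < (X ω).time s (last s ω)} with hD
  have hDm : ∀ s, MeasurableSet[clockInfo X] (D s) := by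
    intro s
    have : D s = ⋂ s' ∈ V, ⋂ (_ : s' ≠ s), {ω | (X ω).time s' (last s' ω) < (X ω).time s (last s ω)} := by
      ext ω; simp [hD]
    rw [this]
    exact V.measurableSet_biInter fun s' _ => .iInter fun _ => measurableSet_lt (htm s') (htm s)
  have hDm' : ∀ s, MeasurableSet (D s) := fun s => hX.clockInfo_le _ (hDm s)
  set hit : Finset (Fin n) → Set Ω := fun V => {ω | ∀ s ∈ V, (X ω).config t s = tgt ((X ω).config u) s}
    with hhit
  have hΦm : Measurable Φ := hΦ.mono (hX.history_le (@measurable_const _ _ _ (clockInfo X) u)) le_rfl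
  have hhm : ∀ V, MeasurableSet (hit V) := by
    intro V
    have : hit V = ⋂ s ∈ V, {ω | (X ω).config t s = tgt ((X ω).config u) s} := by
      ext ω; simp [hhit]
    rw [this]
    refine V.measurableSet_biInter fun s _ => measurableSet_eq_fun ?_ ?_
    · exact (measurable_pi_apply s).comp (hX.measurable_config t)
    · exact (Measurable.of_discrete (f := fun x => tgt x s)).comp (hX.measurable_config u)
  have hlt : ∀ ω, Φ ω ≠ 0 → ∀ s ∈ V, u < (X ω).time s (last s ω) ∧
      (X ω).config t s = (X ω).spin s (last s ω) := by
    intro ω h s hsV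
    have h1 := (hreg ω h).clockCount_add s hut
    have h2 := (hs ω h).2 s hsV
    simp only [← count_eq_clockCount] at h1
    refine ⟨?_, config_eq_spin (hreg ω h) (by simp only [hlast]; omega)⟩
    rw [← not_le, (hreg ω h).le_iff_lt_clockCount, not_lt, ← count_eq_clockCount]
    simp only [hlast]; omega
  -- the step for the site that updates last
  have step : ∀ s ∈ V, ENNReal.ofReal e ^ V.card * ∫⁻ ω, (D s).indicator Φ ω ∂P
      ≤ ∫⁻ ω, (D s).indicator Φ ω * (hit V).indicator 1 ω ∂P := by
    intro s hsV
    have hΦs : Measurable[history X (fun _ => u)] ((D s).indicator Φ) :=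
      hΦ.indicator (clockInfo_le_history _ (hDm s))
    have hsupp : ∀ ω, (D s).indicator Φ ω ≠ 0 → Φ ω ≠ 0 ∧ ω ∈ D s := fun ω h =>
      ⟨fun h0 => h (by simp [Set.indicator_apply, h0]), Set.mem_of_indicator_ne_zero h⟩
    have hih := ih (V.erase s) (Finset.erase_ssubset hsV) hΦs (fun ω h =>
      ⟨hreg ω (hsupp ω h).1, fun s' hs' => (hs ω (hsupp ω h).1).2 s' (Finset.mem_of_mem_erase hs')⟩)
    have hcard : V.card = (V.erase s).card + 1 := (Finset.card_erase_add_one hsV).symm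
    -- The final spins of the other sites are all known at the latest of their last update times, a
    -- maximum that is determined by the clocks and precedes the last update of `s` on `D s`.
    have peel := hX.lintegral_peel_window hΦs (fun ω h => hreg ω (hsupp ω h).1)
      (s := fun ω => (V.erase s).fold max u (fun a => (X ω).time a (last a ω)))
      (measurable_fold_max (V.erase s) u (fun a => htm a)) s (hlm s)
      (fun ω h => by
        refine ⟨(Finset.le_fold_max u).2 (Or.inl le_rfl), (Finset.fold_max_lt _).2
          ⟨(hlt ω (hsupp ω h).1 s hsV).1, fun a ha => ?_⟩⟩
        exact (hsupp ω h).2 a (Finset.mem_of_mem_erase ha) (Finset.ne_of_mem_erase ha))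
      (κ := {a // a ∈ V.erase s}) (site := fun a => a) (M := fun a => last a) (fun a => hlm a)
      (fun a ω _ => (Finset.le_fold_max _).2 (Or.inr ⟨a, a.2, le_rfl⟩))
      (fun x v b => if (∀ a, v a = tgt x a) ∧ b = tgt x s then 1 else 0)
      (fun _ _ _ => by split_ifs <;> simp)
    rw [hcard, pow_succ, mul_comm _ (ENNReal.ofReal e), mul_assoc]
    refine (mul_le_mul_right hih _).trans ?_
    have hmem : ∀ ω, (D s).indicator Φ ω ≠ 0 → ((ω ∈ hit (V.erase s)) ↔
        ∀ a : {a // a ∈ V.erase s}, (X ω).spin a (last a ω) = tgt ((X ω).config u) a) := by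
      intro ω h
      simp only [hhit, Set.mem_ofPred_eq]
      constructor
      · intro H a
        rw [← (hlt ω (hsupp ω h).1 a (Finset.mem_of_mem_erase a.2)).2]; exact H a a.2
      · intro H a ha
        rw [(hlt ω (hsupp ω h).1 a (Finset.mem_of_mem_erase ha)).2]; exact H ⟨a, ha⟩
    have hmem2 : ∀ ω, (D s).indicator Φ ω ≠ 0 → ((ω ∈ hit V) ↔ ω ∈ hit (V.erase s) ∧
        (X ω).spin s (last s ω) = tgt ((X ω).config u) s) := by
      intro ω h
      rw [← (hlt ω (hsupp ω h).1 s hsV).2]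
      simp only [hhit, Set.mem_ofPred_eq]
      constructor
      · exact fun H => ⟨fun a ha => H a (Finset.mem_of_mem_erase ha), H s hsV⟩
      · rintro ⟨H, H2⟩ a ha
        by_cases has : a = s
        · rw [has]; exact H2
        · exact H a (Finset.mem_erase.2 ⟨has, ha⟩)
    calc _ = ∫⁻ ω, ENNReal.ofReal e * ((D s).indicator Φ ω * (hit (V.erase s)).indicator 1 ω) ∂P := by
          rw [lintegral_const_mul]
          exact (hΦm.indicator (hDm' s)).mul (measurable_one.indicator (hhm _))
      _ ≤ _ := lintegral_mono fun ω => ?_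
      _ = _ := peel.symm
      _ = _ := lintegral_mul_congr_of_support fun ω h => ?_
    · by_cases h : (D s).indicator Φ ω = 0
      · simp [h]
      dsimp only
      rw [mul_left_comm]
      refine mul_le_mul_right ?_ _
      by_cases h2 : ω ∈ hit (V.erase s)
      · rw [Set.indicator_of_mem h2, Pi.one_apply, mul_one]
        apply ENNReal.ofReal_le_ofReal
        have h3 := (hmem ω h).1 h2
        simp only [h3, implies_true, true_and, Fintype.sum_bool]
        have l1 := updateProb_ge hψ s true ((X ω).config ((X ω).time s (last s ω)))
        have l2 := updateProb_ge hψ s false ((X ω).config ((X ω).time s (last s ω)))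
        cases tgt ((X ω).config u) s <;> simpa
      · simp [Set.indicator_of_notMem h2]
    · dsimp only
      have e1 := hmem ω h
      have e2 := hmem2 ω h
      by_cases h2 : ω ∈ hit V
      · rw [Set.indicator_of_mem h2, if_pos ⟨e1.1 (e2.1 h2).1, (e2.1 h2).2⟩]; simp
      · rw [Set.indicator_of_notMem h2, if_neg (fun hc => h2 (e2.2 ⟨e1.2 hc.1, hc.2⟩))]; simp
  -- the sum over the site that updates last
  have hcover : ∀ ω, Φ ω ≤ ∑ s ∈ V, (D s).indicator Φ ω := by
    intro ω
    by_cases h : Φ ω = 0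
    · simp [h]
    obtain ⟨s, hsV, hmax⟩ := V.exists_max_image (fun s => (X ω).time s (last s ω)) hV
    have : ω ∈ D s := fun s' hs' hne => lt_of_le_of_ne (hmax s' hs') ((hreg ω h).ne s' s hne _ _)
    calc Φ ω = (D s).indicator Φ ω := by rw [Set.indicator_of_mem this]
      _ ≤ _ := Finset.single_le_sum (f := fun s => (D s).indicator Φ ω) (fun _ _ => zero_le) hsV
  have hdisj : ∀ ω, ∑ s ∈ V, (D s).indicator Φ ω ≤ Φ ω := by
    intro ω
    by_cases hex : ∃ s ∈ V, ω ∈ D s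
    · obtain ⟨s, hsV, hsD⟩ := hex
      rw [Finset.sum_eq_single s]
      · rw [Set.indicator_of_mem hsD]
      · intro s' hs' hne
        refine Set.indicator_of_notMem (fun hc => ?_) _
        exact absurd (hsD s' hs' hne) (not_lt.2 (hc s hsV hne.symm).le)
      · exact fun hc => absurd hsV hc
    · push Not at hex
      rw [Finset.sum_eq_zero fun s hsV => Set.indicator_of_notMem (hex s hsV) _]
      exact zero_le
  calc _ ≤ ENNReal.ofReal e ^ V.card * ∫⁻ ω, ∑ s ∈ V, (D s).indicator Φ ω ∂P :=
        mul_le_mul_right (lintegral_mono hcover) _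
    _ = ∑ s ∈ V, ENNReal.ofReal e ^ V.card * ∫⁻ ω, (D s).indicator Φ ω ∂P := by
      rw [lintegral_finsetSum _ fun s _ => hΦm.indicator (hDm' s), Finset.mul_sum]
    _ ≤ ∑ s ∈ V, ∫⁻ ω, (D s).indicator Φ ω * (hit V).indicator 1 ω ∂P := Finset.sum_le_sum step
    _ = ∫⁻ ω, (∑ s ∈ V, (D s).indicator Φ ω) * (hit V).indicator 1 ω ∂P := by
      simp_rw [Finset.sum_mul]
      exact (lintegral_finsetSum _ fun s _ =>
        (hΦm.indicator (hDm' s)).mul (measurable_one.indicator (hhm V))).symm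
    _ ≤ _ := lintegral_mono fun ω => mul_le_mul_left (hdisj ω) _

end IsGlauberDynamics

/-! ### Exponential moments of the statistic over one block. -/

theorem exp_le_quadratic {y : ℝ} (h : |y| ≤ 1) : Real.exp y ≤ 1 + y + y ^ 2 := by
  have := (abs_le.1 (Real.abs_exp_sub_one_sub_id_le h)).2
  linarith

/-- From α ≤ λ ≤ e^λ one gets α²e^{-2λ} ≤ 1. This keeps the signal of an edge at most one and makes
the window short. -/
theorem sq_mul_exp_le_one {α lam : ℝ} (h0 : 0 ≤ α) (h1 : α ≤ lam) :
    Real.exp (-6 * lam) / 2 * α ^ 2 ≤ 1 := by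
  have h2 : lam + 1 ≤ Real.exp lam := Real.add_one_le_exp lam
  have h3 : Real.exp (-6 * lam) ≤ Real.exp (-2 * lam) := Real.exp_le_exp.2 (by linarith)
  have h4 : Real.exp (-2 * lam) * Real.exp lam ^ 2 = 1 := by
    rw [← Real.exp_nat_mul, ← Real.exp_add]; simp
  have h5 : α ^ 2 ≤ Real.exp lam ^ 2 := pow_le_pow_left₀ h0 (by linarith) 2
  have h6 := Real.exp_pos (-2 * lam)
  have h7 := Real.exp_pos (-6 * lam)
  nlinarith [mul_le_mul h3 h5 (sq_nonneg α) h6.le]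

/-- The clock conditions under which the sites of `V` are the last neighbours of `i` to be updated
in `(u, t₀]`. -/
structure Refreshed {n : ℕ} (ψ : Multilinear n) (τ : Fin n → ℕ → ℝ) (i j : Fin n)
    (V : Finset (Fin n)) (u t₀ : ℝ) : Prop where
  update : ∀ s ∈ V, clockCount τ s u t₀ ≠ 0
  quiet : ∀ a, (dependencyGraph ψ).Adj i a → a ≠ j → a ∉ V → clockCount τ a u t₀ = 0

theorem lintegral_indicator_split {Ω : Type*} [MeasurableSpace Ω] {P : Measure Ω} {Φ f : Ω → ℝ≥0∞}
    {D : Set Ω} (hD : MeasurableSet D) :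
    ∫⁻ ω, Φ ω * f ω ∂P = ∫⁻ ω, D.indicator Φ ω * f ω ∂P + ∫⁻ ω, Dᶜ.indicator Φ ω * f ω ∂P := by
  have e : ∀ U : Set Ω, (fun ω => U.indicator Φ ω * f ω) = U.indicator fun ω => Φ ω * f ω := by
    intro U; funext ω
    by_cases h : ω ∈ U <;> simp [h]
  rw [e D, e Dᶜ, lintegral_indicator hD, lintegral_indicator hD.compl, lintegral_add_compl _ hD]

/-- The statistic of the window `(t₀, t₃]` at a trajectory. -/
noncomputable def windowStat {n : ℕ} (x : Trajectory n) (i : Fin n) (t₀ t₂ : ℝ) : ℝ :=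
  zstat (x.spin i (x.count i 0 t₀)) (x.spin i (x.count i 0 t₀ + 1)) (x.spin i (x.count i 0 t₂))
    (x.spin i (x.count i 0 t₂ + 1))

namespace IsGlauberDynamics

variable {Ω : Type*} [mΩ : MeasurableSpace Ω] {n : ℕ} {ψ : Multilinear n} {P : Measure Ω}
  [IsProbabilityMeasure P] {X : Ω → Trajectory n} (hX : IsGlauberDynamics ψ P X)
  {k d : ℕ} {α lam : ℝ} (hψ : IsMRF k d α lam ψ) (hα : 0 < α) (hαl : α ≤ lam)
  {i j : Fin n} {u t₀ t₁ t₂ t₃ : ℝ} (hu0 : u ≤ t₀) (h01 : t₀ ≤ t₁) (h12 : t₁ ≤ t₂) (h23 : t₂ ≤ t₃)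
include hX h01 h12 h23

/-- On a quiet window before which a maximal monomial is refreshed, the statistic of an edge has
a positive expectation. -/
theorem lintegral_window_edge (hψ : IsMRF k d α lam ψ) (hα : 0 < α) (hαl : α ≤ lam) (hu0 : u ≤ t₀)
    {S : Finset (Fin n)} (hS : IsMaximalMonomial ψ S) (hi : i ∈ S) (hj : j ∈ S)
    (hij : i ≠ j) (hSα : α ≤ |ψ S|) {Φ : Ω → ℝ≥0∞} (hΦ : Measurable[history X (fun _ => u)] Φ)
    (hfin : ∫⁻ ω, Φ ω ∂P ≠ ⊤)
    (hs : ∀ ω, Φ ω ≠ 0 → RegularClock (X ω).time ∧ ClockPattern (X ω).time i j t₀ t₁ t₂ t₃ ∧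
      Quiet ψ (X ω).time i j t₀ t₃ ∧ Refreshed ψ (X ω).time i j ((S.erase i).erase j) u t₀)
    {A B : ℝ} (hB : 0 ≤ B) (hAB : B ≤ A) :
    ∫⁻ ω, Φ ω * ENNReal.ofReal (A + -B * windowStat (X ω) i t₀ t₂) ∂P
      ≤ ∫⁻ ω, Φ ω * ENNReal.ofReal (A - B * (Real.exp (-6 * lam) / 2 * α ^ 2 *
          (Real.exp (-2 * lam) / 2) ^ ((S.erase i).erase j).card)) ∂P := by
  classical
  set V := (S.erase i).erase j with hV
  set e₀ := Real.exp (-6 * lam) / 2 * α ^ 2 with he₀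
  set q := (Real.exp (-2 * lam) / 2) ^ V.card with hq
  have he0 : 0 ≤ e₀ := by positivity
  have he1 : e₀ ≤ 1 := sq_mul_exp_le_one hα.le hαl
  have hq0 : 0 ≤ q := by positivity
  have hlam : 0 ≤ lam := hα.le.trans hαl
  have hq1 : q ≤ 1 := by
    refine pow_le_one₀ (by positivity) ?_
    have : Real.exp (-2 * lam) ≤ 1 := Real.exp_le_one_iff.2 (by linarith)
    linarith
  obtain ⟨hc, hmax, hadj⟩ := hS.adj hi hj hij
  -- The target prescribes spins on `V` that make the mixed derivative large, and keeps all other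
  -- spins as they were at time `u`. The remaining neighbours of `i` other than `j` still have those
  -- spins at `t₀`, by `Refreshed`.
  choose tgt htgt1 htgt2 using Multilinear.exists_abs_eval_ge V ((ψ.pderiv j).pderiv i) hmax
  have hΦ' : Measurable[history X (fun _ => t₀)] Φ :=
    hΦ.mono (history_mono (@measurable_const _ _ _ (clockInfo X) u) fun _ => hu0) le_rfl
  have hΦm : Measurable Φ := hΦ.mono (hX.history_le (@measurable_const _ _ _ (clockInfo X) u)) le_rfl
  have hw := hX.lintegral_window h01 h12 h23 hΦ' (i := i) (j := j)
    (fun ω h => ⟨(hs ω h).1, (hs ω h).2.1, (hs ω h).2.2.1⟩) (A := A) (B := -B)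
    (fun y₁ y₂ a b => by
      have := zstat_le_one y₁ y₂ a b
      nlinarith)
  have hhit := hX.lintegral_hit hψ hu0 tgt V hΦ
    (fun ω h => ⟨(hs ω h).1, (hs ω h).2.2.2.update⟩)
  set hit : Set Ω := {ω | ∀ s ∈ V, (X ω).config t₀ s = tgt ((X ω).config u) s} with hhitd
  have hhm : MeasurableSet hit := by
    have : hit = ⋂ s ∈ V, {ω | (X ω).config t₀ s = tgt ((X ω).config u) s} := by
      ext ω; simp [hhitd]
    rw [this]
    refine V.measurableSet_biInter fun s _ => measurableSet_eq_fun ?_ ?_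
    · exact (measurable_pi_apply s).comp (hX.measurable_config t₀)
    · exact (Measurable.of_discrete (f := fun x => tgt x s)).comp (hX.measurable_config u)
  have hmean : ∀ ω, Φ ω ≠ 0 → ω ∈ hit → e₀ ≤ meanStat ψ i j ((X ω).config t₀) := by
    intro ω h hω
    refine le_trans ?_ (meanStat_ge hψ i j _)
    refine mul_le_mul_of_nonneg_left ?_ (by positivity)
    -- The spin of `j` at `t₀` is not controlled. It does not matter, since the mixed derivative is
    -- half the difference of two values of ∂_iψ with the spin of `j` prescribed.
    have hag : ∀ b a, (dependencyGraph ψ).Adj i a → Function.update ((X ω).config t₀) j b a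
        = Function.update (tgt ((X ω).config u)) j b a := by
      intro b a ha
      by_cases haj : a = j
      · subst haj; simp
      rw [Function.update_of_ne haj, Function.update_of_ne haj]
      by_cases haV : a ∈ V
      · exact hω a haV
      · rw [htgt1 _ a haV]
        exact config_eq_of_count_eq_zero (hs ω h).1 hu0 ((hs ω h).2.2.2.quiet a ha haj haV)
    have h1 := Multilinear.eval_update_sub j (ψ.pderiv i) ((X ω).config t₀)
    rw [eval_pderiv_congr (hag true), eval_pderiv_congr (hag false),
      Multilinear.eval_update_sub j (ψ.pderiv i)] at h1
    have h2 : ((ψ.pderiv i).pderiv j).eval ((X ω).config t₀)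
        = ((ψ.pderiv i).pderiv j).eval (tgt ((X ω).config u)) := by linarith
    rw [h2, Multilinear.pderiv_comm]
    rw [← sq_abs (Multilinear.eval _ _)]
    refine pow_le_pow_left₀ hα.le ?_ 2
    exact hSα.trans (hc ▸ htgt2 _)
  set H := ∫⁻ ω, Φ ω * hit.indicator 1 ω ∂P with hH
  have hsum : ∫⁻ ω, Φ ω * hit.indicator 1 ω ∂P + ∫⁻ ω, Φ ω * hitᶜ.indicator 1 ω ∂P
      = ∫⁻ ω, Φ ω ∂P := by
    refine (lintegral_add_left (hΦm.mul (measurable_one.indicator hhm)) _).symm.trans ?_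
    refine lintegral_congr fun ω => ?_
    by_cases h : ω ∈ hit <;> simp [h]
  -- The lower bound for hitting becomes an upper bound for missing by cancellation in `ℝ≥0∞`, which
  -- is where the finite mass of `Φ` is used.
  have hmiss : ∫⁻ ω, Φ ω * hitᶜ.indicator 1 ω ∂P ≤ ENNReal.ofReal (1 - q) * ∫⁻ ω, Φ ω ∂P := by
    have hqI : ENNReal.ofReal q * ∫⁻ ω, Φ ω ∂P ≤ H := by
      rw [hq, ENNReal.ofReal_pow (by positivity)]; exact hhit
    have hHfin : H ≠ ⊤ := ne_top_of_le_ne_top hfin (by rw [← hsum]; exact le_self_add)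
    have h3 : H + ∫⁻ ω, Φ ω * hitᶜ.indicator 1 ω ∂P ≤ H + ENNReal.ofReal (1 - q) * ∫⁻ ω, Φ ω ∂P := by
      rw [hsum]
      calc ∫⁻ ω, Φ ω ∂P = (ENNReal.ofReal q + ENNReal.ofReal (1 - q)) * ∫⁻ ω, Φ ω ∂P := by
            rw [← ENNReal.ofReal_add hq0 (sub_nonneg.2 hq1)]; simp
        _ ≤ _ := by rw [add_mul]; exact add_le_add hqI le_rfl
    exact (ENNReal.add_le_add_iff_left hHfin).1 h3
  have hAe : 0 ≤ A - B * e₀ := by nlinarith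
  calc _ = ∫⁻ ω, Φ ω * ENNReal.ofReal (A + -B * meanStat ψ i j ((X ω).config t₀)) ∂P := hw
    _ ≤ ∫⁻ ω, (ENNReal.ofReal (A - B * e₀) * Φ ω +
          ENNReal.ofReal (B * e₀) * (Φ ω * hitᶜ.indicator 1 ω)) ∂P := by
      refine lintegral_mono fun ω => ?_
      by_cases h : Φ ω = 0
      · simp [h]
      have hm0 := meanStat_nonneg ψ i j ((X ω).config t₀)
      by_cases hω : ω ∈ hit
      · have := hmean ω h hω
        simp only [Set.indicator_of_notMem (show ω ∉ hitᶜ from fun hc => hc hω), mul_zero, add_zero]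
        rw [mul_comm]
        refine mul_le_mul_left (ENNReal.ofReal_le_ofReal ?_) _
        nlinarith
      · simp only [Set.indicator_of_mem (show ω ∈ hitᶜ from hω), Pi.one_apply, mul_one]
        rw [← add_mul, ← ENNReal.ofReal_add hAe (mul_nonneg hB he0), mul_comm]
        refine mul_le_mul_left (ENNReal.ofReal_le_ofReal ?_) _
        nlinarith
    _ = ENNReal.ofReal (A - B * e₀) * ∫⁻ ω, Φ ω ∂P +
          ENNReal.ofReal (B * e₀) * ∫⁻ ω, Φ ω * hitᶜ.indicator 1 ω ∂P := by
      have hm2 : Measurable fun ω => Φ ω * hitᶜ.indicator 1 ω :=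
        hΦm.mul (measurable_one.indicator hhm.compl)
      rw [lintegral_add_left (hΦm.const_mul _), lintegral_const_mul _ hΦm, lintegral_const_mul _ hm2]
    _ ≤ ENNReal.ofReal (A - B * e₀) * ∫⁻ ω, Φ ω ∂P +
          ENNReal.ofReal (B * e₀) * (ENNReal.ofReal (1 - q) * ∫⁻ ω, Φ ω ∂P) := by
      gcongr
    _ = ∫⁻ ω, Φ ω * ENNReal.ofReal (A - B * (e₀ * q)) ∂P := by
      rw [lintegral_mul_const _ hΦm, ← mul_assoc (ENNReal.ofReal (B * e₀)),
        ← ENNReal.ofReal_mul (mul_nonneg hB he0), ← add_mul,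
        ← ENNReal.ofReal_add hAe (mul_nonneg (mul_nonneg hB he0) (sub_nonneg.2 hq1)), mul_comm]
      congr 2
      ring

/-- The exponential moment of the statistic of an edge, given the clocks. -/
theorem lintegral_block_edge (hψ : IsMRF k d α lam ψ) (hα : 0 < α) (hαl : α ≤ lam) (hu0 : u ≤ t₀)
    {S : Finset (Fin n)} (hS : IsMaximalMonomial ψ S) (hi : i ∈ S) (hj : j ∈ S)
    (hij : i ≠ j) (hSα : α ≤ |ψ S|) {Φ : Ω → ℝ≥0∞} (hΦ : Measurable[history X (fun _ => u)] Φ)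
    (hfin : ∫⁻ ω, Φ ω ∂P ≠ ⊤)
    (hs : ∀ ω, Φ ω ≠ 0 → RegularClock (X ω).time ∧ ClockPattern (X ω).time i j t₀ t₁ t₂ t₃)
    {Q D : Set Ω} (hQm : MeasurableSet[clockInfo X] Q) (hDm : MeasurableSet[clockInfo X] D)
    (hQ : ∀ ω ∈ Q, RegularClock (X ω).time → Quiet ψ (X ω).time i j t₀ t₃)
    (hD : ∀ ω ∈ D, RegularClock (X ω).time →
      Refreshed ψ (X ω).time i j ((S.erase i).erase j) u t₀)
    {θ E : ℝ} (hθ : 0 ≤ θ) (hθ1 : 2 * θ ≤ 1) (hE : 0 ≤ E) :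
    ∫⁻ ω, Φ ω * ENNReal.ofReal (E * Real.exp (-θ * windowStat (X ω) i t₀ t₂)) ∂P
      ≤ ∫⁻ ω, Φ ω * ENNReal.ofReal (E * (1 + 4 * θ ^ 2 - θ * ((Real.exp (-6 * lam) / 2 * α ^ 2 *
          (Real.exp (-2 * lam) / 2) ^ ((S.erase i).erase j).card) * (Q ∩ D).indicator 1 ω
          - 2 * Qᶜ.indicator 1 ω))) ∂P := by
  classical
  set c₁ := Real.exp (-6 * lam) / 2 * α ^ 2 * (Real.exp (-2 * lam) / 2) ^ ((S.erase i).erase j).card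
    with hc₁
  have hQm' := hX.clockInfo_le _ hQm
  have hDm' := hX.clockInfo_le _ hDm
  -- Since |Z| ≤ 2 and 2θ ≤ 1, the bound e^y ≤ 1 + y + y² applies. It leaves an expression affine in
  -- the statistic, the form that `lintegral_window` can integrate.
  have hpt : ∀ ω, E * Real.exp (-θ * windowStat (X ω) i t₀ t₂)
      ≤ E * (1 + 4 * θ ^ 2) + -(E * θ) * windowStat (X ω) i t₀ t₂ := by
    intro ω
    have h1 := neg_two_le_zstat ((X ω).spin i ((X ω).count i 0 t₀))
      ((X ω).spin i ((X ω).count i 0 t₀ + 1)) ((X ω).spin i ((X ω).count i 0 t₂))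
      ((X ω).spin i ((X ω).count i 0 t₂ + 1))
    have h2 := zstat_le_one ((X ω).spin i ((X ω).count i 0 t₀))
      ((X ω).spin i ((X ω).count i 0 t₀ + 1)) ((X ω).spin i ((X ω).count i 0 t₂))
      ((X ω).spin i ((X ω).count i 0 t₂ + 1))
    change -2 ≤ windowStat (X ω) i t₀ t₂ at h1
    change windowStat (X ω) i t₀ t₂ ≤ 1 at h2
    generalize windowStat (X ω) i t₀ t₂ = z at *
    have h3 : Real.exp (-θ * z) ≤ 1 + -θ * z + (-θ * z) ^ 2 :=
      exp_le_quadratic (abs_le.2 ⟨by nlinarith, by nlinarith⟩)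
    have h5 : z ^ 2 ≤ 4 := by nlinarith
    have h4 : (-θ * z) ^ 2 ≤ 4 * θ ^ 2 := by nlinarith [mul_le_mul_of_nonneg_left h5 (sq_nonneg θ)]
    nlinarith
  have hsplit := fun (Φ f : Ω → ℝ≥0∞) => lintegral_indicator_split (P := P) (Φ := Φ) (f := f) hQm'
  have hsplitD := fun (Φ f : Ω → ℝ≥0∞) => lintegral_indicator_split (P := P) (Φ := Φ) (f := f) hDm'
  rw [hsplit, hsplit Φ (fun ω => ENNReal.ofReal (E * (1 + 4 * θ ^ 2 - θ * (c₁ * (Q ∩ D).indicator 1 ω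
          - 2 * Qᶜ.indicator 1 ω)))), hsplitD (Q.indicator Φ),
    hsplitD (Q.indicator Φ) (fun ω => ENNReal.ofReal (E * (1 + 4 * θ ^ 2 - θ *
      (c₁ * (Q ∩ D).indicator 1 ω - 2 * Qᶜ.indicator 1 ω))))]
  have hsub : ∀ (U : Set Ω) (Ψ : Ω → ℝ≥0∞) ω, U.indicator Ψ ω ≠ 0 → ω ∈ U ∧ Ψ ω ≠ 0 := fun U Ψ ω h =>
    ⟨Set.mem_of_indicator_ne_zero h, fun h0 => h (by simp [Set.indicator_apply, h0])⟩
  have hmono : ∀ (U : Set Ω) (Ψ : Ω → ℝ≥0∞), ∫⁻ ω, U.indicator Ψ ω ∂P ≤ ∫⁻ ω, Ψ ω ∂P := fun U Ψ =>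
    lintegral_mono fun ω => Set.indicator_le_self _ _ _
  have hΦQ : Measurable[history X (fun _ => u)] (Q.indicator Φ) :=
    hΦ.indicator (clockInfo_le_history _ hQm)
  -- Quiet and refreshed windows give the signal, quiet but not refreshed ones a nonnegative mean,
  -- and the others at worst the value -2.
  refine add_le_add (add_le_add ?_ ?_) ?_
  · have := hX.lintegral_window_edge h01 h12 h23 hψ hα hαl hu0 hS hi hj hij hSα
      (Φ := D.indicator (Q.indicator Φ)) (hΦQ.indicator (clockInfo_le_history _ hDm))
      (ne_top_of_le_ne_top hfin ((hmono _ _).trans (hmono _ _)))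
      (fun ω h => by
        obtain ⟨h1, h2⟩ := hsub _ _ _ h
        obtain ⟨h3, h4⟩ := hsub _ _ _ h2
        obtain ⟨h5, h6⟩ := hs ω h4
        exact ⟨h5, h6, hQ ω h3 h5, hD ω h1 h5⟩)
      (A := E * (1 + 4 * θ ^ 2)) (B := E * θ) (mul_nonneg hE hθ)
      (mul_le_mul_of_nonneg_left (by nlinarith) hE)
    refine le_trans (lintegral_mono fun ω => ?_) (this.trans_eq (lintegral_mul_congr_of_support
      fun ω h => ?_))
    · exact mul_le_mul_right (ENNReal.ofReal_le_ofReal (hpt ω)) _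
    · obtain ⟨h1, h2⟩ := hsub _ _ _ h
      obtain ⟨h3, h4⟩ := hsub _ _ _ h2
      simp only [Set.indicator_of_mem (show ω ∈ Q ∩ D from ⟨h3, h1⟩),
        Set.indicator_of_notMem (show ω ∉ Qᶜ from fun h => h h3), Pi.one_apply]
      congr 1; ring
  · have hΦ' : Measurable[history X (fun _ => t₀)] (Dᶜ.indicator (Q.indicator Φ)) :=
      (hΦQ.indicator (clockInfo_le_history _ hDm).compl).mono
        (history_mono (@measurable_const _ _ _ (clockInfo X) u) fun _ => hu0) le_rfl
    have := hX.lintegral_window h01 h12 h23 hΦ' (i := i) (j := j)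
      (fun ω h => by
        obtain ⟨h1, h2⟩ := hsub _ _ _ h
        obtain ⟨h3, h4⟩ := hsub _ _ _ h2
        obtain ⟨h5, h6⟩ := hs ω h4
        exact ⟨h5, h6, hQ ω h3 h5⟩) (A := E * (1 + 4 * θ ^ 2)) (B := -(E * θ))
      (fun y₁ y₂ a b => by
        have h1 := zstat_le_one y₁ y₂ a b
        have h2 : θ * zstat y₁ y₂ a b ≤ 1 := by nlinarith [neg_two_le_zstat y₁ y₂ a b]
        have : 0 ≤ E * (1 + 4 * θ ^ 2 - θ * zstat y₁ y₂ a b) := mul_nonneg hE (by nlinarith [sq_nonneg θ])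
        nlinarith)
    refine le_trans (lintegral_mono fun ω => mul_le_mul_right (ENNReal.ofReal_le_ofReal (hpt ω)) _)
      (this.le.trans (lintegral_mono fun ω => ?_))
    by_cases h : Dᶜ.indicator (Q.indicator Φ) ω = 0
    · simp [h]
    obtain ⟨h1, h2⟩ := hsub _ _ _ h
    obtain ⟨h3, h4⟩ := hsub _ _ _ h2
    refine mul_le_mul_right (ENNReal.ofReal_le_ofReal ?_) _
    simp only [Set.indicator_of_notMem (show ω ∉ Q ∩ D from fun h => h1 h.2),
      Set.indicator_of_notMem (show ω ∉ Qᶜ from fun h => h h3)]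
    have := mul_nonneg (mul_nonneg hE hθ) (meanStat_nonneg ψ i j ((X ω).config t₀))
    nlinarith
  · refine lintegral_mono fun ω => ?_
    by_cases h : Qᶜ.indicator Φ ω = 0
    · simp [h]
    obtain ⟨h1, h2⟩ := hsub _ _ _ h
    refine mul_le_mul_right (ENNReal.ofReal_le_ofReal ((hpt ω).trans ?_)) _
    simp only [Set.indicator_of_notMem (show ω ∉ Q ∩ D from fun h => h1 h.1),
      Set.indicator_of_mem h1, Pi.one_apply]
    have h1 := neg_two_le_zstat ((X ω).spin i ((X ω).count i 0 t₀))
      ((X ω).spin i ((X ω).count i 0 t₀ + 1)) ((X ω).spin i ((X ω).count i 0 t₂))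
      ((X ω).spin i ((X ω).count i 0 t₂ + 1))
    change -2 ≤ windowStat (X ω) i t₀ t₂ at h1
    nlinarith [mul_nonneg hE hθ]

/-- The exponential moment of the statistic of a pair without an edge, given the clocks. -/
theorem lintegral_block_nonedge (hu0 : u ≤ t₀) (hij : ¬ (dependencyGraph ψ).Adj i j)
    {Φ : Ω → ℝ≥0∞} (hΦ : Measurable[history X (fun _ => u)] Φ)
    (hs : ∀ ω, Φ ω ≠ 0 → RegularClock (X ω).time ∧ ClockPattern (X ω).time i j t₀ t₁ t₂ t₃)
    {Q : Set Ω} (hQm : MeasurableSet[clockInfo X] Q)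
    (hQ : ∀ ω ∈ Q, RegularClock (X ω).time → Quiet ψ (X ω).time i j t₀ t₃)
    {θ E : ℝ} (hθ : 0 ≤ θ) (hθ1 : 2 * θ ≤ 1) (hE : 0 ≤ E) :
    ∫⁻ ω, Φ ω * ENNReal.ofReal (E * Real.exp (θ * windowStat (X ω) i t₀ t₂)) ∂P
      ≤ ∫⁻ ω, Φ ω * ENNReal.ofReal (E * (1 + 4 * θ ^ 2 + θ * Qᶜ.indicator 1 ω)) ∂P := by
  classical
  have hQm' := hX.clockInfo_le _ hQm
  have hz : ∀ ω, -2 ≤ windowStat (X ω) i t₀ t₂ ∧ windowStat (X ω) i t₀ t₂ ≤ 1 := fun ω =>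
    ⟨neg_two_le_zstat _ _ _ _, zstat_le_one _ _ _ _⟩
  have hpt : ∀ ω, E * Real.exp (θ * windowStat (X ω) i t₀ t₂)
      ≤ E * (1 + 4 * θ ^ 2) + E * θ * windowStat (X ω) i t₀ t₂ := by
    intro ω
    obtain ⟨h1, h2⟩ := hz ω
    generalize windowStat (X ω) i t₀ t₂ = z at *
    have h3 : Real.exp (θ * z) ≤ 1 + θ * z + (θ * z) ^ 2 :=
      exp_le_quadratic (abs_le.2 ⟨by nlinarith, by nlinarith⟩)
    have h5 : z ^ 2 ≤ 4 := by nlinarith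
    have h4 : (θ * z) ^ 2 ≤ 4 * θ ^ 2 := by nlinarith [mul_le_mul_of_nonneg_left h5 (sq_nonneg θ)]
    nlinarith
  have hsplit := fun (Φ f : Ω → ℝ≥0∞) => lintegral_indicator_split (P := P) (Φ := Φ) (f := f) hQm'
  rw [hsplit, hsplit Φ (fun ω => ENNReal.ofReal (E * (1 + 4 * θ ^ 2 + θ * Qᶜ.indicator 1 ω)))]
  have hsub : ∀ (U : Set Ω) (Ψ : Ω → ℝ≥0∞) ω, U.indicator Ψ ω ≠ 0 → ω ∈ U ∧ Ψ ω ≠ 0 := fun U Ψ ω h =>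
    ⟨Set.mem_of_indicator_ne_zero h, fun h0 => h (by simp [Set.indicator_apply, h0])⟩
  -- Without an edge, the mean on a quiet window is zero; on the others only Z ≤ 1 is available.
  refine add_le_add ?_ ?_
  · have hΦ' : Measurable[history X (fun _ => t₀)] (Q.indicator Φ) :=
      (hΦ.indicator (clockInfo_le_history _ hQm)).mono
        (history_mono (@measurable_const _ _ _ (clockInfo X) u) fun _ => hu0) le_rfl
    have := hX.lintegral_window h01 h12 h23 hΦ' (i := i) (j := j)
      (fun ω h => by
        obtain ⟨h1, h2⟩ := hsub _ _ _ h
        obtain ⟨h5, h6⟩ := hs ω h2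
        exact ⟨h5, h6, hQ ω h1 h5⟩) (A := E * (1 + 4 * θ ^ 2)) (B := E * θ)
      (fun y₁ y₂ a b => by
        have h1 := neg_two_le_zstat y₁ y₂ a b
        have h2 : -1 ≤ θ * zstat y₁ y₂ a b := by nlinarith
        have : 0 ≤ E * (1 + 4 * θ ^ 2 + θ * zstat y₁ y₂ a b) := mul_nonneg hE (by nlinarith [sq_nonneg θ])
        nlinarith)
    refine le_trans (lintegral_mono fun ω => mul_le_mul_right (ENNReal.ofReal_le_ofReal (hpt ω)) _)
      (this.le.trans (lintegral_mono fun ω => ?_))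
    by_cases h : Q.indicator Φ ω = 0
    · simp [h]
    obtain ⟨h1, h2⟩ := hsub _ _ _ h
    refine mul_le_mul_right (ENNReal.ofReal_le_ofReal ?_) _
    simp [Set.indicator_of_notMem (show ω ∉ Qᶜ from fun h => h h1), meanStat_eq_zero hij]
  · refine lintegral_mono fun ω => ?_
    by_cases h : Qᶜ.indicator Φ ω = 0
    · simp [h]
    obtain ⟨h1, h2⟩ := hsub _ _ _ h
    refine mul_le_mul_right (ENNReal.ofReal_le_ofReal ((hpt ω).trans ?_)) _
    simp only [Set.indicator_of_mem h1, Pi.one_apply]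
    nlinarith [mul_nonneg hE hθ, (hz ω).2]

end IsGlauberDynamics

theorem measurable_indicator_one {Ω : Type*} {m : MeasurableSpace Ω} {a : Set Ω}
    (ha : MeasurableSet a) : Measurable (a.indicator (1 : Ω → ℝ≥0∞)) :=
  measurable_one.indicator ha

/-! ### The greedy sequence of stops -/

section Greedy

variable (pat : ℕ → Prop) (r : ℕ)

open Classical in
/-- The greedy scan: before index `ℓ`, the next index at which a stop is allowed and the number of
stops. -/
noncomputable def greedy : ℕ → ℕ × ℕ
  | 0 => (r, 0)
  | ℓ + 1 => if (greedy ℓ).1 ≤ ℓ ∧ pat ℓ then (ℓ + r, (greedy ℓ).2 + 1) else greedy ℓ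

/-- The greedy scan stops at `ℓ`. -/
def Hit (ℓ : ℕ) : Prop := (greedy pat r ℓ).1 ≤ ℓ ∧ pat ℓ

variable {pat r}

theorem greedy_succ_of_hit {ℓ : ℕ} (h : Hit pat r ℓ) :
    greedy pat r (ℓ + 1) = (ℓ + r, (greedy pat r ℓ).2 + 1) := by
  rw [greedy]; exact if_pos h

theorem greedy_succ_of_not_hit {ℓ : ℕ} (h : ¬ Hit pat r ℓ) :
    greedy pat r (ℓ + 1) = greedy pat r ℓ := by
  rw [greedy]; exact if_neg h

theorem greedy_fst_mono {ℓ ℓ' : ℕ} (h : ℓ ≤ ℓ') : (greedy pat r ℓ).1 ≤ (greedy pat r ℓ').1 := by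
  induction ℓ', h using Nat.le_induction with
  | base => exact le_rfl
  | succ m _ ih =>
    by_cases hm : Hit pat r m
    · rw [greedy_succ_of_hit hm]
      have := hm.1
      show _ ≤ m + r
      omega
    · rwa [greedy_succ_of_not_hit hm]

/-- A stop raises the next admissible index to `ℓ + r`, and this index never decreases. Hence the
blocks of different stops are disjoint. -/
theorem Hit.add_le {ℓ ℓ' : ℕ} (h : Hit pat r ℓ) (h' : Hit pat r ℓ') (hl : ℓ < ℓ') : ℓ + r ≤ ℓ' := by
  have h1 := greedy_fst_mono (pat := pat) (r := r) (Nat.succ_le_of_lt hl)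
  rw [Nat.succ_eq_add_one, greedy_succ_of_hit h] at h1
  exact h1.trans h'.1

theorem greedy_congr {pat' : ℕ → Prop} {K : ℕ} (h : ∀ ℓ < K, pat ℓ ↔ pat' ℓ) :
    greedy pat r K = greedy pat' r K := by
  induction K with
  | zero => rfl
  | succ K ih =>
    have ih' := ih fun ℓ hℓ => h ℓ (hℓ.trans (Nat.lt_succ_self K))
    have hK := h K (Nat.lt_succ_self K)
    by_cases hp : pat K
    · simp [greedy, ih', hp, hK.1 hp]
    · simp [greedy, ih', hp, mt hK.2 hp]

theorem hit_congr {pat' : ℕ → Prop} {K : ℕ} (h : ∀ ℓ < K, pat ℓ ↔ pat' ℓ) {ℓ : ℕ} (hℓ : ℓ < K) :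
    Hit pat r ℓ ↔ Hit pat' r ℓ := by
  unfold Hit
  rw [greedy_congr fun ℓ' h' => h ℓ' (h'.trans hℓ), h ℓ hℓ]

/-- The number of indices at which the scan looks for a pattern, in terms of the stops. -/
theorem card_attempts (hr : 1 ≤ r) (K : ℕ) :
    ((Finset.range K).filter fun ℓ => (greedy pat r ℓ).1 ≤ ℓ).card
      + r + (r - 1) * (greedy pat r K).2 = max K (greedy pat r K).1 := by
  -- A failed attempt uses up one index; a stop uses up one attempt and `r - 1` skipped indices. The
  -- extra `r` accounts for the indices below `τ_0 + r`, and the maximum for a scan that is still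
  -- inside a skipped block.
  induction K with
  | zero => simp [greedy]
  | succ K ih =>
    rw [Finset.range_add_one, Finset.filter_insert]
    have hnm : K ∉ (Finset.range K).filter fun ℓ => (greedy pat r ℓ).1 ≤ ℓ := by simp
    by_cases hH : Hit pat r K
    · rw [greedy_succ_of_hit hH, if_pos hH.1, Finset.card_insert_of_notMem hnm]
      rw [max_eq_left hH.1] at ih
      simp only [mul_add, mul_one]
      rw [max_eq_right (by omega)]
      omega
    · rw [greedy_succ_of_not_hit hH]
      by_cases h1 : (greedy pat r K).1 ≤ K
      · rw [if_pos h1, Finset.card_insert_of_notMem hnm]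
        rw [max_eq_left h1] at ih
        rw [max_eq_left (by omega)]
        omega
      · rw [if_neg h1, ih, max_eq_right (by omega), max_eq_right (by omega)]

end Greedy

/-! ### The stopping times of the algorithm -/

section Stops

variable {li lj : List (ℝ × Bool)} {L : ℝ} {r : ℕ}

/-- The four parts must be proved together. The second one, that no admissible index has been
overlooked, is what identifies the infimum in the definition of the next stopping time with the
index of a hit. -/
theorem stopIndex_invariant (hr : 1 ≤ r) (K : ℕ) :
    (((greedy (Pattern li lj L r) r K).1 : ℕ∞)
      = stopIndex li lj L r (greedy (Pattern li lj L r) r K).2 + r) ∧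
    (∀ ℓ < K, (greedy (Pattern li lj L r) r K).1 ≤ ℓ → ¬ Pattern li lj L r ℓ) ∧
    (∀ ℓ < K, Hit (Pattern li lj L r) r ℓ →
      stopIndex li lj L r ((greedy (Pattern li lj L r) r ℓ).2 + 1) = ℓ) ∧
    (∀ s, 1 ≤ s → s ≤ (greedy (Pattern li lj L r) r K).2 → ∃ ℓ < K, stopIndex li lj L r s = ℓ) := by
  induction K with
  | zero =>
    refine ⟨by simp [greedy, stopIndex], by simp, by simp, fun s h1 h2 => ?_⟩
    simp only [greedy] at h2; omega
  | succ K ih =>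
    obtain ⟨i1, i2, i3, i4⟩ := ih
    by_cases hH : Hit (Pattern li lj L r) r K
    · have hidx : stopIndex li lj L r ((greedy (Pattern li lj L r) r K).2 + 1) = K := by
        rw [stopIndex, ← i1]
        refine le_antisymm (iInf_le_of_le ⟨K, by exact_mod_cast hH.1, hH.2⟩ le_rfl) (le_iInf fun ℓ => ?_)
        by_contra hc
        push Not at hc
        exact i2 ℓ.1 (by exact_mod_cast hc) (by exact_mod_cast ℓ.2.1) ℓ.2.2
      have hst : ∀ ℓ < K + 1, Hit (Pattern li lj L r) r ℓ →
          stopIndex li lj L r ((greedy (Pattern li lj L r) r ℓ).2 + 1) = ℓ := by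
        intro ℓ hℓ hHℓ
        rcases Nat.lt_succ_iff_lt_or_eq.1 hℓ with h | rfl
        · exact i3 ℓ h hHℓ
        · exact hidx
      rw [greedy_succ_of_hit hH]
      refine ⟨by rw [hidx]; push_cast; rfl, ?_, hst, ?_⟩
      · intro ℓ hℓ h1
        simp only at h1
        omega
      · intro s h1 h2
        rcases Nat.lt_succ_iff_lt_or_eq.1 (Nat.lt_succ_of_le h2) with h | h
        · obtain ⟨ℓ, hℓ, h3⟩ := i4 s h1 (by simp only at h; omega)
          exact ⟨ℓ, hℓ.trans (Nat.lt_succ_self K), h3⟩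
        · exact ⟨K, Nat.lt_succ_self K, by rw [h]; exact hidx⟩
    · rw [greedy_succ_of_not_hit hH]
      refine ⟨i1, ?_, ?_, fun s h1 h2 => ?_⟩
      · intro ℓ hℓ h1
        rcases Nat.lt_succ_iff_lt_or_eq.1 hℓ with h | rfl
        · exact i2 ℓ h h1
        · exact fun hp => hH ⟨h1, hp⟩
      · intro ℓ hℓ hHℓ
        rcases Nat.lt_succ_iff_lt_or_eq.1 hℓ with h | rfl
        · exact i3 ℓ h hHℓ
        · exact absurd hHℓ hH
      · obtain ⟨ℓ, hℓ, h3⟩ := i4 s h1 h2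
        exact ⟨ℓ, hℓ.trans (Nat.lt_succ_self K), h3⟩

/-- The sum of a function over the first `M` stopping times, as a scan over all indices. -/
theorem sum_stopIndex (hr : 1 ≤ r) (F : ℕ → ℝ) (M K : ℕ) :
    open Classical in
    ∑ s ∈ Finset.Icc 1 (min M (greedy (Pattern li lj L r) r K).2), F (stopIndex li lj L r s).toNat
      = ∑ ℓ ∈ Finset.range K, if Hit (Pattern li lj L r) r ℓ ∧
          (greedy (Pattern li lj L r) r ℓ).2 < M then F ℓ else 0 := by
  classical
  induction K with
  | zero => simp [greedy]
  | succ K ih =>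
    rw [Finset.sum_range_succ, ← ih]
    by_cases hH : Hit (Pattern li lj L r) r K
    · rw [greedy_succ_of_hit hH]
      by_cases hM : (greedy (Pattern li lj L r) r K).2 < M
      · rw [if_pos ⟨hH, hM⟩, min_eq_right (by simp only; omega), min_eq_right hM.le,
          Finset.sum_Icc_succ_top (by omega)]
        congr 2
        rw [(stopIndex_invariant hr (K + 1)).2.2.1 K (Nat.lt_succ_self K) hH]
        rfl
      · rw [if_neg fun h => hM h.2, min_eq_left (by simp only; omega), min_eq_left (by omega), add_zero]
    · rw [greedy_succ_of_not_hit hH, if_neg fun h => hH h.1, add_zero]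

/-- If the scan finds fewer than `M` stops below `K`, the next stopping time is at least `K` by the
invariant. It is at most the `M`-th one by monotonicity, so the `M`-th block ends too late. -/
theorem enoughStops_iff (hr : 1 ≤ r) {M K : ℕ} (hM : 1 ≤ M) {T : ℝ}
    (hK : ∀ ℓ : ℕ, ((ℓ : ℝ) + r) * L ≤ T ↔ ℓ < K) :
    EnoughStops li lj L r M T ↔ M ≤ (greedy (Pattern li lj L r) r K).2 := by
  unfold EnoughStops
  rw [hK]
  constructor
  · rintro ⟨h1, h2⟩
    by_contra hc
    push Not at hc
    set ℓ := (stopIndex li lj L r M).toNat with hℓ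
    have hs : stopIndex li lj L r M = ℓ := (ENat.natCast_toNat h1).symm
    -- the number of stops before `ℓ` is less than `M`, so `ℓ` is not the stop number `M`
    have mono : ∀ s, stopIndex li lj L r s + r ≤ stopIndex li lj L r (s + 1) := fun s => by
      rw [stopIndex]
      exact le_iInf fun ℓ => ℓ.2.1
    have mono' : Monotone (stopIndex li lj L r) :=
      monotone_nat_of_le_succ fun s => le_self_add.trans (mono s)
    obtain ⟨i1, i2, -, -⟩ := stopIndex_invariant (li := li) (lj := lj) (L := L) hr K
    set c := (greedy (Pattern li lj L r) r K).2 with hcd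
    have hle : stopIndex li lj L r (c + 1) ≤ ℓ := by rw [← hs]; exact mono' hc
    rw [stopIndex, ← i1] at hle
    have : ∃ ℓ' : {ℓ : ℕ // ((greedy (Pattern li lj L r) r K).1 : ℕ∞) ≤ (ℓ : ℕ∞) ∧ Pattern li lj L r ℓ},
        (ℓ'.1 : ℕ∞) < K := by
      by_contra hn
      push Not at hn
      have h3 := (le_iInf hn).trans hle
      exact absurd (by exact_mod_cast h3 : K ≤ ℓ) (by omega)
    obtain ⟨ℓ', h4⟩ := this
    exact i2 ℓ'.1 (by exact_mod_cast h4) (by exact_mod_cast ℓ'.2.1) ℓ'.2.2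
  · intro h
    obtain ⟨ℓ, h1, h2⟩ := (stopIndex_invariant hr K).2.2.2 M hM h
    rw [h2]
    exact ⟨ENat.natCast_ne_top ℓ, by simpa using h1⟩

end Stops

/-! ### Products along the stops -/

/-- The weight `f ℓ` at the stops, and `1` elsewhere. -/
noncomputable def stopWeight {Ω : Type*} (a : Set Ω) (f : Ω → ℝ≥0∞) (ω : Ω) : ℝ≥0∞ :=
  a.indicator f ω + aᶜ.indicator 1 ω

theorem stopWeight_of_mem {Ω : Type*} {a : Set Ω} {f : Ω → ℝ≥0∞} {ω : Ω} (h : ω ∈ a) :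
    stopWeight a f ω = f ω := by simp [stopWeight, h]

theorem stopWeight_of_notMem {Ω : Type*} {a : Set Ω} {f : Ω → ℝ≥0∞} {ω : Ω} (h : ω ∉ a) :
    stopWeight a f ω = 1 := by simp [stopWeight, h]

theorem measurable_stopWeight {Ω : Type*} {m : MeasurableSpace Ω} {a : Set Ω} {f : Ω → ℝ≥0∞}
    (ha : MeasurableSet a) (hf : Measurable (a.indicator f)) : Measurable (stopWeight a f) :=
  hf.add (measurable_one.indicator ha.compl)

theorem stopWeight_le {Ω : Type*} {a : Set Ω} {f : Ω → ℝ≥0∞} {C : ℝ≥0∞} (hC : 1 ≤ C)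
    (hf : ∀ ω, f ω ≤ C) (ω : Ω) : stopWeight a f ω ≤ C := by
  by_cases h : ω ∈ a
  · rw [stopWeight_of_mem h]; exact hf ω
  · rw [stopWeight_of_notMem h]; exact hC

/-- On a stop, the factors of the previous `r` indices are trivial. -/
theorem prod_stopWeight_trunc {Ω : Type*} {a : ℕ → Set Ω} {r : ℕ}
    (hsep : ∀ ω ℓ ℓ', ω ∈ a ℓ → ω ∈ a ℓ' → ℓ < ℓ' → ℓ + r ≤ ℓ') (f : ℕ → Ω → ℝ≥0∞) {K : ℕ} {ω : Ω}
    (h : ω ∈ a K) : ∏ ℓ ∈ Finset.range K, stopWeight (a ℓ) (f ℓ) ω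
      = ∏ ℓ ∈ (Finset.range K).filter (fun ℓ => ℓ + r ≤ K), stopWeight (a ℓ) (f ℓ) ω := by
  rw [Finset.prod_filter]
  refine Finset.prod_congr rfl fun ℓ hℓ => ?_
  split_ifs with h1
  · rfl
  · exact stopWeight_of_notMem fun h2 => h1 (hsep ω ℓ K h2 h (Finset.mem_range.1 hℓ))

namespace IsGlauberDynamics

variable {Ω : Type*} [mΩ : MeasurableSpace Ω] {n : ℕ} {ψ : Multilinear n} {P : Measure Ω}
  [IsProbabilityMeasure P] {X : Ω → Trajectory n} (hX : IsGlauberDynamics ψ P X)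
include hX

/-- Replacing functions of the spins by functions of the clocks along the stops. -/
theorem lintegral_prod_stopWeight_le {a : ℕ → Set Ω} {f g : ℕ → Ω → ℝ≥0∞} {t : ℕ → ℝ} {r : ℕ}
    (ht : Monotone t) (ha : ∀ ℓ, MeasurableSet[clockInfo X] (a ℓ))
    (hg : ∀ ℓ, Measurable[clockInfo X] (g ℓ))
    (hf : ∀ ℓ, Measurable[history X (fun _ => t (ℓ + r))] ((a ℓ).indicator (f ℓ)))
    {C : ℝ≥0∞} (hC1 : 1 ≤ C) (hC : C ≠ ⊤) (hfC : ∀ ℓ ω, f ℓ ω ≤ C) (hgC : ∀ ℓ ω, g ℓ ω ≤ C)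
    (hsep : ∀ ω ℓ ℓ', ω ∈ a ℓ → ω ∈ a ℓ' → ℓ < ℓ' → ℓ + r ≤ ℓ')
    (hblock : ∀ ℓ (Φ : Ω → ℝ≥0∞), Measurable[history X (fun _ => t ℓ)] Φ → ∫⁻ ω, Φ ω ∂P ≠ ⊤ →
      (∀ ω, Φ ω ≠ 0 → ω ∈ a ℓ) → ∫⁻ ω, Φ ω * f ℓ ω ∂P ≤ ∫⁻ ω, Φ ω * g ℓ ω ∂P)
    (K : ℕ) : ∀ φ : Ω → ℝ≥0∞, Measurable[clockInfo X] φ → (∃ B ≠ ⊤, ∀ ω, φ ω ≤ B) →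
      ∫⁻ ω, φ ω * ∏ ℓ ∈ Finset.range K, stopWeight (a ℓ) (f ℓ) ω ∂P
        ≤ ∫⁻ ω, φ ω * ∏ ℓ ∈ Finset.range K, stopWeight (a ℓ) (g ℓ) ω ∂P := by
  have tm : ∀ s : ℝ, Measurable[clockInfo X] fun _ : Ω => s := fun s =>
    @measurable_const _ _ _ (clockInfo X) s
  induction K with
  | zero => intro φ _ _; simp
  | succ K ih =>
    rintro φ hφ ⟨B, hB, hφB⟩
    have ham := hX.clockInfo_le _ (ha K)
    rw [lintegral_indicator_split ham,
      lintegral_indicator_split (f := fun ω => ∏ ℓ ∈ Finset.range (K + 1), stopWeight (a ℓ) (g ℓ) ω) ham]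
    have hsub : ∀ (U : Set Ω) ω, U.indicator φ ω ≠ 0 → ω ∈ U := fun U ω h =>
      Set.mem_of_indicator_ne_zero h
    have hle : ∀ (U : Set Ω) ω, U.indicator φ ω ≤ B := fun U ω =>
      (Set.indicator_le_self _ _ _).trans (hφB ω)
    refine add_le_add ?_ ?_
    -- At a stop `K`, only factors with `ℓ + r ≤ K` are nontrivial. The truncated product is
    -- therefore determined by the history at the start of the block, as `hblock` requires.
    · set Φ : Ω → ℝ≥0∞ := fun ω => (a K).indicator φ ω *
        ∏ ℓ ∈ (Finset.range K).filter (fun ℓ => ℓ + r ≤ K), stopWeight (a ℓ) (f ℓ) ω with hΦd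
      have hΦm : Measurable[history X (fun _ => t K)] Φ := by
        have h1 : Measurable[history X (fun _ => t K)] ((a K).indicator φ) :=
          (hφ.indicator (ha K)).mono clockInfo_le_history le_rfl
        have h2 : ∀ ℓ ∈ (Finset.range K).filter (fun ℓ => ℓ + r ≤ K),
            Measurable[history X (fun _ => t K)] (stopWeight (a ℓ) (f ℓ)) := fun ℓ hℓ =>
          measurable_stopWeight (clockInfo_le_history _ (ha ℓ)) ((hf ℓ).mono
            (history_mono (tm _) fun _ => ht (Finset.mem_filter.1 hℓ).2) le_rfl)
        exact h1.mul (Finset.measurable_fun_prod _ h2)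
      have hΦfin : ∫⁻ ω, Φ ω ∂P ≠ ⊤ := by
        have : ∀ ω, Φ ω ≤ B * ∏ _ℓ ∈ (Finset.range K).filter (fun ℓ => ℓ + r ≤ K), C := fun ω =>
          mul_le_mul' (hle _ ω) (Finset.prod_le_prod' fun ℓ _ => stopWeight_le hC1 (hfC ℓ) ω)
        refine ne_top_of_le_ne_top ?_ (lintegral_mono this)
        rw [lintegral_const, measure_univ, mul_one, Finset.prod_const]
        exact ENNReal.mul_ne_top hB (ENNReal.pow_ne_top hC)
      have hblk := hblock K Φ hΦm hΦfin fun ω h => hsub _ ω (left_ne_zero_of_mul h)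
      -- The new factor `g K` depends on the clocks only and joins the weight. This is why the
      -- induction runs over all bounded weights determined by the clocks, including future ones.
      have hih := ih (fun ω => (a K).indicator φ ω * g K ω) ((hφ.indicator (ha K)).mul (hg K))
        ⟨B * C, ENNReal.mul_ne_top hB hC, fun ω => mul_le_mul' (hle _ ω) (hgC K ω)⟩
      have htr : ∀ ω, Φ ω = (a K).indicator φ ω * ∏ ℓ ∈ Finset.range K, stopWeight (a ℓ) (f ℓ) ω := by
        intro ω
        by_cases h : ω ∈ a K
        · rw [hΦd, prod_stopWeight_trunc hsep f h]
        · simp [hΦd, h]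
      calc _ = ∫⁻ ω, Φ ω * f K ω ∂P := lintegral_congr fun ω => ?_
        _ ≤ ∫⁻ ω, Φ ω * g K ω ∂P := hblk
        _ = _ := lintegral_congr fun ω => by rw [htr]; ring
        _ ≤ _ := hih
        _ = _ := lintegral_congr fun ω => ?_
      · rw [htr, Finset.prod_range_succ]
        by_cases h : ω ∈ a K
        · rw [stopWeight_of_mem h]; ring
        · simp [h]
      · rw [Finset.prod_range_succ]
        by_cases h : ω ∈ a K
        · rw [stopWeight_of_mem h]; ring
        · simp [h]
    · have hih := ih ((a K)ᶜ.indicator φ) (hφ.indicator (ha K).compl) ⟨B, hB, hle _⟩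
      have e : ∀ f : ℕ → Ω → ℝ≥0∞, ∫⁻ ω, (a K)ᶜ.indicator φ ω *
          ∏ ℓ ∈ Finset.range (K + 1), stopWeight (a ℓ) (f ℓ) ω ∂P
          = ∫⁻ ω, (a K)ᶜ.indicator φ ω * ∏ ℓ ∈ Finset.range K, stopWeight (a ℓ) (f ℓ) ω ∂P := by
        intro f
        refine lintegral_mul_congr_of_support fun ω h => ?_
        rw [Finset.prod_range_succ, stopWeight_of_notMem (hsub _ ω h), mul_one]
      rw [e, e]; exact hih

end IsGlauberDynamics

/-- The product of independent weights of mean at most one along the stops has mean at most one. -/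
theorem lintegral_prod_stopWeight_le_one {Ω : Type*} [mΩ : MeasurableSpace Ω] {P : Measure Ω}
    [IsProbabilityMeasure P] {a : ℕ → Set Ω} {g : ℕ → Ω → ℝ≥0∞} {r : ℕ}
    (hsep : ∀ ω ℓ ℓ', ω ∈ a ℓ → ω ∈ a ℓ' → ℓ < ℓ' → ℓ + r ≤ ℓ') (m₁ m₂ : ℕ → MeasurableSpace Ω)
    (h₁ : ∀ ℓ, m₁ ℓ ≤ mΩ) (h₂ : ∀ ℓ, m₂ ℓ ≤ mΩ) (hind : ∀ ℓ, Indep (m₁ ℓ) (m₂ ℓ) P)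
    (ha : ∀ ℓ ℓ', ℓ ≤ ℓ' → MeasurableSet[m₁ ℓ'] (a ℓ))
    (hg : ∀ ℓ ℓ', ℓ + r ≤ ℓ' → ℓ < ℓ' → Measurable[m₁ ℓ'] (g ℓ)) (hg' : ∀ ℓ, Measurable[m₂ ℓ] (g ℓ))
    (hle : ∀ ℓ, ∫⁻ ω, g ℓ ω ∂P ≤ 1) (K : ℕ) :
    ∫⁻ ω, ∏ ℓ ∈ Finset.range K, stopWeight (a ℓ) (g ℓ) ω ∂P ≤ 1 := by
  induction K with
  | zero => simp
  | succ K ih =>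
    refine le_trans ?_ ih
    have ham := h₁ K _ (ha K K le_rfl)
    have e1 : ∀ K, ∫⁻ ω, ∏ ℓ ∈ Finset.range K, stopWeight (a ℓ) (g ℓ) ω ∂P
        = ∫⁻ ω, (1 : Ω → ℝ≥0∞) ω * ∏ ℓ ∈ Finset.range K, stopWeight (a ℓ) (g ℓ) ω ∂P := by simp
    rw [e1, e1, lintegral_indicator_split ham,
      lintegral_indicator_split (f := fun ω => ∏ ℓ ∈ Finset.range K, stopWeight (a ℓ) (g ℓ) ω) ham]
    refine add_le_add ?_ (le_of_eq (lintegral_mul_congr_of_support fun ω h => ?_))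
    · set Φ : Ω → ℝ≥0∞ := fun ω => (a K).indicator 1 ω *
        ∏ ℓ ∈ (Finset.range K).filter (fun ℓ => ℓ + r ≤ K), stopWeight (a ℓ) (g ℓ) ω with hΦd
      have hΦm : Measurable[m₁ K] Φ := by
        have h1 : Measurable[m₁ K] ((a K).indicator (1 : Ω → ℝ≥0∞)) :=
          measurable_indicator_one (ha K K le_rfl)
        have h2 : ∀ ℓ ∈ (Finset.range K).filter (fun ℓ => ℓ + r ≤ K),
            Measurable[m₁ K] (stopWeight (a ℓ) (g ℓ)) := fun ℓ hℓ => by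
          have hℓ' := Finset.mem_filter.1 hℓ
          have hlt := Finset.mem_range.1 hℓ'.1
          exact measurable_stopWeight (ha ℓ K hlt.le) ((hg ℓ K hℓ'.2 hlt).indicator (ha ℓ K hlt.le))
        exact h1.mul (Finset.measurable_fun_prod _ h2)
      have htr : ∀ ω, Φ ω = (a K).indicator 1 ω * ∏ ℓ ∈ Finset.range K, stopWeight (a ℓ) (g ℓ) ω := by
        intro ω
        by_cases h : ω ∈ a K
        · rw [hΦd, prod_stopWeight_trunc hsep g h]
        · simp [hΦd, h]
      -- The last factor is independent of `Φ` and has mean at most one, so dropping it does not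
      -- decrease the integral.
      calc _ = ∫⁻ ω, (Φ * g K) ω ∂P := lintegral_congr fun ω => ?_
        _ = (∫⁻ ω, Φ ω ∂P) * ∫⁻ ω, g K ω ∂P :=
          lintegral_mul_eq_lintegral_mul_lintegral_of_independent_measurableSpace (h₁ K) (h₂ K)
            (hind K) hΦm (hg' K)
        _ ≤ (∫⁻ ω, Φ ω ∂P) * 1 := mul_le_mul_right (hle K) _
        _ = _ := by rw [mul_one]; exact lintegral_congr fun ω => htr ω
      rw [Pi.mul_apply, htr, Finset.prod_range_succ]
      by_cases h : ω ∈ a K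
      · rw [stopWeight_of_mem h]; ring
      · simp [h]
    · rw [Finset.prod_range_succ,
        stopWeight_of_notMem (show ω ∉ a K from Set.mem_of_indicator_ne_zero h), mul_one]

/-! ### The counts of the updates in a grid of cells -/

/-- The information carried by the coordinates in `S` of a family of counts. -/
abbrev coordInfo {Ω ι : Type*} (N : Ω → ι → ℕ) (S : Set ι) : MeasurableSpace Ω :=
  ⨆ q ∈ S, MeasurableSpace.comap (fun ω => N ω q) ⊤

/-- The bound `B` makes the relevant coordinates finite in number. The function then factors through
a countable discrete space, and its own form is irrelevant. -/
theorem measurable_coordInfo {Ω β : Type*} [MeasurableSpace β] {n : ℕ} (N : Ω → Fin n × ℕ → ℕ)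
    {S : Set (Fin n × ℕ)} (B : ℕ) {f : (Fin n × ℕ → ℕ) → β}
    (hf : ∀ x y, (∀ q ∈ S, q.2 < B → x q = y q) → f x = f y) :
    Measurable[coordInfo N S] fun ω => f (N ω) := by
  classical
  set F : Finset (Fin n × ℕ) := (Finset.univ ×ˢ Finset.range B).filter (· ∈ S) with hF
  have hmem : ∀ q, q ∈ F ↔ q.2 < B ∧ q ∈ S := fun q => by simp [hF]
  have e : (fun ω => f (N ω)) = (fun z : F → ℕ => f fun q => if h : q ∈ F then z ⟨q, h⟩ else 0) ∘
      fun ω (q : F) => N ω q := by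
    funext ω
    refine hf _ _ fun q hq hB => ?_
    have : q ∈ F := (hmem q).2 ⟨hB, hq⟩
    simp [this]
  rw [e]
  refine (Measurable.of_discrete (f := fun z : F → ℕ => _)).comp ?_
  refine @measurable_pi_lambda Ω F _ (coordInfo N S) _ _ fun q => ?_
  have h1 : MeasurableSpace.comap (fun ω => N ω q) ⊤ ≤ coordInfo N S :=
    le_iSup₂_of_le (q : Fin n × ℕ) ((hmem q).1 q.2).2 le_rfl
  exact Measurable.mono (comap_measurable fun ω => N ω q) h1 le_rfl

theorem measurableSet_coordInfo {Ω : Type*} {n : ℕ} (N : Ω → Fin n × ℕ → ℕ)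
    {S : Set (Fin n × ℕ)} (B : ℕ) {p : (Fin n × ℕ → ℕ) → Prop}
    (hp : ∀ x y, (∀ q ∈ S, q.2 < B → x q = y q) → (p x ↔ p y)) :
    MeasurableSet[coordInfo N S] {ω | p (N ω)} := by
  have h : Measurable[coordInfo N S] fun ω => p (N ω) :=
    measurable_coordInfo N B fun x y h => propext (hp x y h)
  exact h (measurableSet_singleton True) |> fun h => by
    convert h using 1
    ext ω; simp

/-- The number of updates of every site in the cells `(c h, (c + 1) h]`. -/
noncomputable def cellCounts {n : ℕ} (h : ℝ) (τ : Fin n → ℕ → ℝ) (q : Fin n × ℕ) : ℕ :=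
  clockCount τ q.1 (q.2 * h) ((q.2 + 1 : ℕ) * h)

/-- The update pattern `iijii` in the window number `w`, consisting of three cells. -/
structure CellPattern {n : ℕ} (x : Fin n × ℕ → ℕ) (i j : Fin n) (w : ℕ) : Prop where
  first_i : 2 ≤ x (i, 3 * w)
  first_j : x (j, 3 * w) = 0
  second_i : x (i, 3 * w + 1) = 0
  second_j : 1 ≤ x (j, 3 * w + 1)
  third_i : 2 ≤ x (i, 3 * w + 2)
  third_j : x (j, 3 * w + 2) = 0

theorem CellPattern.congr {n : ℕ} {x y : Fin n × ℕ → ℕ} {i j : Fin n} {w : ℕ}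
    (h : ∀ a c, a = i ∨ a = j → 3 * w ≤ c → c < 3 * (w + 1) → x (a, c) = y (a, c)) :
    CellPattern x i j w ↔ CellPattern y i j w := by
  have e1 := h i (3 * w) (.inl rfl) le_rfl (by omega)
  have e2 := h i (3 * w + 1) (.inl rfl) (by omega) (by omega)
  have e3 := h i (3 * w + 2) (.inl rfl) (by omega) (by omega)
  have e4 := h j (3 * w) (.inr rfl) le_rfl (by omega)
  have e5 := h j (3 * w + 1) (.inr rfl) (by omega) (by omega)
  have e6 := h j (3 * w + 2) (.inr rfl) (by omega) (by omega)
  exact ⟨fun ⟨a, b, c, d, e, f⟩ => ⟨e1 ▸ a, e4 ▸ b, e2 ▸ c, e5 ▸ d, e3 ▸ e, e6 ▸ f⟩,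
    fun ⟨a, b, c, d, e, f⟩ => ⟨e1 ▸ a, e4 ▸ b, e2 ▸ c, e5 ▸ d, e3 ▸ e, e6 ▸ f⟩⟩

/-- The cell version of `Quiet`. -/
def CellQuiet {n : ℕ} (ψ : Multilinear n) (x : Fin n × ℕ → ℕ) (i j : Fin n) (w : ℕ) : Prop :=
  ∀ a, a ≠ i → a ≠ j → ((dependencyGraph ψ).Adj i a ∨ (dependencyGraph ψ).Adj j a) →
    ∀ c ∈ Finset.Ico (3 * w) (3 * w + 3), x (a, c) = 0

/-- The cell version of `Refreshed`, for the `ρ` windows before the window number `w`. -/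
structure CellRefreshed {n : ℕ} (ψ : Multilinear n) (x : Fin n × ℕ → ℕ) (i j : Fin n)
    (V : Finset (Fin n)) (ρ w : ℕ) : Prop where
  update : ∀ s ∈ V, ¬ ∀ c ∈ Finset.Ico (3 * (w - ρ)) (3 * w), x (s, c) = 0
  quiet : ∀ a, (dependencyGraph ψ).Adj i a → a ≠ j → a ∉ V →
    ∀ c ∈ Finset.Ico (3 * (w - ρ)) (3 * w), x (a, c) = 0

namespace RegularClock

variable {n : ℕ} {τ : Fin n → ℕ → ℝ} (hτ : RegularClock τ) {h : ℝ} (h0 : 0 ≤ h)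
include hτ h0

theorem clockCount_eq_sum_cellCounts (a : Fin n) {p q : ℕ} (hpq : p ≤ q) :
    clockCount τ a (p * h) (q * h) = ∑ c ∈ Finset.Ico p q, cellCounts h τ (a, c) := by
  have hm : ∀ {p q : ℕ}, p ≤ q → (p : ℝ) * h ≤ q * h := fun {p q} hpq =>
    mul_le_mul_of_nonneg_right (by exact_mod_cast hpq) h0
  induction q, hpq using Nat.le_induction with
  | base =>
    have := hτ.clockCount_add a (le_refl ((p : ℝ) * h))
    simp only [Finset.Ico_self, Finset.sum_empty]; omega
  | succ q hq ih =>
    rw [Finset.sum_Ico_succ_top hq, ← ih, cellCounts]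
    have h1 := hτ.clockCount_add a (hm hq)
    have h2 := hτ.clockCount_add a (hm (Nat.le_succ q))
    have h3 := hτ.clockCount_add a (hm (hq.trans (Nat.le_succ q)))
    simp only [Nat.succ_eq_add_one] at h2 h3 ⊢
    omega

theorem clockCount_eq_zero_iff (a : Fin n) {p q : ℕ} (hpq : p ≤ q) :
    clockCount τ a (p * h) (q * h) = 0 ↔ ∀ c ∈ Finset.Ico p q, cellCounts h τ (a, c) = 0 := by
  rw [hτ.clockCount_eq_sum_cellCounts h0 a hpq, Finset.sum_eq_zero_iff]

theorem quiet_iff {ψ : Multilinear n} {i j : Fin n} {w : ℕ} :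
    Quiet ψ τ i j ((3 * w : ℕ) * h) ((3 * w + 3 : ℕ) * h) ↔ CellQuiet ψ (cellCounts h τ) i j w := by
  refine forall_congr' fun a => forall_congr' fun _ => forall_congr' fun _ => forall_congr' fun _ => ?_
  exact hτ.clockCount_eq_zero_iff h0 a (Nat.le_add_right _ _)

theorem refreshed_iff {ψ : Multilinear n} {i j : Fin n} {V : Finset (Fin n)} {ρ w : ℕ} :
    Refreshed ψ τ i j V ((3 * (w - ρ) : ℕ) * h) ((3 * w : ℕ) * h)
      ↔ CellRefreshed ψ (cellCounts h τ) i j V ρ w := by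
  have e := fun a => hτ.clockCount_eq_zero_iff h0 a (p := 3 * (w - ρ)) (q := 3 * w) (by omega)
  exact ⟨fun ⟨h1, h2⟩ => ⟨fun s hs h => h1 s hs ((e s).2 h), fun a x y z => (e a).1 (h2 a x y z)⟩,
    fun ⟨h1, h2⟩ => ⟨fun s hs h => h1 s hs ((e s).1 h), fun a x y z => (e a).2 (h2 a x y z)⟩⟩

end RegularClock

theorem clockPattern_iff {n : ℕ} {τ : Fin n → ℕ → ℝ} {h : ℝ} {i j : Fin n} {w : ℕ} :
    ClockPattern τ i j ((3 * w : ℕ) * h) ((3 * w + 1 : ℕ) * h) ((3 * w + 2 : ℕ) * h)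
      ((3 * w + 3 : ℕ) * h) ↔ CellPattern (cellCounts h τ) i j w :=
  ⟨fun ⟨a, b, c, d, e, f⟩ => ⟨a, b, c, d, e, f⟩, fun ⟨a, b, c, d, e, f⟩ => ⟨a, b, c, d, e, f⟩⟩

/-! ### Independence of the cells -/

namespace IsGlauberDynamics

variable {Ω : Type*} [mΩ : MeasurableSpace Ω] {n : ℕ} {ψ : Multilinear n} {P : Measure Ω}
  [IsProbabilityMeasure P] {X : Ω → Trajectory n} (hX : IsGlauberDynamics ψ P X)
include hX

theorem iIndepFun_cellCounts {h : ℝ} (h0 : 0 ≤ h) :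
    iIndepFun (fun q ω => cellCounts h (X ω).time q) P :=
  hX.count_indep (fun c => c * h) (by simp) fun a b hab =>
    mul_le_mul_of_nonneg_right (by exact_mod_cast hab) h0

theorem hasLaw_cellCounts {h : ℝ} (h0 : 0 ≤ h) (q : Fin n × ℕ) :
    HasLaw (fun ω => cellCounts h (X ω).time q) (poissonMeasure h.toNNReal) P := by
  have := hX.count_law q.1 (q.2 * h) ((q.2 + 1 : ℕ) * h) (by positivity)
    (mul_le_mul_of_nonneg_right (by push_cast; linarith) h0)
  rwa [show ((q.2 + 1 : ℕ) : ℝ) * h - q.2 * h = h by push_cast; ring] at this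

theorem measurable_cellCounts (h : ℝ) (q : Fin n × ℕ) :
    Measurable fun ω => cellCounts h (X ω).time q := hX.measurable_count _ _ _

theorem coordInfo_le (h : ℝ) (S : Set (Fin n × ℕ)) :
    coordInfo (fun ω => cellCounts h (X ω).time) S ≤ mΩ :=
  iSup₂_le fun q _ => (hX.measurable_cellCounts h q).comap_le

theorem indep_coordInfo {h : ℝ} (h0 : 0 ≤ h) {S T : Set (Fin n × ℕ)} (hST : Disjoint S T) :
    Indep (coordInfo (fun ω => cellCounts h (X ω).time) S)
      (coordInfo (fun ω => cellCounts h (X ω).time) T) P :=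
  indep_iSup_of_disjoint (fun q => (hX.measurable_cellCounts h q).comap_le)
    (hX.iIndepFun_cellCounts h0) hST

end IsGlauberDynamics

theorem coordInfo_le_clockInfo {Ω : Type*} {n : ℕ} {X : Ω → Trajectory n} (h : ℝ)
    (S : Set (Fin n × ℕ)) : coordInfo (fun ω => cellCounts h (X ω).time) S ≤ clockInfo X :=
  iSup₂_le fun _ _ => Measurable.comap_le (m₁ := clockInfo X) (measurable_clockInfo_count _ _ _)

/-! ### Large deviations along the stops -/

open Classical in
theorem sum_hit_eq_min (pat : ℕ → Prop) (r M K : ℕ) :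
    (∑ ℓ ∈ Finset.range K, if Hit pat r ℓ ∧ (greedy pat r ℓ).2 < M then 1 else 0)
      = min M (greedy pat r K).2 := by
  induction K with
  | zero => simp [greedy]
  | succ K ih =>
    rw [Finset.sum_range_succ, ih]
    by_cases hH : Hit pat r K
    · rw [greedy_succ_of_hit hH]
      by_cases hM : (greedy pat r K).2 < M
      · rw [if_pos ⟨hH, hM⟩]; simp only; omega
      · rw [if_neg fun h => hM h.2]; simp only; omega
    · rw [greedy_succ_of_not_hit hH, if_neg fun h => hH h.1, add_zero]

/-- The pattern of the window at the end of the block of `r` windows that starts at `ℓ`. -/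
abbrev blockPattern {n : ℕ} (x : Fin n × ℕ → ℕ) (i j : Fin n) (r : ℕ) (ℓ : ℕ) : Prop :=
  CellPattern x i j (ℓ + r - 1)

/-- The greedy scan makes one of its first `M` stops at `ℓ`. -/
abbrev StopAt {n : ℕ} (x : Fin n × ℕ → ℕ) (i j : Fin n) (r M ℓ : ℕ) : Prop :=
  Hit (blockPattern x i j r) r ℓ ∧ (greedy (blockPattern x i j r) r ℓ).2 < M

theorem blockPattern_congr {n : ℕ} {x y : Fin n × ℕ → ℕ} {i j : Fin n} {r ℓ : ℕ} (hr : 1 ≤ r)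
    (h : ∀ a c, a = i ∨ a = j → c < 3 * (ℓ + r) → x (a, c) = y (a, c)) :
    blockPattern x i j r ℓ ↔ blockPattern y i j r ℓ :=
  CellPattern.congr fun a c ha _ hc => h a c ha (by omega)

/-- Stops are decided by the clocks of `i` and `j` alone, up to the end of the block. So a stop does
not bias the clocks of the other sites, on which quietness and refreshing depend. -/
theorem stopAt_congr {n : ℕ} {x y : Fin n × ℕ → ℕ} {i j : Fin n} {r M ℓ : ℕ} (hr : 1 ≤ r)
    (h : ∀ a c, a = i ∨ a = j → c < 3 * (ℓ + r) → x (a, c) = y (a, c)) :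
    StopAt x i j r M ℓ ↔ StopAt y i j r M ℓ := by
  have hp : ∀ ℓ' < ℓ + 1, blockPattern x i j r ℓ' ↔ blockPattern y i j r ℓ' := fun ℓ' hℓ' =>
    blockPattern_congr hr fun a c ha hc => h a c ha (by omega)
  rw [StopAt, StopAt, hit_congr hp (Nat.lt_succ_self ℓ),
    greedy_congr (K := ℓ) fun ℓ' hℓ' => hp ℓ' (by omega)]

namespace IsGlauberDynamics

variable {Ω : Type*} [mΩ : MeasurableSpace Ω] {n : ℕ} {ψ : Multilinear n} {P : Measure Ω}
  [IsProbabilityMeasure P] {X : Ω → Trajectory n} (hX : IsGlauberDynamics ψ P X)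
include hX

/-- With two rings in each interval, the four spins of the statistic have been chosen by time `t₃`,
so they agree with masked spins, which the history knows. -/
theorem measurable_windowStat_indicator {i : Fin n} {t₀ t₂ t₃ : ℝ} {a : Set Ω}
    (ha : MeasurableSet[clockInfo X] a) (f : ℝ → ℝ≥0∞)
    (h : ∀ ω ∈ a, RegularClock (X ω).time ∧ t₀ ≤ t₂ ∧ t₂ ≤ t₃ ∧ 2 ≤ (X ω).count i t₀ t₂ ∧
      2 ≤ (X ω).count i t₂ t₃) :
    Measurable[history X (fun _ => t₃)] (a.indicator fun ω => f (windowStat (X ω) i t₀ t₂)) := by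
  have hc : ∀ t (k : ℕ), Measurable[clockInfo X] fun ω => (X ω).count i 0 t + k := fun t k =>
    (@Measurable.of_discrete _ _ _ _ _ (fun m : ℕ => m + k)).comp (measurable_clockInfo_count i 0 t)
  set ms : Ω → Bool × Bool × Bool × Bool := fun ω =>
    (maskedSpin X (fun _ => t₃) i (fun ω => (X ω).count i 0 t₀ + 0) ω,
      maskedSpin X (fun _ => t₃) i (fun ω => (X ω).count i 0 t₀ + 1) ω,
      maskedSpin X (fun _ => t₃) i (fun ω => (X ω).count i 0 t₂ + 0) ω,
      maskedSpin X (fun _ => t₃) i (fun ω => (X ω).count i 0 t₂ + 1) ω) with hms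
  have hmm : Measurable[history X (fun _ => t₃)] ms :=
    (measurable_maskedSpin i (hc t₀ 0)).prodMk ((measurable_maskedSpin i (hc t₀ 1)).prodMk
      ((measurable_maskedSpin i (hc t₂ 0)).prodMk (measurable_maskedSpin i (hc t₂ 1))))
  have e : (a.indicator fun ω => f (windowStat (X ω) i t₀ t₂))
      = a.indicator fun ω => (fun z : Bool × Bool × Bool × Bool => f (zstat z.1 z.2.1 z.2.2.1 z.2.2.2)) (ms ω) := by
    funext ω
    by_cases hω : ω ∈ a
    · rw [Set.indicator_of_mem hω, Set.indicator_of_mem hω]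
      obtain ⟨hτ, h02, h23, h1, h2⟩ := h ω hω
      have a1 := hτ.clockCount_add i h02
      have a2 := hτ.clockCount_add i h23
      simp only [count_eq_clockCount] at h1 h2
      have hle : ∀ m, m < clockCount (X ω).time i 0 t₃ → (X ω).time i m ≤ t₃ := fun m hm =>
        (hτ.le_iff_lt_clockCount i t₃ m).2 hm
      simp only [hms, windowStat]
      rw [maskedSpin_eq, maskedSpin_eq, maskedSpin_eq, maskedSpin_eq]
      · rfl
      all_goals
        refine hle _ ?_
        simp only [count_eq_clockCount]
        omega
    · simp [hω]
  rw [e]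
  exact ((@Measurable.of_discrete _ _ _ _ _ (fun z : Bool × Bool × Bool × Bool =>
    f (zstat z.1 z.2.1 z.2.2.1 z.2.2.2))).comp hmm).indicator (clockInfo_le_history _ ha)

/-- A bound for the probability that the sum of the statistic over the first `M` stops deviates. -/
theorem measure_sum_windowStat_le {h : ℝ} (h0 : 0 ≤ h) {i j : Fin n} {r : ℕ} (hr : 1 ≤ r)
    {s v γ : ℝ} (hs : |s| ≤ 1) {G : ℕ → (Fin n × ℕ → ℕ) → ℝ} {C : ℝ} (hGC : ∀ ℓ x, G ℓ x ≤ C)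
    (hG : ∀ ℓ x y, (∀ a c, a ≠ i → a ≠ j → 3 * ℓ ≤ c → c < 3 * (ℓ + r) → x (a, c) = y (a, c)) →
      G ℓ x = G ℓ y)
    (hGle : ∀ ℓ, ∫⁻ ω, ENNReal.ofReal (G ℓ (cellCounts h (X ω).time)) ∂P ≤ 1)
    (hblock : ∀ ℓ (Φ : Ω → ℝ≥0∞), Measurable[history X (fun _ => (3 * ℓ : ℕ) * h)] Φ →
      ∫⁻ ω, Φ ω ∂P ≠ ⊤ →
      (∀ ω, Φ ω ≠ 0 → RegularClock (X ω).time ∧ ClockPattern (X ω).time i j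
        ((3 * (ℓ + r - 1) : ℕ) * h) ((3 * (ℓ + r - 1) + 1 : ℕ) * h)
        ((3 * (ℓ + r - 1) + 2 : ℕ) * h) ((3 * (ℓ + r - 1) + 3 : ℕ) * h)) →
      ∫⁻ ω, Φ ω * ENNReal.ofReal (Real.exp (γ - v) * Real.exp (s * windowStat (X ω) i
          ((3 * (ℓ + r - 1) : ℕ) * h) ((3 * (ℓ + r - 1) + 2 : ℕ) * h))) ∂P
        ≤ ∫⁻ ω, Φ ω * ENNReal.ofReal (G ℓ (cellCounts h (X ω).time)) ∂P) (M K : ℕ) :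
    open Classical in
    P {ω | M ≤ (greedy (blockPattern (cellCounts h (X ω).time) i j r) r K).2 ∧
        v * M ≤ s * ∑ ℓ ∈ Finset.range K, if StopAt (cellCounts h (X ω).time) i j r M ℓ then
          windowStat (X ω) i ((3 * (ℓ + r - 1) : ℕ) * h) ((3 * (ℓ + r - 1) + 2 : ℕ) * h) else 0}
      ≤ ENNReal.ofReal (Real.exp (-(γ * M))) := by
  classical
  set N : Ω → Fin n × ℕ → ℕ := fun ω => cellCounts h (X ω).time with hN
  set Z : ℕ → Ω → ℝ := fun ℓ ω =>
    windowStat (X ω) i ((3 * (ℓ + r - 1) : ℕ) * h) ((3 * (ℓ + r - 1) + 2 : ℕ) * h) with hZ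
  set f : ℕ → Ω → ℝ≥0∞ := fun ℓ ω => ENNReal.ofReal (Real.exp (γ - v) * Real.exp (s * Z ℓ ω)) with hf
  set g : ℕ → Ω → ℝ≥0∞ := fun ℓ ω => ENNReal.ofReal (G ℓ (N ω)) with hg
  set a : ℕ → Set Ω := fun ℓ => {ω | StopAt (N ω) i j r M ℓ} with ha
  set R : Set Ω := {ω | RegularClock (X ω).time} with hR
  -- Integrating out spins needs regular clocks, while independence needs an event determined by the
  -- counts. The two versions of the event differ by a null set.
  set a' : ℕ → Set Ω := fun ℓ => a ℓ ∩ R with ha'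
  -- `S₁` consists of all cells before the block and the cells of `i` and `j` up to its end: it
  -- decides the stop and the earlier factors. `S₂` consists of the cells of the other sites inside
  -- the block, on which the factor of the block depends.
  set S₁ : ℕ → Set (Fin n × ℕ) := fun ℓ =>
    {q | q.2 < 3 * ℓ ∨ ((q.1 = i ∨ q.1 = j) ∧ q.2 < 3 * (ℓ + r))} with hS₁
  set S₂ : ℕ → Set (Fin n × ℕ) := fun ℓ =>
    {q | q.1 ≠ i ∧ q.1 ≠ j ∧ 3 * ℓ ≤ q.2 ∧ q.2 < 3 * (ℓ + r)} with hS₂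
  have hmono : ∀ {p q : ℕ}, p ≤ q → (p : ℝ) * h ≤ q * h := fun hpq =>
    mul_le_mul_of_nonneg_right (by exact_mod_cast hpq) h0
  have hRm : MeasurableSet[clockInfo X] R :=
    (measurable_clockInfo_comp measurable_id) (measurableSet_regularClock n)
  have ham : ∀ ℓ ℓ', ℓ ≤ ℓ' → MeasurableSet[coordInfo N (S₁ ℓ')] (a ℓ) := fun ℓ ℓ' hℓ =>
    measurableSet_coordInfo N (3 * (ℓ + r)) fun x y hxy => stopAt_congr hr fun b c hb hc =>
      hxy (b, c) (.inr ⟨hb, by simp only; omega⟩) hc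
  have ham' : ∀ ℓ, MeasurableSet[clockInfo X] (a' ℓ) := fun ℓ =>
    (coordInfo_le_clockInfo h _ _ (ham ℓ ℓ le_rfl)).inter hRm
  have hgm₂ : ∀ ℓ, Measurable[coordInfo N (S₂ ℓ)] (g ℓ) := fun ℓ =>
    measurable_coordInfo N (3 * (ℓ + r)) (f := fun x => ENNReal.ofReal (G ℓ x)) fun x y hxy => by
      rw [hG ℓ x y fun b c hb hb' hc hc' => hxy (b, c) ⟨hb, hb', hc, hc'⟩ hc']
  have hgm₁ : ∀ ℓ ℓ', ℓ + r ≤ ℓ' → ℓ < ℓ' → Measurable[coordInfo N (S₁ ℓ')] (g ℓ) :=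
    fun ℓ ℓ' hℓ _ =>
    measurable_coordInfo N (3 * (ℓ + r)) (f := fun x => ENNReal.ofReal (G ℓ x)) fun x y hxy => by
      rw [hG ℓ x y fun b c hb hb' hc hc' => hxy (b, c) (.inl (by simp only; omega)) hc']
  have hsep : ∀ ω ℓ ℓ', ω ∈ a ℓ → ω ∈ a ℓ' → ℓ < ℓ' → ℓ + r ≤ ℓ' := fun ω ℓ ℓ' h1 h2 hlt =>
    Hit.add_le h1.1 h2.1 hlt
  have hpat : ∀ ℓ, ∀ ω ∈ a' ℓ, ClockPattern (X ω).time i j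
        ((3 * (ℓ + r - 1) : ℕ) * h) ((3 * (ℓ + r - 1) + 1 : ℕ) * h)
        ((3 * (ℓ + r - 1) + 2 : ℕ) * h) ((3 * (ℓ + r - 1) + 3 : ℕ) * h) := fun ℓ ω hω =>
    clockPattern_iff.2 hω.1.1.2
  have hZb : ∀ ℓ ω, |Z ℓ ω| ≤ 2 := fun ℓ ω => by
    have h1 := neg_two_le_zstat ((X ω).spin i ((X ω).count i 0 ((3 * (ℓ + r - 1) : ℕ) * h)))
      ((X ω).spin i ((X ω).count i 0 ((3 * (ℓ + r - 1) : ℕ) * h) + 1))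
      ((X ω).spin i ((X ω).count i 0 ((3 * (ℓ + r - 1) + 2 : ℕ) * h)))
      ((X ω).spin i ((X ω).count i 0 ((3 * (ℓ + r - 1) + 2 : ℕ) * h) + 1))
    have h2 := zstat_le_one ((X ω).spin i ((X ω).count i 0 ((3 * (ℓ + r - 1) : ℕ) * h)))
      ((X ω).spin i ((X ω).count i 0 ((3 * (ℓ + r - 1) : ℕ) * h) + 1))
      ((X ω).spin i ((X ω).count i 0 ((3 * (ℓ + r - 1) + 2 : ℕ) * h)))
      ((X ω).spin i ((X ω).count i 0 ((3 * (ℓ + r - 1) + 2 : ℕ) * h) + 1))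
    exact abs_le.2 ⟨h1, h2.trans (by norm_num)⟩
  have hfm : ∀ ℓ, Measurable[history X (fun _ => ((3 * (ℓ + r) : ℕ) : ℝ) * h)]
      ((a' ℓ).indicator (f ℓ)) := by
    intro ℓ
    have := hX.measurable_windowStat_indicator (i := i) (t₀ := (3 * (ℓ + r - 1) : ℕ) * h)
      (t₂ := (3 * (ℓ + r - 1) + 2 : ℕ) * h) (t₃ := (3 * (ℓ + r) : ℕ) * h) (ham' ℓ)
      (fun z => ENNReal.ofReal (Real.exp (γ - v) * Real.exp (s * z))) (fun ω hω => by
        refine ⟨hω.2, hmono (by omega), hmono (by omega), ?_, ?_⟩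
        · refine (hpat ℓ ω hω).first_i.trans ?_
          have e1 := hω.2.clockCount_add i (hmono (show 3 * (ℓ + r - 1) ≤ 3 * (ℓ + r - 1) + 1 by omega))
          have e2 := hω.2.clockCount_add i (hmono (show 3 * (ℓ + r - 1) ≤ 3 * (ℓ + r - 1) + 2 by omega))
          have e3 := hω.2.clockCount_mono i (hmono (show 3 * (ℓ + r - 1) + 1 ≤ 3 * (ℓ + r - 1) + 2 by omega))
          rw [count_eq_clockCount]
          omega
        · rw [show 3 * (ℓ + r) = 3 * (ℓ + r - 1) + 3 by omega]
          exact (hpat ℓ ω hω).third_i)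
    exact this
  -- the spins are integrated out, then the clocks
  set C' : ℝ := max (max 1 C) (Real.exp (γ - v) * Real.exp 2)
  have hC1 : (1 : ℝ≥0∞) ≤ ENNReal.ofReal C' := by
    rw [← ENNReal.ofReal_one]
    exact ENNReal.ofReal_le_ofReal ((le_max_left _ _).trans (le_max_left _ _))
  have hA := hX.lintegral_prod_stopWeight_le (a := a') (f := f) (g := g) (r := r)
    (t := fun ℓ => ((3 * ℓ : ℕ) : ℝ) * h) (fun p q hpq => hmono (by omega)) ham'
    (fun ℓ => (hgm₂ ℓ).mono (coordInfo_le_clockInfo h _) le_rfl)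
    hfm
    (C := ENNReal.ofReal C') hC1 ENNReal.ofReal_ne_top
    (fun ℓ ω => ENNReal.ofReal_le_ofReal (le_trans (mul_le_mul_of_nonneg_left
      (Real.exp_le_exp.2 (by
        have h1 := hZb ℓ ω
        have h2 : |s * Z ℓ ω| ≤ 1 * 2 := by
          rw [abs_mul]; exact mul_le_mul hs h1 (abs_nonneg _) zero_le_one
        linarith [le_abs_self (s * Z ℓ ω)])) (Real.exp_nonneg _)) (le_max_right _ _)))
    (fun ℓ ω => ENNReal.ofReal_le_ofReal ((hGC ℓ _).trans ((le_max_right _ _).trans (le_max_left _ _))))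
    (fun ω ℓ ℓ' h1 h2 => hsep ω ℓ ℓ' h1.1 h2.1)
    (fun ℓ Φ hΦ hfin hsupp => hblock ℓ Φ hΦ hfin fun ω hω =>
      ⟨(hsupp ω hω).2, hpat ℓ ω (hsupp ω hω)⟩) K (fun _ => 1)
    (@measurable_const _ _ _ (clockInfo X) 1) ⟨1, ENNReal.one_ne_top, fun _ => le_rfl⟩
  have hB := lintegral_prod_stopWeight_le_one (P := P) (a := a) (g := g) (r := r) hsep
    (fun ℓ => coordInfo N (S₁ ℓ)) (fun ℓ => coordInfo N (S₂ ℓ))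
    (fun ℓ => hX.coordInfo_le h _) (fun ℓ => hX.coordInfo_le h _)
    (fun ℓ => hX.indep_coordInfo h0 (Set.disjoint_left.2 fun q h1 h2 => by
      simp only [hS₁, hS₂, Set.mem_ofPred_eq] at h1 h2
      rcases h1 with h1 | ⟨h1 | h1, -⟩
      · omega
      · exact h2.1 h1
      · exact h2.2.1 h1)) ham hgm₁ hgm₂ hGle K
  have hreg : ∀ᵐ ω ∂P, ω ∈ R := hX.ae_regularClock
  have hsw : ∀ (f : Ω → ℝ≥0∞) ℓ ω, ω ∈ R → stopWeight (a' ℓ) f ω = stopWeight (a ℓ) f ω := by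
    intro f ℓ ω hω
    by_cases h1 : ω ∈ a ℓ
    · rw [stopWeight_of_mem h1, stopWeight_of_mem (show ω ∈ a' ℓ from ⟨h1, hω⟩)]
    · rw [stopWeight_of_notMem h1, stopWeight_of_notMem fun h2 => h1 h2.1]
  have hfin : ∫⁻ ω, ∏ ℓ ∈ Finset.range K, stopWeight (a ℓ) (f ℓ) ω ∂P ≤ 1 := by
    refine le_trans (le_of_eq ?_) (hA.trans (le_of_eq_of_le ?_ hB))
    · refine lintegral_congr_ae ?_
      filter_upwards [hreg] with ω hω
      rw [one_mul]
      exact Finset.prod_congr rfl fun ℓ _ => (hsw _ ℓ ω hω).symm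
    · refine lintegral_congr_ae ?_
      filter_upwards [hreg] with ω hω
      rw [one_mul]
      exact Finset.prod_congr rfl fun ℓ _ => hsw _ ℓ ω hω
  -- Markov's inequality
  have haem : AEMeasurable (fun ω => ∏ ℓ ∈ Finset.range K, stopWeight (a ℓ) (f ℓ) ω) P := by
    have h1 : Measurable fun ω => ∏ ℓ ∈ Finset.range K, stopWeight (a' ℓ) (f ℓ) ω :=
      Finset.measurable_fun_prod _ fun ℓ _ => measurable_stopWeight (hX.clockInfo_le _ (ham' ℓ))
        ((hfm ℓ).mono (hX.history_le (@measurable_const _ _ _ (clockInfo X) _)) le_rfl)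
    refine h1.aemeasurable.congr ?_
    filter_upwards [hreg] with ω hω
    exact Finset.prod_congr rfl fun ℓ _ => hsw _ ℓ ω hω
  have hprod : ∀ ω, ∏ ℓ ∈ Finset.range K, stopWeight (a ℓ) (f ℓ) ω = ENNReal.ofReal (Real.exp
      ((γ - v) * ((min M (greedy (blockPattern (N ω) i j r) r K).2 : ℕ) : ℝ)
        + s * ∑ ℓ ∈ Finset.range K, if StopAt (N ω) i j r M ℓ then Z ℓ ω else 0)) := by
    intro ω
    have e : ∀ ℓ, stopWeight (a ℓ) (f ℓ) ω = ENNReal.ofReal (Real.exp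
        ((γ - v) * (((if StopAt (N ω) i j r M ℓ then 1 else 0 : ℕ)) : ℝ)
          + s * (if StopAt (N ω) i j r M ℓ then Z ℓ ω else 0))) := by
      intro ℓ
      by_cases h1 : StopAt (N ω) i j r M ℓ
      · rw [stopWeight_of_mem (show ω ∈ a ℓ from h1), if_pos h1, if_pos h1]
        simp only [hf, ← Real.exp_add, Nat.cast_one, mul_one]
      · rw [stopWeight_of_notMem (show ω ∉ a ℓ from h1), if_neg h1, if_neg h1]
        simp
    rw [Finset.prod_congr rfl fun ℓ _ => e ℓ, ← ENNReal.ofReal_prod_of_nonneg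
      (fun _ _ => Real.exp_nonneg _), ← Real.exp_sum, Finset.sum_add_distrib, ← Finset.mul_sum,
      ← Finset.mul_sum, ← Nat.cast_sum, sum_hit_eq_min]
  have hmk : ∀ ω ∈ {ω | M ≤ (greedy (blockPattern (N ω) i j r) r K).2 ∧
        v * M ≤ s * ∑ ℓ ∈ Finset.range K, if StopAt (N ω) i j r M ℓ then Z ℓ ω else 0},
      ENNReal.ofReal (Real.exp (γ * M)) ≤ ∏ ℓ ∈ Finset.range K, stopWeight (a ℓ) (f ℓ) ω := by
    rintro ω ⟨h1, h2⟩
    rw [hprod, min_eq_left h1]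
    exact ENNReal.ofReal_le_ofReal (Real.exp_le_exp.2 (by linarith))
  have hpos : ENNReal.ofReal (Real.exp (γ * M)) ≠ 0 := by
    simp [Real.exp_pos]
  calc P _ ≤ P {ω | ENNReal.ofReal (Real.exp (γ * M))
          ≤ ∏ ℓ ∈ Finset.range K, stopWeight (a ℓ) (f ℓ) ω} := measure_mono hmk
    _ ≤ (∫⁻ ω, ∏ ℓ ∈ Finset.range K, stopWeight (a ℓ) (f ℓ) ω ∂P) / ENNReal.ofReal (Real.exp (γ * M)) :=
      meas_ge_le_lintegral_div haem hpos ENNReal.ofReal_ne_top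
    _ ≤ 1 / ENNReal.ofReal (Real.exp (γ * M)) := ENNReal.div_le_div_right hfin _
    _ = _ := by
      rw [one_div, ← ENNReal.ofReal_inv_of_pos (Real.exp_pos _), Real.exp_neg]

end IsGlauberDynamics

/-! ### Probabilities of clock events -/

theorem lintegral_ofReal_le_one {Ω : Type*} [MeasurableSpace Ω] {P : Measure Ω}
    {f : Ω → ℝ} (hf : Integrable f P) (h0 : ∀ ω, 0 ≤ f ω) (h1 : ∫ ω, f ω ∂P ≤ 1) :
    ∫⁻ ω, ENNReal.ofReal (f ω) ∂P ≤ 1 := by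
  rw [← ofReal_integral_eq_lintegral_ofReal hf (ae_of_all _ h0), ← ENNReal.ofReal_one]
  exact ENNReal.ofReal_le_ofReal h1

theorem greedy_blockPattern_congr {n : ℕ} {x y : Fin n × ℕ → ℕ} {i j : Fin n} {r ℓ : ℕ} (hr : 1 ≤ r)
    (h : ∀ a c, c < 3 * (ℓ + r - 1) → x (a, c) = y (a, c)) :
    greedy (blockPattern x i j r) r ℓ = greedy (blockPattern y i j r) r ℓ :=
  greedy_congr fun _ h' => blockPattern_congr hr fun a c _ hc => h a c (by omega)

namespace IsGlauberDynamics

variable {Ω : Type*} [mΩ : MeasurableSpace Ω] {n : ℕ} {ψ : Multilinear n} {P : Measure Ω}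
  [IsProbabilityMeasure P] {X : Ω → Trajectory n} (hX : IsGlauberDynamics ψ P X)
include hX

theorem measurableSet_cells (h : ℝ) {p : (Fin n × ℕ → ℕ) → Prop} (B : ℕ)
    (hp : ∀ x y, (∀ a c, c < B → x (a, c) = y (a, c)) → (p x ↔ p y)) :
    MeasurableSet {ω | p (cellCounts h (X ω).time)} :=
  hX.coordInfo_le h Set.univ _ (measurableSet_coordInfo (fun ω => cellCounts h (X ω).time) B
    fun x y hxy => hp x y fun a c hc => hxy (a, c) trivial hc)

/-- Six independent Poisson counts: two of them contribute at least e^{-h}h²/2 each, one contributes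
at least he^{-h}, and three contribute e^{-h} each. -/
theorem measure_cellPattern_ge {h : ℝ} (h0 : 0 ≤ h) {i j : Fin n} (hij : i ≠ j) (w : ℕ) :
    ENNReal.ofReal (h ^ 5 * Real.exp (-6 * h) / 4)
      ≤ P {ω | CellPattern (cellCounts h (X ω).time) i j w} := by
  classical
  set U : Fin n × ℕ → Set ℕ := fun q =>
    if q.1 = i then (if q.2 = 3 * w + 1 then {0} else {m | 2 ≤ m})
      else (if q.2 = 3 * w + 1 then {m | 1 ≤ m} else {0}) with hU
  set F : Finset (Fin n × ℕ) := {i, j} ×ˢ {3 * w, 3 * w + 1, 3 * w + 2} with hF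
  have hsub : (⋂ q ∈ F, (fun ω => cellCounts h (X ω).time q) ⁻¹' U q)
      ⊆ {ω | CellPattern (cellCounts h (X ω).time) i j w} := by
    intro ω hω
    simp only [Set.mem_iInter, Set.mem_preimage] at hω
    have e := fun (a : Fin n) (c : ℕ) (ha : a = i ∨ a = j)
      (hc : c = 3 * w ∨ c = 3 * w + 1 ∨ c = 3 * w + 2) => hω (a, c) (by simp [hF, ha, hc])
    have hji : j ≠ i := hij.symm
    refine ⟨?_, ?_, ?_, ?_, ?_, ?_⟩
    · simpa [hU] using e i (3 * w) (.inl rfl) (.inl rfl)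
    · simpa [hU, hji] using e j (3 * w) (.inr rfl) (.inl rfl)
    · simpa [hU] using e i (3 * w + 1) (.inl rfl) (.inr (.inl rfl))
    · simpa [hU, hji] using e j (3 * w + 1) (.inr rfl) (.inr (.inl rfl))
    · simpa [hU] using e i (3 * w + 2) (.inl rfl) (.inr (.inr rfl))
    · simpa [hU, hji] using e j (3 * w + 2) (.inr rfl) (.inr (.inr rfl))
  refine le_trans ?_ (measure_mono hsub)
  rw [(hX.iIndepFun_cellCounts h0).measure_inter_preimage_eq_mul F (fun _ _ => .of_discrete)]
  set e := Real.exp (-h) with he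
  have e0 : 0 < e := Real.exp_pos _
  have e1 : e ≤ 1 := Real.exp_le_one_iff.2 (by linarith)
  have law : ∀ q (s : Set ℕ), P ((fun ω => cellCounts h (X ω).time q) ⁻¹' s)
      = poissonMeasure h.toNNReal s := fun q s =>
    (hX.hasLaw_cellCounts h0 q).measure_eq (p := fun m => m ∈ s) .of_discrete
  have l0 := fun q => (law q {0}).trans (poissonMeasure_zero_set h h0)
  have l1 : ∀ q, ENNReal.ofReal (h * e) ≤ P ((fun ω => cellCounts h (X ω).time q) ⁻¹' {m | 1 ≤ m}) := by
    intro q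
    rw [law, poissonMeasure_pos_set h h0]
    refine ENNReal.ofReal_le_ofReal ?_
    have h1 := Real.add_one_le_exp h
    have h2 : e * Real.exp h = 1 := by rw [he, ← Real.exp_add]; simp
    nlinarith
  have l2 : ∀ q, ENNReal.ofReal (e * h ^ 2 / 2)
      ≤ P ((fun ω => cellCounts h (X ω).time q) ⁻¹' {m | 2 ≤ m}) := fun q => by
    rw [law]; exact poissonMeasure_two_le_set h h0
  rw [hF, Finset.prod_product, Finset.prod_pair hij]
  have h3 : (3 * w) ∉ ({3 * w + 1, 3 * w + 2} : Finset ℕ) := by simp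
  simp only [Finset.prod_insert h3, Finset.prod_pair (show 3 * w + 1 ≠ 3 * w + 2 by omega)]
  have u1 : U (i, 3 * w) = {m | 2 ≤ m} := by simp [hU]
  have u2 : U (i, 3 * w + 1) = {0} := by simp [hU]
  have u3 : U (i, 3 * w + 2) = {m | 2 ≤ m} := by simp [hU]
  have u4 : U (j, 3 * w) = {0} := by simp [hU, hij.symm]
  have u5 : U (j, 3 * w + 1) = {m | 1 ≤ m} := by simp [hU, hij.symm]
  have u6 : U (j, 3 * w + 2) = {0} := by simp [hU, hij.symm]
  rw [u1, u2, u3, u4, u5, u6, l0, l0, l0]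
  refine le_trans ?_ (mul_le_mul' (mul_le_mul' (l2 _) (mul_le_mul' le_rfl (l2 _)))
    (mul_le_mul' le_rfl (mul_le_mul' (l1 _) le_rfl)))
  rw [← ENNReal.ofReal_mul (by positivity), ← ENNReal.ofReal_mul (by positivity),
    ← ENNReal.ofReal_mul (by positivity), ← ENNReal.ofReal_mul (by positivity),
    ← ENNReal.ofReal_mul (by positivity)]
  refine ENNReal.ofReal_le_ofReal (le_of_eq ?_)
  rw [show Real.exp (-6 * h) = e ^ 6 by rw [he, ← Real.exp_nat_mul]; congr 1; push_cast; ring]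
  ring

/-- With high probability there are at least `M` stops. -/
theorem measure_stops_lt_le {h : ℝ} (h0 : 0 ≤ h) {i j : Fin n} {r M K : ℕ} (hr : 1 ≤ r)
    {b : ℝ} (hb : 0 ≤ b)
    (hp : ∀ w, ENNReal.ofReal (2 * b) ≤ P {ω | CellPattern (cellCounts h (X ω).time) i j w}) :
    P {ω | (greedy (blockPattern (cellCounts h (X ω).time) i j r) r K).2 < M}
      ≤ ENNReal.ofReal (Real.exp (M - b * ((K : ℝ) - r * M))) := by
  classical
  set N : Ω → Fin n × ℕ → ℕ := fun ω => cellCounts h (X ω).time with hN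
  set a : ℕ → Set Ω := fun ℓ => {ω | (greedy (blockPattern (N ω) i j r) r ℓ).1 ≤ ℓ} with ha
  set c₀ : ℝ := 1 - Real.exp (-1) with hc₀
  have hc₁ : 1 / 2 ≤ c₀ := by
    have h1 := Real.exp_neg 1
    have h2 : (2 : ℝ) ≤ Real.exp 1 := by linarith [Real.add_one_le_exp (1 : ℝ)]
    have h3 : Real.exp (-1) ≤ 1 / 2 := by
      rw [h1, one_div]; exact inv_anti₀ (by norm_num) h2
    linarith
  -- With success probability p ≥ 2b, this weight has mean e^b(1 - c₀p) ≤ e^b(1 - b) ≤ 1. That is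
  -- the reason for asking c₀ ≥ 1/2.
  set G : ℕ → (Fin n × ℕ → ℕ) → ℝ := fun ℓ x =>
    Real.exp (b - if blockPattern x i j r ℓ then 1 else 0) with hG
  set g : ℕ → Ω → ℝ≥0∞ := fun ℓ ω => ENNReal.ofReal (G ℓ (N ω)) with hg
  set S₁ : ℕ → Set (Fin n × ℕ) := fun ℓ => {q | q.2 < 3 * (ℓ + r - 1)} with hS₁
  set S₂ : ℕ → Set (Fin n × ℕ) := fun ℓ => {q | 3 * (ℓ + r - 1) ≤ q.2} with hS₂
  have hgcongr : ∀ ℓ (x y : Fin n × ℕ → ℕ), (∀ a c, 3 * (ℓ + r - 1) ≤ c → c < 3 * (ℓ + r) →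
      x (a, c) = y (a, c)) → ENNReal.ofReal (G ℓ x) = ENNReal.ofReal (G ℓ y) := by
    intro ℓ x y hxy
    have : blockPattern x i j r ℓ ↔ blockPattern y i j r ℓ :=
      CellPattern.congr fun a c _ h1 h2 => hxy a c h1 (by omega)
    simp only [hG, this]
  have hpm : ∀ ℓ, MeasurableSet {ω | blockPattern (N ω) i j r ℓ} := fun ℓ =>
    hX.measurableSet_cells h (3 * (ℓ + r)) fun x y hxy => blockPattern_congr hr fun a c _ hc => hxy a c hc
  -- Here `a ℓ` is the event that the scan makes an attempt at `ℓ`. It is decided by earlier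
  -- windows, and different attempts look at different windows, so separation by one index is
  -- enough.
  have hB := lintegral_prod_stopWeight_le_one (P := P) (a := a) (g := g) (r := 1)
    (fun ω ℓ ℓ' _ _ hlt => hlt)
    (fun ℓ => coordInfo N (S₁ ℓ)) (fun ℓ => coordInfo N (S₂ ℓ))
    (fun ℓ => hX.coordInfo_le h _) (fun ℓ => hX.coordInfo_le h _)
    (fun ℓ => hX.indep_coordInfo h0 (Set.disjoint_left.2 fun q h1 h2 => by
      simp only [hS₁, hS₂, Set.mem_ofPred_eq] at h1 h2
      omega))
    (fun ℓ ℓ' hℓ => measurableSet_coordInfo N (3 * (ℓ + r - 1))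
      (p := fun x => (greedy (blockPattern x i j r) r ℓ).1 ≤ ℓ) fun x y hxy => by
        rw [greedy_blockPattern_congr hr fun a c hc =>
          hxy (a, c) (by simp only [hS₁, Set.mem_ofPred_eq]; omega) hc])
    (fun ℓ ℓ' hℓ _ => measurable_coordInfo N (3 * (ℓ + r)) (f := fun x => ENNReal.ofReal (G ℓ x))
      fun x y hxy => hgcongr ℓ x y fun a c _ hc =>
        hxy (a, c) (by simp only [hS₁, Set.mem_ofPred_eq]; omega) hc)
    (fun ℓ => measurable_coordInfo N (3 * (ℓ + r)) (f := fun x => ENNReal.ofReal (G ℓ x))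
      fun x y hxy => hgcongr ℓ x y fun a c h1 hc => hxy (a, c) h1 hc)
    (fun ℓ => by
      have e : ∀ ω, G ℓ (N ω) = Real.exp b - Real.exp b * c₀ *
          {ω | blockPattern (N ω) i j r ℓ}.indicator 1 ω := by
        intro ω
        by_cases h1 : blockPattern (N ω) i j r ℓ
        · rw [Set.indicator_of_mem (show ω ∈ {ω | blockPattern (N ω) i j r ℓ} from h1)]
          simp only [hG, if_pos h1, hc₀, Pi.one_apply]
          rw [Real.exp_sub, Real.exp_neg]; ring
        · rw [Set.indicator_of_notMem (show ω ∉ {ω | blockPattern (N ω) i j r ℓ} from h1)]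
          simp only [hG, if_neg h1]; simp
      have hint : Integrable (fun ω => Real.exp b * c₀ *
          {ω | blockPattern (N ω) i j r ℓ}.indicator (1 : Ω → ℝ) ω) P :=
        ((integrable_const (1 : ℝ)).indicator (hpm ℓ)).const_mul _
      refine lintegral_ofReal_le_one ?_ (fun ω => Real.exp_nonneg _) ?_
      · simp only [e]
        exact (integrable_const _).sub hint
      · simp only [e]
        rw [integral_sub (integrable_const _) hint, integral_const_mul, integral_indicator_one (hpm ℓ)]
        simp only [integral_const, probReal_univ, one_smul]
        have h1 : 2 * b ≤ P.real {ω | blockPattern (N ω) i j r ℓ} :=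
          (ENNReal.ofReal_le_iff_le_toReal (measure_ne_top _ _)).1 (hp _)
        have h2 : Real.exp b * (1 - b) ≤ 1 := by
          have h3 : 1 - b ≤ Real.exp (-b) := Real.one_sub_le_exp_neg b
          calc Real.exp b * (1 - b) ≤ Real.exp b * Real.exp (-b) :=
                mul_le_mul_of_nonneg_left h3 (Real.exp_nonneg _)
            _ = 1 := by rw [← Real.exp_add]; simp
        have h4 : b ≤ c₀ * P.real {ω | blockPattern (N ω) i j r ℓ} := by nlinarith
        nlinarith [mul_le_mul_of_nonneg_left h4 (Real.exp_nonneg b)]) K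
  have hprod : ∀ ω, ∏ ℓ ∈ Finset.range K, stopWeight (a ℓ) (g ℓ) ω = ENNReal.ofReal (Real.exp
      (b * (((Finset.range K).filter fun ℓ => (greedy (blockPattern (N ω) i j r) r ℓ).1 ≤ ℓ).card : ℝ)
        - ((greedy (blockPattern (N ω) i j r) r K).2 : ℝ))) := by
    intro ω
    clear hB
    induction K with
    | zero => simp [greedy]
    | succ K ih =>
      rw [Finset.prod_range_succ, ih, Finset.range_add_one, Finset.filter_insert]
      have hnm : K ∉ (Finset.range K).filter fun ℓ => (greedy (blockPattern (N ω) i j r) r ℓ).1 ≤ ℓ := by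
        simp
      by_cases h1 : (greedy (blockPattern (N ω) i j r) r K).1 ≤ K
      · rw [stopWeight_of_mem (show ω ∈ a K from h1), if_pos h1, Finset.card_insert_of_notMem hnm,
          ← ENNReal.ofReal_mul (Real.exp_nonneg _), ← Real.exp_add]
        by_cases h2 : blockPattern (N ω) i j r K
        · rw [greedy_succ_of_hit ⟨h1, h2⟩, if_pos h2]
          push_cast
          congr 2; ring
        · rw [greedy_succ_of_not_hit fun h => h2 h.2, if_neg h2]
          push_cast
          congr 2; ring
      · rw [stopWeight_of_notMem (show ω ∉ a K from h1), if_neg h1, mul_one,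
          greedy_succ_of_not_hit fun h => h1 h.1]
  set z := b * ((K : ℝ) - r * M) - M with hz
  have hsub : {ω | (greedy (blockPattern (N ω) i j r) r K).2 < M}
      ⊆ {ω | ENNReal.ofReal (Real.exp z) ≤ ∏ ℓ ∈ Finset.range K, stopWeight (a ℓ) (g ℓ) ω} := by
    intro ω hω
    show ENNReal.ofReal (Real.exp z) ≤ _
    rw [hprod]
    refine ENNReal.ofReal_le_ofReal (Real.exp_le_exp.2 ?_)
    have h1 := card_attempts (pat := blockPattern (N ω) i j r) hr K
    set A := ((Finset.range K).filter fun ℓ => (greedy (blockPattern (N ω) i j r) r ℓ).1 ≤ ℓ).card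
    set cn := (greedy (blockPattern (N ω) i j r) r K).2 with hcn
    have h2 : cn + 1 ≤ M := hω
    -- With fewer than `M` stops, at most `r * M` indices are not attempts, counting the initial
    -- `r`.
    have h3 : K ≤ A + r * M := by
      have h4 : K ≤ A + r + (r - 1) * cn := h1 ▸ le_max_left _ _
      have h5 : (r - 1) * cn ≤ r * cn := Nat.mul_le_mul_right _ (by omega)
      have h6 : r * (cn + 1) ≤ r * M := Nat.mul_le_mul_left _ h2
      rw [mul_add, mul_one] at h6
      omega
    have h7 : (K : ℝ) - r * M ≤ A := by
      have : (K : ℝ) ≤ A + r * M := by exact_mod_cast h3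
      linarith
    have h8 : (cn : ℝ) ≤ M := by exact_mod_cast (by omega : cn ≤ M)
    have := mul_le_mul_of_nonneg_left h7 hb
    linarith
  have haem : AEMeasurable (fun ω => ∏ ℓ ∈ Finset.range K, stopWeight (a ℓ) (g ℓ) ω) P := by
    refine Measurable.aemeasurable (Finset.measurable_fun_prod _ fun ℓ _ => ?_)
    have h1 : MeasurableSet (a ℓ) := hX.measurableSet_cells h
      (p := fun x => (greedy (blockPattern x i j r) r ℓ).1 ≤ ℓ) (3 * (ℓ + r - 1)) fun x y hxy => by
        rw [greedy_blockPattern_congr hr hxy]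
    refine measurable_stopWeight h1 (Measurable.indicator ?_ h1)
    exact (measurable_coordInfo N (S := Set.univ) (3 * (ℓ + r)) (f := fun x => ENNReal.ofReal (G ℓ x))
      fun x y hxy => hgcongr ℓ x y fun a c _ hc => hxy (a, c) trivial hc).mono
        (hX.coordInfo_le h _) le_rfl
  calc P _ ≤ _ := measure_mono hsub
    _ ≤ _ := meas_ge_le_lintegral_div haem (by simp [Real.exp_pos]) ENNReal.ofReal_ne_top
    _ ≤ 1 / ENNReal.ofReal (Real.exp z) := ENNReal.div_le_div_right hB _
    _ = _ := by
      rw [one_div, ← ENNReal.ofReal_inv_of_pos (Real.exp_pos _), ← Real.exp_neg, hz, neg_sub]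

end IsGlauberDynamics

/-! ### The parameters of the algorithm -/

section Parameters

variable {k d : ℕ} {α lam : ℝ} (hd : 1 ≤ d) (hα : 0 < α) (hαl : α ≤ lam)
include hd hα hαl

theorem exp_div_le_half : Real.exp (-2 * lam) / (2 * d) ≤ 1 / 2 := by
  have hd' : (1 : ℝ) ≤ d := by exact_mod_cast hd
  have h1 : Real.exp (-2 * lam) ≤ 1 := Real.exp_le_one_iff.2 (by linarith)
  rw [div_le_div_iff₀ (by positivity) (by norm_num)]
  linarith

theorem qBurn_pos : 0 < qBurn k d lam := by
  have hd' : (0 : ℝ) < d := by exact_mod_cast hd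
  unfold qBurn; positivity

theorem qBurn_le : qBurn k d lam ≤ 1 / 2 * (1 / 2) ^ (k - 2) := by
  unfold qBurn
  have := pow_le_pow_left₀ (by positivity) (exp_div_le_half hd hα hαl) (k - 2)
  linarith

theorem sq_mul_exp_le_two : α ^ 2 * Real.exp (-6 * lam) ≤ 2 := by
  have := sq_mul_exp_le_one hα.le hαl
  linarith

theorem window_pos : 0 < window k d α lam := by
  have := qBurn_pos (k := k) hd hα hαl
  have hd' : (0 : ℝ) < d := by exact_mod_cast hd
  unfold window; positivity

theorem window_mul_le : window k d α lam * d ≤ (1 / 2) ^ (k - 2) / 64 := by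
  have hd' : (0 : ℝ) < d := by exact_mod_cast hd
  have e : window k d α lam * d = (α ^ 2 * Real.exp (-6 * lam)) * qBurn k d lam / 64 := by
    unfold window; field_simp
  have h1 := sq_mul_exp_le_two hd hα hαl
  have h2 := qBurn_le (k := k) hd hα hαl
  have h3 := qBurn_pos (k := k) hd hα hαl
  rw [e]
  have : (α ^ 2 * Real.exp (-6 * lam)) * qBurn k d lam ≤ 2 * (1 / 2 * (1 / 2) ^ (k - 2)) :=
    mul_le_mul h1 h2 h3.le (by norm_num)
  linarith

theorem window_le : window k d α lam ≤ (1 / 2) ^ (k - 2) / 64 := by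
  have hd' : (1 : ℝ) ≤ d := by exact_mod_cast hd
  have h1 := window_mul_le (k := k) hd hα hαl
  have h2 := window_pos (k := k) hd hα hαl
  nlinarith

theorem window_le' : window k d α lam ≤ 1 / 64 := by
  have h1 := window_le (k := k) hd hα hαl
  have : (1 / 2 : ℝ) ^ (k - 2) ≤ 1 := pow_le_one₀ (by norm_num) (by norm_num)
  linarith

/-- This relation ties the bias to the threshold: at most 2d clocks must be silent during a window
of length L, which fails with probability at most 2dL = 2κ/5. -/
theorem threshold_eq : threshold k d α lam = 5 * (d * window k d α lam) := by
  have hd' : (0 : ℝ) < d := by exact_mod_cast hd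
  unfold threshold window; field_simp

theorem threshold_pos : 0 < threshold k d α lam := by
  have h2 := window_pos (k := k) hd hα hαl
  have hd' : (0 : ℝ) < d := by exact_mod_cast hd
  rw [threshold_eq hd hα hαl]; positivity

theorem threshold_le : threshold k d α lam ≤ 5 / 64 := by
  have h1 := window_mul_le (k := k) hd hα hαl
  have : (1 / 2 : ℝ) ^ (k - 2) ≤ 1 := pow_le_one₀ (by norm_num) (by norm_num)
  rw [threshold_eq hd hα hαl]; linarith

theorem qGood_pos : 0 < qGood k d α lam := by
  have h2 := window_pos (k := k) hd hα hαl
  unfold qGood; positivity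

theorem log_blockLength_pos : Real.log 2 ≤ Real.log (2 * max 1 (2 * ((k : ℝ) - 2))) :=
  Real.log_le_log (by norm_num) (by linarith [le_max_left (1 : ℝ) (2 * ((k : ℝ) - 2))])

theorem one_le_blockLength : 1 ≤ blockLength k d α lam := by
  have h1 := window_pos (k := k) hd hα hαl
  have h2 := (Real.log_pos (by norm_num : (1 : ℝ) < 2)).trans_le (log_blockLength_pos (k := k) hd hα hαl)
  exact Nat.one_le_iff_ne_zero.2 (Nat.ceil_pos.2 (div_pos h2 h1)).ne'

/-- The block length is of order k / L at most, and L decays like 2^{-k}, so kL ≤ 1 and the power L⁵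
in q' leaves ample room. The bound absorbs the loss of one block at the end of the trajectory. -/
theorem qGood_mul_blockLength_le (hk : 2 ≤ k) : qGood k d α lam * blockLength k d α lam ≤ 1 := by
  have h1 := window_pos (k := k) hd hα hαl
  have h2 := window_le (k := k) hd hα hαl
  have h2' := window_le' (k := k) hd hα hαl
  set L := window k d α lam
  have hk' : (2 : ℝ) ≤ k := by exact_mod_cast hk
  set y := 2 * max 1 (2 * ((k : ℝ) - 2)) with hy
  have hy0 : 0 < y := by positivity
  have h3 : Real.log y ≤ 2 * k := by
    have h5 : y ≤ 2 * k + 2 * k := by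
      rw [hy]
      rcases max_cases (1 : ℝ) (2 * ((k : ℝ) - 2)) with h | h <;> rw [h.1] <;> linarith
    have h4 := Real.log_le_sub_one_of_pos (half_pos hy0)
    have h6 : Real.log y = Real.log 2 + Real.log (y / 2) := by
      rw [← Real.log_mul (by norm_num) (half_pos hy0).ne']; congr 1; ring
    have h7 : Real.log 2 ≤ 2 - 1 := Real.log_le_sub_one_of_pos (by norm_num)
    linarith
  have h4 : (blockLength k d α lam : ℝ) ≤ 2 * k / L + 1 := by
    have h0 : 0 ≤ Real.log y / L := by
      have := (Real.log_nonneg (by norm_num : (1 : ℝ) ≤ 2)).trans (log_blockLength_pos (k := k) hd hα hαl)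
      positivity
    have h5 := (Nat.ceil_lt_add_one h0).le
    have h6 : Real.log y / L ≤ 2 * k / L := div_le_div_of_nonneg_right h3 h1.le
    unfold blockLength
    linarith
  have h5 : (k : ℝ) * L ≤ 1 := by
    have h6 : (k : ℝ) ≤ 4 * 2 ^ (k - 2) := by
      have h7 : k < 2 ^ k := Nat.lt_two_pow_self
      have h8 : 2 ^ k = 4 * 2 ^ (k - 2) := by
        rw [show (4 : ℕ) = 2 ^ 2 by norm_num, ← pow_add]; congr 1; omega
      exact_mod_cast (h8 ▸ h7).le
    have h9 : (1 / 2 : ℝ) ^ (k - 2) * 2 ^ (k - 2) = 1 := by rw [← mul_pow]; norm_num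
    have h10 : (0 : ℝ) < 2 ^ (k - 2) := by positivity
    calc (k : ℝ) * L ≤ 4 * 2 ^ (k - 2) * ((1 / 2) ^ (k - 2) / 64) :=
          mul_le_mul h6 h2 h1.le (by positivity)
      _ = 4 / 64 * ((1 / 2 : ℝ) ^ (k - 2) * 2 ^ (k - 2)) := by ring
      _ ≤ 1 := by rw [h9]; norm_num
  have h11 : qGood k d α lam * blockLength k d α lam ≤ L ^ 5 / 6 ^ 5 * (2 * k / L + 1) :=
    mul_le_mul_of_nonneg_left h4 (qGood_pos (k := k) hd hα hαl).le
  refine h11.trans ?_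
  have e : L ^ 5 / 6 ^ 5 * (2 * k / L + 1) = L ^ 3 / 6 ^ 5 * (2 * (k * L)) + L ^ 5 / 6 ^ 5 := by
    field_simp
  rw [e]
  have h12 : L ^ 3 ≤ 1 := pow_le_one₀ h1.le (by linarith)
  have h13 : L ^ 5 ≤ 1 := pow_le_one₀ h1.le (by linarith)
  have h14 : L ^ 3 * (k * L) ≤ 1 * 1 := mul_le_mul h12 h5 (by positivity) zero_le_one
  norm_num at h14 ⊢
  nlinarith

/-- Because 6⁵ = 32 · 3⁵, the claim amounts to e^{-2L} ≥ 1/4. -/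
theorem two_qGood_le : 2 * qGood k d α lam
    ≤ (window k d α lam / 3) ^ 5 * Real.exp (-6 * (window k d α lam / 3)) / 4 := by
  have h1 := window_pos (k := k) hd hα hαl
  have h2 := window_le' (k := k) hd hα hαl
  unfold qGood
  set L := window k d α lam
  have h3 : 1 - 2 * L ≤ Real.exp (-6 * (L / 3)) := by
    have := Real.add_one_le_exp (-6 * (L / 3)); linarith
  have h4 : 0 < L ^ 5 := by positivity
  have h5 : (1 / 4 : ℝ) ≤ Real.exp (-6 * (L / 3)) := by linarith
  nlinarith [mul_le_mul_of_nonneg_left h5 h4.le]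

end Parameters

/-! ### Probabilities of quiet windows and of refreshed neighbourhoods -/

namespace IsGlauberDynamics

variable {Ω : Type*} [mΩ : MeasurableSpace Ω] {n : ℕ} {ψ : Multilinear n} {P : Measure Ω}
  [IsProbabilityMeasure P] {X : Ω → Trajectory n} (hX : IsGlauberDynamics ψ P X)
  {k d : ℕ} {α lam : ℝ} (hψ : IsMRF k d α lam ψ)
include hX hψ

theorem measure_not_cellQuiet_le {h : ℝ} (h0 : 0 ≤ h) (i j : Fin n) (w : ℕ) :
    P {ω | ¬ CellQuiet ψ (cellCounts h (X ω).time) i j w} ≤ ENNReal.ofReal (2 * d * (3 * h)) := by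
  classical
  set A : Finset (Fin n) := Finset.univ.filter fun a =>
    (dependencyGraph ψ).Adj i a ∨ (dependencyGraph ψ).Adj j a with hA
  have hcard : A.card ≤ 2 * d := by
    have e : ∀ i, (Finset.univ.filter fun a => (dependencyGraph ψ).Adj i a).card ≤ d := fun i => by
      have := hψ.vertex_degree i
      rwa [Set.ncard_eq_toFinset_card', Set.toFinset_ofPred] at this
    rw [hA, Finset.filter_or, two_mul]
    exact (Finset.card_union_le _ _).trans (add_le_add (e i) (e j))
  set t₀ : ℝ := (3 * w : ℕ) * h with ht₀
  set t₃ : ℝ := (3 * w + 3 : ℕ) * h with ht₃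
  have h03 : t₃ - t₀ = 3 * h := by rw [ht₀, ht₃]; push_cast; ring
  calc P _ ≤ P (⋃ a ∈ A, {ω | 1 ≤ (X ω).count a t₀ t₃}) := by
        refine measure_mono_ae ?_
        filter_upwards [hX.ae_regularClock] with ω hω hq
        change ¬ CellQuiet ψ (cellCounts h (X ω).time) i j w at hq
        rw [← hω.quiet_iff h0] at hq
        unfold Quiet at hq
        push Not at hq
        obtain ⟨a, -, -, ha, hc⟩ := hq
        exact Set.mem_biUnion (show a ∈ A by simp [hA, ha]) (Nat.one_le_iff_ne_zero.2 hc)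
    _ ≤ ∑ a ∈ A, P {ω | 1 ≤ (X ω).count a t₀ t₃} := measure_biUnion_finset_le _ _
    _ ≤ ∑ _a ∈ A, ENNReal.ofReal (3 * h) := Finset.sum_le_sum fun a _ => by
        have := hX.measure_count_ge_one_le a (a := t₀) (b := t₃) (by positivity) (by linarith)
        rwa [h03] at this
    _ ≤ _ := by
        rw [Finset.sum_const, nsmul_eq_mul, ← ENNReal.ofReal_natCast, ← ENNReal.ofReal_mul (by positivity)]
        refine ENNReal.ofReal_le_ofReal (mul_le_mul_of_nonneg_right ?_ (by positivity))
        exact_mod_cast hcard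

/-- Apart from `j`, the site `i` has at most `d - 1` neighbours, whose clocks are independent: those
in `V` must ring and the rest must not. -/
theorem measure_refreshed_ge {i j : Fin n} (hij : (dependencyGraph ψ).Adj i j) {V : Finset (Fin n)}
    (hV : ∀ a ∈ V, (dependencyGraph ψ).Adj i a ∧ a ≠ j) {u t₀ : ℝ} (hu : 0 ≤ u) (hut : u ≤ t₀) :
    ENNReal.ofReal ((1 - Real.exp (-(t₀ - u))) ^ V.card * Real.exp (-(t₀ - u)) ^ (d - 1))
      ≤ P {ω | Refreshed ψ (X ω).time i j V u t₀} := by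
  classical
  set A : Finset (Fin n) := Finset.univ.filter fun a => (dependencyGraph ψ).Adj i a ∧ a ≠ j with hA
  have hVA : V ⊆ A := fun a ha => by simp [hA, hV a ha]
  have hcard : A.card ≤ d - 1 := by
    have h1 := hψ.vertex_degree i
    rw [Set.ncard_eq_toFinset_card', Set.toFinset_ofPred] at h1
    have h2 : A = (Finset.univ.filter fun a => (dependencyGraph ψ).Adj i a).erase j := by
      ext a; simp [hA, and_comm]
    rw [h2, Finset.card_erase_of_mem (by simpa using hij)]
    exact Nat.sub_le_sub_right h1 1
  set y := t₀ - u with hy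
  have hy0 : 0 ≤ y := by linarith
  set e := Real.exp (-y) with he
  have e0 : 0 < e := Real.exp_pos _
  have e1 : e ≤ 1 := Real.exp_le_one_iff.2 (by linarith)
  have hind : iIndepFun (fun (a : Fin n) ω => (X ω).count a u t₀) P := by
    have h1 := hX.count_indep (fun m => if m = 0 then u else t₀) (by simpa using hu)
      (monotone_nat_of_le_succ fun m => by by_cases hm : m = 0 <;> simp [hm, hut])
    have h2 := h1.precomp (g := fun a : Fin n => (a, 0)) (fun a b hab => by simpa using hab)
    simpa using h2
  set U : Fin n → Set ℕ := fun a => if a ∈ V then {m | 1 ≤ m} else {0} with hU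
  have hsub : (⋂ a ∈ A, (fun ω => (X ω).count a u t₀) ⁻¹' U a)
      ⊆ {ω | Refreshed ψ (X ω).time i j V u t₀} := by
    intro ω hω
    simp only [Set.mem_iInter, Set.mem_preimage] at hω
    refine ⟨fun s hs => ?_, fun a ha haj haV => ?_⟩
    · have := hω s (hVA hs)
      simp only [hU, if_pos hs, Set.mem_ofPred_eq] at this
      exact Nat.one_le_iff_ne_zero.1 this
    · have := hω a (by simp [hA, ha, haj])
      simp only [hU, if_neg haV] at this
      exact this
  refine le_trans ?_ (measure_mono hsub)
  rw [hind.measure_inter_preimage_eq_mul A (fun _ _ => .of_discrete)]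
  have law : ∀ a (s : Set ℕ), P ((fun ω => (X ω).count a u t₀) ⁻¹' s)
      = poissonMeasure y.toNNReal s := fun a s =>
    (hX.count_law a u t₀ hu hut).measure_eq (p := fun m => m ∈ s) .of_discrete
  rw [← Finset.prod_sdiff hVA]
  have p1 : ∏ a ∈ V, P ((fun ω => (X ω).count a u t₀) ⁻¹' U a) = ENNReal.ofReal ((1 - e) ^ V.card) := by
    rw [ENNReal.ofReal_pow (by linarith), ← Finset.prod_const]
    exact Finset.prod_congr rfl fun a ha => by
      rw [law]; simp only [hU, if_pos ha]; exact poissonMeasure_pos_set y hy0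
  have p2 : ∏ a ∈ A \ V, P ((fun ω => (X ω).count a u t₀) ⁻¹' U a)
      = ENNReal.ofReal (e ^ (A \ V).card) := by
    rw [ENNReal.ofReal_pow e0.le, ← Finset.prod_const]
    exact Finset.prod_congr rfl fun a ha => by
      rw [law]; simp only [hU, if_neg (Finset.mem_sdiff.1 ha).2]; exact poissonMeasure_zero_set y hy0
  rw [p1, p2, mul_comm (ENNReal.ofReal _),
    ← ENNReal.ofReal_mul (show 0 ≤ (1 - e) ^ V.card from pow_nonneg (by linarith) _)]
  refine ENNReal.ofReal_le_ofReal (mul_le_mul_of_nonneg_left ?_ (pow_nonneg (by linarith) _))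
  exact pow_le_pow_of_le_one e0.le e1 ((Finset.card_le_card Finset.sdiff_subset).trans hcard)

end IsGlauberDynamics

/-- A number of windows in which prescribed neighbours are likely to update and the others not. -/
theorem exists_refresh_length {k d : ℕ} {α lam : ℝ} (hd : 1 ≤ d) (hα : 0 < α) (hαl : α ≤ lam) {v : ℕ}
    (hvk : v ≤ k - 2) (hvd : v ≤ d - 1) :
    ∃ ρ : ℕ, ρ + 1 ≤ blockLength k d α lam ∧ 1 / 3 * (1 / (d : ℝ)) ^ v
      ≤ (1 - Real.exp (-(ρ * window k d α lam))) ^ v * Real.exp (-(ρ * window k d α lam)) ^ (d - 1) := by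
  have hL := window_pos (k := k) hd hα hαl
  have hL1 := window_le' (k := k) hd hα hαl
  have hLd := window_mul_le (k := k) hd hα hαl
  have hr := one_le_blockLength (k := k) hd hα hαl
  rcases Nat.eq_zero_or_pos v with rfl | hv
  · exact ⟨0, by omega, by norm_num⟩
  obtain ⟨m, rfl⟩ : ∃ m, d = m + 1 := ⟨d - 1, by omega⟩
  have hm : (1 : ℝ) ≤ m := by exact_mod_cast (by omega : 1 ≤ m)
  have hk : (3 : ℝ) ≤ k := by exact_mod_cast (by omega : 3 ≤ k)
  simp only [Nat.add_sub_cancel]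
  have h2 : (1 / 2 : ℝ) ^ (k - 2) ≤ 1 := pow_le_one₀ (by norm_num) (by norm_num)
  set L := window k (m + 1) α lam
  have hl2 := Real.log_two_gt_d9
  -- During time p = log(d / (d - 1)) a clock rings with probability exactly 1/d. Moreover p(d - 1)
  -- ≤ 1, so d - 1 clocks stay silent with probability at least 1/e, and at least 1/3 after rounding
  -- up to whole windows.
  set p := Real.log (((m + 1 : ℕ) : ℝ) / m) with hp
  have hmd : (0 : ℝ) < ((m + 1 : ℕ) : ℝ) / m := by positivity
  have hp0 : 0 ≤ p := Real.log_nonneg (by rw [le_div_iff₀ (by linarith)]; push_cast; linarith)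
  have hp2 : p ≤ Real.log 2 := Real.log_le_log hmd (by
    rw [div_le_iff₀ (by linarith)]; push_cast; linarith)
  have hpe : Real.exp (-p) = 1 - 1 / ((m + 1 : ℕ) : ℝ) := by
    rw [Real.exp_neg, hp, Real.exp_log hmd]; push_cast; field_simp; ring
  refine ⟨⌈p / L⌉₊, ?_, ?_⟩
  -- A nonempty `V` forces k ≥ 3, so the block lasts at least log 4, twice the bound log 2 for p.
  -- The extra window is the one in which the pattern is observed.
  · have h1 := Nat.ceil_lt_add_one (div_nonneg hp0 hL.le)
    have h3 : (2 * Real.log 2) / L ≤ blockLength k (m + 1) α lam := by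
      refine le_trans (div_le_div_of_nonneg_right ?_ hL.le) (Nat.le_ceil _)
      rw [show 2 * Real.log 2 = Real.log (2 * 2) by rw [Real.log_mul] <;> norm_num; ring]
      refine Real.log_le_log (by norm_num) ?_
      have := le_max_right (1 : ℝ) (2 * ((k : ℝ) - 2))
      linarith
    have h4 : p / L ≤ Real.log 2 / L := div_le_div_of_nonneg_right hp2 hL.le
    have h5 : 2 ≤ Real.log 2 / L := by rw [le_div_iff₀ hL]; linarith
    have h6 : (2 * Real.log 2) / L = Real.log 2 / L + Real.log 2 / L := by ring
    have h7 : (⌈p / L⌉₊ : ℝ) + 1 < (blockLength k (m + 1) α lam : ℝ) + 1 := by linarith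
    have h8 : ⌈p / L⌉₊ + 1 < blockLength k (m + 1) α lam + 1 := by exact_mod_cast h7
    omega
  · set y := (⌈p / L⌉₊ : ℝ) * L with hy
    have hy1 : p ≤ y := by
      rw [hy, ← div_le_iff₀ hL]; exact Nat.le_ceil _
    have hy2 : y ≤ p + L := by
      have h1 := (Nat.ceil_lt_add_one (div_nonneg hp0 hL.le)).le
      have h3 := mul_le_mul_of_nonneg_right h1 hL.le
      rwa [add_mul, div_mul_cancel₀ _ hL.ne', one_mul] at h3
    have h1 : 1 / ((m + 1 : ℕ) : ℝ) ≤ 1 - Real.exp (-y) := by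
      have := Real.exp_le_exp.2 (neg_le_neg hy1)
      rw [hpe] at this; linarith
    have h3 : Real.exp (-(p + L)) ^ m ≤ Real.exp (-y) ^ m :=
      pow_le_pow_left₀ (Real.exp_nonneg _) (Real.exp_le_exp.2 (by linarith)) m
    have h4 : p * m ≤ 1 := by
      have h5 : p ≤ ((m + 1 : ℕ) : ℝ) / m - 1 := Real.log_le_sub_one_of_pos hmd
      have h6 : (((m + 1 : ℕ) : ℝ) / m - 1) * m = 1 := by push_cast; field_simp; ring
      nlinarith
    have h5 : (1 / 3 : ℝ) ≤ Real.exp (-(p + L)) ^ m := by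
      rw [← Real.exp_nat_mul]
      have h6 : L * m ≤ 1 / 64 := by push_cast at hLd; nlinarith
      have h7 : -1 + -(1 / 64 : ℝ) ≤ m * -(p + L) := by nlinarith
      refine le_trans ?_ (Real.exp_le_exp.2 h7)
      rw [Real.exp_add]
      have h8 := Real.exp_neg_one_gt_d9
      have h9 := Real.add_one_le_exp (-(1 / 64 : ℝ))
      nlinarith
    rw [mul_comm]
    exact mul_le_mul (pow_le_pow_left₀ (by positivity) h1 v) (h5.trans h3) (by norm_num)
      (pow_nonneg (by linarith [show 0 ≤ 1 / ((m + 1 : ℕ) : ℝ) by positivity]) _)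

/-! ### The probability of misjudging one pair of sites. -/

open Classical in
/-- The sum of the statistic over the first `M` stops at an index below `K`. -/
noncomputable def stopSum {n : ℕ} (x : Trajectory n) (h : ℝ) (i j : Fin n) (r M K : ℕ) : ℝ :=
  ∑ ℓ ∈ Finset.range K, if StopAt (cellCounts h x.time) i j r M ℓ then
    windowStat x i ((3 * (ℓ + r - 1) : ℕ) * h) ((3 * (ℓ + r - 1) + 2 : ℕ) * h) else 0

theorem CellQuiet.congr {n : ℕ} {ψ : Multilinear n} {x y : Fin n × ℕ → ℕ} {i j : Fin n} {w : ℕ}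
    (h : ∀ a c, a ≠ i → a ≠ j → 3 * w ≤ c → c < 3 * w + 3 → x (a, c) = y (a, c)) :
    CellQuiet ψ x i j w ↔ CellQuiet ψ y i j w := by
  refine forall_congr' fun a => forall_congr' fun hi => forall_congr' fun hj => forall_congr' fun _ =>
    forall_congr' fun c => forall_congr' fun hc => ?_
  rw [Finset.mem_Ico] at hc
  rw [h a c hi hj hc.1 hc.2]

theorem CellRefreshed.congr {n : ℕ} {ψ : Multilinear n} {x y : Fin n × ℕ → ℕ} {i j : Fin n}
    {V : Finset (Fin n)} (hV : ∀ a ∈ V, a ≠ i ∧ a ≠ j) {ρ w : ℕ}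
    (h : ∀ a c, a ≠ i → a ≠ j → 3 * (w - ρ) ≤ c → c < 3 * w → x (a, c) = y (a, c)) :
    CellRefreshed ψ x i j V ρ w ↔ CellRefreshed ψ y i j V ρ w := by
  have e : ∀ a, a ≠ i → a ≠ j → ((∀ c ∈ Finset.Ico (3 * (w - ρ)) (3 * w), x (a, c) = 0) ↔
      ∀ c ∈ Finset.Ico (3 * (w - ρ)) (3 * w), y (a, c) = 0) := fun a hi hj =>
    forall_congr' fun c => forall_congr' fun hc => by
      rw [Finset.mem_Ico] at hc
      rw [h a c hi hj hc.1 hc.2]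
  exact ⟨fun ⟨h1, h2⟩ => ⟨fun s hs hc => h1 s hs ((e s (hV s hs).1 (hV s hs).2).2 hc),
      fun a ha hj hVa => (e a ha.ne' hj).1 (h2 a ha hj hVa)⟩,
    fun ⟨h1, h2⟩ => ⟨fun s hs hc => h1 s hs ((e s (hV s hs).1 (hV s hs).2).1 hc),
      fun a ha hj hVa => (e a ha.ne' hj).2 (h2 a ha hj hVa)⟩⟩

namespace IsGlauberDynamics

variable {Ω : Type*} [mΩ : MeasurableSpace Ω] {n : ℕ} {ψ : Multilinear n} {P : Measure Ω}
  [IsProbabilityMeasure P] {X : Ω → Trajectory n} (hX : IsGlauberDynamics ψ P X)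
  {k d : ℕ} {α lam : ℝ} (hψ : IsMRF k d α lam ψ) (hd : 1 ≤ d) (hα : 0 < α) (hαl : α ≤ lam)
include hX hψ hd hα hαl

/-- The mean of the statistic at a stop is at most the probability 2κ/5 that the window is not
quiet, so exceeding κ is a deviation by 3κ/5. -/
theorem measure_nonedge_le {i j : Fin n} (hij : ¬ (dependencyGraph ψ).Adj i j) (M K : ℕ) :
    P {ω | M ≤ (greedy (blockPattern (cellCounts (window k d α lam / 3) (X ω).time) i j
          (blockLength k d α lam)) (blockLength k d α lam) K).2 ∧
        threshold k d α lam * M ≤ stopSum (X ω) (window k d α lam / 3) i j (blockLength k d α lam) M K}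
      ≤ ENNReal.ofReal (Real.exp (-(9 * threshold k d α lam ^ 2 / 400 * M))) := by
  classical
  have hL := window_pos (k := k) hd hα hαl
  have hκ0 := threshold_pos (k := k) hd hα hαl
  have hκ1 := threshold_le (k := k) hd hα hαl
  have hκL := threshold_eq (k := k) hd hα hαl
  have hr := one_le_blockLength (k := k) hd hα hαl
  set L := window k d α lam
  set κ := threshold k d α lam
  set r := blockLength k d α lam
  set h := L / 3 with hh
  have h0 : 0 ≤ h := by positivity
  have hmono : ∀ {p q : ℕ}, p ≤ q → (p : ℝ) * h ≤ q * h := fun hpq =>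
    mul_le_mul_of_nonneg_right (by exact_mod_cast hpq) h0
  -- The minimizer of 4θ² - θ · 3κ/5; the minimum is -9κ²/400, which is -γ.
  set θ := 3 * κ / 40 with hθ
  set γ := 9 * κ ^ 2 / 400 with hγ
  set E := Real.exp (γ - θ * κ) with hE
  have hE0 : 0 < E := Real.exp_pos _
  set G : ℕ → (Fin n × ℕ → ℕ) → ℝ := fun ℓ x =>
    E * (1 + 4 * θ ^ 2 + θ * if CellQuiet ψ x i j (ℓ + r - 1) then 0 else 1) with hG
  set Q : ℕ → Set Ω := fun ℓ => {ω | CellQuiet ψ (cellCounts h (X ω).time) i j (ℓ + r - 1)} with hQ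
  have hθ0 : 0 < θ := by positivity
  have hGQ : ∀ ℓ ω, G ℓ (cellCounts h (X ω).time) = E * (1 + 4 * θ ^ 2 + θ * (Q ℓ)ᶜ.indicator 1 ω) := by
    intro ℓ ω
    by_cases hq : CellQuiet ψ (cellCounts h (X ω).time) i j (ℓ + r - 1)
    · rw [Set.indicator_of_notMem (fun h : ω ∈ (Q ℓ)ᶜ => h hq)]; simp [hG, hq]
    · rw [Set.indicator_of_mem (show ω ∈ (Q ℓ)ᶜ from hq)]; simp [hG, hq]
  have hQm : ∀ ℓ, MeasurableSet[clockInfo X] (Q ℓ) := fun ℓ =>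
    coordInfo_le_clockInfo h Set.univ _ (measurableSet_coordInfo _ (3 * (ℓ + r))
      (p := fun x => CellQuiet ψ x i j (ℓ + r - 1)) fun x y hxy => CellQuiet.congr fun a c _ _ _ hc =>
        hxy (a, c) trivial (by simp only; omega))
  have hmain := hX.measure_sum_windowStat_le h0 (i := i) (j := j) hr (s := θ) (v := θ * κ) (γ := γ)
    (G := G) (C := E * (1 + 4 * θ ^ 2 + θ)) (by rw [abs_of_pos hθ0]; linarith) ?_ ?_ ?_ ?_ M K
  · refine le_trans (measure_mono ?_) hmain
    intro ω hω
    refine ⟨hω.1, ?_⟩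
    have := mul_le_mul_of_nonneg_left hω.2 hθ0.le
    rw [← mul_assoc] at this
    exact this
  · intro ℓ x
    simp only [hG]
    refine mul_le_mul_of_nonneg_left ?_ hE0.le
    split_ifs <;> linarith
  · intro ℓ x y hxy
    have : CellQuiet ψ x i j (ℓ + r - 1) ↔ CellQuiet ψ y i j (ℓ + r - 1) :=
      CellQuiet.congr fun a c hi hj h1 h2 => hxy a c hi hj (by omega) (by omega)
    simp only [hG, this]
  · intro ℓ
    have hQm' := hX.clockInfo_le _ (hQm ℓ)
    have hint : Integrable (fun ω => θ * (Q ℓ)ᶜ.indicator (1 : Ω → ℝ) ω) P :=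
      ((integrable_const (1 : ℝ)).indicator hQm'.compl).const_mul _
    have hP : P.real (Q ℓ)ᶜ ≤ 2 * κ / 5 := by
      have h1 := hX.measure_not_cellQuiet_le hψ h0 i j (ℓ + r - 1)
      have h2 := ENNReal.toReal_le_of_le_ofReal (by positivity) h1
      refine h2.trans (le_of_eq ?_)
      rw [hκL, hh]; ring
    simp only [hGQ]
    refine lintegral_ofReal_le_one (((integrable_const _).add hint).const_mul _) (fun ω => ?_) ?_
    · have : 0 ≤ (Q ℓ)ᶜ.indicator (1 : Ω → ℝ) ω := Set.indicator_nonneg (fun _ _ => zero_le_one) ω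
      positivity
    · rw [integral_const_mul, integral_add (integrable_const _) hint, integral_const_mul,
        integral_indicator_one hQm'.compl]
      simp only [integral_const, probReal_univ, one_smul]
      have h1 : 1 + 4 * θ ^ 2 + θ * P.real (Q ℓ)ᶜ ≤ Real.exp (-(γ - θ * κ)) := by
        refine le_trans ?_ (Real.add_one_le_exp _)
        have := mul_le_mul_of_nonneg_left hP hθ0.le
        rw [hγ]; rw [hθ] at this ⊢; nlinarith
      calc _ ≤ E * Real.exp (-(γ - θ * κ)) := mul_le_mul_of_nonneg_left h1 hE0.le
        _ = 1 := by rw [hE, ← Real.exp_add]; simp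
  · intro ℓ Φ hΦ hfin hs
    have := hX.lintegral_block_nonedge (hmono (Nat.le_succ (3 * (ℓ + r - 1))))
      (hmono (Nat.le_succ (3 * (ℓ + r - 1) + 1))) (hmono (Nat.le_succ (3 * (ℓ + r - 1) + 2)))
      (hmono (show 3 * ℓ ≤ 3 * (ℓ + r - 1) by omega)) hij hΦ hs (hQm ℓ)
      (fun ω hω hτ => (hτ.quiet_iff h0).2 hω) hθ0.le (by linarith) hE0.le
    simp only [hGQ]
    exact this

set_option maxHeartbeats 800000 in
theorem measure_edge_le (hk : 2 ≤ k) {i j : Fin n} (hij : (dependencyGraph ψ).Adj i j) (M K : ℕ) :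
    P {ω | M ≤ (greedy (blockPattern (cellCounts (window k d α lam / 3) (X ω).time) i j
          (blockLength k d α lam)) (blockLength k d α lam) K).2 ∧
        stopSum (X ω) (window k d α lam / 3) i j (blockLength k d α lam) M K ≤ threshold k d α lam * M}
      ≤ ENNReal.ofReal (Real.exp (-(9 * threshold k d α lam ^ 2 / 400 * M))) := by
  classical
  have hL := window_pos (k := k) hd hα hαl
  have hκ0 := threshold_pos (k := k) hd hα hαl
  have hκ1 := threshold_le (k := k) hd hα hαl
  have hκL := threshold_eq (k := k) hd hα hαl
  have hr := one_le_blockLength (k := k) hd hα hαl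
  obtain ⟨S, hS, hi, hj, hSα⟩ := hψ.edge_coeff i j hij
  set V := (S.erase i).erase j with hV
  have hne : i ≠ j := hij.ne
  have hVadj : ∀ a ∈ V, (dependencyGraph ψ).Adj i a ∧ a ≠ j := fun a ha => by
    rw [hV, Finset.mem_erase, Finset.mem_erase] at ha
    exact ⟨(hS.adj hi ha.2.2 (Ne.symm ha.2.1)).2.2, ha.1⟩
  have hVij : ∀ a ∈ V, a ≠ i ∧ a ≠ j := fun a ha => ⟨(hVadj a ha).1.ne', (hVadj a ha).2⟩
  have hVcard : V.card = S.card - 2 := by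
    rw [hV, Finset.card_erase_of_mem (by simp [hne.symm, hj]), Finset.card_erase_of_mem hi]; omega
  have hvk : V.card ≤ k - 2 := by
    have : S.card ≤ k := by
      by_contra! hc
      exact hS.1 (hψ.degree S hc)
    omega
  have hvd : V.card ≤ d - 1 := by
    have h1 := hψ.vertex_degree i
    rw [Set.ncard_eq_toFinset_card', Set.toFinset_ofPred] at h1
    have h2 : V ⊆ (Finset.univ.filter fun a => (dependencyGraph ψ).Adj i a).erase j := fun a ha => by
      simp [hVadj a ha]
    refine (Finset.card_le_card h2).trans ?_
    rw [Finset.card_erase_of_mem (by simpa using hij)]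
    exact Nat.sub_le_sub_right h1 1
  obtain ⟨ρ, hρ, hρD⟩ := exists_refresh_length hd hα hαl hvk hvd
  have hd' : (1 : ℝ) ≤ d := by exact_mod_cast hd
  set c₁ := Real.exp (-6 * lam) / 2 * α ^ 2 * (Real.exp (-2 * lam) / 2) ^ V.card with hc₁
  have hc₁0 : 0 ≤ c₁ := by positivity
  have hc₁1 : c₁ ≤ 1 := by
    have h1 := sq_mul_exp_le_one hα.le hαl
    have h2 : (Real.exp (-2 * lam) / 2) ^ V.card ≤ 1 := by
      refine pow_le_one₀ (by positivity) ?_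
      have : Real.exp (-2 * lam) ≤ 1 := Real.exp_le_one_iff.2 (by linarith)
      linarith
    exact mul_le_one₀ h1 (by positivity) h2
  -- the signal is large enough
  have hc₁κ : 64 / 15 * threshold k d α lam ≤ c₁ * (1 / 3 * (1 / (d : ℝ)) ^ V.card) := by
    have h1 : (Real.exp (-2 * lam) / (2 * d)) ^ (k - 2) ≤ (Real.exp (-2 * lam) / (2 * d)) ^ V.card :=
      pow_le_pow_of_le_one (by positivity) ((exp_div_le_half hd hα hαl).trans (by norm_num)) hvk
    have h2 : c₁ * (1 / 3 * (1 / (d : ℝ)) ^ V.card)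
        = Real.exp (-6 * lam) / 2 * α ^ 2 * (1 / 3) * (Real.exp (-2 * lam) / (2 * d)) ^ V.card := by
      rw [hc₁, show Real.exp (-2 * lam) / (2 * (d : ℝ)) = Real.exp (-2 * lam) / 2 * (1 / d) by
        field_simp, mul_pow]; ring
    rw [h2]
    unfold threshold qBurn
    have h3 : 0 ≤ Real.exp (-6 * lam) / 2 * α ^ 2 * (1 / 3) := by positivity
    have := mul_le_mul_of_nonneg_left h1 h3
    refine le_trans (le_of_eq ?_) this
    ring
  set L := window k d α lam
  set κ := threshold k d α lam
  set r := blockLength k d α lam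
  set h := L / 3 with hh
  have h0 : 0 ≤ h := by positivity
  have hmono : ∀ {p q : ℕ}, p ≤ q → (p : ℝ) * h ≤ q * h := fun hpq =>
    mul_le_mul_of_nonneg_right (by exact_mod_cast hpq) h0
  -- The minimizer of 4θ² - θκ, where κ is the gap between the mean bound 2κ and the threshold. The
  -- minimum -κ²/16 is below -γ, so the exponent of the non-edge case serves here too.
  set θ := κ / 8 with hθ
  set γ := 9 * κ ^ 2 / 400 with hγ
  set E := Real.exp (γ - -(θ * κ)) with hE
  have hE0 : 0 < E := Real.exp_pos _
  set G : ℕ → (Fin n × ℕ → ℕ) → ℝ := fun ℓ x =>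
    E * (1 + 4 * θ ^ 2 - θ * (c₁ * (if CellQuiet ψ x i j (ℓ + r - 1) ∧
      CellRefreshed ψ x i j V ρ (ℓ + r - 1) then 1 else 0)
        - 2 * if CellQuiet ψ x i j (ℓ + r - 1) then 0 else 1)) with hG
  set Q : ℕ → Set Ω := fun ℓ => {ω | CellQuiet ψ (cellCounts h (X ω).time) i j (ℓ + r - 1)} with hQ
  set D : ℕ → Set Ω := fun ℓ => {ω | CellRefreshed ψ (cellCounts h (X ω).time) i j V ρ (ℓ + r - 1)}
    with hD
  have hθ0 : 0 < θ := by positivity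
  have hGQ : ∀ ℓ ω, G ℓ (cellCounts h (X ω).time) = E * (1 + 4 * θ ^ 2 - θ *
      (c₁ * (Q ℓ ∩ D ℓ).indicator 1 ω - 2 * (Q ℓ)ᶜ.indicator 1 ω)) := by
    intro ℓ ω
    by_cases hq : CellQuiet ψ (cellCounts h (X ω).time) i j (ℓ + r - 1)
    · rw [Set.indicator_of_notMem (fun h : ω ∈ (Q ℓ)ᶜ => h hq)]
      by_cases hr : CellRefreshed ψ (cellCounts h (X ω).time) i j V ρ (ℓ + r - 1)
      · rw [Set.indicator_of_mem (show ω ∈ Q ℓ ∩ D ℓ from ⟨hq, hr⟩)]; simp [hG, hq, hr]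
      · rw [Set.indicator_of_notMem (fun h : ω ∈ Q ℓ ∩ D ℓ => hr h.2)]; simp [hG, hq, hr]
    · rw [Set.indicator_of_mem (show ω ∈ (Q ℓ)ᶜ from hq),
        Set.indicator_of_notMem (fun h : ω ∈ Q ℓ ∩ D ℓ => hq h.1)]
      simp [hG, hq]
  have hQm : ∀ ℓ, MeasurableSet[clockInfo X] (Q ℓ) := fun ℓ =>
    coordInfo_le_clockInfo h Set.univ _ (measurableSet_coordInfo _ (3 * (ℓ + r))
      (p := fun x => CellQuiet ψ x i j (ℓ + r - 1)) fun x y hxy => CellQuiet.congr fun a c _ _ _ hc =>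
        hxy (a, c) trivial (by simp only; omega))
  have hDm : ∀ ℓ, MeasurableSet[clockInfo X] (D ℓ) := fun ℓ =>
    coordInfo_le_clockInfo h Set.univ _ (measurableSet_coordInfo _ (3 * (ℓ + r))
      (p := fun x => CellRefreshed ψ x i j V ρ (ℓ + r - 1)) fun x y hxy =>
        CellRefreshed.congr hVij fun a c _ _ _ hc => hxy (a, c) trivial (by simp only; omega))
  have hmain := hX.measure_sum_windowStat_le h0 (i := i) (j := j) hr (s := -θ) (v := -(θ * κ)) (γ := γ)
    (G := G) (C := E * (1 + 4 * θ ^ 2 + 2 * θ)) (by rw [abs_neg, abs_of_pos hθ0]; linarith)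
    ?_ ?_ ?_ ?_ M K
  · refine le_trans (measure_mono ?_) hmain
    intro ω hω
    refine ⟨hω.1, ?_⟩
    have := mul_le_mul_of_nonneg_left hω.2 hθ0.le
    have h2 : -(θ * κ) * M ≤ -θ * stopSum (X ω) h i j r M K := by linarith
    exact h2
  · intro ℓ x
    simp only [hG]
    refine mul_le_mul_of_nonneg_left ?_ hE0.le
    have : 0 ≤ θ * c₁ := by positivity
    split_ifs <;> nlinarith
  · intro ℓ x y hxy
    have e1 : CellQuiet ψ x i j (ℓ + r - 1) ↔ CellQuiet ψ y i j (ℓ + r - 1) :=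
      CellQuiet.congr fun a c hi hj h1 h2 => hxy a c hi hj (by omega) (by omega)
    have e2 : CellRefreshed ψ x i j V ρ (ℓ + r - 1) ↔ CellRefreshed ψ y i j V ρ (ℓ + r - 1) :=
      CellRefreshed.congr hVij fun a c hi hj h1 h2 => hxy a c hi hj (by omega) (by omega)
    simp only [hG, e1, e2]
  · intro ℓ
    have hQm' := hX.clockInfo_le _ (hQm ℓ)
    have hDm' := hX.clockInfo_le _ (hDm ℓ)
    have hi1 : Integrable (fun ω => c₁ * (Q ℓ ∩ D ℓ).indicator (1 : Ω → ℝ) ω) P :=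
      ((integrable_const (1 : ℝ)).indicator (hQm'.inter hDm')).const_mul _
    have hi2 : Integrable (fun ω => 2 * (Q ℓ)ᶜ.indicator (1 : Ω → ℝ) ω) P :=
      ((integrable_const (1 : ℝ)).indicator hQm'.compl).const_mul _
    have hi3 : Integrable (fun ω => θ * (c₁ * (Q ℓ ∩ D ℓ).indicator (1 : Ω → ℝ) ω
        - 2 * (Q ℓ)ᶜ.indicator (1 : Ω → ℝ) ω)) P := (hi1.sub hi2).const_mul _
    have hP : P.real (Q ℓ)ᶜ ≤ 2 * κ / 5 := by
      have h1 := hX.measure_not_cellQuiet_le hψ h0 i j (ℓ + r - 1)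
      have h2 := ENNReal.toReal_le_of_le_ofReal (by positivity) h1
      refine h2.trans (le_of_eq ?_)
      rw [hκL, hh]; ring
    have hPD : 1 / 3 * (1 / (d : ℝ)) ^ V.card ≤ P.real (D ℓ) := by
      have h1 := hX.measure_refreshed_ge hψ hij hVadj (u := (3 * (ℓ + r - 1 - ρ) : ℕ) * h)
        (t₀ := (3 * (ℓ + r - 1) : ℕ) * h) (by positivity) (hmono (by omega))
      have h2 : ((3 * (ℓ + r - 1) : ℕ) : ℝ) * h - (3 * (ℓ + r - 1 - ρ) : ℕ) * h = ρ * L := by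
        have : 3 * (ℓ + r - 1) = 3 * (ℓ + r - 1 - ρ) + 3 * ρ := by omega
        rw [this, hh]; push_cast; ring
      rw [h2] at h1
      have h3 : P {ω | Refreshed ψ (X ω).time i j V ((3 * (ℓ + r - 1 - ρ) : ℕ) * h)
          ((3 * (ℓ + r - 1) : ℕ) * h)} = P (D ℓ) := by
        refine measure_congr ?_
        filter_upwards [hX.ae_regularClock] with ω hω
        exact propext (hω.refreshed_iff h0)
      rw [h3] at h1
      exact hρD.trans ((ENNReal.ofReal_le_iff_le_toReal (measure_ne_top _ _)).1 h1)
    have hPQD : P.real (D ℓ) - P.real (Q ℓ)ᶜ ≤ P.real (Q ℓ ∩ D ℓ) := by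
      have h1 : P.real (D ℓ) ≤ P.real ((Q ℓ ∩ D ℓ) ∪ (Q ℓ)ᶜ) := measureReal_mono fun ω hω => by
        by_cases hq : ω ∈ Q ℓ
        · exact .inl ⟨hq, hω⟩
        · exact .inr hq
      linarith [measureReal_union_le (μ := P) (Q ℓ ∩ D ℓ) (Q ℓ)ᶜ]
    simp only [hGQ]
    refine lintegral_ofReal_le_one (((integrable_const _).sub hi3).const_mul _) (fun ω => ?_) ?_
    · have h1 : 0 ≤ (Q ℓ)ᶜ.indicator (1 : Ω → ℝ) ω := Set.indicator_nonneg (fun _ _ => zero_le_one) ω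
      have h2 : (Q ℓ ∩ D ℓ).indicator (1 : Ω → ℝ) ω ≤ 1 := Set.indicator_le_self' (fun _ _ => zero_le_one) ω
      have h3 : c₁ * (Q ℓ ∩ D ℓ).indicator (1 : Ω → ℝ) ω ≤ 1 := by
        have h4 : 0 ≤ (Q ℓ ∩ D ℓ).indicator (1 : Ω → ℝ) ω := Set.indicator_nonneg (fun _ _ => zero_le_one) ω
        nlinarith
      refine mul_nonneg hE0.le ?_
      nlinarith [sq_nonneg θ]
    · rw [integral_const_mul, integral_sub (integrable_const _) hi3, integral_const_mul,
        integral_sub hi1 hi2, integral_const_mul, integral_const_mul,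
        integral_indicator_one hQm'.compl, integral_indicator_one (hQm'.inter hDm')]
      simp only [integral_const, probReal_univ, one_smul]
      -- From the signal 64κ/15, at most 2κ/5 is lost to refreshed windows that are not quiet and
      -- 4κ/5 to the value -2. What remains is 46κ/15.
      have h0 : 2 * κ ≤ c₁ * P.real (Q ℓ ∩ D ℓ) - 2 * P.real (Q ℓ)ᶜ := by
        have h1 := mul_le_mul_of_nonneg_left hPQD hc₁0
        have h2 := mul_le_mul_of_nonneg_left hPD hc₁0
        have h3 : c₁ * P.real (Q ℓ)ᶜ ≤ P.real (Q ℓ)ᶜ :=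
          mul_le_of_le_one_left measureReal_nonneg hc₁1
        linarith
      have h1 : 1 + 4 * θ ^ 2 - θ * (c₁ * P.real (Q ℓ ∩ D ℓ) - 2 * P.real (Q ℓ)ᶜ)
          ≤ Real.exp (-(γ - -(θ * κ))) := by
        refine le_trans ?_ (Real.add_one_le_exp _)
        have := mul_le_mul_of_nonneg_left h0 hθ0.le
        have e1 : θ ^ 2 = κ ^ 2 / 64 := by rw [hθ]; ring
        have e2 : θ * κ = κ ^ 2 / 8 := by rw [hθ]; ring
        have e3 : θ * (2 * κ) = κ ^ 2 / 4 := by rw [hθ]; ring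
        linarith [sq_nonneg κ]
      calc _ ≤ E * Real.exp (-(γ - -(θ * κ))) := mul_le_mul_of_nonneg_left h1 hE0.le
        _ = 1 := by rw [hE, ← Real.exp_add]; simp
  · intro ℓ Φ hΦ hfin hs
    have hΦ' : Measurable[history X (fun _ => (3 * (ℓ + r - 1 - ρ) : ℕ) * h)] Φ :=
      hΦ.mono (history_mono (@measurable_const _ _ _ (clockInfo X) _) fun _ => hmono (by omega)) le_rfl
    have := hX.lintegral_block_edge (hmono (Nat.le_succ (3 * (ℓ + r - 1))))
      (hmono (Nat.le_succ (3 * (ℓ + r - 1) + 1))) (hmono (Nat.le_succ (3 * (ℓ + r - 1) + 2)))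
      hψ hα hαl (hmono (show 3 * (ℓ + r - 1 - ρ) ≤ 3 * (ℓ + r - 1) by omega)) hS hi hj hne hSα hΦ' hfin
      hs (hQm ℓ) (hDm ℓ) (fun ω hω hτ => (hτ.quiet_iff h0).2 hω)
      (fun ω hω hτ => (hτ.refreshed_iff h0).2 hω) hθ0.le (by linarith) hE0.le
    simp only [hGQ]
    exact this

end IsGlauberDynamics

/-! ### The observed lists -/

theorem filter_range_eq_range' {p : ℕ → Bool} {a b N : ℕ} (hab : a ≤ b) (hbN : b ≤ N)
    (hp : ∀ m < N, p m = true ↔ a ≤ m ∧ m < b) :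
    (List.range N).filter p = List.range' a (b - a) := by
  have e : List.range N = List.range' 0 a ++ (List.range' a (b - a) ++ List.range' b (N - b)) := by
    have h1 := List.range'_append_1 (s := a) (m := b - a) (n := N - b)
    have h2 := List.range'_append_1 (s := 0) (m := a) (n := b - a + (N - b))
    rw [show a + (b - a) = b by omega] at h1
    rw [h1, List.range_eq_range']
    rw [zero_add] at h2
    rw [h2]; congr 1; omega
  rw [e, List.filter_append, List.filter_append]
  have f1 : (List.range' 0 a).filter p = [] := List.filter_eq_nil_iff.2 fun m hm => by
    rw [List.mem_range'_1] at hm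
    rw [hp m (by omega)]; omega
  have f2 : (List.range' a (b - a)).filter p = List.range' a (b - a) := List.filter_eq_self.2 fun m hm => by
    rw [List.mem_range'_1] at hm
    rw [hp m (by omega)]; omega
  have f3 : (List.range' b (N - b)).filter p = [] := List.filter_eq_nil_iff.2 fun m hm => by
    rw [List.mem_range'_1] at hm
    rw [hp m (by omega)]; omega
  rw [f1, f2, f3]; simp

section Link

variable {n : ℕ} {x : Trajectory n} (hx : RegularClock x.time)
include hx

theorem observe_valid (T : ℝ) : (observe x T).Valid T := by
  intro i
  refine ⟨?_, ?_⟩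
  · simp only [observe]
    rw [List.pairwise_map]
    exact (List.pairwise_lt_range).imp fun h => hx.strictMono i h
  · intro u hu
    simp only [observe, List.mem_map, List.mem_range] at hu
    obtain ⟨m, hm, rfl⟩ := hu
    exact ⟨hx.time_pos i m, (hx.le_iff_lt_clockCount i T m).2 hm⟩

/-- On a regular clock the rings in an interval have consecutive numbers, so filtering by time
selects a range of numbers. -/
theorem updatesIn_observe (i : Fin n) {a b T : ℝ} (hab : a ≤ b) (hbT : b ≤ T) :
    updatesIn ((observe x T).updates i) a b
      = (List.range' (x.count i 0 a) (x.count i a b)).map fun m => (x.time i m, x.spin i m) := by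
  simp only [updatesIn, observe, List.filter_map]
  congr 1
  rw [count_eq_clockCount x i a b, hx.clockCount_eq_sub i a b]
  refine filter_range_eq_range' (hx.clockCount_mono i hab) (hx.clockCount_mono i hbT) fun m _ => ?_
  simp only [Function.comp, Bool.and_eq_true, decide_eq_true_eq]
  rw [← not_le, hx.le_iff_lt_clockCount i a, hx.le_iff_lt_clockCount i b, not_lt]
  rfl

variable {L T : ℝ} (hL : 0 ≤ L) {r ℓ : ℕ} (hr : 1 ≤ r) (hT : ((ℓ : ℝ) + r) * L ≤ T)
include hL hr hT

theorem third_observe (i : Fin n) {p : ℕ} (hp : p < 3) :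
    third ((observe x T).updates i) L r ℓ p
      = (List.range' (x.count i 0 ((3 * (ℓ + r - 1) + p : ℕ) * (L / 3)))
          (cellCounts (L / 3) x.time (i, 3 * (ℓ + r - 1) + p))).map
        fun m => (x.time i m, x.spin i m) := by
  have e : ((ℓ + r - 1 : ℕ) : ℝ) = (ℓ : ℝ) + r - 1 := by
    rw [Nat.cast_sub (by omega)]; push_cast; ring
  have e1 : ((ℓ : ℝ) + r - 1) * L + p * (L / 3) = ((3 * (ℓ + r - 1) + p : ℕ) : ℝ) * (L / 3) := by
    push_cast; rw [e]; ring
  have e2 : ((ℓ : ℝ) + r - 1) * L + (p + 1) * (L / 3)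
      = ((3 * (ℓ + r - 1) + p + 1 : ℕ) : ℝ) * (L / 3) := by
    push_cast; rw [e]; ring
  rw [third, e1, e2, updatesIn_observe hx i]
  · rfl
  · exact mul_le_mul_of_nonneg_right (by push_cast; linarith) (by positivity)
  · refine le_trans (le_of_eq_of_le e2.symm ?_) hT
    have hp' : (p : ℝ) + 1 ≤ 3 := by exact_mod_cast hp
    nlinarith

theorem pattern_observe_iff (i j : Fin n) :
    Pattern ((observe x T).updates i) ((observe x T).updates j) L r ℓ
      ↔ blockPattern (cellCounts (L / 3) x.time) i j r ℓ := by
  have e := fun i {p} (hp : p < 3) => third_observe hx hL hr hT i hp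
  unfold Pattern
  rw [e i (show 0 < 3 by norm_num), e i (show 1 < 3 by norm_num), e i (show 2 < 3 by norm_num),
    e j (show 0 < 3 by norm_num), e j (show 1 < 3 by norm_num), e j (show 2 < 3 by norm_num)]
  simp only [List.length_map, List.length_range', List.map_eq_nil_iff, List.range'_eq_nil_iff]
  exact ⟨fun ⟨⟨a, b⟩, ⟨c, d⟩, ⟨e, f⟩⟩ => ⟨a, b, c, d, e, f⟩,
    fun ⟨a, b, c, d, e, f⟩ => ⟨⟨a, b⟩, ⟨c, d⟩, ⟨e, f⟩⟩⟩

theorem indicator_third_observe (i : Fin n) {p m : ℕ} (hp : p < 3)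
    (hm : m < cellCounts (L / 3) x.time (i, 3 * (ℓ + r - 1) + p)) :
    indicator (third ((observe x T).updates i) L r ℓ p) m
      = bit (x.spin i (x.count i 0 ((3 * (ℓ + r - 1) + p : ℕ) * (L / 3)) + m)) := by
  rw [third_observe hx hL hr hT i hp, indicator, bit, List.getElem?_map, List.getElem?_range' hm]
  simp

theorem statistic_observe {i j : Fin n} (hp : blockPattern (cellCounts (L / 3) x.time) i j r ℓ) :
    statistic ((observe x T).updates i) L r ℓ
      = windowStat x i ((3 * (ℓ + r - 1) : ℕ) * (L / 3)) ((3 * (ℓ + r - 1) + 2 : ℕ) * (L / 3)) := by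
  have h1 := hp.first_i
  have h2 := hp.third_i
  rw [statistic, indicator_third_observe hx hL hr hT i (show 0 < 3 by norm_num) (by simpa using by omega),
    indicator_third_observe hx hL hr hT i (show 0 < 3 by norm_num) (by simpa using by omega),
    indicator_third_observe hx hL hr hT i (show 2 < 3 by norm_num) (by omega),
    indicator_third_observe hx hL hr hT i (show 2 < 3 by norm_num) (by omega)]
  rfl

end Link

/-! ### The algorithm on an observed trajectory. -/

section Algorithm

variable {n : ℕ} {x : Trajectory n} (hx : RegularClock x.time) {L T : ℝ} (hL : 0 ≤ L) {r M K : ℕ}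
  (hr : 1 ≤ r) (hM : 1 ≤ M) (hK : ∀ ℓ : ℕ, ((ℓ : ℝ) + r) * L ≤ T ↔ ℓ < K) (i j : Fin n)
include hx hL hr hM hK

theorem enoughStops_observe_iff :
    EnoughStops ((observe x T).updates i) ((observe x T).updates j) L r M T
      ↔ M ≤ (greedy (blockPattern (cellCounts (L / 3) x.time) i j r) r K).2 := by
  rw [enoughStops_iff hr hM hK, greedy_congr fun ℓ hℓ => pattern_observe_iff hx hL hr ((hK ℓ).2 hℓ) i j]

theorem average_observe
    (h : M ≤ (greedy (blockPattern (cellCounts (L / 3) x.time) i j r) r K).2) :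
    average ((observe x T).updates i) ((observe x T).updates j) L r M
      = 1 / (M : ℝ) * stopSum x (L / 3) i j r M K := by
  classical
  have hp := fun ℓ hℓ => pattern_observe_iff hx hL hr ((hK ℓ).2 hℓ) i j
  have h1 := sum_stopIndex (li := (observe x T).updates i) (lj := (observe x T).updates j) (L := L) hr
    (fun ℓ => statistic ((observe x T).updates i) L r ℓ) M K
  rw [greedy_congr hp, min_eq_left h] at h1
  rw [average, h1, stopSum]
  congr 1
  refine Finset.sum_congr rfl fun ℓ hℓ => ?_
  have hℓ := Finset.mem_range.1 hℓ
  rw [hit_congr hp hℓ, greedy_congr (K := ℓ) fun ℓ' h' => hp ℓ' (h'.trans hℓ)]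
  split_ifs with h2
  · exact statistic_observe hx hL hr ((hK ℓ).2 hℓ) h2.1.2
  · rfl

end Algorithm

theorem exists_index_bound {L T : ℝ} (hL : 0 < L) {r : ℕ} (hr : r * L ≤ T) :
    ∃ K : ℕ, (∀ ℓ : ℕ, ((ℓ : ℝ) + r) * L ≤ T ↔ ℓ < K) ∧ T / L - r ≤ K := by
  have h1 : (r : ℝ) ≤ T / L := by rwa [le_div_iff₀ hL]
  have h0 : 0 ≤ T / L := (Nat.cast_nonneg r).trans h1
  have h2 : r ≤ ⌊T / L⌋₊ := Nat.le_floor h1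
  refine ⟨⌊T / L⌋₊ + 1 - r, fun ℓ => ?_, ?_⟩
  · rw [← le_div_iff₀ hL, ← Nat.cast_add, ← Nat.le_floor_iff h0]; omega
  · rw [Nat.cast_sub (by omega)]
    have := Nat.lt_floor_add_one (T / L)
    push_cast; linarith

/-- The algorithm is correct on every trajectory on which no pair of sites is misjudged. -/
theorem findMarkovBlanket_observe {n k d : ℕ} {α lam δ : ℝ} {ψ : Multilinear n} (hd : 1 ≤ d)
    (hα : 0 < α) (hαl : α ≤ lam) {x : Trajectory n} (hx : RegularClock x.time)
    (hM : 1 ≤ samples k d α lam δ n) {K : ℕ}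
    (hK : ∀ ℓ : ℕ, ((ℓ : ℝ) + blockLength k d α lam) * window k d α lam ≤ horizon k d α lam δ n ↔ ℓ < K)
    (hcnt : ∀ i j : Fin n, i < j → samples k d α lam δ n
      ≤ (greedy (blockPattern (cellCounts (window k d α lam / 3) x.time) i j (blockLength k d α lam))
        (blockLength k d α lam) K).2)
    (hadj : ∀ i j : Fin n, i < j → ((dependencyGraph ψ).Adj i j ↔
      threshold k d α lam * samples k d α lam δ n ≤ stopSum x (window k d α lam / 3) i j
        (blockLength k d α lam) (samples k d α lam δ n) K)) :
    findMarkovBlanket k d α lam δ (observe x (horizon k d α lam δ n)) = some (dependencyGraph ψ) := by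
  have hL := (window_pos (k := k) hd hα hαl).le
  have hr := one_le_blockLength (k := k) hd hα hαl
  have hM' : (0 : ℝ) < samples k d α lam δ n := by exact_mod_cast hM
  simp only [findMarkovBlanket]
  rw [if_pos fun i j hij => (enoughStops_observe_iff hx hL hr hM hK i j).2 (hcnt i j hij)]
  congr 1
  have key : ∀ i j : Fin n, i < j → (threshold k d α lam ≤
      average ((observe x (horizon k d α lam δ n)).updates i)
        ((observe x (horizon k d α lam δ n)).updates j) (window k d α lam) (blockLength k d α lam)
        (samples k d α lam δ n) ↔ (dependencyGraph ψ).Adj i j) := fun i j hij => by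
    rw [average_observe hx hL hr hM hK i j (hcnt i j hij), hadj i j hij, one_div, ← div_eq_inv_mul,
      le_div_iff₀ hM']
  ext a b
  rw [SimpleGraph.fromRel_adj]
  constructor
  · rintro ⟨-, ⟨h1, h2⟩ | ⟨h1, h2⟩⟩
    · exact (key a b h1).1 h2
    · exact ((key b a h1).1 h2).symm
  · intro h
    rcases lt_or_gt_of_ne h.ne with h1 | h1
    · exact ⟨h.ne, .inl ⟨h1, (key a b h1).2 h⟩⟩
    · exact ⟨h.ne, .inr ⟨h1, (key b a h1).2 h.symm⟩⟩

/-! ### The failure probability -/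

section Samples

variable {k d : ℕ} {α lam : ℝ} (hd : 1 ≤ d) (hα : 0 < α) (hαl : α ≤ lam) {n : ℕ} (hn : 2 ≤ n) {δ : ℝ}
  (hδ : 0 < δ) (hδ1 : δ ≤ 1)
include hd hα hαl hn hδ hδ1

/-- The argument is at least 8, and log 8 = 3 log 2 > 2. -/
theorem two_le_log : 2 ≤ Real.log (2 * (n : ℝ) ^ 2 / δ) := by
  have hn' : (2 : ℝ) ≤ n := by exact_mod_cast hn
  have h1 : (8 : ℝ) ≤ 2 * (n : ℝ) ^ 2 / δ := by
    rw [le_div_iff₀ hδ]; nlinarith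
  have h2 : Real.log 8 = 3 * Real.log 2 := by
    rw [show (8 : ℝ) = 2 ^ 3 by norm_num, Real.log_pow]; norm_num
  have h3 := Real.log_two_gt_d9
  have := Real.log_le_log (by norm_num) h1
  linarith

theorem le_threshold_sq_mul_samples :
    2000 * Real.log (2 * (n : ℝ) ^ 2 / δ) ≤ threshold k d α lam ^ 2 * samples k d α lam δ n := by
  have hκ := threshold_pos (k := k) hd hα hαl
  have := Nat.le_ceil (2000 * Real.log (2 * (n : ℝ) ^ 2 / δ) / threshold k d α lam ^ 2)
  rw [div_le_iff₀ (by positivity)] at this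
  exact this.trans (le_of_eq (mul_comm _ _))

theorem le_samples : 2000 * Real.log (2 * (n : ℝ) ^ 2 / δ) ≤ samples k d α lam δ n := by
  have h1 := le_threshold_sq_mul_samples (k := k) hd hα hαl hn hδ hδ1
  have hκ := threshold_pos (k := k) hd hα hαl
  have hκ1 := threshold_le (k := k) hd hα hαl
  have h2 : threshold k d α lam ^ 2 ≤ 1 := pow_le_one₀ hκ.le (by linarith)
  have h3 : (0 : ℝ) ≤ samples k d α lam δ n := Nat.cast_nonneg _
  nlinarith

theorem one_le_samples : 1 ≤ samples k d α lam δ n := by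
  have h1 := le_samples (k := k) hd hα hαl hn hδ hδ1
  have h2 := two_le_log hd hα hαl hn hδ hδ1
  have : (1 : ℝ) ≤ samples k d α lam δ n := by linarith
  exact_mod_cast this

theorem horizon_div : horizon k d α lam δ n / window k d α lam
    = samples k d α lam δ n * blockLength k d α lam + 2 * samples k d α lam δ n / qGood k d α lam := by
  have hL := window_pos (k := k) hd hα hαl
  rw [horizon, mul_div_cancel_left₀ _ hL.ne']

theorem blockLength_mul_window_le : blockLength k d α lam * window k d α lam ≤ horizon k d α lam δ n := by
  have hL := window_pos (k := k) hd hα hαl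
  have hq := qGood_pos (k := k) hd hα hαl
  rw [← le_div_iff₀ hL, horizon_div hd hα hαl hn hδ hδ1]
  have h1 : (1 : ℝ) ≤ samples k d α lam δ n := by exact_mod_cast one_le_samples hd hα hαl hn hδ hδ1
  have h2 : (0 : ℝ) ≤ 2 * samples k d α lam δ n / qGood k d α lam := by positivity
  have h3 : (0 : ℝ) ≤ blockLength k d α lam := Nat.cast_nonneg _
  nlinarith

end Samples

namespace IsGlauberDynamics

variable {Ω : Type*} [mΩ : MeasurableSpace Ω] {n : ℕ} {ψ : Multilinear n} {P : Measure Ω}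
  [IsProbabilityMeasure P] {X : Ω → Trajectory n} (hX : IsGlauberDynamics ψ P X)
include hX

set_option maxHeartbeats 800000 in
theorem measure_findMarkovBlanket_ne_le {k d : ℕ} {α lam δ : ℝ} (hψ : IsMRF k d α lam ψ) (hk : 2 ≤ k)
    (hd : 1 ≤ d) (hα : 0 < α) (hαl : α ≤ lam) (hn : 2 ≤ n) (hδ : 0 < δ) (hδ1 : δ ≤ 1) :
    P {ω | findMarkovBlanket k d α lam δ (observe (X ω) (horizon k d α lam δ n))
      ≠ some (dependencyGraph ψ)} ≤ ENNReal.ofReal (δ / 2) := by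
  classical
  have hL := window_pos (k := k) hd hα hαl
  have hr := one_le_blockLength (k := k) hd hα hαl
  have hq := qGood_pos (k := k) hd hα hαl
  have hM := one_le_samples (k := k) hd hα hαl hn hδ hδ1
  obtain ⟨K, hK, hKT⟩ := exists_index_bound hL
    (blockLength_mul_window_le (k := k) hd hα hαl hn hδ hδ1)
  have hlog := two_le_log hd hα hαl hn hδ hδ1
  have hM2 := le_samples (k := k) hd hα hαl hn hδ hδ1
  have hMκ := le_threshold_sq_mul_samples (k := k) hd hα hαl hn hδ hδ1
  have hqr := qGood_mul_blockLength_le (k := k) hd hα hαl hk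
  have hdiv := horizon_div (k := k) hd hα hαl hn hδ hδ1
  have hn' : (2 : ℝ) ≤ n := by exact_mod_cast hn
  set Λ := Real.log (2 * (n : ℝ) ^ 2 / δ) with hΛ
  have hΛe : Real.exp (-Λ) = δ / (2 * (n : ℝ) ^ 2) := by
    rw [Real.exp_neg, hΛ, Real.exp_log (by positivity), inv_div]
  set L := window k d α lam
  set κ := threshold k d α lam
  set r := blockLength k d α lam
  set M := samples k d α lam δ n
  set few : Fin n → Fin n → Set Ω := fun i j =>
    {ω | (greedy (blockPattern (cellCounts (L / 3) (X ω).time) i j r) r K).2 < M} with hfew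
  set wrong : Fin n → Fin n → Set Ω := fun i j => if (dependencyGraph ψ).Adj i j then
    {ω | M ≤ (greedy (blockPattern (cellCounts (L / 3) (X ω).time) i j r) r K).2 ∧
        stopSum (X ω) (L / 3) i j r M K ≤ κ * M} else
    {ω | M ≤ (greedy (blockPattern (cellCounts (L / 3) (X ω).time) i j r) r K).2 ∧
        κ * M ≤ stopSum (X ω) (L / 3) i j r M K} with hwrong
  -- One factor e^{-Λ} equals δ/(2n²), and the other is at most 1/2. Two such bad events for each
  -- pair add up to δ/(2n²), hence to δ/2 over at most n² pairs.
  have hsmall : ∀ z : ℝ, z ≤ -(2 * Λ) → ENNReal.ofReal (Real.exp z)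
      ≤ ENNReal.ofReal (δ / (4 * (n : ℝ) ^ 2)) := fun z hz => by
    refine ENNReal.ofReal_le_ofReal ((Real.exp_le_exp.2 hz).trans ?_)
    rw [show -(2 * Λ) = -Λ + -Λ by ring, Real.exp_add]
    have h1 : Real.exp (-Λ) ≤ 1 / 2 := by
      rw [hΛe, div_le_div_iff₀ (by positivity) (by norm_num)]; nlinarith
    have h2 : Real.exp (-Λ) * Real.exp (-Λ) ≤ 1 / 2 * Real.exp (-Λ) :=
      mul_le_mul_of_nonneg_right h1 (Real.exp_nonneg _)
    refine h2.trans (le_of_eq ?_)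
    rw [hΛe]; field_simp; norm_num
  have hfewle : ∀ i j, i ≠ j → P (few i j) ≤ ENNReal.ofReal (δ / (4 * (n : ℝ) ^ 2)) := by
    intro i j hij
    have h1 := hX.measure_stops_lt_le (h := L / 3) (by positivity) (i := i) (j := j) (M := M) (K := K) hr
      hq.le fun w => (ENNReal.ofReal_le_ofReal (two_qGood_le (k := k) hd hα hαl)).trans
        (hX.measure_cellPattern_ge (by positivity) hij w)
    refine h1.trans (hsmall _ ?_)
    -- The choice of T gives K ≥ Mr + 2M/q' - r. With q'r ≤ 1 the exponent is at most 1 - M, and M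
    -- is at least 2000Λ.
    rw [hdiv] at hKT
    have h2 := mul_le_mul_of_nonneg_left hKT hq.le
    have h3 : qGood k d α lam * ((M : ℝ) * r + 2 * M / qGood k d α lam - r)
        = qGood k d α lam * (r * M) + 2 * M - qGood k d α lam * r := by field_simp
    rw [h3] at h2
    have h4 : qGood k d α lam * ((K : ℝ) - r * M) = qGood k d α lam * K - qGood k d α lam * (r * M) := by
      ring
    rw [h4]
    linarith
  have hwrongle : ∀ i j, i ≠ j → P (wrong i j) ≤ ENNReal.ofReal (δ / (4 * (n : ℝ) ^ 2)) := by
    intro i j hij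
    have h1 : P (wrong i j) ≤ ENNReal.ofReal (Real.exp (-(9 * κ ^ 2 / 400 * M))) := by
      simp only [hwrong]
      split_ifs with h
      · exact hX.measure_edge_le hψ hd hα hαl hk h M K
      · exact hX.measure_nonedge_le hψ hd hα hαl h M K
    exact h1.trans (hsmall _ (by linarith))
  have hsub : ∀ᵐ ω ∂P, ω ∈ {ω | findMarkovBlanket k d α lam δ (observe (X ω) (horizon k d α lam δ n))
      ≠ some (dependencyGraph ψ)} → ω ∈ ⋃ q ∈ (Finset.univ : Finset (Fin n × Fin n)).filter
        (fun q => q.1 < q.2), few q.1 q.2 ∪ wrong q.1 q.2 := by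
    filter_upwards [hX.ae_regularClock] with ω hω hne
    by_contra hc
    simp only [Set.mem_iUnion, not_exists, Finset.mem_filter, Finset.mem_univ, true_and] at hc
    have hc' : ∀ i j : Fin n, i < j → ω ∉ few i j ∧ ω ∉ wrong i j := fun i j hij => by
      have := hc (i, j) hij
      exact ⟨fun h => this (.inl h), fun h => this (.inr h)⟩
    have hcnt : ∀ i j : Fin n, i < j → M ≤
        (greedy (blockPattern (cellCounts (L / 3) (X ω).time) i j r) r K).2 := fun i j hij =>
      not_lt.1 (hc' i j hij).1
    refine hne (findMarkovBlanket_observe hd hα hαl hω hM hK hcnt fun i j hij => ?_)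
    have h1 := (hc' i j hij).2
    simp only [hwrong] at h1
    constructor
    · intro h
      rw [if_pos h] at h1
      by_contra h2
      exact h1 ⟨hcnt i j hij, (not_le.1 h2).le⟩
    · intro h
      by_contra h2
      rw [if_neg h2] at h1
      exact h1 ⟨hcnt i j hij, h⟩
  refine (measure_mono_ae hsub).trans ((measure_biUnion_finset_le _ _).trans ?_)
  have hterm : ∀ q ∈ (Finset.univ : Finset (Fin n × Fin n)).filter (fun q => q.1 < q.2),
      P (few q.1 q.2 ∪ wrong q.1 q.2) ≤ ENNReal.ofReal (δ / (2 * (n : ℝ) ^ 2)) := fun q hq => by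
    have hne : q.1 ≠ q.2 := (Finset.mem_filter.1 hq).2.ne
    refine (measure_union_le _ _).trans ((add_le_add (hfewle _ _ hne) (hwrongle _ _ hne)).trans ?_)
    rw [← ENNReal.ofReal_add (by positivity) (by positivity)]
    refine ENNReal.ofReal_le_ofReal (le_of_eq ?_)
    field_simp; norm_num
  refine (Finset.sum_le_sum hterm).trans ?_
  rw [Finset.sum_const, nsmul_eq_mul, ← ENNReal.ofReal_natCast, ← ENNReal.ofReal_mul (by positivity)]
  refine ENNReal.ofReal_le_ofReal ?_
  have hcard : ((Finset.univ : Finset (Fin n × Fin n)).filter (fun q => q.1 < q.2)).card ≤ n ^ 2 := by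
    refine (Finset.card_filter_le _ _).trans (le_of_eq ?_)
    simp [sq]
  have hcard' : (((Finset.univ : Finset (Fin n × Fin n)).filter (fun q => q.1 < q.2)).card : ℝ)
      ≤ (n : ℝ) ^ 2 := by exact_mod_cast hcard
  refine (mul_le_mul_of_nonneg_right hcard' (by positivity)).trans (le_of_eq ?_)
  field_simp

/-- The number of updates is not much larger than its expectation. -/
theorem measure_size_gt_le {T : ℝ} (hT : 0 ≤ T) (s : ℝ) :
    P {ω | s < ((observe (X ω) T).size : ℝ)} ≤ ENNReal.ofReal (Real.exp (2 * n * T - s)) := by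
  have hsize : ∀ ω, (observe (X ω) T).size = ∑ i, (X ω).count i 0 T := fun ω => by
    simp [Observation.size, observe]
  have hind : iIndepFun (fun (a : Fin n) ω => (X ω).count a 0 T) P := by
    have h1 := hX.count_indep (fun m => if m = 0 then 0 else T) (by simp)
      (monotone_nat_of_le_succ fun m => by by_cases hm : m = 0 <;> simp [hm, hT])
    have h2 := h1.precomp (g := fun a : Fin n => (a, 0)) (fun a b hab => by simpa using hab)
    simpa using h2
  set f : ℕ → ℝ≥0∞ := fun m => ENNReal.ofReal (Real.exp m) with hf
  have hfm : Measurable f := Measurable.of_discrete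
  have hprod : ∫⁻ ω, ∏ a : Fin n, f ((X ω).count a 0 T) ∂P
      = ENNReal.ofReal (Real.exp (T * (Real.exp 1 - 1))) ^ n := by
    have h1 := hind.comp (fun _ => f) (fun _ => Measurable.of_discrete)
    have h2 := lintegral_prod_eq_prod_lintegral_of_indepFun Finset.univ
      (fun (a : Fin n) ω => f ((X ω).count a 0 T)) h1
      (fun a => hfm.comp (hX.measurable_count a 0 T))
    rw [h2]
    have h3 : ∀ a : Fin n, ∫⁻ ω, f ((X ω).count a 0 T) ∂P
        = ENNReal.ofReal (Real.exp (T * (Real.exp 1 - 1))) := fun a => by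
      have h4 := (hX.count_law a 0 T le_rfl hT).lintegral_comp (f := f)
        (Measurable.of_discrete).aemeasurable
      rw [sub_zero] at h4
      rw [h4]
      exact lintegral_exp_poissonMeasure T hT
    simp [h3]
  have hsub : {ω | s < ((observe (X ω) T).size : ℝ)}
      ⊆ {ω | ENNReal.ofReal (Real.exp s) ≤ ∏ a : Fin n, f ((X ω).count a 0 T)} := by
    intro ω hω
    show ENNReal.ofReal (Real.exp s) ≤ _
    rw [← ENNReal.ofReal_prod_of_nonneg (fun _ _ => Real.exp_nonneg _), ← Real.exp_sum]
    refine ENNReal.ofReal_le_ofReal (Real.exp_le_exp.2 ?_)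
    have h1 : s < ((observe (X ω) T).size : ℝ) := hω
    rw [hsize] at h1
    push_cast at h1
    exact h1.le
  have hm : Measurable fun ω => ∏ a : Fin n, f ((X ω).count a 0 T) :=
    Finset.measurable_fun_prod _ fun a _ => hfm.comp (hX.measurable_count a 0 T)
  calc P _ ≤ _ := measure_mono hsub
    _ ≤ _ := meas_ge_le_lintegral_div hm.aemeasurable (by simp [Real.exp_pos]) ENNReal.ofReal_ne_top
    _ ≤ _ := by
      rw [hprod, ← ENNReal.ofReal_pow (Real.exp_nonneg _), ← Real.exp_nat_mul,
        ← ENNReal.ofReal_div_of_pos (Real.exp_pos _), ← Real.exp_sub]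
      refine ENNReal.ofReal_le_ofReal (Real.exp_le_exp.2 ?_)
      have h1 : Real.exp 1 - 1 ≤ 2 := by linarith [Real.exp_one_lt_d9]
      have h2 : (n : ℝ) * (T * (Real.exp 1 - 1)) ≤ n * (T * 2) := by gcongr
      linarith

end IsGlauberDynamics

/-! ### Reasoning about structured programs -/

/-- The instruction writes the natural number register `x`. -/
def Instr.writesNat (x : ℕ) : Instr → Bool
  | const y _ | add y _ _ | sub y _ _ | load y _ _ => x == y
  | _ => false

/-- The instruction writes the real register `x`. -/
def Instr.writesReal (x : ℕ) : Instr → Bool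
  | cast y _ | radd y _ _ | rsub y _ _ | rmul y _ _ | rdiv y _ _ | rexp y _ | rlog y _ | rload y _ _ =>
    x == y
  | _ => false

/-- The instruction writes to the natural number array `a`. -/
def Instr.writesNatArr (a : ℕ) : Instr → Bool
  | store b _ _ => a == b
  | _ => false

/-- The instruction writes to the real array `a`. -/
def Instr.writesRealArr (a : ℕ) : Instr → Bool
  | rstore b _ _ => a == b
  | _ => false

/-- Some instruction of the program satisfies `f`. -/
def Program.any (f : Instr → Bool) : Program → Bool
  | instr a => f a
  | seq p q => p.any f || q.any f
  | ite _ p q => p.any f || q.any f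
  | loop _ p => p.any f

/-- What the program `p` does not write is the same in both memories. -/
structure Frame (p : Program) (s s' : Memory) : Prop where
  nat : ∀ x, p.any (Instr.writesNat x) = false → s'.nat x = s.nat x
  real : ∀ x, p.any (Instr.writesReal x) = false → s'.real x = s.real x
  natArr : ∀ a, p.any (Instr.writesNatArr a) = false → s'.natArr a = s.natArr a
  realArr : ∀ a, p.any (Instr.writesRealArr a) = false → s'.realArr a = s.realArr a

theorem Frame.refl (p : Program) (s : Memory) : Frame p s s :=
  ⟨fun _ _ => rfl, fun _ _ => rfl, fun _ _ => rfl, fun _ _ => rfl⟩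

theorem Frame.trans {p : Program} {s₁ s₂ s₃ : Memory} (h : Frame p s₁ s₂) (h' : Frame p s₂ s₃) :
    Frame p s₁ s₃ :=
  ⟨fun x hx => (h'.nat x hx).trans (h.nat x hx), fun x hx => (h'.real x hx).trans (h.real x hx),
    fun x hx => (h'.natArr x hx).trans (h.natArr x hx),
    fun x hx => (h'.realArr x hx).trans (h.realArr x hx)⟩

theorem Frame.mono {p q : Program} {s s' : Memory} (h : Frame p s s')
    (hpq : ∀ f, q.any f = false → p.any f = false) : Frame q s s' :=
  ⟨fun x hx => h.nat x (hpq _ hx), fun x hx => h.real x (hpq _ hx),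
    fun x hx => h.natArr x (hpq _ hx), fun x hx => h.realArr x (hpq _ hx)⟩

theorem frame_exec (a : Instr) (s : Memory) : Frame (.instr a) s (a.exec s) := by
  constructor <;> intro x hx <;> cases a <;>
    simp_all [Program.any, Instr.writesNat, Instr.writesReal, Instr.writesNatArr,
      Instr.writesRealArr, Instr.exec]

/-- What a program writes is a syntactic matter, so for a concrete program the preservation of a
register or array is later discharged by `rfl`. -/
theorem Run.frame {p : Program} {s s' : Memory} {t : ℕ} (h : Run p s t s') : Frame p s s' := by
  have any_or : ∀ {f : Instr → Bool} {p q : Program}, (p.any f || q.any f) = false →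
      p.any f = false ∧ q.any f = false := Bool.or_eq_false_iff.1
  induction h with
  | instr a s => exact frame_exec a s
  | @seq p q _ _ _ _ _ _ _ ih₁ ih₂ =>
    exact (ih₁.mono (q := .seq p q) fun f hf => (any_or hf).1).trans (ih₂.mono fun f hf => (any_or hf).2)
  | ite_true _ _ ih => exact ih.mono fun f hf => (any_or hf).1
  | ite_false _ _ ih => exact ih.mono fun f hf => (any_or hf).2
  | @loop_true b p _ _ _ _ _ _ _ _ ih₁ ih₂ =>
    exact (ih₁.mono (q := .loop b p) fun f hf => hf).trans ih₂
  | loop_false _ => exact .refl _ _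

/-- Started with the memory `s`, the program `p` halts after at most `B` steps with a memory that
satisfies `Q`. -/
def Runs (p : Program) (s : Memory) (B : ℕ) (Q : Memory → Prop) : Prop :=
  ∃ t s', Run p s t s' ∧ t ≤ B ∧ Q s'

namespace Runs

variable {p q : Program} {s : Memory} {B B' : ℕ} {Q R : Memory → Prop} {b : Test}

theorem mono (h : Runs p s B Q) (hB : B ≤ B') (hQ : ∀ s', Frame p s s' → Q s' → R s') :
    Runs p s B' R := by
  obtain ⟨t, s', h1, h2, h3⟩ := h
  exact ⟨t, s', h1, h2.trans hB, hQ s' h1.frame h3⟩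

theorem seq (h : Runs p s B R) (h' : ∀ s', Frame p s s' → R s' → Runs q s' B' Q) :
    Runs (.seq p q) s (B + B') Q := by
  obtain ⟨t, s₁, h1, h2, h3⟩ := h
  obtain ⟨t', s₂, h1', h2', h3'⟩ := h' s₁ h1.frame h3
  exact ⟨t + t', s₂, .seq h1 h1', add_le_add h2 h2', h3'⟩

theorem ite (h : b.Holds s → Runs p s B Q) (h' : ¬ b.Holds s → Runs q s B Q) :
    Runs (.ite b p q) s (1 + B) Q := by
  by_cases hb : b.Holds s
  · obtain ⟨t, s₁, h1, h2, h3⟩ := h hb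
    exact ⟨1 + t, s₁, .ite_true hb h1, Nat.add_le_add_left h2 1, h3⟩
  · obtain ⟨t, s₁, h1, h2, h3⟩ := h' hb
    exact ⟨1 + t, s₁, .ite_false hb h1, Nat.add_le_add_left h2 1, h3⟩

/-- The rule for loops, for an invariant that depends on a budget for the remaining steps. -/
theorem loop (I : ℕ → Memory → Prop) {m : ℕ} (h0 : I m s)
    (h : ∀ m s', Frame p s s' → I m s' → b.Holds s' →
      ∃ B, Runs p s' B fun s'' => ∃ m', m' + B + 1 ≤ m ∧ I m' s'') :
    Runs (.loop b p) s (m + 1) fun s' => ¬ b.Holds s' ∧ ∃ m', I m' s' := by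
  have key : ∀ m s', Frame p s s' → I m s' →
      Runs (.loop b p) s' (m + 1) fun s' => ¬ b.Holds s' ∧ ∃ m', I m' s' := by
    intro m
    induction m using Nat.strong_induction_on with
    | _ m ih =>
      intro s' hF hI
      by_cases hb : b.Holds s'
      · obtain ⟨B, t, s₁, h1, h2, m', h3, h4⟩ := h m s' hF hI hb
        obtain ⟨t', s₂, h5, h6, h7⟩ := ih m' (by omega) s₁ (hF.trans h1.frame) h4
        exact ⟨1 + t + t', s₂, .loop_true hb h1 h5, by omega, h7⟩
      · exact ⟨1, s', .loop_false hb, by omega, hb, m, hI⟩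
  exact key m s (.refl _ _) h0

/-- The rule for loops that count the register `x` up to the value `N` of the register `y`. -/
theorem count {x y : ℕ} (N : ℕ) (C : ℕ → ℕ) (J : ℕ → Memory → Prop)
    (hy : p.any (Instr.writesNat y) = false) (hx0 : s.nat x = 0) (hyN : s.nat y = N) (h0 : J 0 s)
    (h : ∀ i < N, ∀ s', Frame p s s' → s'.nat x = i → J i s' →
      Runs p s' (C i) fun s'' => s''.nat x = i + 1 ∧ J (i + 1) s'') :
    Runs (.loop (.natLt x y) p) s ((∑ i ∈ Finset.range N, (C i + 1)) + 1) (J N) := by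
  have := Runs.loop (b := .natLt x y) (p := p) (s := s)
    (fun m s' => ∃ i ≤ N, s'.nat x = i ∧ s'.nat y = N ∧ J i s' ∧
      m = ∑ i ∈ Finset.Ico i N, (C i + 1)) (m := ∑ i ∈ Finset.range N, (C i + 1))
    ⟨0, Nat.zero_le _, hx0, hyN, h0, by rw [Finset.range_eq_Ico]⟩ ?_
  · refine this.mono le_rfl fun s' _ ⟨h1, m', i, hi, h2, h3, h4, _⟩ => ?_
    have h5 : ¬ s'.nat x < s'.nat y := h1
    have : i = N := by omega
    rwa [← this]
  · rintro m s' hF ⟨i, hi, h2, h3, h4, rfl⟩ hb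
    have hb' : s'.nat x < s'.nat y := hb
    have hlt : i < N := by omega
    refine ⟨C i, (h i hlt s' hF h2 h4).mono le_rfl fun s'' hF' ⟨h5, h6⟩ => ?_⟩
    refine ⟨_, ?_, i + 1, hlt, h5, ?_, h6, rfl⟩
    · rw [Finset.sum_eq_sum_Ico_succ_bot hlt]; omega
    · rw [hF'.nat y hy, h3]

end Runs

/-- The effect of a list of instructions. The register `99` is never read. -/
noncomputable def execs : List Instr → Memory → Memory
  | [], s => (Instr.const 99 0).exec s
  | a :: l, s => execs l (a.exec s)

/-- A list of instructions as a program. -/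
def block : List Instr → Program
  | [] => .instr (.const 99 0)
  | a :: l => .seq (.instr a) (block l)

/-- The value of a natural number register after an instruction. -/
noncomputable def Instr.natVal (s : Memory) (w : ℕ) : Instr → ℕ
  | const x c => if w = x then c else s.nat w
  | add x y z => if w = x then s.nat y + s.nat z else s.nat w
  | sub x y z => if w = x then s.nat y - s.nat z else s.nat w
  | load x a y => if w = x then s.natArr a (s.nat y) else s.nat w
  | _ => s.nat w

/-- The value of a real register after an instruction. -/
noncomputable def Instr.realVal (s : Memory) (w : ℕ) : Instr → ℝ
  | cast x y => if w = x then s.nat y else s.real w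
  | radd x y z => if w = x then s.real y + s.real z else s.real w
  | rsub x y z => if w = x then s.real y - s.real z else s.real w
  | rmul x y z => if w = x then s.real y * s.real z else s.real w
  | rdiv x y z => if w = x then s.real y / s.real z else s.real w
  | rexp x y => if w = x then Real.exp (s.real y) else s.real w
  | rlog x y => if w = x then Real.log (s.real y) else s.real w
  | rload x a y => if w = x then s.realArr a (s.nat y) else s.real w
  | _ => s.real w

/-- A natural number array after an instruction. -/
noncomputable def Instr.natArrVal (s : Memory) (b : ℕ) : Instr → ℕ → ℕ
  | store a x y => if b = a then Function.update (s.natArr b) (s.nat x) (s.nat y) else s.natArr b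
  | _ => s.natArr b

/-- A real array after an instruction. -/
noncomputable def Instr.realArrVal (s : Memory) (b : ℕ) : Instr → ℕ → ℝ
  | rstore a x y => if b = a then Function.update (s.realArr b) (s.nat x) (s.real y) else s.realArr b
  | _ => s.realArr b

theorem exec_nat (a : Instr) (s : Memory) (w : ℕ) : (a.exec s).nat w = a.natVal s w := by
  cases a <;> simp [Instr.exec, Instr.natVal, Function.update_apply]

theorem exec_real (a : Instr) (s : Memory) (w : ℕ) : (a.exec s).real w = a.realVal s w := by
  cases a <;> simp [Instr.exec, Instr.realVal, Function.update_apply]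

theorem exec_natArr (a : Instr) (s : Memory) (b : ℕ) : (a.exec s).natArr b = a.natArrVal s b := by
  cases a with
  | store c x y => by_cases h : b = c <;> simp [Instr.exec, Instr.natArrVal, h]
  | _ => rfl

theorem exec_realArr (a : Instr) (s : Memory) (b : ℕ) : (a.exec s).realArr b = a.realArrVal s b := by
  cases a with
  | rstore c x y => by_cases h : b = c <;> simp [Instr.exec, Instr.realArrVal, h]
  | _ => rfl

theorem run_block (l : List Instr) (s : Memory) : Run (block l) s (l.length + 1) (execs l s) := by
  induction l generalizing s with
  | nil => exact .instr _ _
  | cons a l ih =>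
    have := Run.seq (.instr a s) (ih (a.exec s))
    rw [List.length_cons, add_comm _ 1]
    exact this

theorem Runs.block {l : List Instr} {s : Memory} {Q : Memory → Prop} (h : Q (execs l s)) {B : ℕ}
    (hB : l.length + 1 ≤ B := by simp) : Runs (block l) s B Q :=
  ⟨_, _, run_block l s, hB, h⟩

/-! ### Rounding -/

/-- The integer part of the real register `21` is computed in the register `x`, with one in the
register `4` and in the real register `6`, and zero in the real register `20`. -/
def floorProgram (x : ℕ) : Program :=
  .seq (block [.const x 0, .radd 22 20 6])
    (.loop (.realLe 22 21) (block [.add x x 4, .radd 22 22 6]))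

/-- The machine cannot round, so the integer part is found by counting up while the next integer is
at most `v`. The cost is linear in `v`, which is harmless since all rounded quantities are
O(log(n/δ)). -/
theorem runs_floorProgram {x : ℕ} (hx4 : x ≠ 4) (hx : x ≠ 99) {s : Memory} {v : ℝ} (hv : 0 ≤ v)
    (h4 : s.nat 4 = 1) (h6 : s.real 6 = 1) (h20 : s.real 20 = 0) (h21 : s.real 21 = v) :
    Runs (floorProgram x) s (4 * ⌊v⌋₊ + 10) fun s' => s'.nat x = ⌊v⌋₊ := by
  have h1 : Runs (block [.const x 0, .radd 22 20 6]) s 3 fun s' => s'.nat x = 0 ∧ s'.real 22 = 1 ∧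
      s'.nat 4 = 1 ∧ s'.real 6 = 1 ∧ s'.real 21 = v := by
    refine Runs.block ?_
    simp [execs, exec_nat, exec_real, Instr.natVal, Instr.realVal, h4, h6, h20, h21, hx, hx4.symm]
  refine (h1.seq (B' := 4 * ⌊v⌋₊ + 1) (Q := fun s' => s'.nat x = ⌊v⌋₊)
    fun s₁ _ ⟨a1, a2, a3, a4, a5⟩ => ?_).mono (by omega) fun _ _ h => h
  have := Runs.loop (b := .realLe 22 21) (p := block [.add x x 4, .radd 22 22 6]) (s := s₁)
    (fun m s' => ∃ c : ℕ, s'.nat x = c ∧ s'.real 22 = c + 1 ∧ (c : ℝ) ≤ v ∧ s'.nat 4 = 1 ∧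
      s'.real 6 = 1 ∧ s'.real 21 = v ∧ m = 4 * (⌊v⌋₊ - c))
    (m := 4 * ⌊v⌋₊) ⟨0, a1, by simp [a2], by simpa using hv, a3, a4, a5, rfl⟩ ?_
  · refine this.mono le_rfl fun s' _ ⟨hb, m, c, c1, c2, c3, _, _, c6, _⟩ => ?_
    have hb' : ¬ s'.real 22 ≤ s'.real 21 := hb
    rw [c2, c6, not_le] at hb'
    rw [c1, eq_comm, Nat.floor_eq_iff hv]
    exact ⟨c3, hb'⟩
  · rintro m s' _ ⟨c, c1, c2, c3, c4, c5, c6, rfl⟩ hb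
    have hb' : s'.real 22 ≤ s'.real 21 := hb
    rw [c2, c6] at hb'
    have hc : c + 1 ≤ ⌊v⌋₊ := Nat.le_floor (by push_cast; exact hb')
    refine ⟨3, Runs.block ⟨4 * (⌊v⌋₊ - (c + 1)), by omega, c + 1, ?_⟩⟩
    simp [execs, exec_nat, exec_real, Instr.natVal, Instr.realVal, c1, c2, c4, c5, c6, hx, hx4.symm]
    exact hb'

/-- Rounding up instead. -/
def ceilProgram (x : ℕ) : Program :=
  .seq (floorProgram x) (.seq (block [.cast 22 x])
    (.ite (.realLe 21 22) (block []) (block [.add x x 4])))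

theorem runs_ceilProgram {x : ℕ} (hx4 : x ≠ 4) (hx : x ≠ 99) {s : Memory} {v : ℝ} (hv : 0 ≤ v)
    (h4 : s.nat 4 = 1) (h6 : s.real 6 = 1) (h20 : s.real 20 = 0) (h21 : s.real 21 = v) :
    Runs (ceilProgram x) s (4 * ⌈v⌉₊ + 20) fun s' => s'.nat x = ⌈v⌉₊ := by
  have hfc := Nat.floor_le_ceil v
  have hcf := Nat.ceil_le_floor_add_one v
  refine ((runs_floorProgram hx4 hx hv h4 h6 h20 h21).seq (B' := 10) (Q := fun s' => s'.nat x = ⌈v⌉₊)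
    fun s₁ hF a1 => ?_).mono (by omega) fun _ _ h => h
  have b4 : s₁.nat 4 = 1 := by
    rw [hF.nat 4 (by simp [floorProgram, Program.any, GlauberMRF.block, Instr.writesNat, hx4.symm]), h4]
  have b21 : s₁.real 21 = v := by rw [hF.real 21 rfl, h21]
  have h1 : Runs (GlauberMRF.block [.cast 22 x]) s₁ 2 fun s' => s'.nat x = ⌊v⌋₊ ∧ s'.real 22 = ⌊v⌋₊ ∧
      s'.nat 4 = 1 ∧ s'.real 21 = v := by
    refine Runs.block ?_
    simp [execs, exec_nat, exec_real, Instr.natVal, Instr.realVal, a1, b4, b21, hx]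
  refine (h1.seq (B' := 8) (Q := fun s' => s'.nat x = ⌈v⌉₊) fun s₂ _ ⟨c1, c2, c3, c4⟩ => ?_).mono
    (by omega) fun _ _ h => h
  refine (Runs.ite (B := 2) (fun hb => ?_) fun hb => ?_).mono (by omega) fun _ _ h => h
  · have hb' : s₂.real 21 ≤ s₂.real 22 := hb
    rw [c2, c4] at hb'
    refine Runs.block ?_
    simp only [execs, exec_nat, Instr.natVal, if_neg hx, c1]
    exact le_antisymm hfc (Nat.ceil_le.2 hb')
  · have hb' : ¬ s₂.real 21 ≤ s₂.real 22 := hb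
    rw [c2, c4, not_le] at hb'
    refine Runs.block ?_
    have h5 : ⌊v⌋₊ < ⌈v⌉₊ := Nat.lt_ceil.2 hb'
    simp only [execs, exec_nat, Instr.natVal, if_neg hx, c1, c3, if_true]
    omega

open Instr

/-! ### The program: parameters -/

/-- Literals, and the base of the power in `qBurn`. -/
def literalProgram : Program := block
  [const 4 1, cast 6 4, const 10 2, cast 7 10, const 10 6, cast 8 10, const 10 64, cast 9 10,
    const 10 5, cast 10 10, const 10 2000, cast 11 10, cast 12 0, cast 13 2, const 10 2, sub 11 1 10,
    rsub 14 20 7, rmul 14 14 1, rexp 14 14, rmul 15 7 13, rdiv 14 14 15, radd 16 20 6, const 12 0]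

/-- The power in `qBurn`. -/
def powerProgram : Program := .loop (.natLt 12 11) (block [rmul 16 16 14, add 12 12 4])

/-- The window, the threshold, the length of a cell, and the quotient that is rounded to `M`. -/
def windowProgram : Program := block
  -- After this line the registers 16, 17, 18 hold q, α² and e^{-6λ}. Below, 3, 4, 5 become L, κ,
  -- L/3, and 21 becomes the quotient.
  [rdiv 17 6 7, rmul 16 17 16, rmul 17 0 0, rsub 18 20 8, rmul 18 18 1, rexp 18 18,
    rmul 19 17 16, rmul 19 19 18, rmul 21 9 13, rdiv 3 19 21,
    rmul 4 10 17, rmul 4 4 16, rdiv 4 4 9, rmul 4 4 18, const 10 3, cast 21 10, rdiv 5 3 21,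
    rmul 21 12 12, rmul 21 7 21, rdiv 21 21 2, rlog 21 21, rmul 21 11 21, rmul 22 4 4, rdiv 21 21 22]

/-- The quotient that is rounded to the block length. -/
def blockLengthProgram : Program :=
  .seq (block [cast 21 1, rsub 21 21 7, rmul 21 7 21])
    (.seq (.ite (.realLe 6 21) (block []) (block [radd 21 20 6]))
      (block [rmul 21 7 21, rlog 21 21, rdiv 21 21 3]))

/-- The length of the trajectory, in windows. -/
def horizonProgram : Program := block
  [cast 21 5, cast 22 6, rmul 22 21 22, rmul 23 3 3, rmul 23 23 23, rmul 23 23 3, rmul 24 8 8,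
    rmul 24 24 24, rmul 24 24 8, rdiv 23 23 24, rmul 24 7 21, rdiv 24 24 23, radd 21 22 24]

/-- All parameters. -/
def paramProgram : Program :=
  .seq (.seq (.seq literalProgram powerProgram) windowProgram) <| .seq (ceilProgram 5) <|
  .seq blockLengthProgram <| .seq (ceilProgram 6) <| .seq horizonProgram <| .seq (floorProgram 7) <|
  block [add 8 7 7, add 8 8 7, add 8 8 4, add 9 7 4, sub 9 9 6]

/-- The number of windows in the observed trajectory. -/
noncomputable def numWindows (k d : ℕ) (α lam δ : ℝ) (n : ℕ) : ℕ :=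
  ⌊(samples k d α lam δ n * blockLength k d α lam + 2 * samples k d α lam δ n / qGood k d α lam : ℝ)⌋₊

/-- The registers that hold the parameters. -/
structure HoldsParams (k d : ℕ) (α lam δ : ℝ) (n : ℕ) (s : Memory) : Prop where
  sites : s.nat 0 = n
  zero : s.nat 3 = 0
  one : s.nat 4 = 1
  samples : s.nat 5 = samples k d α lam δ n
  blockLength : s.nat 6 = blockLength k d α lam
  numWindows : s.nat 7 = numWindows k d α lam δ n
  rowLength : s.nat 8 = 3 * GlauberMRF.numWindows k d α lam δ n + 1
  indexBound : s.nat 9 = GlauberMRF.numWindows k d α lam δ n + 1 - GlauberMRF.blockLength k d α lam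
  threshold : s.real 4 = threshold k d α lam
  cell : s.real 5 = window k d α lam / 3
  rone : s.real 6 = 1
  rtwo : s.real 7 = 2

section Params

variable {n k d : ℕ} {α lam δ : ℝ} {s : Memory} (hn : s.nat 0 = n) (hk : s.nat 1 = k)
  (hd : s.nat 2 = d) (h3 : s.nat 3 = 0) (hα : s.real 0 = α) (hlam : s.real 1 = lam)
  (hδ : s.real 2 = δ) (h20 : s.real 20 = 0)
include hn hk hd h3 hα hlam hδ h20

theorem runs_literalProgram : Runs literalProgram s 24 fun s' =>
    (s'.nat 0 = n ∧ s'.nat 1 = k ∧ s'.nat 3 = 0 ∧ s'.nat 4 = 1 ∧ s'.nat 11 = k - 2 ∧ s'.nat 12 = 0) ∧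
    s'.real 0 = α ∧ s'.real 1 = lam ∧ s'.real 2 = δ ∧ s'.real 20 = 0 ∧ s'.real 6 = 1 ∧ s'.real 7 = 2 ∧
    s'.real 8 = 6 ∧ s'.real 9 = 64 ∧ s'.real 10 = 5 ∧ s'.real 11 = 2000 ∧ s'.real 12 = n ∧
    s'.real 13 = d ∧ s'.real 14 = Real.exp (-2 * lam) / (2 * d) ∧ s'.real 16 = 1 := by
  refine Runs.block ?_
  simp [execs, exec_nat, exec_real, natVal, realVal, hn, hk, hd, h3, hα, hlam, hδ, h20]

theorem runs_powerProgram : Runs (.seq literalProgram powerProgram) s (4 * k + 30) fun s' =>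
    (s'.nat 0 = n ∧ s'.nat 1 = k ∧ s'.nat 3 = 0 ∧ s'.nat 4 = 1) ∧
    s'.real 0 = α ∧ s'.real 1 = lam ∧ s'.real 2 = δ ∧ s'.real 20 = 0 ∧ s'.real 6 = 1 ∧ s'.real 7 = 2 ∧
    s'.real 8 = 6 ∧ s'.real 9 = 64 ∧ s'.real 10 = 5 ∧ s'.real 11 = 2000 ∧ s'.real 12 = n ∧
    s'.real 13 = d ∧ s'.real 16 = (Real.exp (-2 * lam) / (2 * d)) ^ (k - 2) := by
  refine ((runs_literalProgram hn hk hd h3 hα hlam hδ h20).seq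
    (B' := (∑ _i ∈ Finset.range (k - 2), (3 + 1)) + 1)
    (Q := _) fun s₁ _ ⟨⟨a0, a1, a3, a4, a11, a12⟩, b0, b1, b2, b20, b6, b7, b8, b9, b10, b11, b12, b13, b14, b16⟩ =>
      (Runs.count (x := 12) (y := 11) (p := block [rmul 16 16 14, add 12 12 4]) (k - 2) (fun _ => 3)
        (fun i s' => s'.real 16 = (Real.exp (-2 * lam) / (2 * d)) ^ i) rfl a12 a11 (by simp [b16])
        fun i _ s' hF hi hJ => Runs.block ?_).mono le_rfl fun s' hF hJ => ?_).mono ?_ fun _ _ h => h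
  · have c14 := hF.real 14 rfl
    have c4 := hF.nat 4 rfl
    simp [execs, exec_nat, exec_real, natVal, realVal, hi, hJ, c14, c4, a4, b14, pow_succ]
  · exact ⟨⟨(hF.nat 0 rfl).trans a0, (hF.nat 1 rfl).trans a1, (hF.nat 3 rfl).trans a3,
      (hF.nat 4 rfl).trans a4⟩, (hF.real 0 rfl).trans b0, (hF.real 1 rfl).trans b1,
      (hF.real 2 rfl).trans b2, (hF.real 20 rfl).trans b20, (hF.real 6 rfl).trans b6,
      (hF.real 7 rfl).trans b7, (hF.real 8 rfl).trans b8, (hF.real 9 rfl).trans b9,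
      (hF.real 10 rfl).trans b10, (hF.real 11 rfl).trans b11, (hF.real 12 rfl).trans b12,
      (hF.real 13 rfl).trans b13, hJ⟩
  · simp only [Finset.sum_const, Finset.card_range, smul_eq_mul]; omega

theorem runs_windowProgram : Runs (.seq (.seq literalProgram powerProgram) windowProgram) s (4 * k + 60)
    fun s' => (s'.nat 0 = n ∧ s'.nat 1 = k ∧ s'.nat 3 = 0 ∧ s'.nat 4 = 1) ∧
    s'.real 20 = 0 ∧ s'.real 6 = 1 ∧ s'.real 7 = 2 ∧ s'.real 8 = 6 ∧ s'.real 3 = window k d α lam ∧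
    s'.real 4 = threshold k d α lam ∧ s'.real 5 = window k d α lam / 3 ∧
    s'.real 21 = 2000 * Real.log (2 * (n : ℝ) ^ 2 / δ) / threshold k d α lam ^ 2 := by
  refine ((runs_powerProgram hn hk hd h3 hα hlam hδ h20).seq (B' := 25) (Q := _)
    fun s₂ _ ⟨⟨a0, a1, a3, a4⟩, b0, b1, b2, b20, b6, b7, b8, b9, b10, b11, b12, b13, b16⟩ =>
    Runs.block ?_).mono (by omega) fun _ _ h => h
  simp [execs, exec_nat, exec_real, natVal, realVal, a0, a1, a3, a4, b0, b1, b2, b20, b6, b7, b8, b9,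
    b10, b11, b12, b13, b16]
  unfold threshold window qBurn
  simp only [neg_mul]
  refine ⟨by ring, by ring, by ring, ?_⟩
  rw [pow_two (n : ℝ)]
  congr 1
  ring

theorem runs_paramProgram (hd1 : 1 ≤ d) (hα0 : 0 < α) (hαl : α ≤ lam) (hn2 : 2 ≤ n)
    (hδ0 : 0 < δ) (hδ1 : δ ≤ 1) :
    Runs paramProgram s (4 * (k + samples k d α lam δ n + blockLength k d α lam
      + numWindows k d α lam δ n) + 200) (HoldsParams k d α lam δ n) := by
  have hL := window_pos (k := k) hd1 hα0 hαl
  have hq := qGood_pos (k := k) hd1 hα0 hαl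
  have hκ := threshold_pos (k := k) hd1 hα0 hαl
  have hlog := two_le_log hd1 hα0 hαl hn2 hδ0 hδ1
  have hlogr : 0 ≤ Real.log (2 * max 1 (2 * ((k : ℝ) - 2))) / window k d α lam := by
    have := (Real.log_nonneg (by norm_num : (1 : ℝ) ≤ 2)).trans (log_blockLength_pos (k := k) hd1 hα0 hαl)
    positivity
  refine ((runs_windowProgram hn hk hd h3 hα hlam hδ h20).seq
    (B' := 4 * (samples k d α lam δ n + blockLength k d α lam + numWindows k d α lam δ n) + 140)
    (Q := HoldsParams k d α lam δ n) ?_).mono (by omega) fun _ _ h => h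
  rintro s₁ - ⟨⟨a0, a1, a3, a4⟩, b20, b6, b7, b8, b3, b4, b5, b21⟩
  have hM := runs_ceilProgram (x := 5) (by decide) (by decide) (by positivity) a4 b6 b20 b21
  refine (hM.seq (B' := 4 * (blockLength k d α lam + numWindows k d α lam δ n) + 120)
    (Q := HoldsParams k d α lam δ n) ?_).mono (by unfold samples; omega) fun _ _ h => h
  intro s₂ F₂ a5
  replace a5 : s₂.nat 5 = samples k d α lam δ n := a5
  replace a0 := (F₂.nat 0 rfl).trans a0
  replace a1 := (F₂.nat 1 rfl).trans a1
  replace a3 := (F₂.nat 3 rfl).trans a3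
  replace a4 := (F₂.nat 4 rfl).trans a4
  replace b20 := (F₂.real 20 rfl).trans b20
  replace b6 := (F₂.real 6 rfl).trans b6
  replace b7 := (F₂.real 7 rfl).trans b7
  replace b8 := (F₂.real 8 rfl).trans b8
  replace b3 := (F₂.real 3 rfl).trans b3
  replace b4 := (F₂.real 4 rfl).trans b4
  replace b5 := (F₂.real 5 rfl).trans b5
  clear F₂ b21 hM
  have hr : Runs blockLengthProgram s₂ 20 fun s' =>
      s'.real 21 = Real.log (2 * max 1 (2 * ((k : ℝ) - 2))) / window k d α lam := by
    refine (Runs.seq (B := 4) (B' := 7) (R := fun s' => s'.real 21 = 2 * ((k : ℝ) - 2)) (Runs.block ?_)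
      fun s₃ F₃ c21 => ?_).mono (by norm_num) fun _ _ h => h
    · simp [execs, exec_real, realVal, a1, b7]
    · have d6 : s₃.real 6 = 1 := (F₃.real 6 rfl).trans b6
      have d7 : s₃.real 7 = 2 := (F₃.real 7 rfl).trans b7
      have d3 : s₃.real 3 = window k d α lam := (F₃.real 3 rfl).trans b3
      have d20 : s₃.real 20 = 0 := (F₃.real 20 rfl).trans b20
      refine (Runs.seq (B := 1 + 2) (B' := 4) (R := fun s' => s'.real 21 = max 1 (2 * ((k : ℝ) - 2)))
        (Runs.ite (fun h => Runs.block ?_) fun h => Runs.block ?_) fun s₄ F₄ e21 => Runs.block ?_).mono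
          (by norm_num) fun _ _ h => h
      · have h' : s₃.real 6 ≤ s₃.real 21 := h
        rw [d6, c21] at h'
        simp [execs, exec_real, realVal, c21, max_eq_right h']
      · have h' : ¬ s₃.real 6 ≤ s₃.real 21 := h
        rw [d6, c21, not_le] at h'
        simp [execs, exec_real, realVal, d6, d20, max_eq_left h'.le]
      · simp [execs, exec_real, realVal, e21, (F₄.real 7 rfl).trans d7, (F₄.real 3 rfl).trans d3]
  refine (hr.seq (B' := 4 * (blockLength k d α lam + numWindows k d α lam δ n) + 100)
    (Q := HoldsParams k d α lam δ n) ?_).mono (by omega) fun _ _ h => h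
  intro s₃ F₃ b21
  replace a0 := (F₃.nat 0 rfl).trans a0
  replace a3 := (F₃.nat 3 rfl).trans a3
  replace a4 := (F₃.nat 4 rfl).trans a4
  replace a5 := (F₃.nat 5 rfl).trans a5
  replace b20 := (F₃.real 20 rfl).trans b20
  replace b6 := (F₃.real 6 rfl).trans b6
  replace b7 := (F₃.real 7 rfl).trans b7
  replace b8 := (F₃.real 8 rfl).trans b8
  replace b3 := (F₃.real 3 rfl).trans b3
  replace b4 := (F₃.real 4 rfl).trans b4
  replace b5 := (F₃.real 5 rfl).trans b5
  clear F₃ hr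
  have hr := runs_ceilProgram (x := 6) (by decide) (by decide) hlogr a4 b6 b20 b21
  refine (hr.seq (B' := 4 * numWindows k d α lam δ n + 80)
    (Q := HoldsParams k d α lam δ n) ?_).mono (by unfold blockLength; omega) fun _ _ h => h
  intro s₄ F₄ a6
  replace a6 : s₄.nat 6 = blockLength k d α lam := a6
  replace a0 := (F₄.nat 0 rfl).trans a0
  replace a3 := (F₄.nat 3 rfl).trans a3
  replace a4 := (F₄.nat 4 rfl).trans a4
  replace a5 := (F₄.nat 5 rfl).trans a5
  replace b20 := (F₄.real 20 rfl).trans b20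
  replace b6 := (F₄.real 6 rfl).trans b6
  replace b7 := (F₄.real 7 rfl).trans b7
  replace b8 := (F₄.real 8 rfl).trans b8
  replace b3 := (F₄.real 3 rfl).trans b3
  replace b4 := (F₄.real 4 rfl).trans b4
  replace b5 := (F₄.real 5 rfl).trans b5
  clear F₄ hr
  have hT : Runs horizonProgram s₄ 14 fun s' => s'.real 21 =
      samples k d α lam δ n * blockLength k d α lam + 2 * samples k d α lam δ n / qGood k d α lam := by
    refine Runs.block ?_
    simp [execs, exec_nat, exec_real, natVal, realVal, a5, a6, b7, b8, b3]
    unfold qGood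
    ring
  refine (hT.seq (B' := 4 * numWindows k d α lam δ n + 60)
    (Q := HoldsParams k d α lam δ n) ?_).mono (by omega) fun _ _ h => h
  intro s₅ F₅ b21
  replace a0 := (F₅.nat 0 rfl).trans a0
  replace a3 := (F₅.nat 3 rfl).trans a3
  replace a4 := (F₅.nat 4 rfl).trans a4
  replace a5 := (F₅.nat 5 rfl).trans a5
  replace a6 := (F₅.nat 6 rfl).trans a6
  replace b20 := (F₅.real 20 rfl).trans b20
  replace b6 := (F₅.real 6 rfl).trans b6
  replace b7 := (F₅.real 7 rfl).trans b7
  replace b4 := (F₅.real 4 rfl).trans b4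
  replace b5 := (F₅.real 5 rfl).trans b5
  clear F₅ hT
  have hW := runs_floorProgram (x := 7) (by decide) (by decide) (by positivity) a4 b6 b20 b21
  refine (hW.seq (B' := 40)
    (Q := HoldsParams k d α lam δ n) ?_).mono (by unfold numWindows; omega) fun _ _ h => h
  intro s₆ F₆ a7
  replace a7 : s₆.nat 7 = numWindows k d α lam δ n := a7
  refine Runs.block ?_
  constructor
  all_goals
    simp [execs, exec_nat, exec_real, natVal, realVal, a7, (F₆.nat 0 rfl).trans a0,
      (F₆.nat 3 rfl).trans a3, (F₆.nat 4 rfl).trans a4, (F₆.nat 5 rfl).trans a5,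
      (F₆.nat 6 rfl).trans a6, (F₆.real 4 rfl).trans b4, (F₆.real 5 rfl).trans b5,
      (F₆.real 6 rfl).trans b6, (F₆.real 7 rfl).trans b7]
  ring

end Params

/-! ### The program: the table of the numbers of updates -/

/-- The number of updates in the first `c` cells of length `h`. -/
noncomputable def cumCount (h : ℝ) (l : List (ℝ × Bool)) (c : ℕ) : ℕ :=
  l.countP fun u => decide (u.1 ≤ c * h)

/-- In a list ordered by time, the updates up to `t` form an initial segment whose length is their
number. -/
theorem le_iff_lt_countP {l : List (ℝ × Bool)} (hl : l.Pairwise fun u v => u.1 < v.1) (t : ℝ) {m : ℕ}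
    (hm : m < l.length) : l[m].1 ≤ t ↔ m < l.countP fun u => decide (u.1 ≤ t) := by
  induction l generalizing m with
  | nil => simp at hm
  | cons a l ih =>
    rw [List.pairwise_cons] at hl
    by_cases ha : a.1 ≤ t
    · rw [List.countP_cons_of_pos (by simpa using ha)]
      cases m with
      | zero => simpa using ha
      | succ m =>
        rw [List.getElem_cons_succ, ih hl.2 (by simpa using hm)]; omega
    · have h0 : l.countP (fun u => decide (u.1 ≤ t)) = 0 := by
        rw [List.countP_eq_zero]
        intro u hu
        have := hl.1 u hu
        simp only [decide_eq_true_eq]; linarith [not_le.1 ha]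
      rw [List.countP_cons_of_neg (by simpa using ha), h0]
      cases m with
      | zero => simpa using ha
      | succ m =>
        have := hl.1 _ (List.getElem_mem (l := l) (n := m) (by simpa using hm))
        simp only [List.getElem_cons_succ, not_lt_zero, iff_false, not_le]
        linarith [not_le.1 ha]

theorem cumCount_le_length (h : ℝ) (l : List (ℝ × Bool)) (c : ℕ) : cumCount h l c ≤ l.length :=
  List.countP_le_length

theorem cumCount_mono {h : ℝ} (h0 : 0 ≤ h) (l : List (ℝ × Bool)) {c c' : ℕ} (hc : c ≤ c') :
    cumCount h l c ≤ cumCount h l c' :=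
  List.countP_mono_left fun u _ hu => by
    simp only [decide_eq_true_eq] at hu ⊢
    exact hu.trans (mul_le_mul_of_nonneg_right (by exact_mod_cast hc) h0)

/-- The part of the memory that holds the observation. -/
structure HoldsInput (n : ℕ) (upd : ℕ → List (ℝ × Bool)) (off : ℕ → ℕ) (s : Memory) : Prop where
  length : ∀ i < n, s.natArr 1 i = (upd i).length
  offset : ∀ i < n, s.natArr 2 i = off i
  time : ∀ i < n, ∀ m (hm : m < (upd i).length), s.realArr 0 (off i + m) = (upd i)[m].1
  spin : ∀ i < n, ∀ m (hm : m < (upd i).length), s.natArr 3 (off i + m) = (upd i)[m].2.toNat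

/-- Write the number of updates up to the end of the cell, and go to the next cell. -/
def emitProgram : Program := block [store 5 13 16, add 13 13 4, add 17 17 4]

/-- One step of the merge of the updates of a site with the ends of the cells. -/
def mergeStep : Program :=
  .seq (block [cast 21 17, rmul 21 21 5])
    (.ite (.natLt 16 14)
      (.seq (block [add 18 15 16, rload 22 0 18])
        (.ite (.realLe 22 21) (block [add 16 16 4]) emitProgram))
      emitProgram)

/-- The row of the table that belongs to a site. -/
def rowProgram : Program :=
  .seq (block [load 14 1 12, load 15 2 12, const 16 0, const 17 0])
    (.seq (.loop (.natLt 17 8) mergeStep) (block [add 12 12 4]))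

/-- The table of the numbers of updates of all sites up to the ends of the cells. -/
def tableProgram : Program :=
  .seq (block [const 12 0, const 13 0]) (.loop (.natLt 12 0) rowProgram)

section Table

variable {n C : ℕ} {h : ℝ} (h0 : 0 ≤ h) {upd : ℕ → List (ℝ × Bool)} {off : ℕ → ℕ}
  (hsort : ∀ i < n, (upd i).Pairwise fun u v => u.1 < v.1)
include h0

/-- The invariant of the merge. -/
structure MergeInv (C : ℕ) (h : ℝ) (upd : ℕ → List (ℝ × Bool)) (off : ℕ → ℕ) (i p c : ℕ) (s : Memory) :
    Prop where
  site : s.nat 12 = i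
  pos : s.nat 13 = i * C + c
  len : s.nat 14 = (upd i).length
  off : s.nat 15 = off i
  ptr : s.nat 16 = p
  cell : s.nat 17 = c
  le_len : p ≤ (upd i).length
  le_cum : p ≤ cumCount h (upd i) c
  le_row : c ≤ C
  rows : ∀ i' < i, ∀ c' < C, s.natArr 5 (i' * C + c') = cumCount h (upd i') c'
  row : ∀ c' < c, s.natArr 5 (i * C + c') = cumCount h (upd i) c'

theorem runs_emitProgram {s : Memory} {i p c : ℕ} (hc : c < C) (h4 : s.nat 4 = 1)
    (hI : MergeInv C h upd off i p c s) (hp : p = cumCount h (upd i) c) :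
    Runs emitProgram s 4 (MergeInv C h upd off i p (c + 1)) := by
  refine Runs.block ?_
  have hne : ∀ i' < i, ∀ c' < C, i' * C + c' ≠ i * C + c := fun i' hi' c' hc' he => by
    have : (i' + 1) * C ≤ i * C := Nat.mul_le_mul_right C hi'
    rw [add_mul, one_mul] at this
    omega
  have hsim : ∀ q, (execs [store 5 13 16, add 13 13 4, add 17 17 4] s).natArr 5 q
      = if q = i * C + c then p else s.natArr 5 q := fun q => by
    simp [execs, exec_natArr, natArrVal, hI.pos, hI.ptr, Function.update_apply]
  constructor
  · simp [execs, exec_nat, natVal, hI.site]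
  · simp [execs, exec_nat, natVal, hI.pos, h4, add_assoc]
  · simp [execs, exec_nat, natVal, hI.len]
  · simp [execs, exec_nat, natVal, hI.off]
  · simp [execs, exec_nat, natVal, hI.ptr]
  · simp [execs, exec_nat, natVal, hI.cell, h4]
  · exact hI.le_len
  · exact hI.le_cum.trans (cumCount_mono h0 _ (Nat.le_succ c))
  · exact hc
  · intro i' hi' c' hc'
    rw [hsim, if_neg (hne i' hi' c' hc'), hI.rows i' hi' c' hc']
  · intro c' hc'
    rw [hsim]
    split_ifs with he
    · rw [hp, show c' = c by omega]
    · exact hI.row c' (by omega)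

include hsort

/-- Each step either consumes an update or completes an entry of the row. So the number of remaining
updates plus remaining entries decreases, and serves as the budget of the loop. -/
theorem runs_mergeStep {s : Memory} {i p c : ℕ} (hi : i < n) (hc : c < C) (h4 : s.nat 4 = 1)
    (h5 : s.real 5 = h) (hin : HoldsInput n upd off s) (hI : MergeInv C h upd off i p c s) :
    Runs mergeStep s 15 fun s' => ∃ p' c', (upd i).length - p' + (C - c') + 1
      ≤ (upd i).length - p + (C - c) ∧ MergeInv C h upd off i p' c' s' := by
  have hle := hI.le_cum.trans (cumCount_le_length h (upd i) c)
  refine (Runs.seq (B := 3) (B' := 12) (R := fun s' => s'.real 21 = c * h) (Runs.block ?_)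
    fun s₁ F₁ a21 => ?_).mono (by norm_num) fun _ _ h => h
  · simp [execs, exec_real, realVal, hI.cell, h5]
  have hI₁ : MergeInv C h upd off i p c s₁ :=
    ⟨(F₁.nat 12 rfl).trans hI.site, (F₁.nat 13 rfl).trans hI.pos, (F₁.nat 14 rfl).trans hI.len,
      (F₁.nat 15 rfl).trans hI.off, (F₁.nat 16 rfl).trans hI.ptr, (F₁.nat 17 rfl).trans hI.cell,
      hI.le_len, hI.le_cum, hI.le_row, by rw [F₁.natArr 5 rfl]; exact hI.rows,
      by rw [F₁.natArr 5 rfl]; exact hI.row⟩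
  have b4 : s₁.nat 4 = 1 := (F₁.nat 4 rfl).trans h4
  have btime := hin.time i hi
  rw [← F₁.realArr 0 rfl] at btime
  clear hI
  refine (Runs.ite (B := 10) (fun hlt => ?_) fun hlt => ?_).mono (by norm_num) fun _ _ h => h
  · have hlt' : s₁.nat 16 < s₁.nat 14 := hlt
    rw [hI₁.ptr, hI₁.len] at hlt'
    refine (Runs.seq (B := 3) (B' := 6) (R := fun s' => s'.real 22 = (upd i)[p].1) (Runs.block ?_)
      fun s₂ F₂ a22 => ?_).mono (by norm_num) fun _ _ h => h
    · simp [execs, exec_nat, exec_real, natVal, realVal, hI₁.off, hI₁.ptr, exec_realArr, realArrVal,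
        btime p hlt']
    have hI₂ : MergeInv C h upd off i p c s₂ :=
      ⟨(F₂.nat 12 rfl).trans hI₁.site, (F₂.nat 13 rfl).trans hI₁.pos, (F₂.nat 14 rfl).trans hI₁.len,
        (F₂.nat 15 rfl).trans hI₁.off, (F₂.nat 16 rfl).trans hI₁.ptr, (F₂.nat 17 rfl).trans hI₁.cell,
        hI₁.le_len, hI₁.le_cum, hI₁.le_row, by rw [F₂.natArr 5 rfl]; exact hI₁.rows,
        by rw [F₂.natArr 5 rfl]; exact hI₁.row⟩
    have c4 : s₂.nat 4 = 1 := (F₂.nat 4 rfl).trans b4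
    have c21 : s₂.real 21 = c * h := (F₂.real 21 rfl).trans a21
    have hiff := le_iff_lt_countP (hsort i hi) (c * h) hlt'
    refine (Runs.ite (B := 4) (fun hb => ?_) fun hb => ?_).mono (by norm_num) fun _ _ h => h
    · have hb' : s₂.real 22 ≤ s₂.real 21 := hb
      rw [a22, c21] at hb'
      have hcum : p + 1 ≤ cumCount h (upd i) c := hiff.1 hb'
      refine Runs.block ⟨p + 1, c, by omega, ?_⟩
      constructor
      · simp [execs, exec_nat, natVal, hI₂.site]
      · simp [execs, exec_nat, natVal, hI₂.pos]
      · simp [execs, exec_nat, natVal, hI₂.len]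
      · simp [execs, exec_nat, natVal, hI₂.off]
      · simp [execs, exec_nat, natVal, hI₂.ptr, c4]
      · simp [execs, exec_nat, natVal, hI₂.cell]
      · omega
      · exact hcum
      · exact hI₂.le_row
      · simpa [execs, exec_natArr, natArrVal] using hI₂.rows
      · simpa [execs, exec_natArr, natArrVal] using hI₂.row
    · have hb' : ¬ s₂.real 22 ≤ s₂.real 21 := hb
      rw [a22, c21] at hb'
      have hcum : cumCount h (upd i) c ≤ p := not_lt.1 (mt hiff.2 hb')
      exact (runs_emitProgram h0 hc c4 hI₂ (le_antisymm hI₂.le_cum hcum)).mono le_rfl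
        fun s' _ hs' => ⟨p, c + 1, by omega, hs'⟩
  · have hlt' : ¬ s₁.nat 16 < s₁.nat 14 := hlt
    rw [hI₁.ptr, hI₁.len, not_lt] at hlt'
    exact (runs_emitProgram h0 hc b4 hI₁ (le_antisymm hI₁.le_cum
      ((cumCount_le_length h (upd i) c).trans hlt'))).mono (by norm_num)
        fun s' _ hs' => ⟨p, c + 1, by omega, hs'⟩

/-- The merge reads every update once and writes every entry once. This is why the number of updates
enters the cost linearly and is not multiplied by the number of pairs. -/
theorem runs_tableProgram {s : Memory} (hn : s.nat 0 = n) (h4 : s.nat 4 = 1) (h8 : s.nat 8 = C)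
    (h5 : s.real 5 = h) (hin : HoldsInput n upd off s) :
    Runs tableProgram s (16 * ∑ i ∈ Finset.range n, (upd i).length + n * (16 * C + 20) + 10) fun s' =>
      ∀ i < n, ∀ c < C, s'.natArr 5 (i * C + c) = cumCount h (upd i) c := by
  refine (Runs.seq (B := 3) (R := fun s' => s'.nat 12 = 0 ∧ s'.nat 13 = 0) (Runs.block ?_)
    (B' := (∑ i ∈ Finset.range n, (16 * ((upd i).length + C) + 15 + 1)) + 1)
    fun s₁ F₁ ⟨a12, a13⟩ => ?_).mono ?_ fun _ _ h => h
  · simp [execs, exec_nat, natVal]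
  · have b0 : s₁.nat 0 = n := (F₁.nat 0 rfl).trans hn
    refine (Runs.count (x := 12) (y := 0) (p := rowProgram) n
      (fun i => 16 * ((upd i).length + C) + 15)
      (fun i s' => s'.nat 13 = i * C ∧ ∀ i' < i, ∀ c < C, s'.natArr 5 (i' * C + c) = cumCount h (upd i') c)
      rfl a12 b0 ⟨by simp [a13], by simp⟩ ?_).mono le_rfl fun _ _ h => h.2
    rintro i hi s₂ F₂ b12 ⟨b13, brows⟩
    have b4 : s₂.nat 4 = 1 := (F₂.nat 4 rfl).trans ((F₁.nat 4 rfl).trans h4)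
    have b8 : s₂.nat 8 = C := (F₂.nat 8 rfl).trans ((F₁.nat 8 rfl).trans h8)
    have b5 : s₂.real 5 = h := (F₂.real 5 rfl).trans ((F₁.real 5 rfl).trans h5)
    have bin : HoldsInput n upd off s₂ :=
      ⟨by rw [F₂.natArr 1 rfl, F₁.natArr 1 rfl]; exact hin.length,
        by rw [F₂.natArr 2 rfl, F₁.natArr 2 rfl]; exact hin.offset,
        by rw [F₂.realArr 0 rfl, F₁.realArr 0 rfl]; exact hin.time,
        by rw [F₂.natArr 3 rfl, F₁.natArr 3 rfl]; exact hin.spin⟩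
    refine (Runs.seq (B := 5) (R := MergeInv C h upd off i 0 0) (Runs.block ?_)
      (B' := 16 * ((upd i).length + C) + 5) fun s₃ F₃ hI => ?_).mono (by omega) fun _ _ h => h
    · constructor
      · simp [execs, exec_nat, natVal, b12]
      · simp [execs, exec_nat, natVal, b13]
      · simp [execs, exec_nat, natVal, b12, bin.length i hi]
      · simp [execs, exec_nat, natVal, exec_natArr, natArrVal, b12, bin.offset i hi]
      · simp [execs, exec_nat, natVal]
      · simp [execs, exec_nat, natVal]
      · exact Nat.zero_le _
      · exact Nat.zero_le _
      · exact Nat.zero_le _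
      · simpa [execs, exec_natArr, natArrVal] using brows
      · simp
    have c4 : s₃.nat 4 = 1 := (F₃.nat 4 rfl).trans b4
    have c8 : s₃.nat 8 = C := (F₃.nat 8 rfl).trans b8
    have c5 : s₃.real 5 = h := (F₃.real 5 rfl).trans b5
    have cin : HoldsInput n upd off s₃ :=
      ⟨by rw [F₃.natArr 1 rfl]; exact bin.length, by rw [F₃.natArr 2 rfl]; exact bin.offset,
        by rw [F₃.realArr 0 rfl]; exact bin.time, by rw [F₃.natArr 3 rfl]; exact bin.spin⟩
    have hloop := Runs.loop (b := .natLt 17 8) (p := mergeStep) (s := s₃)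
      (fun m s' => ∃ p c, m = 16 * ((upd i).length - p + (C - c)) ∧ MergeInv C h upd off i p c s')
      (m := 16 * ((upd i).length + C)) ⟨0, 0, by simp, hI⟩ ?_
    · refine (hloop.seq (B' := 2) fun s₄ F₄ ⟨hb, m, p, c, _, hI₄⟩ => Runs.block ?_).mono
        (by omega) fun _ _ h => h
      have hb' : ¬ s₄.nat 17 < s₄.nat 8 := hb
      rw [F₄.nat 8 rfl, c8, hI₄.cell] at hb'
      have hcC : c = C := le_antisymm hI₄.le_row (not_lt.1 hb')
      subst hcC
      refine ⟨?_, ?_, ?_⟩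
      · simp [execs, exec_nat, natVal, hI₄.site, (F₄.nat 4 rfl).trans c4]
      · simp [execs, exec_nat, natVal, hI₄.pos, add_mul]
      · intro i' hi' c' hc'
        simp only [execs, exec_natArr, natArrVal]
        rcases Nat.lt_succ_iff_lt_or_eq.1 hi' with h1 | rfl
        · exact hI₄.rows i' h1 c' hc'
        · exact hI₄.row c' hc'
    · rintro m s' F' ⟨p, c, rfl, hI'⟩ hb
      have hb' : s'.nat 17 < s'.nat 8 := hb
      rw [hI'.cell, F'.nat 8 rfl, c8] at hb'
      refine ⟨15, (runs_mergeStep h0 hsort hi hb' ((F'.nat 4 rfl).trans c4) ((F'.real 5 rfl).trans c5)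
        ⟨by rw [F'.natArr 1 rfl]; exact cin.length, by rw [F'.natArr 2 rfl]; exact cin.offset,
          by rw [F'.realArr 0 rfl]; exact cin.time, by rw [F'.natArr 3 rfl]; exact cin.spin⟩ hI').mono
        le_rfl fun s'' _ ⟨p', c', hm, hI''⟩ => ⟨_, ?_, p', c', rfl, hI''⟩⟩
      omega
  · have : ∑ i ∈ Finset.range n, (16 * ((upd i).length + C) + 15 + 1)
        = 16 * ∑ i ∈ Finset.range n, (upd i).length + n * (16 * C + 16) := by
      simp only [Finset.sum_add_distrib, ← Finset.mul_sum, Finset.sum_const, Finset.card_range,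
        smul_eq_mul]
      ring
    rw [this]
    have : n * (16 * C + 16) ≤ n * (16 * C + 20) := Nat.mul_le_mul_left _ (by omega)
    omega

end Table

/-! ### The program: the scan of a pair of sites -/

/-- The updates in an interval are a segment of the ordered list, cut at two cumulative counts.
Hence the table determines the lengths of the thirds and locates their spins. -/
theorem updatesIn_eq_take_drop {l : List (ℝ × Bool)} (hl : l.Pairwise fun u v => u.1 < v.1) {a b : ℝ}
    (hab : a ≤ b) : updatesIn l a b = (l.drop (l.countP fun u => decide (u.1 ≤ a))).take
      (l.countP (fun u => decide (u.1 ≤ b)) - l.countP fun u => decide (u.1 ≤ a)) := by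
  induction l with
  | nil => rfl
  | cons u l ih =>
    rw [List.pairwise_cons] at hl
    have hz : ∀ t < u.1, l.countP (fun v => decide (v.1 ≤ t)) = 0 := fun t ht => by
      rw [List.countP_eq_zero]
      intro v hv
      have := hl.1 v hv
      simp only [decide_eq_true_eq]; linarith
    have ih := ih hl.2
    unfold updatesIn at ih ⊢
    rcases le_or_gt u.1 a with h1 | h1
    · have h2 := h1.trans hab
      simp [h1, h2, not_lt.2 h1, ih]
    · rcases le_or_gt u.1 b with h2 | h2
      · simp [h1, h2, not_le.2 h1, ih, hz a h1]
      · rw [hz a h1, hz b h2] at ih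
        simp [not_le.2 h1, not_le.2 h2, ih, hz a h1, hz b h2]

section Cells

variable {l : List (ℝ × Bool)} (hl : l.Pairwise fun u v => u.1 < v.1) {L : ℝ} (hL : 0 < L) {r : ℕ}
  (hr : 1 ≤ r) (ℓ p : ℕ)
include hl hL hr

theorem third_eq_take_drop : third l L r ℓ p = (l.drop (cumCount (L / 3) l (3 * (ℓ + (r - 1)) + p))).take
    (cumCount (L / 3) l (3 * (ℓ + (r - 1)) + p + 1) - cumCount (L / 3) l (3 * (ℓ + (r - 1)) + p)) := by
  have h1 : ((ℓ : ℝ) + r - 1) * L + p * (L / 3) = ((3 * (ℓ + (r - 1)) + p : ℕ) : ℝ) * (L / 3) := by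
    push_cast [Nat.cast_sub hr]; ring
  have h2 : ((ℓ : ℝ) + r - 1) * L + (p + 1) * (L / 3)
      = ((3 * (ℓ + (r - 1)) + p + 1 : ℕ) : ℝ) * (L / 3) := by
    push_cast [Nat.cast_sub hr]; ring
  rw [third, h1, h2, updatesIn_eq_take_drop hl]
  · rfl
  · exact mul_le_mul_of_nonneg_right (by exact_mod_cast Nat.le_succ _) (by positivity)

theorem length_third : (third l L r ℓ p).length
    = cumCount (L / 3) l (3 * (ℓ + (r - 1)) + p + 1) - cumCount (L / 3) l (3 * (ℓ + (r - 1)) + p) := by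
  have := cumCount_le_length (L / 3) l (3 * (ℓ + (r - 1)) + p + 1)
  rw [third_eq_take_drop hl hL hr, List.length_take, List.length_drop]
  omega

theorem indicator_third {m : ℕ} (hm : m < (third l L r ℓ p).length) :
    ∃ h : cumCount (L / 3) l (3 * (ℓ + (r - 1)) + p) + m < l.length, indicator (third l L r ℓ p) m
      = (l[cumCount (L / 3) l (3 * (ℓ + (r - 1)) + p) + m].2.toNat : ℝ) := by
  have h1 := cumCount_le_length (L / 3) l (3 * (ℓ + (r - 1)) + p + 1)
  have hm' := hm
  rw [length_third hl hL hr] at hm'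
  have hlt : cumCount (L / 3) l (3 * (ℓ + (r - 1)) + p) + m < l.length := by omega
  refine ⟨hlt, ?_⟩
  rw [indicator, third_eq_take_drop hl hL hr, List.getElem?_take_of_lt hm', List.getElem?_drop,
    List.getElem?_eq_getElem hlt]
  cases h : (l[cumCount (L / 3) l (3 * (ℓ + (r - 1)) + p) + m]).2 <;> simp [h]

end Cells

/-- Load the entries of the table at the ends of the three cells. -/
def loadProgram : Program := block
  [load 25 5 23, add 38 23 4, load 26 5 38, add 38 38 4, load 27 5 38, add 38 38 4, load 28 5 38,
    load 29 5 24, add 38 24 4, load 30 5 38, add 38 38 4, load 31 5 38, add 38 38 4, load 32 5 38]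

/-- A number that vanishes iff the block is a stop. -/
def defectProgram : Program := block
  [sub 33 26 25, sub 33 36 33, sub 38 30 29, add 33 33 38, sub 38 27 26, add 33 33 38, sub 38 31 30,
    sub 38 4 38, add 33 33 38, sub 38 28 27, sub 38 36 38, add 33 33 38, sub 38 32 31, add 33 33 38,
    sub 38 21 20, add 33 33 38]

/-- Add the statistic to the sum. -/
def statisticProgram : Program := block
  [add 38 18 25, load 39 3 38, cast 22 39, add 38 38 4, load 39 3 38, cast 23 39, add 38 18 27,
    load 39 3 38, cast 24 39, add 38 38 4, load 39 3 38, cast 25 39, rmul 23 22 23, rmul 22 7 22,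
    rmul 22 22 24, rsub 23 23 22, rmul 24 24 25, radd 23 23 24, radd 21 21 23]

/-- What is done at a stop. -/
def hitProgram : Program :=
  .seq (.ite (.natLt 22 5) statisticProgram (block [])) (block [add 22 22 4, add 21 20 6])

/-- One step of the scan. -/
def scanStep : Program :=
  .seq (.seq loadProgram defectProgram) (.seq (.ite (.natLt 3 33) (block []) hitProgram)
    (block [add 20 20 4, add 23 23 35, add 24 24 35]))

/-- The memory holds the parameters, the input, and the table. -/
structure Ready (n C : ℕ) (L κ : ℝ) (M r K : ℕ) (upd : ℕ → List (ℝ × Bool)) (off : ℕ → ℕ)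
    (s : Memory) : Prop where
  sites : s.nat 0 = n
  zero : s.nat 3 = 0
  one : s.nat 4 = 1
  samples : s.nat 5 = M
  blockLength : s.nat 6 = r
  rowLength : s.nat 8 = C
  indexBound : s.nat 9 = K
  three : s.nat 35 = 3
  two : s.nat 36 = 2
  base : s.nat 37 = 3 * (r - 1)
  threshold : s.real 4 = κ
  rone : s.real 6 = 1
  rtwo : s.real 7 = 2
  offset : ∀ i < n, s.natArr 2 i = off i
  spin : ∀ i < n, ∀ m (hm : m < (upd i).length), s.natArr 3 (off i + m) = (upd i)[m].2.toNat
  table : ∀ i < n, ∀ c < C, s.natArr 5 (i * C + c) = cumCount (L / 3) (upd i) c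

/-- The program does not write to the registers and arrays that `Ready` is about. -/
def Program.keepsReady (p : Program) : Bool :=
  !(p.any (writesNat 0) || p.any (writesNat 3) || p.any (writesNat 4) || p.any (writesNat 5) ||
    p.any (writesNat 6) || p.any (writesNat 8) || p.any (writesNat 9) || p.any (writesNat 35) ||
    p.any (writesNat 36) || p.any (writesNat 37) || p.any (writesReal 4) || p.any (writesReal 6) ||
    p.any (writesReal 7) || p.any (writesNatArr 2) || p.any (writesNatArr 3) || p.any (writesNatArr 5))

section Scan

variable {n C : ℕ} {L κ : ℝ} {M r K : ℕ} {upd : ℕ → List (ℝ × Bool)} {off : ℕ → ℕ}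

/-- For a concrete program the condition `hp` is checked by evaluation, through its default proof.
-/
theorem Ready.of_frame {p : Program} {s s' : Memory} (h : Ready n C L κ M r K upd off s)
    (hF : Frame p s s') (hp : p.keepsReady = true := by rfl) : Ready n C L κ M r K upd off s' := by
  simp only [Program.keepsReady, Bool.not_eq_true', Bool.or_eq_false_iff] at hp
  obtain ⟨⟨⟨⟨⟨⟨⟨⟨⟨⟨⟨⟨⟨⟨⟨p0, p3⟩, p4⟩, p5⟩, p6⟩, p8⟩, p9⟩, p35⟩, p36⟩, p37⟩, q4⟩, q6⟩, q7⟩, a2⟩, a3⟩, a5⟩ := hp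
  constructor
  · rw [hF.nat 0 p0, h.sites]
  · rw [hF.nat 3 p3, h.zero]
  · rw [hF.nat 4 p4, h.one]
  · rw [hF.nat 5 p5, h.samples]
  · rw [hF.nat 6 p6, h.blockLength]
  · rw [hF.nat 8 p8, h.rowLength]
  · rw [hF.nat 9 p9, h.indexBound]
  · rw [hF.nat 35 p35, h.three]
  · rw [hF.nat 36 p36, h.two]
  · rw [hF.nat 37 p37, h.base]
  · rw [hF.real 4 q4, h.threshold]
  · rw [hF.real 6 q6, h.rone]
  · rw [hF.real 7 q7, h.rtwo]
  · rw [hF.natArr 2 a2]; exact h.offset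
  · rw [hF.natArr 3 a3]; exact h.spin
  · rw [hF.natArr 5 a5]; exact h.table

open Classical in
/-- The sum of the statistic over the first `M` stops before `ℓ`. -/
noncomputable def scanSum (li lj : List (ℝ × Bool)) (L : ℝ) (r M ℓ : ℕ) : ℝ :=
  ∑ ℓ' ∈ Finset.range ℓ, if Hit (Pattern li lj L r) r ℓ' ∧ (greedy (Pattern li lj L r) r ℓ').2 < M
    then statistic li L r ℓ' else 0

/-- The invariant of the scan. -/
structure ScanInv (C : ℕ) (L : ℝ) (M r : ℕ) (upd : ℕ → List (ℝ × Bool)) (i j ℓ : ℕ) (s : Memory) :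
    Prop where
  next : s.nat 21 = (greedy (Pattern (upd i) (upd j) L r) r ℓ).1
  count : s.nat 22 = (greedy (Pattern (upd i) (upd j) L r) r ℓ).2
  rowi : s.nat 23 = i * C + 3 * (ℓ + (r - 1))
  rowj : s.nat 24 = j * C + 3 * (ℓ + (r - 1))
  sum : s.real 21 = scanSum (upd i) (upd j) L r M ℓ

variable (hL : 0 < L) (hr : 1 ≤ r) (hsort : ∀ i < n, (upd i).Pairwise fun u v => u.1 < v.1)
include hL hr hsort

/-- The stop condition in terms of the table. -/
theorem hit_iff_defect {i j ℓ : ℕ} (hi : i < n) (hj : j < n) (a b : ℕ → ℕ)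
    (ha : ∀ p < 4, a p = cumCount (L / 3) (upd i) (3 * (ℓ + (r - 1)) + p))
    (hb : ∀ p < 4, b p = cumCount (L / 3) (upd j) (3 * (ℓ + (r - 1)) + p)) :
    Hit (Pattern (upd i) (upd j) L r) r ℓ ↔
      ¬ 0 < 2 - (a 1 - a 0) + (b 1 - b 0) + (a 2 - a 1) + (1 - (b 2 - b 1)) + (2 - (a 3 - a 2))
        + (b 3 - b 2) + ((greedy (Pattern (upd i) (upd j) L r) r ℓ).1 - ℓ) := by
  have hi := hsort i hi
  have hj := hsort j hj
  unfold Hit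
  generalize (greedy (Pattern (upd i) (upd j) L r) r ℓ).1 = g
  simp only [Pattern, ← List.length_eq_zero_iff, length_third hi hL hr, length_third hj hL hr,
    add_assoc, Nat.reduceAdd, ← ha 0 (by omega), ← ha 1 (by omega), ← ha 2 (by omega),
    ← ha 3 (by omega), ← hb 0 (by omega), ← hb 1 (by omega), ← hb 2 (by omega), ← hb 3 (by omega)]
  -- With truncated subtraction each summand is the shortfall in one condition, and a sum of natural
  -- numbers vanishes iff all summands do.
  omega

variable (hC : ∀ ℓ < K, 3 * (ℓ + (r - 1)) + 3 < C)
include hC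

/-- Eight entries of the table decide whether there is a stop, and two of them locate the four
spins. So the cost is constant, however many updates the window contains. -/
theorem runs_scanStep {i j ℓ : ℕ} (hi : i < n) (hj : j < n) (hℓ : ℓ < K) {s : Memory}
    (hR : Ready n C L κ M r K upd off s) (h18 : s.nat 18 = off i) (h20 : s.nat 20 = ℓ)
    (hI : ScanInv C L M r upd i j ℓ s) :
    Runs scanStep s 61 fun s' => s'.nat 20 = ℓ + 1 ∧ ScanInv C L M r upd i j (ℓ + 1) s' := by
  have hCℓ := hC ℓ hℓ
  have hti : ∀ p < 4, s.natArr 5 (i * C + 3 * (ℓ + (r - 1)) + p)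
      = cumCount (L / 3) (upd i) (3 * (ℓ + (r - 1)) + p) := fun p hp => by
    rw [add_assoc, hR.table i hi _ (by omega)]
  have htj : ∀ p < 4, s.natArr 5 (j * C + 3 * (ℓ + (r - 1)) + p)
      = cumCount (L / 3) (upd j) (3 * (ℓ + (r - 1)) + p) := fun p hp => by
    rw [add_assoc, hR.table j hj _ (by omega)]
  obtain ⟨a, ha⟩ : ∃ a : ℕ → ℕ, a = fun p => cumCount (L / 3) (upd i) (3 * (ℓ + (r - 1)) + p) := ⟨_, rfl⟩
  obtain ⟨b, hb⟩ : ∃ b : ℕ → ℕ, b = fun p => cumCount (L / 3) (upd j) (3 * (ℓ + (r - 1)) + p) := ⟨_, rfl⟩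
  have hiff := hit_iff_defect hL hr hsort (ℓ := ℓ) hi hj a b (fun p _ => by rw [ha])
    fun p _ => by rw [hb]
  have hload : Runs loadProgram s 15 fun s' => s'.nat 25 = a 0 ∧ s'.nat 26 = a 1 ∧ s'.nat 27 = a 2 ∧
      s'.nat 28 = a 3 ∧ s'.nat 29 = b 0 ∧ s'.nat 30 = b 1 ∧ s'.nat 31 = b 2 ∧ s'.nat 32 = b 3 := by
    refine Runs.block ?_
    have e0 := hti 0 (by omega)
    have f0 := htj 0 (by omega)
    have e1 := hti 1 (by omega)
    have f1 := htj 1 (by omega)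
    have e2 := hti 2 (by omega)
    have f2 := htj 2 (by omega)
    have e3 := hti 3 (by omega)
    have f3 := htj 3 (by omega)
    rw [add_zero] at e0 f0
    simp [execs, exec_nat, exec_natArr, natVal, natArrVal, hI.rowi, hI.rowj, hR.one, ha, hb, e0, f0,
      add_assoc]
    simp only [← add_assoc, e1, e2, e3, f1, f2, f3]
    simp
  have hdefect : Runs (.seq loadProgram defectProgram) s 32 fun s' =>
      (s'.nat 25 = a 0 ∧ s'.nat 26 = a 1 ∧ s'.nat 27 = a 2 ∧ s'.nat 28 = a 3) ∧
      s'.nat 33 = 2 - (a 1 - a 0) + (b 1 - b 0) + (a 2 - a 1) + (1 - (b 2 - b 1)) + (2 - (a 3 - a 2))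
        + (b 3 - b 2) + ((greedy (Pattern (upd i) (upd j) L r) r ℓ).1 - ℓ) := by
    refine hload.seq (B' := 17) fun s₁ F₁ ⟨a25, a26, a27, a28, a29, a30, a31, a32⟩ => Runs.block ?_
    have R₁ := hR.of_frame F₁
    have b20 := (F₁.nat 20 rfl).trans h20
    have b21 := (F₁.nat 21 rfl).trans hI.next
    simp [execs, exec_nat, natVal, a25, a26, a27, a28, a29, a30, a31, a32, R₁.one, R₁.two, b20, b21]
  refine (hdefect.seq (B' := 29) (Q := fun s' => s'.nat 20 = ℓ + 1 ∧
    ScanInv C L M r upd i j (ℓ + 1) s') ?_).mono le_rfl fun _ _ h => h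
  rintro s₂ F₂ ⟨⟨a25, a26, a27, a28⟩, a33⟩
  have R₂ := hR.of_frame F₂
  have b18 := (F₂.nat 18 rfl).trans h18
  have b20 := (F₂.nat 20 rfl).trans h20
  have hI₂ : ScanInv C L M r upd i j ℓ s₂ :=
    ⟨(F₂.nat 21 rfl).trans hI.next, (F₂.nat 22 rfl).trans hI.count, (F₂.nat 23 rfl).trans hI.rowi,
      (F₂.nat 24 rfl).trans hI.rowj, (F₂.real 21 rfl).trans hI.sum⟩
  have hbranch : Runs (.ite (.natLt 3 33) (block []) hitProgram) s₂ 25 fun s' =>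
      s'.nat 21 = (greedy (Pattern (upd i) (upd j) L r) r (ℓ + 1)).1 ∧
      s'.nat 22 = (greedy (Pattern (upd i) (upd j) L r) r (ℓ + 1)).2 ∧
      s'.real 21 = scanSum (upd i) (upd j) L r M (ℓ + 1) := by
    refine Runs.ite (B := 24) (fun hlt => ?_) fun hlt => ?_
    · have hlt' : s₂.nat 3 < s₂.nat 33 := hlt
      rw [R₂.zero, a33] at hlt'
      have hnot := fun h => hiff.1 h hlt'
      refine Runs.block ?_
      rw [greedy_succ_of_not_hit hnot, scanSum, Finset.sum_range_succ, if_neg fun h => hnot h.1]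
      simp [execs, exec_nat, exec_real, natVal, realVal, hI₂.next, hI₂.count, hI₂.sum, scanSum]
    · have hlt' : ¬ s₂.nat 3 < s₂.nat 33 := hlt
      rw [R₂.zero, a33] at hlt'
      have hhit := hiff.2 hlt'
      have hstat : Runs (.ite (.natLt 22 5) statisticProgram (block [])) s₂ 21 fun s' =>
          s'.real 21 = scanSum (upd i) (upd j) L r M (ℓ + 1) := by
        refine Runs.ite (B := 20) (fun hlt => ?_) fun hlt => ?_
        · have hlt' : s₂.nat 22 < s₂.nat 5 := hlt
          rw [hI₂.count, R₂.samples] at hlt'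
          have hp := hhit.2
          obtain ⟨h00, e00⟩ := indicator_third (hsort i hi) hL hr ℓ 0 (m := 0) (by have := hp.1.1; omega)
          obtain ⟨h01, e01⟩ := indicator_third (hsort i hi) hL hr ℓ 0 (m := 1) (by have := hp.1.1; omega)
          obtain ⟨h20, e20⟩ := indicator_third (hsort i hi) hL hr ℓ 2 (m := 0) (by have := hp.2.2.1; omega)
          obtain ⟨h21, e21⟩ := indicator_third (hsort i hi) hL hr ℓ 2 (m := 1) (by have := hp.2.2.1; omega)
          have ea0 : cumCount (L / 3) (upd i) (3 * (ℓ + (r - 1)) + 0) = a 0 := by rw [ha]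
          have ea2 : cumCount (L / 3) (upd i) (3 * (ℓ + (r - 1)) + 2) = a 2 := by rw [ha]
          rw [← R₂.spin i hi, ea0, add_zero] at e00
          rw [← R₂.spin i hi, ea0, ← add_assoc] at e01
          rw [← R₂.spin i hi, ea2, add_zero] at e20
          rw [← R₂.spin i hi, ea2, ← add_assoc] at e21
          refine Runs.block ?_
          rw [scanSum, Finset.sum_range_succ, if_pos ⟨hhit, hlt'⟩, statistic, e00, e01, e20, e21]
          simp [execs, exec_nat, exec_real, exec_natArr, natVal, realVal, natArrVal, hI₂.sum, scanSum,
            a25, a27, b18, R₂.one, R₂.rtwo]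
        · have hlt' : ¬ s₂.nat 22 < s₂.nat 5 := hlt
          rw [hI₂.count, R₂.samples] at hlt'
          refine Runs.block ?_
          rw [scanSum, Finset.sum_range_succ, if_neg fun h => hlt' h.2]
          simp [execs, exec_real, realVal, hI₂.sum, scanSum]
      refine hstat.seq (B' := 3) fun s₃ F₃ c21 => Runs.block ?_
      rw [greedy_succ_of_hit hhit]
      have R₃ := R₂.of_frame F₃
      have c20 := (F₃.nat 20 rfl).trans b20
      have c22 := (F₃.nat 22 rfl).trans hI₂.count
      simp [execs, exec_nat, exec_real, natVal, realVal, c20, c22, c21, R₃.one, R₃.blockLength]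
  refine (hbranch.seq (B' := 4) fun s₃ F₃ ⟨c21, c22, d21⟩ => Runs.block ?_)
  have R₃ := R₂.of_frame F₃
  have c20 := (F₃.nat 20 rfl).trans b20
  have c23 := (F₃.nat 23 rfl).trans hI₂.rowi
  have c24 := (F₃.nat 24 rfl).trans hI₂.rowj
  refine ⟨?_, ?_, ?_, ?_, ?_, ?_⟩ <;>
    simp [execs, exec_nat, exec_real, natVal, realVal, c20, c21, c22, c23, c24, d21, R₃.one, R₃.three]
  · ring
  · ring

end Scan

/-- Accept the pair in the registers `14` and `15` if the sum is large enough. -/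
def decideProgram : Program :=
  .ite (.natLt 22 5) (block [const 19 0])
    (.seq (block [cast 22 5, rdiv 22 6 22, rmul 22 22 21])
      (.ite (.realLe 4 22) (block [store 4 14 4, store 4 15 4]) (block [])))

/-- The decision about a pair of sites. -/
def pairStep : Program :=
  .seq (block [const 20 0, add 21 6 3, const 22 0, add 23 16 3, add 24 17 3, rsub 21 6 6])
    (.seq (.loop (.natLt 20 9) scanStep) decideProgram)

/-- The scan of the pair finds `M` stops. -/
def ScanEnough (li lj : List (ℝ × Bool)) (L : ℝ) (r M K : ℕ) : Prop :=
  M ≤ (greedy (Pattern li lj L r) r K).2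

/-- The scan of the pair finds `M` stops, and the average of the statistic is large. -/
def ScanAccept (li lj : List (ℝ × Bool)) (L κ : ℝ) (r M K : ℕ) : Prop :=
  ScanEnough li lj L r M K ∧ κ ≤ 1 / (M : ℝ) * scanSum li lj L r M K

section Pairs

variable {n C : ℕ} {L κ : ℝ} {M r K : ℕ} {upd : ℕ → List (ℝ × Bool)} {off : ℕ → ℕ}
  (hL : 0 < L) (hr : 1 ≤ r) (hsort : ∀ i < n, (upd i).Pairwise fun u v => u.1 < v.1)
  (hC : ∀ ℓ < K, 3 * (ℓ + (r - 1)) + 3 < C)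
include hL hr hsort hC

open Classical in
theorem runs_pairStep {i j : ℕ} (hi : i < n) (hj : j < n) {s : Memory}
    (hR : Ready n C L κ M r K upd off s) (h16 : s.nat 16 = i * C + 3 * (r - 1))
    (h17 : s.nat 17 = j * C + 3 * (r - 1)) (h18 : s.nat 18 = off i) :
    Runs pairStep s (62 * K + 30) fun s' =>
      s'.nat 19 = (if ScanEnough (upd i) (upd j) L r M K then s.nat 19 else 0) ∧
      s'.natArr 4 = if ScanAccept (upd i) (upd j) L κ r M K then
        Function.update (Function.update (s.natArr 4) (s.nat 14) 1) (s.nat 15) 1 else s.natArr 4 := by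
  have hinit : Runs (block [const 20 0, add 21 6 3, const 22 0, add 23 16 3, add 24 17 3, rsub 21 6 6])
      s 7 fun s' => s'.nat 20 = 0 ∧ ScanInv C L M r upd i j 0 s' := by
    refine Runs.block ⟨?_, ?_, ?_, ?_, ?_, ?_⟩ <;>
      simp [execs, exec_nat, exec_real, natVal, realVal, hR.blockLength, hR.zero, hR.rone, h16, h17,
        greedy, scanSum]
  refine (hinit.seq (B' := 62 * K + 20) (Q := _) fun s₁ F₁ ⟨a20, hI⟩ => ?_).mono (by omega)
    fun _ _ h => h
  have R₁ := hR.of_frame F₁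
  have hscan := Runs.count (x := 20) (y := 9) (p := scanStep) K (fun _ => 61)
    (fun ℓ s' => ScanInv C L M r upd i j ℓ s') rfl a20 R₁.indexBound hI fun ℓ hℓ s' F hx hJ =>
      runs_scanStep hL hr hsort hC hi hj hℓ (R₁.of_frame F)
        ((F.nat 18 rfl).trans ((F₁.nat 18 rfl).trans h18)) hx hJ
  refine (hscan.seq (B' := 15) (Q := _) fun s₂ F₂ hI₂ => ?_).mono
    (by simp only [Finset.sum_const, Finset.card_range, smul_eq_mul]; omega) fun _ _ h => h
  have R₂ := R₁.of_frame F₂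
  have b19 : s₂.nat 19 = s.nat 19 := (F₂.nat 19 rfl).trans (F₁.nat 19 rfl)
  have b14 : s₂.nat 14 = s.nat 14 := (F₂.nat 14 rfl).trans (F₁.nat 14 rfl)
  have b15 : s₂.nat 15 = s.nat 15 := (F₂.nat 15 rfl).trans (F₁.nat 15 rfl)
  have b4 : s₂.natArr 4 = s.natArr 4 := (F₂.natArr 4 rfl).trans (F₁.natArr 4 rfl)
  refine Runs.ite (B := 14) (fun hlt => ?_) fun hlt => ?_
  · have hlt' : s₂.nat 22 < s₂.nat 5 := hlt
    rw [hI₂.count, R₂.samples] at hlt'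
    have hnot : ¬ ScanEnough (upd i) (upd j) L r M K := not_le.2 hlt'
    rw [if_neg hnot, if_neg fun h : ScanAccept _ _ _ _ _ _ _ => hnot h.1]
    refine Runs.block ?_
    simp [execs, exec_nat, exec_natArr, natVal, natArrVal, b4]
  · have hlt' : ¬ s₂.nat 22 < s₂.nat 5 := hlt
    rw [hI₂.count, R₂.samples, not_lt] at hlt'
    rw [if_pos (show ScanEnough (upd i) (upd j) L r M K from hlt')]
    have havg : Runs (block [cast 22 5, rdiv 22 6 22, rmul 22 22 21]) s₂ 4 fun s' =>
        s'.real 22 = 1 / (M : ℝ) * scanSum (upd i) (upd j) L r M K := by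
      refine Runs.block ?_
      simp [execs, exec_real, realVal, R₂.samples, R₂.rone, hI₂.sum]
    refine (havg.seq (B' := 10) (Q := _) fun s₃ F₃ c22 => ?_)
    have R₃ := R₂.of_frame F₃
    have c19 := (F₃.nat 19 rfl).trans b19
    have c14 := (F₃.nat 14 rfl).trans b14
    have c15 := (F₃.nat 15 rfl).trans b15
    have c4 := (F₃.natArr 4 rfl).trans b4
    refine Runs.ite (B := 9) (fun hle => ?_) fun hle => ?_
    · have hle' : s₃.real 4 ≤ s₃.real 22 := hle
      rw [c22, R₃.threshold] at hle'
      rw [if_pos (show ScanAccept (upd i) (upd j) L κ r M K from ⟨hlt', hle'⟩)]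
      refine Runs.block ?_
      simp [execs, exec_nat, exec_natArr, natVal, natArrVal, c4, c14, c15, c19, R₃.one]
    · have hle' : ¬ s₃.real 4 ≤ s₃.real 22 := hle
      rw [c22, R₃.threshold] at hle'
      rw [if_neg fun h : ScanAccept (upd i) (upd j) L κ r M K => hle' h.2]
      refine Runs.block ?_
      simp [execs, exec_nat, exec_natArr, natVal, natArrVal, c4, c19]

end Pairs

/-! ### The program: all pairs of sites -/

/-- Scan the pair if it is increasing, and go to the next pair of the same row. -/
def innerStep : Program :=
  .seq (.ite (.natLt 12 13) pairStep (block []))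
    (block [add 13 13 4, add 14 14 4, add 15 15 0, add 17 17 8])

/-- One row of pairs. -/
def siteStep : Program :=
  .seq (block [load 18 2 12, const 13 0, add 15 12 3, add 17 37 3])
    (.seq (.loop (.natLt 13 0) innerStep) (block [add 12 12 4, add 16 16 8]))

/-- The initialization of the loop over all pairs. -/
def pairInit : Program := block
  [const 12 0, const 14 0, const 19 1, const 35 3, const 36 2, sub 37 6 4, add 38 37 37, add 37 38 37,
    add 16 37 3]

/-- The pair `(a, b)` comes before the pair `(i, j)`. -/
def PairBefore (i j a b : ℕ) : Prop := a < i ∨ (a = i ∧ b < j)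

open Classical in
/-- The result for the pairs before `(i, j)`: register `19` tells whether all of them satisfy `E`,
and the array `4` is the adjacency matrix of those which satisfy `A`. -/
structure ResultInv (n : ℕ) (E A : ℕ → ℕ → Prop) (i j : ℕ) (s : Memory) : Prop where
  ok : s.nat 19 = if ∀ a b, a < b → b < n → PairBefore i j a b → E a b then 1 else 0
  adj : ∀ a b, a < b → b < n →
    s.natArr 4 (a * n + b) = (if PairBefore i j a b ∧ A a b then 1 else 0) ∧
    s.natArr 4 (b * n + a) = (if PairBefore i j a b ∧ A a b then 1 else 0)
  diag : ∀ a < n, s.natArr 4 (a * n + a) = 0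

theorem rowIndex_inj {n a b i j : ℕ} (hb : b < n) (hj : j < n) (h : a * n + b = i * n + j) :
    a = i ∧ b = j := by
  have h1 : (a * n + b) / n = (i * n + j) / n := by rw [h]
  rw [mul_comm a, mul_comm i, Nat.mul_add_div (by omega), Nat.mul_add_div (by omega),
    Nat.div_eq_of_lt hb, Nat.div_eq_of_lt hj] at h1
  obtain rfl : a = i := by omega
  exact ⟨rfl, by omega⟩

section Result

variable {n : ℕ} {E A : ℕ → ℕ → Prop} {i j i' j' : ℕ} {s s' : Memory}

open Classical in
theorem ResultInv.congr (h : ResultInv n E A i j s) (h19 : s'.nat 19 = s.nat 19)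
    (h4 : s'.natArr 4 = s.natArr 4)
    (hb : ∀ a b, a < b → b < n → (PairBefore i j a b ↔ PairBefore i' j' a b)) :
    ResultInv n E A i' j' s' := by
  constructor
  · rw [h19, h.ok]
    refine if_congr (forall₄_congr fun a b h1 h2 => ?_) rfl rfl
    rw [hb a b h1 h2]
  · intro a b h1 h2
    rw [h4]
    simpa only [hb a b h1 h2] using h.adj a b h1 h2
  · rw [h4]; exact h.diag

-- The two entries written for the pair do not collide with those of any other pair or with the
-- diagonal, because row-by-row addresses are injective.
open Classical in
theorem ResultInv.step (h : ResultInv n E A i j s) (hij : i < j) (hj : j < n)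
    (h19 : s'.nat 19 = if E i j then s.nat 19 else 0)
    (h4 : s'.natArr 4 = if A i j then
      Function.update (Function.update (s.natArr 4) (i * n + j) 1) (j * n + i) 1 else s.natArr 4) :
    ResultInv n E A i (j + 1) s' := by
  have hsucc : ∀ a b, PairBefore i (j + 1) a b ↔ PairBefore i j a b ∨ (a = i ∧ b = j) := fun a b => by
    unfold PairBefore; omega
  have hval : ∀ q, s'.natArr 4 q
      = if A i j ∧ (q = i * n + j ∨ q = j * n + i) then 1 else s.natArr 4 q := fun q => by
    rw [h4]
    by_cases hA : A i j
    · by_cases h1 : q = j * n + i <;> by_cases h2 : q = i * n + j <;>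
        simp [hA, h1, h2, Function.update_apply]
    · simp [hA]
  constructor
  · rw [h19, h.ok]
    by_cases hE : E i j
    · rw [if_pos hE]
      refine if_congr (forall₄_congr fun a b h1 h2 => ?_) rfl rfl
      rw [hsucc]
      refine ⟨fun h3 h4 => h4.elim h3 fun h5 => by rw [h5.1, h5.2]; exact hE, fun h3 h4 => h3 (.inl h4)⟩
    · rw [if_neg hE, if_neg fun h3 => hE (h3 i j hij hj ((hsucc i j).2 (.inr ⟨rfl, rfl⟩)))]
  · intro a b h1 h2
    by_cases hab : a = i ∧ b = j
    · obtain ⟨rfl, rfl⟩ := hab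
      have hnot : ¬ PairBefore a b a b := by unfold PairBefore; omega
      have := h.adj a b h1 h2
      simp only [hnot, false_and, if_false] at this
      rw [hval, hval, this.1, this.2]
      have hs : PairBefore a (b + 1) a b := (hsucc a b).2 (.inr ⟨rfl, rfl⟩)
      simp [hs]
    · have n1 : a * n + b ≠ i * n + j := fun h => hab (rowIndex_inj h2 hj h)
      have n2 : a * n + b ≠ j * n + i := fun h => by have := rowIndex_inj h2 (hij.trans hj) h; omega
      have n3 : b * n + a ≠ i * n + j := fun h => by have := rowIndex_inj (h1.trans h2) hj h; omega
      have n4 : b * n + a ≠ j * n + i := fun h => by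
        have := rowIndex_inj (h1.trans h2) (hij.trans hj) h; omega
      have := h.adj a b h1 h2
      rw [hval, hval, this.1, this.2]
      simp [n1, n2, n3, n4, hsucc, hab]
  · intro a ha
    have n1 : a * n + a ≠ i * n + j := fun h => by have := rowIndex_inj ha hj h; omega
    have n2 : a * n + a ≠ j * n + i := fun h => by have := rowIndex_inj ha (hij.trans hj) h; omega
    rw [hval, h.diag a ha]
    simp [n1, n2]

end Result

section Pairs

variable {n C : ℕ} {L κ : ℝ} {M r K : ℕ} {upd : ℕ → List (ℝ × Bool)} {off : ℕ → ℕ}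
  (hL : 0 < L) (hr : 1 ≤ r) (hsort : ∀ i < n, (upd i).Pairwise fun u v => u.1 < v.1)
  (hC : ∀ ℓ < K, 3 * (ℓ + (r - 1)) + 3 < C)
include hL hr hsort hC

/-- The result of the scan of all pairs before `(i, j)`. -/
def ScanResult (n : ℕ) (L κ : ℝ) (M r K : ℕ) (upd : ℕ → List (ℝ × Bool)) : ℕ → ℕ → Memory → Prop :=
  ResultInv n (fun a b => ScanEnough (upd a) (upd b) L r M K)
    fun a b => ScanAccept (upd a) (upd b) L κ r M K

theorem runs_innerStep {i j : ℕ} (hi : i < n) (hj : j < n) {s : Memory}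
    (hR : Ready n C L κ M r K upd off s) (h12 : s.nat 12 = i) (h13 : s.nat 13 = j)
    (h14 : s.nat 14 = i * n + j) (h15 : s.nat 15 = j * n + i) (h16 : s.nat 16 = i * C + 3 * (r - 1))
    (h17 : s.nat 17 = j * C + 3 * (r - 1)) (h18 : s.nat 18 = off i)
    (hI : ScanResult n L κ M r K upd i j s) :
    Runs innerStep s (62 * K + 36) fun s' => s'.nat 13 = j + 1 ∧ s'.nat 14 = i * n + (j + 1) ∧
      s'.nat 15 = (j + 1) * n + i ∧ s'.nat 17 = (j + 1) * C + 3 * (r - 1) ∧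
      ScanResult n L κ M r K upd i (j + 1) s' := by
  have hbranch : Runs (.ite (.natLt 12 13) pairStep (block [])) s (62 * K + 31)
      (ScanResult n L κ M r K upd i (j + 1)) := by
    refine (Runs.ite (B := 62 * K + 30) (fun hlt => ?_) fun hlt => ?_).mono (by omega) fun _ _ h => h
    · have hlt' : s.nat 12 < s.nat 13 := hlt
      rw [h12, h13] at hlt'
      refine (runs_pairStep hL hr hsort hC hi hj hR h16 h17 h18).mono le_rfl fun s' _ ⟨e1, e2⟩ => ?_
      rw [h14, h15] at e2
      exact hI.step hlt' hj e1 e2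
    · have hlt' : ¬ s.nat 12 < s.nat 13 := hlt
      rw [h12, h13] at hlt'
      refine (Runs.block (B := 1) (l := []) (Q := ScanResult n L κ M r K upd i (j + 1)) ?_).mono
        (by omega) fun _ _ h => h
      -- For `j ≤ i` no increasing pair lies between `(i, j)` and `(i, j + 1)`, so skipping the pair
      -- keeps the invariant.
      refine hI.congr (by simp [execs, exec_nat, natVal]) (by simp [execs, exec_natArr, natArrVal]) ?_
      intro a b h1 h2
      unfold PairBefore
      omega
  refine hbranch.seq (B' := 5) fun s₁ F₁ hI₁ => Runs.block ?_
  have R₁ := hR.of_frame F₁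
  have b13 := (F₁.nat 13 rfl).trans h13
  have b14 := (F₁.nat 14 rfl).trans h14
  have b15 := (F₁.nat 15 rfl).trans h15
  have b17 := (F₁.nat 17 rfl).trans h17
  refine ⟨?_, ?_, ?_, ?_, hI₁.congr ?_ ?_ fun _ _ _ _ => Iff.rfl⟩ <;>
    simp [execs, exec_nat, exec_natArr, natVal, natArrVal, b13, b14, b15, b17, R₁.one, R₁.sites,
      R₁.rowLength, add_assoc]
  · ring
  · ring

/-- The invariant of the loop over the rows. -/
def RowInv (n C : ℕ) (L κ : ℝ) (M r K : ℕ) (upd : ℕ → List (ℝ × Bool)) (i : ℕ) (s : Memory) : Prop :=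
  s.nat 14 = i * n ∧ s.nat 16 = i * C + 3 * (r - 1) ∧ ScanResult n L κ M r K upd i 0 s

theorem runs_siteStep {i : ℕ} (hi : i < n) {s : Memory} (hR : Ready n C L κ M r K upd off s)
    (h12 : s.nat 12 = i) (hI : RowInv n C L κ M r K upd i s) :
    Runs siteStep s (n * (62 * K + 37) + 10) fun s' => s'.nat 12 = i + 1 ∧
      RowInv n C L κ M r K upd (i + 1) s' := by
  obtain ⟨h14, h16, hI⟩ := hI
  have hinit : Runs (block [load 18 2 12, const 13 0, add 15 12 3, add 17 37 3]) s 5 fun s' =>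
      s'.nat 13 = 0 ∧ s'.nat 18 = off i ∧ s'.nat 14 = i * n + 0 ∧ s'.nat 15 = 0 * n + i ∧
      s'.nat 17 = 0 * C + 3 * (r - 1) ∧ ScanResult n L κ M r K upd i 0 s' := by
    refine Runs.block ⟨?_, ?_, ?_, ?_, ?_, hI.congr ?_ ?_ fun _ _ _ _ => Iff.rfl⟩ <;>
      simp [execs, exec_nat, exec_natArr, natVal, natArrVal, h12, h14, hR.zero, hR.base,
        hR.offset i hi]
  refine (hinit.seq (B' := n * (62 * K + 37) + 5) (Q := _) fun s₁ F₁ ⟨a13, a18, a14, a15, a17, hI₁⟩ =>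
    ?_).mono (by omega) fun _ _ h => h
  have R₁ := hR.of_frame F₁
  have a12 := (F₁.nat 12 rfl).trans h12
  have a16 := (F₁.nat 16 rfl).trans h16
  have hloop := Runs.count (x := 13) (y := 0) (p := innerStep) n (fun _ => 62 * K + 36)
    (fun j s' => s'.nat 14 = i * n + j ∧ s'.nat 15 = j * n + i ∧ s'.nat 17 = j * C + 3 * (r - 1) ∧
      ScanResult n L κ M r K upd i j s') rfl a13 R₁.sites ⟨a14, a15, a17, hI₁⟩
    fun j hj s' F hx hJ => runs_innerStep hL hr hsort hC hi hj (R₁.of_frame F)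
      ((F.nat 12 rfl).trans a12) hx hJ.1 hJ.2.1 ((F.nat 16 rfl).trans a16) hJ.2.2.1
      ((F.nat 18 rfl).trans a18) hJ.2.2.2
  refine (hloop.seq (B' := 3) (Q := _) fun s₂ F₂ ⟨b14, _, _, hI₂⟩ => Runs.block ?_).mono
    (by simp only [Finset.sum_const, Finset.card_range, smul_eq_mul, add_assoc, Nat.reduceAdd]; omega) fun _ _ h => h
  have R₂ := R₁.of_frame F₂
  have b12 := (F₂.nat 12 rfl).trans a12
  have b16 := (F₂.nat 16 rfl).trans a16
  refine ⟨?_, ?_, ?_, hI₂.congr ?_ ?_ fun a b h1 h2 => ?_⟩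
  iterate 5
    · simp [execs, exec_nat, exec_natArr, natVal, natArrVal, b12, b14, b16, R₂.one, R₂.rowLength]
      try ring
  · unfold PairBefore; omega

theorem runs_pairLoop {s : Memory} (hR : Ready n C L κ M r K upd off s) (h12 : s.nat 12 = 0)
    (hI : RowInv n C L κ M r K upd 0 s) :
    Runs (.loop (.natLt 12 0) siteStep) s (n * (n * (62 * K + 37) + 11) + 1)
      (ScanResult n L κ M r K upd n 0) := by
  refine (Runs.count (x := 12) (y := 0) (p := siteStep) n (fun _ => n * (62 * K + 37) + 10)
    (fun i s' => RowInv n C L κ M r K upd i s') rfl h12 hR.sites hI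
    fun i hi s' F hx hJ => runs_siteStep hL hr hsort hC hi (hR.of_frame F) hx hJ).mono
    (by simp only [Finset.sum_const, Finset.card_range, smul_eq_mul, add_assoc, Nat.reduceAdd]; omega) fun _ _ h => h.2.2

end Pairs

/-! ### The complete program -/

theorem getElem?_flatten_sum_add {β : Type*} (l : List (List β)) {i : ℕ} (hi : i < l.length) {m : ℕ}
    (hm : m < l[i].length) : l.flatten[((l.take i).map List.length).sum + m]? = l[i][m]? := by
  induction l generalizing i with
  | nil => simp at hi
  | cons a l ih =>
    cases i with
    | zero => simpa using List.getElem?_append_left hm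
    | succ i =>
      simp only [List.take_succ_cons, List.map_cons, List.sum_cons, List.flatten_cons,
        List.getElem_cons_succ, add_assoc] at hm ⊢
      rw [List.getElem?_append_right (Nat.le_add_right _ _), Nat.add_sub_cancel_left]
      exact ih (by simpa using hi) hm

/-- The updates of the site with a given number. -/
noncomputable def Observation.siteUpdates {n : ℕ} (obs : Observation n) (i : ℕ) : List (ℝ × Bool) :=
  if h : i < n then obs.updates ⟨i, h⟩ else []

/-- The position of the first update of a site in the concatenation. -/
noncomputable def Observation.siteOffset {n : ℕ} (obs : Observation n) (i : ℕ) : ℕ :=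
  ∑ j : Fin n, if (j : ℕ) < i then (obs.updates j).length else 0

section Input

variable {n : ℕ} (obs : Observation n)

theorem Observation.siteUpdates_coe (i : Fin n) : obs.siteUpdates i = obs.updates i := by
  simp [Observation.siteUpdates]

theorem Observation.size_eq_sum_siteUpdates :
    obs.size = ∑ i ∈ Finset.range n, (obs.siteUpdates i).length := by
  rw [Finset.sum_range]
  simp [Observation.size, Observation.siteUpdates_coe]

theorem Observation.concat_getElem? (i : Fin n) {m : ℕ} (hm : m < (obs.updates i).length) :
    obs.concat[obs.siteOffset i + m]? = some (obs.updates i)[m] := by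
  have h := getElem?_flatten_sum_add (List.ofFn obs.updates) (i := i) (m := m) (by simp) (by simpa using hm)
  have e : (((List.ofFn obs.updates).take i).map List.length).sum = obs.siteOffset i := by
    rw [List.map_take, List.map_ofFn, List.sum_take_ofFn, Finset.sum_filter]
    rfl
  rw [e] at h
  rw [Observation.concat, h]
  simp [hm]

theorem holdsInput_inputMemory (k d : ℕ) (α lam δ : ℝ) :
    HoldsInput n obs.siteUpdates obs.siteOffset (inputMemory k d α lam δ obs) := by
  constructor
  · intro i hi
    simp [inputMemory, Observation.siteUpdates, hi]
  · intro i hi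
    simp [inputMemory, Observation.siteOffset, hi]
  · intro i hi m hm
    have hm' : m < (obs.updates ⟨i, hi⟩).length := by simpa [Observation.siteUpdates, hi] using hm
    have := obs.concat_getElem? ⟨i, hi⟩ hm'
    simp only at this
    simp [inputMemory, this, Observation.siteUpdates, hi]
  · intro i hi m hm
    have hm' : m < (obs.updates ⟨i, hi⟩).length := by simpa [Observation.siteUpdates, hi] using hm
    have := obs.concat_getElem? ⟨i, hi⟩ hm'
    simp only at this
    simp [inputMemory, this, Observation.siteUpdates, hi]

end Input

/-- The loop over all pairs, and the final copy of the flag. -/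
def pairProgram : Program :=
  .seq pairInit (.seq (.loop (.natLt 12 0) siteStep) (block [add 0 19 3]))

/-- The program that implements `FindMarkovBlanket`. -/
def markovBlanketProgram : Program := .seq paramProgram (.seq tableProgram pairProgram)

section Correct

variable {n k d : ℕ} {α lam δ : ℝ} (hd : 1 ≤ d) (hα : 0 < α) (hαl : α ≤ lam) (hn : 2 ≤ n)
  (hδ : 0 < δ) (hδ1 : δ ≤ 1)
include hd hα hαl hn hδ hδ1

/-- The blocks that end by the horizon are those with `ℓ + r` at most the integer part of T / L.
This gives the bound of the scan explicitly, zero if no block fits. -/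
theorem block_end_le_horizon_iff (ℓ : ℕ) :
    ((ℓ : ℝ) + blockLength k d α lam) * window k d α lam ≤ horizon k d α lam δ n ↔
      ℓ < numWindows k d α lam δ n + 1 - blockLength k d α lam := by
  have hL := window_pos (k := k) hd hα hαl
  have hq := qGood_pos (k := k) hd hα hαl
  rw [← le_div_iff₀ hL, horizon_div hd hα hαl hn hδ hδ1, ← Nat.cast_add,
    ← Nat.le_floor_iff (by positivity)]
  unfold numWindows
  omega

open Classical in
/-- What the final memory holds is the result of the algorithm. -/
theorem represents_of_scanResult {obs : Observation n} {s : Memory}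
    (h : ScanResult n (window k d α lam) (threshold k d α lam) (samples k d α lam δ n)
      (blockLength k d α lam) (numWindows k d α lam δ n + 1 - blockLength k d α lam) obs.siteUpdates n 0 s)
    {s' : Memory} (h0 : s'.nat 0 = s.nat 19) (h4 : s'.natArr 4 = s.natArr 4) :
    Represents s' (findMarkovBlanket k d α lam δ obs) := by
  have hr := one_le_blockLength (k := k) hd hα hαl
  have hM := one_le_samples (k := k) hd hα hαl hn hδ hδ1
  have hK := block_end_le_horizon_iff (k := k) hd hα hαl hn hδ hδ1
  set L := window k d α lam
  set r := blockLength k d α lam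
  set M := samples k d α lam δ n
  set K := numWindows k d α lam δ n + 1 - r
  have hE : ∀ i j : Fin n, ScanEnough (obs.siteUpdates i) (obs.siteUpdates j) L r M K ↔
      EnoughStops (obs.updates i) (obs.updates j) L r M (horizon k d α lam δ n) := fun i j => by
    rw [enoughStops_iff hr hM hK, Observation.siteUpdates_coe, Observation.siteUpdates_coe]
    rfl
  have hbefore : ∀ a b, b < n → a < b → PairBefore n 0 a b := fun a b h1 h2 => .inl (h2.trans h1)
  have hok : s'.nat 0 = if ∀ i j : Fin n, i < j →
      EnoughStops (obs.updates i) (obs.updates j) L r M (horizon k d α lam δ n) then 1 else 0 := by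
    rw [h0, h.ok]
    refine if_congr ⟨fun h1 i j hij => ?_, fun h1 a b hab hb _ => ?_⟩ rfl rfl
    · exact (hE i j).1 (h1 i j hij j.2 (hbefore _ _ j.2 hij))
    · exact (hE ⟨a, hab.trans hb⟩ ⟨b, hb⟩).2 (h1 _ _ hab)
  unfold findMarkovBlanket
  by_cases hall : ∀ i j : Fin n, i < j →
      EnoughStops (obs.updates i) (obs.updates j) L r M (horizon k d α lam δ n)
  · rw [if_pos hall] at hok
    rw [if_pos hall]
    have hA : ∀ i j : Fin n, i < j →
        (ScanAccept (obs.siteUpdates i) (obs.siteUpdates j) L (threshold k d α lam) r M K ↔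
          threshold k d α lam ≤ average (obs.updates i) (obs.updates j) L r M) := fun i j hij => by
      have h1 := (hE i j).2 (hall i j hij)
      unfold ScanAccept average scanSum
      rw [and_iff_right h1]
      rw [Observation.siteUpdates_coe, Observation.siteUpdates_coe] at h1 ⊢
      rw [← sum_stopIndex hr, min_eq_left h1]
    refine ⟨hok, fun i j => ?_⟩
    rw [h4]
    have key : s.natArr 4 ((i : ℕ) * n + j) = if (SimpleGraph.fromRel fun i j : Fin n =>
        i < j ∧ threshold k d α lam ≤ average (obs.updates i) (obs.updates j) L r M).Adj i j
        then 1 else 0 := by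
      rcases lt_trichotomy i j with hij | rfl | hij
      · rw [(h.adj i j hij j.2).1]
        refine if_congr ?_ rfl rfl
        rw [hA i j hij, SimpleGraph.fromRel_adj]
        simp [hbefore _ _ j.2 hij, hij, hij.ne, hij.not_gt]
      · rw [h.diag i i.2]; simp
      · rw [(h.adj j i hij i.2).2]
        refine if_congr ?_ rfl rfl
        rw [hA j i hij, SimpleGraph.fromRel_adj]
        simp [hbefore _ _ i.2 hij, hij, hij.ne', hij.not_gt]
    exact ⟨fun h => by rw [key, if_pos h], fun h => by rw [key, if_neg h]⟩
  · rw [if_neg hall] at hok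
    rw [if_neg hall]
    exact hok

/-- The terms of the bound come from the merge, from the table and the scans of the at most n² pairs
over all windows, and from the computation and rounding of the parameters. -/
theorem runs_markovBlanketProgram (obs : Observation n) (hobs : obs.Valid (horizon k d α lam δ n)) :
    Runs markovBlanketProgram (inputMemory k d α lam δ obs)
      (16 * obs.size + 200 * n ^ 2 * (numWindows k d α lam δ n + 1)
        + 4 * (k + samples k d α lam δ n + blockLength k d α lam) + 300)
      fun s => Represents s (findMarkovBlanket k d α lam δ obs) := by
  have hr := one_le_blockLength (k := k) hd hα hαl
  have hL := window_pos (k := k) hd hα hαl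
  have hin := holdsInput_inputMemory obs k d α lam δ
  have hsort : ∀ i < n, (obs.siteUpdates i).Pairwise fun u v => u.1 < v.1 := fun i hi => by
    simpa [Observation.siteUpdates, hi] using (hobs ⟨i, hi⟩).1
  have hsize := obs.size_eq_sum_siteUpdates
  have hparam := runs_paramProgram (n := n) (k := k) (d := d) (α := α) (lam := lam) (δ := δ)
    (s := inputMemory k d α lam δ obs) (by simp [inputMemory]) (by simp [inputMemory])
    (by simp [inputMemory]) (by simp [inputMemory]) (by simp [inputMemory]) (by simp [inputMemory])
    (by simp [inputMemory]) (by simp [inputMemory]) hd hα hαl hn hδ hδ1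
  set M := samples k d α lam δ n with hMd
  set r := blockLength k d α lam with hrd
  set W := numWindows k d α lam δ n with hWd
  set s := inputMemory k d α lam δ obs with hs
  -- The output array is zero initially, so the diagonal and the rejected pairs never have to be
  -- written.
  have hz : s.natArr 4 = fun _ => 0 := by funext m; simp [hs, inputMemory]
  refine (hparam.seq (B' := 16 * obs.size + (n * (16 * (3 * W + 1) + 20) + 10)
    + (n * (n * (62 * W + 37) + 11) + 20)) (Q := _) fun s₁ F₁ H₁ => ?_).mono ?_ fun _ _ h => h
  · have hin₁ : HoldsInput n obs.siteUpdates obs.siteOffset s₁ :=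
      ⟨by rw [F₁.natArr 1 rfl]; exact hin.length, by rw [F₁.natArr 2 rfl]; exact hin.offset,
        by rw [F₁.realArr 0 rfl]; exact hin.time, by rw [F₁.natArr 3 rfl]; exact hin.spin⟩
    have htable := runs_tableProgram (by positivity) hsort H₁.sites H₁.one H₁.rowLength H₁.cell hin₁
    refine (htable.seq (B' := n * (n * (62 * W + 37) + 11) + 20) (Q := _) fun s₂ F₂ T₂ => ?_).mono
      (by rw [hsize, ← hWd]; omega) fun _ _ h => h
    have hinit : Runs pairInit s₂ 10 fun s' => s'.nat 12 = 0 ∧ RowInv n (3 * W + 1)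
        (window k d α lam) (threshold k d α lam) M r (W + 1 - r) obs.siteUpdates 0 s' ∧
        s'.nat 35 = 3 ∧ s'.nat 36 = 2 ∧ s'.nat 37 = 3 * (r - 1) := by
      have b6 := (F₂.nat 6 rfl).trans H₁.blockLength
      have b4 := (F₂.nat 4 rfl).trans H₁.one
      have b3 := (F₂.nat 3 rfl).trans H₁.zero
      have c4 := (F₂.natArr 4 rfl).trans ((F₁.natArr 4 rfl).trans hz)
      have hnb : ∀ a b, ¬ PairBefore 0 0 a b := fun a b => by unfold PairBefore; omega
      refine Runs.block ⟨?_, ⟨?_, ?_, ?_, ?_, ?_⟩, ?_, ?_, ?_⟩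
      all_goals
        simp [execs, exec_nat, exec_natArr, natVal, natArrVal, b3, b4, b6, c4, hnb]
      all_goals omega
    refine (hinit.seq (B' := n * (n * (62 * W + 37) + 11) + 5) (Q := _)
      fun s₃ F₃ ⟨a12, hI, a35, a36, a37⟩ => ?_).mono (by omega) fun _ _ h => h
    have R₃ : Ready n (3 * W + 1) (window k d α lam) (threshold k d α lam) M r (W + 1 - r)
        obs.siteUpdates obs.siteOffset s₃ := by
      constructor
      · exact (F₃.nat 0 rfl).trans ((F₂.nat 0 rfl).trans H₁.sites)
      · exact (F₃.nat 3 rfl).trans ((F₂.nat 3 rfl).trans H₁.zero)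
      · exact (F₃.nat 4 rfl).trans ((F₂.nat 4 rfl).trans H₁.one)
      · exact (F₃.nat 5 rfl).trans ((F₂.nat 5 rfl).trans H₁.samples)
      · exact (F₃.nat 6 rfl).trans ((F₂.nat 6 rfl).trans H₁.blockLength)
      · exact (F₃.nat 8 rfl).trans ((F₂.nat 8 rfl).trans H₁.rowLength)
      · exact (F₃.nat 9 rfl).trans ((F₂.nat 9 rfl).trans H₁.indexBound)
      · exact a35
      · exact a36
      · exact a37
      · exact (F₃.real 4 rfl).trans ((F₂.real 4 rfl).trans H₁.threshold)
      · exact (F₃.real 6 rfl).trans ((F₂.real 6 rfl).trans H₁.rone)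
      · exact (F₃.real 7 rfl).trans ((F₂.real 7 rfl).trans H₁.rtwo)
      · rw [F₃.natArr 2 rfl, F₂.natArr 2 rfl]; exact hin₁.offset
      · rw [F₃.natArr 3 rfl, F₂.natArr 3 rfl]; exact hin₁.spin
      · rw [F₃.natArr 5 rfl]; exact T₂
    -- A row has `3 * W + 1` entries, one for each cell end including time zero, so the last entry
    -- read for a block, at most number `3 * W`, exists.
    have hloop := runs_pairLoop hL hr hsort (K := W + 1 - r) (by intro ℓ hℓ; omega) R₃ a12 hI
    refine (hloop.seq (B' := 2) (Q := _) fun s₄ F₄ hres => Runs.block ?_).mono ?_ fun _ _ h => h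
    · have R₄ := R₃.of_frame F₄
      refine represents_of_scanResult hd hα hαl hn hδ hδ1 hres ?_ ?_ <;>
        simp [execs, exec_nat, exec_natArr, natVal, natArrVal, R₄.zero]
    · have : n * (n * (62 * (W + 1 - r) + 37) + 11) ≤ n * (n * (62 * W + 37) + 11) := by
        gcongr; omega
      omega
  · have h1 : n ≤ n ^ 2 := Nat.le_self_pow two_ne_zero n
    have h2 : n * (16 * (3 * W + 1) + 20) ≤ 48 * (n ^ 2 * W) + 36 * n ^ 2 :=
      (Nat.mul_le_mul_right _ h1).trans (by ring_nf; rfl)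
    have h3 : n * (n * (62 * W + 37) + 11) ≤ 62 * (n ^ 2 * W) + 48 * n ^ 2 := by
      have : n * (n * (62 * W + 37) + 11) = 62 * (n ^ 2 * W) + 37 * n ^ 2 + 11 * n := by ring
      omega
    have h4 : W ≤ n ^ 2 * W := Nat.le_mul_of_pos_left _ (by positivity)
    have h5 : 200 * n ^ 2 * (W + 1) = 200 * (n ^ 2 * W) + 200 * n ^ 2 := by ring
    rw [h5]
    omega

end Correct

/-! ### The constants -/

section Constants

variable {n k d : ℕ} {α lam δ : ℝ} (hd : 1 ≤ d) (hα : 0 < α) (hαl : α ≤ lam) (hn : 2 ≤ n)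
  (hδ : 0 < δ) (hδ1 : δ ≤ 1)

/-- The number of samples is at most this constant times `log (n / δ)`. -/
noncomputable def samplesConst (k d : ℕ) (α lam : ℝ) : ℝ := 6000 / threshold k d α lam ^ 2 + 2

/-- The number of windows is at most this constant times `log (n / δ)`. -/
noncomputable def windowsConst (k d : ℕ) (α lam : ℝ) : ℝ :=
  samplesConst k d α lam * (blockLength k d α lam + 2 / qGood k d α lam)

/-- With high probability, the number of updates is at most this constant times `n log (n / δ)`. -/
noncomputable def updatesConst (k d : ℕ) (α lam : ℝ) : ℝ :=
  2 * (window k d α lam * windowsConst k d α lam) + 1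

/-- The constant of the theorem. -/
noncomputable def totalConst (k d : ℕ) (α lam : ℝ) : ℝ :=
  window k d α lam * windowsConst k d α lam + 16 * updatesConst k d α lam
    + 200 * (windowsConst k d α lam + 2)
    + 4 * (2 * k + samplesConst k d α lam + 2 * blockLength k d α lam) + 600

include hn hδ hδ1 in
theorem one_le_two_mul_log_div : 1 ≤ 2 * Real.log (n / δ) := by
  have h2 : (2 : ℝ) ≤ n := by exact_mod_cast hn
  have h1 : (2 : ℝ) ≤ n / δ := by rw [le_div_iff₀ hδ]; nlinarith
  have := Real.log_le_log two_pos h1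
  linarith [Real.log_two_gt_d9]

include hn hδ hδ1 in
-- Because 2n² ≤ n³ and δ³ ≤ δ.
theorem log_two_mul_sq_div_le : Real.log (2 * (n : ℝ) ^ 2 / δ) ≤ 3 * Real.log (n / δ) := by
  have h2 : (2 : ℝ) ≤ n := by exact_mod_cast hn
  have h0 : (0 : ℝ) < n := by linarith
  have e : 3 * Real.log (n / δ) = Real.log ((n / δ) ^ 3) := by rw [Real.log_pow]; norm_num
  rw [e]
  refine Real.log_le_log (by positivity) ?_
  rw [div_pow, div_le_div_iff₀ hδ (by positivity)]
  have h3 : δ ^ 3 ≤ δ := pow_le_of_le_one hδ.le hδ1 (by norm_num)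
  have h4 : 2 * (n : ℝ) ^ 2 ≤ (n : ℝ) ^ 3 := by nlinarith [sq_nonneg (n : ℝ)]
  exact mul_le_mul h4 h3 (by positivity) (by positivity)

include hd hα hαl

theorem samplesConst_pos : 0 < samplesConst k d α lam := by
  have := threshold_pos (k := k) hd hα hαl
  unfold samplesConst; positivity

theorem windowsConst_pos : 0 < windowsConst k d α lam := by
  have h1 := samplesConst_pos (k := k) hd hα hαl
  have h2 := qGood_pos (k := k) hd hα hαl
  unfold windowsConst; positivity

theorem updatesConst_pos : 0 < updatesConst k d α lam := by
  have h1 := windowsConst_pos (k := k) hd hα hαl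
  have h2 := window_pos (k := k) hd hα hαl
  unfold updatesConst; positivity

theorem updatesConst_le_totalConst : updatesConst k d α lam ≤ totalConst k d α lam := by
  have h1 := samplesConst_pos (k := k) hd hα hαl
  have h2 := windowsConst_pos (k := k) hd hα hαl
  have h3 := updatesConst_pos (k := k) hd hα hαl
  have h4 := window_pos (k := k) hd hα hαl
  have h5 : 0 ≤ window k d α lam * windowsConst k d α lam + 15 * updatesConst k d α lam
    + 200 * (windowsConst k d α lam + 2)
    + 4 * (2 * k + samplesConst k d α lam + 2 * blockLength k d α lam) + 600 := by positivity
  unfold totalConst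
  linarith

theorem windowsConst_le_totalConst :
    window k d α lam * windowsConst k d α lam ≤ totalConst k d α lam := by
  have h1 := windowsConst_pos (k := k) hd hα hαl
  have h2 := window_pos (k := k) hd hα hαl
  have h3 := mul_pos h2 h1
  have h4 := updatesConst_le_totalConst (k := k) hd hα hαl
  unfold updatesConst at h4
  linarith

include hn hδ hδ1

/-- The summand 2 in the constant absorbs the rounding, since 2 log(n/δ) ≥ 1. -/
theorem samples_le : (samples k d α lam δ n : ℝ) ≤ samplesConst k d α lam * Real.log (n / δ) := by
  have h1 := log_two_mul_sq_div_le hn hδ hδ1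
  have h2 := one_le_two_mul_log_div hn hδ hδ1
  have hκ := threshold_pos (k := k) hd hα hαl
  have h3 := two_le_log hd hα hαl hn hδ hδ1
  have h4 : (samples k d α lam δ n : ℝ)
      ≤ 2000 * Real.log (2 * (n : ℝ) ^ 2 / δ) / threshold k d α lam ^ 2 + 1 :=
    (Nat.ceil_lt_add_one (by positivity)).le
  have h5 : 2000 * Real.log (2 * (n : ℝ) ^ 2 / δ) / threshold k d α lam ^ 2
      ≤ 6000 / threshold k d α lam ^ 2 * Real.log (n / δ) := by
    rw [div_mul_eq_mul_div]
    exact div_le_div_of_nonneg_right (by linarith) (by positivity)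
  unfold samplesConst
  rw [add_mul]
  linarith

theorem horizon_div_window_le : (samples k d α lam δ n * blockLength k d α lam
    + 2 * samples k d α lam δ n / qGood k d α lam : ℝ) ≤ windowsConst k d α lam * Real.log (n / δ) := by
  have h1 := samples_le (k := k) hd hα hαl hn hδ hδ1
  have h2 := qGood_pos (k := k) hd hα hαl
  calc (samples k d α lam δ n * blockLength k d α lam
        + 2 * samples k d α lam δ n / qGood k d α lam : ℝ)
      = samples k d α lam δ n * (blockLength k d α lam + 2 / qGood k d α lam) := by ring
    _ ≤ samplesConst k d α lam * Real.log (n / δ)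
        * (blockLength k d α lam + 2 / qGood k d α lam) := by gcongr
    _ = _ := by unfold windowsConst; ring

theorem horizon_le : horizon k d α lam δ n
    ≤ window k d α lam * windowsConst k d α lam * Real.log (n / δ) := by
  rw [mul_assoc]
  exact mul_le_mul_of_nonneg_left (horizon_div_window_le hd hα hαl hn hδ hδ1)
    (window_pos (k := k) hd hα hαl).le

theorem numWindows_le : (numWindows k d α lam δ n : ℝ) ≤ windowsConst k d α lam * Real.log (n / δ) := by
  have := qGood_pos (k := k) hd hα hαl
  exact (Nat.floor_le (by positivity)).trans (horizon_div_window_le hd hα hαl hn hδ hδ1)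

/-- The summand 1 in `updatesConst` leaves a surplus of n log(n/δ) ≥ log(n/δ) in the exponent, which
gives δ/n ≤ δ/2. -/
theorem exp_size_le : Real.exp (2 * n * horizon k d α lam δ n
    - updatesConst k d α lam * n * Real.log (n / δ)) ≤ δ / 2 := by
  have h1 := horizon_le (k := k) hd hα hαl hn hδ hδ1
  have h2 := one_le_two_mul_log_div hn hδ hδ1
  have hn' : (2 : ℝ) ≤ n := by exact_mod_cast hn
  have h3 : 2 * n * horizon k d α lam δ n
      ≤ 2 * n * (window k d α lam * windowsConst k d α lam * Real.log (n / δ)) := by gcongr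
  have h4 : Real.log (n / δ) ≤ n * Real.log (n / δ) := by nlinarith
  calc Real.exp (2 * n * horizon k d α lam δ n - updatesConst k d α lam * n * Real.log (n / δ))
      ≤ Real.exp (-Real.log (n / δ)) := by
        refine Real.exp_le_exp.2 ?_
        unfold updatesConst
        linarith
    _ = δ / n := by rw [Real.exp_neg, Real.exp_log (by positivity), inv_div]
    _ ≤ δ / 2 := by gcongr

/-- The number of steps of the program. -/
theorem steps_le {m : ℕ} (hm : (m : ℝ) ≤ updatesConst k d α lam * n * Real.log (n / δ)) :
    ((16 * m + 200 * n ^ 2 * (numWindows k d α lam δ n + 1)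
      + 4 * (k + samples k d α lam δ n + blockLength k d α lam) + 300 : ℕ) : ℝ)
      ≤ totalConst k d α lam * n ^ 2 * Real.log (n / δ) := by
  have h1 := samples_le (k := k) hd hα hαl hn hδ hδ1
  have h2 := one_le_two_mul_log_div hn hδ hδ1
  have h3 := numWindows_le (k := k) hd hα hαl hn hδ hδ1
  have c1 := samplesConst_pos (k := k) hd hα hαl
  have c2 := windowsConst_pos (k := k) hd hα hαl
  have c3 := updatesConst_pos (k := k) hd hα hαl
  have c4 := window_pos (k := k) hd hα hαl
  have hn' : (2 : ℝ) ≤ n := by exact_mod_cast hn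
  set lg := Real.log (n / δ)
  have hlg : 0 ≤ lg := by linarith
  have hnn : (n : ℝ) ≤ n ^ 2 := by nlinarith
  have hn1 : (1 : ℝ) ≤ n ^ 2 := by linarith
  have e1 : (m : ℝ) ≤ updatesConst k d α lam * (n ^ 2 * lg) :=
    hm.trans (by rw [mul_assoc]; gcongr)
  have e2 : (n : ℝ) ^ 2 * (numWindows k d α lam δ n + 1)
      ≤ n ^ 2 * ((windowsConst k d α lam + 2) * lg) := by
    gcongr; linarith
  have e3 : lg ≤ n ^ 2 * lg := le_mul_of_one_le_left hlg hn1
  have e4 : (samples k d α lam δ n : ℝ) ≤ samplesConst k d α lam * (n ^ 2 * lg) :=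
    h1.trans (by gcongr)
  have e5 : (1 : ℝ) ≤ 2 * (n ^ 2 * lg) := by linarith
  have e6 : (k : ℝ) ≤ k * (2 * (n ^ 2 * lg)) := le_mul_of_one_le_right (Nat.cast_nonneg _) e5
  have e7 : (blockLength k d α lam : ℝ) ≤ blockLength k d α lam * (2 * (n ^ 2 * lg)) :=
    le_mul_of_one_le_right (Nat.cast_nonneg _) e5
  have e8 : 0 ≤ window k d α lam * windowsConst k d α lam * (n ^ 2 * lg) := by positivity
  push_cast
  unfold totalConst
  linarith

end Constants

/-! ### The total failure probability and the conclusion. -/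

/-- With probability at least `1 - δ`, the algorithm succeeds and there are not too many updates. -/
theorem IsGlauberDynamics.measure_failure_le {Ω : Type*} [MeasurableSpace Ω] {P : Measure Ω}
    [IsProbabilityMeasure P] {n k d : ℕ} {α lam δ : ℝ} {ψ : Multilinear n} {X : Ω → Trajectory n}
    (hX : IsGlauberDynamics ψ P X) (hψ : IsMRF k d α lam ψ) (hk : 2 ≤ k) (hd : 1 ≤ d) (hα : 0 < α)
    (hαl : α ≤ lam) (hn : 2 ≤ n) (hδ : 0 < δ) (hδ1 : δ ≤ 1) :
    P {ω | ¬ (RegularClock (X ω).time ∧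
        findMarkovBlanket k d α lam δ (observe (X ω) (horizon k d α lam δ n))
          = some (dependencyGraph ψ) ∧
        ((observe (X ω) (horizon k d α lam δ n)).size : ℝ)
          ≤ updatesConst k d α lam * n * Real.log (n / δ))} ≤ ENNReal.ofReal δ := by
  have hT : 0 ≤ horizon k d α lam δ n :=
    (by have := window_pos (k := k) hd hα hαl; positivity :
      (0 : ℝ) ≤ blockLength k d α lam * window k d α lam).trans
      (blockLength_mul_window_le hd hα hαl hn hδ hδ1)
  have h1 := hX.measure_findMarkovBlanket_ne_le hψ hk hd hα hαl hn hδ hδ1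
  have h2 := (hX.measure_size_gt_le hT (updatesConst k d α lam * n * Real.log (n / δ))).trans
    (ENNReal.ofReal_le_ofReal (exp_size_le hd hα hαl hn hδ hδ1))
  have h3 : P {ω | ¬ RegularClock (X ω).time} = 0 := hX.ae_regularClock
  refine (measure_mono (fun ω hω => ?_)).trans ((measure_union_le _ _).trans
    (add_le_add ((measure_union_le _ _).trans (add_le_add h3.le h1)) h2) |>.trans ?_)
  · simp only [Set.mem_ofPred_eq, Set.mem_union] at hω ⊢
    by_contra! hcon
    exact hω ⟨hcon.1.1, hcon.1.2, hcon.2⟩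
  · rw [zero_add, ← ENNReal.ofReal_add (by linarith) (by linarith), add_halves]

end GlauberMRF

theorem mainTheorem1 :
    -- a single program that implements the algorithm for all parameters and all inputs
    ∃ prog : Program,
      (∀ (n k d : ℕ) (α lam δ : ℝ), 2 ≤ n → 2 ≤ k → 1 ≤ d → 0 < α → α ≤ lam → 0 < δ → δ ≤ 1 →
        ∀ obs : Observation n, obs.Valid (horizon k d α lam δ n) →
          ∃ (t : ℕ) (s : Memory), Run prog (inputMemory k d α lam δ obs) t s ∧
            Represents s (findMarkovBlanket k d α lam δ obs)) ∧
      ∀ (k d : ℕ) (α lam : ℝ), 2 ≤ k → 1 ≤ d → 0 < α → α ≤ lam →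
        -- the implicit constant depends on `k, d, α, lam` only
        ∃ C : ℝ, 0 < C ∧ ∀ (n : ℕ) (δ : ℝ), 2 ≤ n → 0 < δ → δ ≤ 1 →
          horizon k d α lam δ n ≤ C * Real.log (n / δ) ∧
          ∀ ψ : Multilinear n, IsMRF k d α lam ψ →
          ∀ (Ω : Type*) [MeasurableSpace Ω] (P : Measure Ω) [IsProbabilityMeasure P]
            (X : Ω → Trajectory n), IsGlauberDynamics ψ P X →
            -- the complement of the good event has probability at most `δ`
            P {ω | ¬ (findMarkovBlanket k d α lam δ (observe (X ω) (horizon k d α lam δ n))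
                    = some (dependencyGraph ψ) ∧
                  ((observe (X ω) (horizon k d α lam δ n)).size : ℝ)
                    ≤ C * n * Real.log (n / δ) ∧
                  ∃ (t : ℕ) (s : Memory),
                    Run prog (inputMemory k d α lam δ
                      (observe (X ω) (horizon k d α lam δ n))) t s ∧
                    Represents s (some (dependencyGraph ψ)) ∧
                    (t : ℝ) ≤ C * (n : ℝ) ^ 2 * Real.log (n / δ))}
              ≤ ENNReal.ofReal δ := by
  refine ⟨markovBlanketProgram, ?_, fun k d α lam hk hd hα hαl => ⟨totalConst k d α lam, ?_, ?_⟩⟩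
  · intro n k d α lam δ hn _ hd hα hαl hδ hδ1 obs hobs
    obtain ⟨t, s, hrun, -, hs⟩ := runs_markovBlanketProgram hd hα hαl hn hδ hδ1 obs hobs
    exact ⟨t, s, hrun, hs⟩
  · exact (updatesConst_pos hd hα hαl).trans_le (updatesConst_le_totalConst hd hα hαl)
  · intro n δ hn hδ hδ1
    have hlog := one_le_two_mul_log_div hn hδ hδ1
    refine ⟨(horizon_le hd hα hαl hn hδ hδ1).trans (mul_le_mul_of_nonneg_right
      (windowsConst_le_totalConst hd hα hαl) (by linarith)), ?_⟩
    intro ψ hψ Ω _ P _ X hX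
    refine le_trans (MeasureTheory.measure_mono ?_)
      (hX.measure_failure_le hψ hk hd hα hαl hn hδ hδ1)
    refine Set.ofPred_subset_ofPred.2 fun ω hω hgood => hω ?_
    -- Regular clocks are part of the good event because only then is the observation known to be
    -- well-formed, which the program relies on.
    obtain ⟨hclock, hfind, hsize⟩ := hgood
    obtain ⟨t, s, hrun, ht, hs⟩ := runs_markovBlanketProgram (k := k) hd hα hαl hn hδ hδ1
      (observe (X ω) (horizon k d α lam δ n)) (observe_valid hclock _)
    refine ⟨hfind, hsize.trans ?_, t, s, hrun, hfind ▸ hs,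
      (Nat.cast_le.2 ht).trans (steps_le hd hα hαl hn hδ hδ1 hsize)⟩
    gcongr
    · linarith
    · exact updatesConst_le_totalConst hd hα hαl
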